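/- **Symmetric functions.** Let $\Lambda=\mathbb Z[h_1,h_2,\dots]$, $h_0=1$, $h_{-q}=0$ for $q>0$. For a sequence of integers $I=(a_1,\dots,a_p)$ put $s_I=\det(h_{a_i+j-i})_{1\le i,j\le p}$. The $s_\lambda$, $\lambda$ a partition, form a $\mathbb Z$-basis of $\Lambda$; let $c^\mu_{\sigma\tau}$ be the coefficient of $s_\mu$ in $s_\sigma s_\tau$. **Diagrams.** A rectangle diagram consists of rectangles $R_{ij}$ ($0\le i<j\le n$), each given by a number of rows and a number of columns (possibly zero), such that $R_{i,j+1}$ has at most as many rows as $R_{ij}$, and $R_{ij}$ has at most as many columns as $R_{i+1,j}$. (Rank conditions $(r_{ij})_{0\le i\le j\le n}$ that can occur give such a diagram: $R_{ij}$ has $r_{i+1,j}-r_{ij}$ rows and $r_{i,j-1}-r_{ij}$ columns.) A tableau diagram is a filling of each $R_{ij}$ with integers to a semistandard tableau $T_{ij}$, such that the entries of $T_{ij}$ are strictly larger than those of every $T_{kl}$ with $i\le k<l\le j$, $(k,l)\ne(i,j)$. The product $U\cdot V$ of tableaux is the usual one, by row insertion of $V$ into $U$. **Paths.** A path $\gamma$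 goes from $(0,0)$ to $(n,n)$ through points $(i,j)$ with $0\le i\le j\le n$, with steps down $(i,j)\to(i,j+1)$, up $(i,j)\to(i+1,j)$ and horizontal $(i,j)\to(i+1,j+1)$; its length $\ell$ is its number of steps. The lowest path is $n$ steps down followed by $n$ steps up. Any other path $\gamma$ lies above a path $\gamma'$ obtained from it by replacing an up step followed by a down step by one horizontal step (Case 1), or by replacing a horizontal step $(i,j-1)\to(i+1,j)$ by the down-pointing angle $(i,j-1)\to(i,j)\to(i+1,j)$ (Case 2, at the rectangle $R_{ij}$). **$P_\gamma$.** Define $P_\gamma\in\Lambda^{\otimes\ell}$ inductively by $P_\gamma=1\otimes\dots\otimes1$ for the lowest path. In Case 1, $P_\gamma$ is obtained from $P_{\gamma'}$ by replacing each basis element $\cdots\otimes s_\mu\otimes\cdots$ (with $s_\mu$ at the horizontal step) by $\sum_{\sigma,\tau}c^\mu_{\sigma\tau}\,(\cdots\otimes s_\sigma\otimes s_\tau\otimes\cdots)$. In Case 2, let $R_{ij}$ have $a$ rows and $b$ columns; each basis element $\cdots\otimes s_\tau\otimes s_\sigma\otimes\cdots$ (with $s_\tau,s_\sigma$ at the angle)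 is replaced by zero if $\sigma$ has more than $a$ rows, and otherwise by $\cdots\otimes s_I\otimes\cdots$ with $I=(b+\sigma_1,\dots,b+\sigma_a,\tau_1,\tau_2,\dots)$. **Factor sequences** of a path, for a given tableau diagram: the lowest path has the only factor sequence $(\emptyset,\dots,\emptyset)$. In Case 1, $(\dots,P,Q,\dots)$ is a factor sequence of $\gamma$ whenever $(\dots,P\cdot Q,\dots)$ is one of $\gamma'$, for tableaux $P,Q$. In Case 2, $(\dots,Q\cdot T_{ij}\cdot P,\dots)$ is a factor sequence of $\gamma$ whenever $(\dots,Q,P,\dots)$ is one of $\gamma'$. **Fomin's involution.** Consider diagrams (finite lists of rows, possibly empty) with weakly increasing rows. A violation is a box below the first row such that the box directly above it is missing or not strictly smaller. Put $S(D)=s_I$, with $I$ the sequence of row lengths of $D$. If the lower of two consecutive rows, an upper row $u$ of length $p$ and a lower row $v$ of length $q$, contains a violation, the exchange operation replaces them by the unique weakly increasing rows $u',v'$ of lengths $q-1,p+1$ with $v'\cdot u'=v\cdot u$. Violations are ordered by: $(i,j)$ (row $i$, column $j$) is smaller than $(i',j')$ if $j-i<j'-i'$, or $j-i=j'-i'$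 and $i<i'$. Let $a\ge1$ and let $Q,P$ be tableaux, $P$ with at most $a$ rows, such that the diagram $D$ with $P$ in the top $a$ rows and $Q$ below is not a tableau and $S(D)\ne0$. Exchange rows $a,a+1$ of $D$; as long as there are violations outside row $a+1$, exchange the row of the smallest such violation with the row above it, and then again rows $a,a+1$. When all violations are in row $a+1$, let $P'$ be the top $a$ rows and $Q'$ the rest; $(Q',P')$ is the image of $(Q,P)$. **Conjecture 2** for a tableau diagram: let $\gamma$ be any path with a down-pointing angle at $R_{ij}$, with $a$ rows, $b$ columns and tableau $T=T_{ij}$, and let $(\dots,X,Y,\dots)$ be a factor sequence of $\gamma$ with $X,Y$ the labels of the two steps of the angle, $Y$ with at most $a$ rows. Let $D$ be the diagram with $T$ and to its right $Y$ in the top $a$ rows and $X$ below, and suppose that $D$ is not a tableau (that is, $(X,Y)$ does not fit around $T$) and $S(D)\neq0$. Let $X_0$ be the first $b$ columns of $X$ and $\tilde X$ the rest, let $(\tilde X',Y')$ be the image of $(\tilde X,Y)$ under Fomin's involution, and $X'=X_0\cdot\tilde X'$. Then $(\dots,X',Y',\dots)$ is a factor sequence of $\gamma$. **Theorem.** Let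 a tableau diagram of a rectangle diagram be given for which Conjecture 2 holds. Then for every path $\gamma$, with $\ell$ its length, there are finitely many factor sequences, $P_\gamma$ is well defined (independent of the choices of $\gamma'$), and $$P_\gamma=\sum_{(W_1,\dots,W_\ell)}S(W_1)\otimes\dots\otimes S(W_\ell)\in\Lambda^{\otimes\ell},$$ where the sum is over all factor sequences of $\gamma$. Equivalently (Conjecture 1A), for all partitions $\mu_1,\dots,\mu_\ell$ the coefficient of $s_{\mu_1}\otimes\dots\otimes s_{\mu_\ell}$ in $P_\gamma$ is the number of factor sequences $(W_1,\dots,W_\ell)$ of $\gamma$ such that $W_i$ has shape $\mu_i$ for each $i$. -/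

import Mathlib

open scoped TensorProduct

namespace QuiverFactor

noncomputable section

/-- The ring of symmetric functions `ℤ[h₁, h₂, …]`; the variable `X i` stands for `h_{i+1}`. -/
abbrev Lam : Type := MvPolynomial ℕ ℤ

/-- `h_k` for an arbitrary integer `k`, with `h_0 = 1` and `h_k = 0` for `k < 0`. -/
def hSym (k : ℤ) : Lam :=
  if k < 0 then 0 else if k = 0 then 1 else MvPolynomial.X (k.toNat - 1)

/-- The Schur function `s_I = det (h_{a_i + j - i})` of a sequence of integers. -/
def schur (I : List ℤ) : Lam :=
  Matrix.det (Matrix.of fun i j : Fin I.length => hSym (I.get i + (j : ℤ) - (i : ℤ)))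

/-- The row lengths of a Young diagram, as a sequence of integers. -/
def parts (μ : YoungDiagram) : List ℤ := μ.rowLens.map (fun k : ℕ => (k : ℤ))

/-- The exponent vector of the monomial `h_k`. -/
def hexp (k : ℤ) : ℕ →₀ ℕ := if 0 < k then Finsupp.single (k.toNat - 1) 1 else 0

/-- The degree of a monomial in the `h`s. -/
def mdeg : (ℕ →₀ ℕ) →+ ℕ := Finsupp.liftAddHom fun k => AddMonoidHom.mulRight (k + 1)

/-- The sum of the squares of the indices of the `h`s in a monomial. -/
def msq : (ℕ →₀ ℕ) →+ ℕ := Finsupp.liftAddHom fun k => AddMonoidHom.mulRight ((k + 1) ^ 2)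

lemma mdeg_hexp {k : ℤ} (hk : 0 ≤ k) : ((mdeg (hexp k) : ℕ) : ℤ) = k := by
  unfold hexp mdeg
  split_ifs with h0
  · simp; omega
  · simp; omega

lemma msq_hexp {k : ℤ} (hk : 0 ≤ k) : ((msq (hexp k) : ℕ) : ℤ) = k ^ 2 := by
  unfold hexp msq
  split_ifs with h0
  · obtain ⟨m, rfl⟩ : ∃ m : ℕ, k = m + 1 := ⟨k.toNat - 1, by omega⟩
    simp
  · have : k = 0 := by omega
    simp [this]

lemma hSym_eq {k : ℤ} (hk : 0 ≤ k) : hSym k = MvPolynomial.monomial (hexp k) 1 := by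
  unfold hSym hexp
  rcases hk.lt_or_eq with h0 | h0
  · rw [if_neg (by omega), if_neg (by omega), if_pos h0]; rfl
  · subst h0; simp

lemma msq_le (m : ℕ →₀ ℕ) : msq m ≤ mdeg m ^ 2 := by
  have h1 : msq m = ∑ k ∈ m.support, m k * (k + 1) ^ 2 := by
    simp [msq, Finsupp.sum]
  have h2 : mdeg m = ∑ k ∈ m.support, m k * (k + 1) := by
    simp [mdeg, Finsupp.sum]
  rw [h1, h2]
  calc _ ≤ ∑ k ∈ m.support, (m k * (k + 1)) ^ 2 := by
        refine Finset.sum_le_sum fun k _ => ?_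
        rw [mul_pow]
        exact Nat.mul_le_mul_right _ (Nat.le_self_pow (by norm_num) _)
    _ ≤ _ := Finset.sum_sq_le_sq_sum_of_nonneg (fun _ _ => Nat.zero_le _)

/-- The exponent vector of `h_{μ₁} h_{μ₂} ⋯`. -/
def expo (μ : YoungDiagram) : ℕ →₀ ℕ := (μ.rowLens.map fun k : ℕ => hexp k).sum

lemma expo_eq_count (μ : YoungDiagram) (i : ℕ) : expo μ i = μ.rowLens.count (i + 1) := by
  have hp := μ.pos_of_mem_rowLens
  unfold expo
  generalize μ.rowLens = w at hp
  induction w with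
  | nil => simp
  | cons a t ih =>
    have ha : 0 < a := hp a (by simp)
    have ht := ih (fun x hx => hp x (by simp [hx]))
    simp only [List.map_cons, List.sum_cons, Finsupp.add_apply, ht, List.count_cons]
    rw [add_comm]
    congr 1
    simp only [hexp, Nat.cast_pos, ha, if_true, Finsupp.single_apply, beq_iff_eq, Int.toNat_natCast]
    congr 1
    simp only [eq_iff_iff]
    omega

lemma expo_injective : Function.Injective expo := by
  intro μ ν hμν
  apply YoungDiagram.equivListRowLens.injective
  apply Subtype.ext
  have hperm : μ.rowLens.Perm ν.rowLens := by
    rw [List.perm_iff_count]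
    intro a
    rcases a with _ | a
    · rw [List.count_eq_zero_of_not_mem, List.count_eq_zero_of_not_mem]
      · exact fun h0 => absurd (ν.pos_of_mem_rowLens _ h0) (by simp)
      · exact fun h0 => absurd (μ.pos_of_mem_rowLens _ h0) (by simp)
    · rw [← expo_eq_count, ← expo_eq_count, hμν]
  exact hperm.eq_of_pairwise' μ.rowLens_sorted.pairwise ν.rowLens_sorted.pairwise

lemma expo_surjective : Function.Surjective expo := by
  intro m
  let s : Multiset ℕ := (Finsupp.toMultiset m).map (· + 1)
  let w : List ℕ := s.sort (· ≥ ·)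
  have hw : w.SortedGE := (Multiset.pairwise_sort s (· ≥ ·)).sortedGE
  have hpos : ∀ x ∈ w, 0 < x := by
    intro x hx
    have hx' : x ∈ s := by simpa [w] using hx
    simp only [s, Multiset.mem_map] at hx'
    obtain ⟨y, _, rfl⟩ := hx'
    omega
  refine ⟨YoungDiagram.ofRowLens w hw, ?_⟩
  ext i
  rw [expo_eq_count, YoungDiagram.rowLens_ofRowLens_eq_self hpos, ← Multiset.coe_count,
    Multiset.sort_eq, Multiset.count_map_eq_count' _ _ (add_left_injective 1),
    Finsupp.count_toMultiset]

/-- The monomials of the same degree as `m` with a larger sum of squares. -/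
def bigger (m : ℕ →₀ ℕ) : Submodule ℤ Lam :=
  Submodule.span ℤ ((fun m' => MvPolynomial.monomial m' (1 : ℤ)) ''
    {m' | mdeg m' = mdeg m ∧ msq m < msq m'})

lemma antitone_sum {N : ℕ} (a : Fin N → ℤ) (ha : Antitone a) (π : Equiv.Perm (Fin N))
    (hπ : π ≠ 1) :
    ∑ i, a i ^ 2 < ∑ i, (a (π i) + (i : ℤ) - (π i : ℤ)) ^ 2 := by
  let f : Fin N → ℤ := fun i => a i - (i : ℤ)
  let g : Fin N → ℤ := fun i => (i : ℤ)
  have hf : StrictAnti f := by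
    intro i j hij
    have h1 := ha hij.le
    have h2 : (i : ℕ) < j := hij
    simp only [f]; omega
  have hg : StrictMono g := by
    intro i j hij
    have h2 : (i : ℕ) < j := hij
    simp only [g]; omega
  have hfg : Antivary f g := fun i j hij => (hf (hg.lt_iff_lt.1 hij)).le
  have key : ∑ i, f i * g i < ∑ i, f (π i) * g i := by
    rw [hfg.sum_mul_lt_sum_comp_perm_mul_iff]
    intro hanti
    apply hπ
    have hmono : StrictMono π := by
      intro i j hij
      have := hanti (hg hij)
      simp only [Function.comp] at this
      exact lt_of_le_of_ne (hf.le_iff_ge.1 this) (fun h => hij.ne (π.injective h))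
    ext i
    have := (Subsingleton.elim (hmono.orderIsoOfSurjective π π.surjective) (OrderIso.refl _))
    have h2 := congrArg (fun e : Fin N ≃o Fin N => e i) this
    simpa using congrArg Fin.val h2
  have e1 : ∑ i, a i ^ 2 = ∑ i, f i ^ 2 + 2 * ∑ i, f i * g i + ∑ i, g i ^ 2 := by
    rw [Finset.mul_sum, ← Finset.sum_add_distrib, ← Finset.sum_add_distrib]
    exact Finset.sum_congr rfl fun i _ => by simp only [f, g]; ring
  have e2 : ∑ i, (a (π i) + (i : ℤ) - (π i : ℤ)) ^ 2
      = ∑ i, f (π i) ^ 2 + 2 * ∑ i, f (π i) * g i + ∑ i, g i ^ 2 := by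
    rw [Finset.mul_sum, ← Finset.sum_add_distrib, ← Finset.sum_add_distrib]
    exact Finset.sum_congr rfl fun i _ => by simp only [f, g]; ring
  rw [e1, e2, Equiv.sum_comp π (fun i => f i ^ 2)]
  linarith

lemma schur_triangular (μ : YoungDiagram) :
    schur (parts μ) - MvPolynomial.monomial (expo μ) 1 ∈ bigger (expo μ) := by
  set I := parts μ with hI
  let a : Fin I.length → ℤ := fun i => I.get i
  have ha : Antitone a := by
    have hs : I.SortedGE := by
      have := μ.rowLens_sorted.pairwise
      have h2 : I.Pairwise (· ≥ ·) := by
        rw [hI, parts, List.pairwise_map]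
        exact this.imp (fun h => by exact_mod_cast h)
      exact h2.sortedGE
    exact hs.antitone_get
  have ha0 : ∀ i, 0 ≤ a i := by
    intro i
    have hmem : I.get i ∈ parts μ := List.get_mem _ _
    simp only [parts, List.mem_map] at hmem
    obtain ⟨k, _, hk⟩ := hmem
    change 0 ≤ I.get i
    rw [← hk]; positivity
  have hexpo : expo μ = ∑ i, hexp (a i) := by
    have : expo μ = (I.map hexp).sum := by simp [expo, hI, parts, Function.comp_def]
    rw [this]
    conv_lhs => rw [← List.ofFn_get I, List.map_ofFn, List.sum_ofFn]
    rfl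
  have hdet : schur I = ∑ π : Equiv.Perm (Fin I.length),
      Equiv.Perm.sign π • ∏ i, hSym (a (π i) + (i : ℤ) - (π i : ℤ)) := by
    rw [schur, Matrix.det_apply]; rfl
  have hone : MvPolynomial.monomial (expo μ) (1 : ℤ)
      = Equiv.Perm.sign (1 : Equiv.Perm (Fin I.length)) •
        ∏ i, hSym (a ((1 : Equiv.Perm (Fin I.length)) i) + (i : ℤ)
          - ((1 : Equiv.Perm (Fin I.length)) i : ℤ)) := by
    simp only [Equiv.Perm.sign_one, one_smul, Equiv.Perm.one_apply, add_sub_cancel_right]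
    rw [hexpo, MvPolynomial.monomial_sum_one]
    exact Finset.prod_congr rfl fun i _ => (hSym_eq (ha0 i)).symm
  rw [hdet, hone, ← Finset.sum_erase_eq_sub (Finset.mem_univ _)]
  refine Submodule.sum_mem _ fun π hπ => ?_
  have hπ1 : π ≠ 1 := Finset.ne_of_mem_erase hπ
  rw [Units.smul_def]
  refine Submodule.smul_mem _ _ ?_
  by_cases hneg : ∃ i, a (π i) + (i : ℤ) - (π i : ℤ) < 0
  · obtain ⟨i, hi⟩ := hneg
    rw [Finset.prod_eq_zero (Finset.mem_univ i) (by simp [hSym, hi])]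
    exact Submodule.zero_mem _
  · push Not at hneg
    rw [Finset.prod_congr rfl fun i _ => hSym_eq (hneg i), ← MvPolynomial.monomial_sum_one]
    refine Submodule.subset_span ⟨_, ⟨?_, ?_⟩, rfl⟩
    · rw [hexpo, map_sum, map_sum, ← Nat.cast_inj (R := ℤ), Nat.cast_sum, Nat.cast_sum,
        Finset.sum_congr rfl fun i _ => mdeg_hexp (hneg i),
        Finset.sum_congr rfl fun i _ => mdeg_hexp (ha0 i),
        Finset.sum_sub_distrib, Finset.sum_add_distrib, Equiv.sum_comp π a,
        Equiv.sum_comp π (fun i => ((i : ℕ) : ℤ))]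
      ring
    · rw [hexpo, map_sum, map_sum, ← Nat.cast_lt (α := ℤ), Nat.cast_sum, Nat.cast_sum,
        Finset.sum_congr rfl fun i _ => msq_hexp (hneg i),
        Finset.sum_congr rfl fun i _ => msq_hexp (ha0 i)]
      exact antitone_sum a ha π hπ1

lemma coeff_bigger {m m' : ℕ →₀ ℕ} {p : Lam} (hp : p ∈ bigger m) (hm : msq m' ≤ msq m) :
    MvPolynomial.coeff m' p = 0 := by
  refine Submodule.span_induction ?_ ?_ ?_ ?_ hp
  · rintro _ ⟨k, ⟨_, hk⟩, rfl⟩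
    rw [MvPolynomial.coeff_monomial, if_neg]
    rintro rfl
    omega
  · simp
  · intro x y _ _ hx hy; simp [hx, hy]
  · intro c x _ hx; rw [MvPolynomial.coeff_smul, hx, smul_zero]

open Classical in
lemma schur_linearIndependent :
    LinearIndependent ℤ (fun μ : YoungDiagram => schur (parts μ)) := by
  rw [linearIndependent_iff]
  intro l hl
  by_contra hne
  obtain ⟨μ, hμ, hmin⟩ := Finset.exists_min_image l.support (fun μ => msq (expo μ))
    (Finsupp.support_nonempty_iff.2 hne)
  have hco : ∀ ν, msq (expo μ) ≤ msq (expo ν) →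
      MvPolynomial.coeff (expo μ) (schur (parts ν)) = if ν = μ then 1 else 0 := by
    intro ν hν
    have h1 := coeff_bigger (schur_triangular ν) hν
    rw [MvPolynomial.coeff_sub, MvPolynomial.coeff_monomial, sub_eq_zero] at h1
    rw [h1]
    simp [expo_injective.eq_iff]
  have h0 := congrArg (MvPolynomial.coeff (expo μ)) hl
  rw [Finsupp.linearCombination_apply, Finsupp.sum, MvPolynomial.coeff_sum,
    Finset.sum_congr rfl (fun ν hν => by
      rw [MvPolynomial.coeff_smul, hco ν (hmin ν hν)])] at h0
  simp at h0
  simp [h0] at hμ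

lemma schur_span :
    ⊤ ≤ Submodule.span ℤ (Set.range (fun μ : YoungDiagram => schur (parts μ))) := by
  have key : ∀ N : ℕ, ∀ m : ℕ →₀ ℕ, mdeg m ^ 2 - msq m = N →
      MvPolynomial.monomial m (1 : ℤ) ∈
        Submodule.span ℤ (Set.range (fun μ : YoungDiagram => schur (parts μ))) := by
    intro N
    induction N using Nat.strong_induction_on with
    | _ N ih =>
      intro m hm
      obtain ⟨μ, rfl⟩ := expo_surjective m
      have hb : bigger (expo μ) ≤
          Submodule.span ℤ (Set.range (fun μ : YoungDiagram => schur (parts μ))) := by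
        refine Submodule.span_le.2 ?_
        rintro _ ⟨k, ⟨hk1, hk2⟩, rfl⟩
        refine ih _ ?_ k rfl
        have := msq_le k
        rw [hk1] at this ⊢
        omega
      have h1 := Submodule.sub_mem _ (Submodule.subset_span (Set.mem_range_self μ)) (hb (schur_triangular μ))
      simpa using h1
  intro p _
  induction p using MvPolynomial.induction_on' with
  | monomial u a =>
    have := Submodule.smul_mem _ a (key _ u rfl)
    simpa [MvPolynomial.smul_monomial] using this
  | add p q hp hq => exact Submodule.add_mem _ (hp trivial) (hq trivial)

/-- The basis of `Λ` given by the Schur functions of partitions. -/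
def schurBasis : Module.Basis YoungDiagram ℤ Lam :=
  Module.Basis.mk schur_linearIndependent schur_span

/-- The Littlewood-Richardson coefficient `c^μ_{στ}`: the coefficient of `s_μ` in `s_σ s_τ`. -/
def lrCoeff (μ σ τ : YoungDiagram) : ℤ :=
  schurBasis.repr (schur (parts σ) * schur (parts τ)) μ

/-- The basis `s_{μ₁} ⊗ ⋯ ⊗ s_{μ_ℓ}` of the tensor power `Λ^{⊗ℓ}`. -/
def tensorBasis (ℓ : ℕ) : Module.Basis (Fin ℓ → YoungDiagram) ℤ (⨂[ℤ]^ℓ Lam) :=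
  Basis.piTensorProduct fun _ => schurBasis

/-- The element `f₁ ⊗ ⋯ ⊗ f_ℓ` of `Λ^{⊗ℓ}`, for a list `f` of length `ℓ`. -/
def pureTensor (ℓ : ℕ) (f : List Lam) : ⨂[ℤ]^ℓ Lam :=
  PiTensorProduct.tprod ℤ fun k : Fin ℓ => f.getD k 1

/-- `s_{μ₁}, s_{μ₂}, …` for a list of partitions. -/
def schurs (μ : List YoungDiagram) : List Lam := μ.map fun ν => schur (parts ν)

/-! ### Diagrams with weakly increasing rows, tableaux and their product -/

/-- A diagram filled with integers, as the list of its rows from top to bottom.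
Empty rows are allowed. -/
abbrev Diagram : Type := List (List ℤ)

/-- The content of the box in row `i` and column `j` (counted from `0`), if there is one. -/
def Diagram.box (D : Diagram) (i j : ℕ) : Option ℤ := (D[i]?).bind fun r => r[j]?

/-- A violation: a box not in the top row, such that there is no box directly above it or the
box directly above it is not strictly smaller. -/
def Diagram.Violation (D : Diagram) (i j : ℕ) : Prop :=
  0 < i ∧ ∃ x, D.box i j = some x ∧ ∀ y, D.box (i - 1) j = some y → x ≤ y

/-- The rows are weakly increasing and there are no violations: up to empty rows at the bottom,
the diagram is a semistandard tableau. -/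
def Diagram.Semistandard (D : Diagram) : Prop :=
  (∀ r ∈ D, r.Pairwise (· ≤ ·)) ∧ ∀ i j, ¬ D.Violation i j

/-- A (semistandard) tableau: a diagram without empty rows, with weakly increasing rows and
strictly increasing columns. -/
def Diagram.IsTableau (D : Diagram) : Prop :=
  (∀ r ∈ D, r ≠ []) ∧ D.Semistandard

/-- The sequence of row lengths. -/
def Diagram.shape (D : Diagram) : List ℕ := D.map List.length

/-- The symmetric function `S(D) = s_I`, with `I` the sequence of row lengths of `D`. -/
def Diagram.S (D : Diagram) : Lam := schur (D.map fun r => (r.length : ℤ))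

/-- Remove the empty rows. -/
def Diagram.trim (D : Diagram) : Diagram := D.filter fun r => !r.isEmpty

/-- Row bumping into one row: `x` replaces the leftmost entry larger than `x`, which is bumped
out, or is put at the end of the row if there is no such entry. -/
def bumpRow (x : ℤ) : List ℤ → List ℤ × Option ℤ
  | [] => ([x], none)
  | y :: ys => if x < y then (x :: ys, some y) else (y :: (bumpRow x ys).1, (bumpRow x ys).2)

/-- Row insertion of `x` into a tableau. -/
def rowInsert (x : ℤ) : Diagram → Diagram
  | [] => [[x]]
  | r :: rs =>
    match bumpRow x r with
    | (r', none) => r' :: rs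
    | (r', some y) => r' :: rowInsert y rs

/-- The product `U · V` of tableaux: the entries of `V`, read row by row from left to right and
from the bottom row to the top row, are row inserted into `U`. -/
def tmul (U V : Diagram) : Diagram :=
  V.reverse.flatten.foldl (fun W x => rowInsert x W) U

/-- The left part of the vertical cut after column `b`. -/
def leftCut (b : ℕ) (X : Diagram) : Diagram := Diagram.trim (X.map fun r => r.take b)

/-- The right part of the vertical cut after column `b`. -/
def rightCut (b : ℕ) (X : Diagram) : Diagram := Diagram.trim (X.map fun r => r.drop b)

/-! ### Fomin's involution -/

/-- The exchange operation between row `i` and row `i + 1` (counted from `0`): if row `i + 1`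
contains a violation, the two rows `u` and `v` are replaced by weakly increasing rows `u'` and
`v'`, of lengths `v.length - 1` and `u.length + 1`, with the same product. -/
def Exchange (i : ℕ) (D D' : Diagram) : Prop :=
  (∃ j, D.Violation (i + 1) j) ∧
  ∃ (A B : Diagram) (u v u' v' : List ℤ), A.length = i ∧
    D = A ++ u :: v :: B ∧ D' = A ++ u' :: v' :: B ∧
    u'.Pairwise (· ≤ ·) ∧ v'.Pairwise (· ≤ ·) ∧
    u'.length + 1 = v.length ∧ v'.length = u.length + 1 ∧
    tmul [v'] [u'] = tmul [v] [u]

/-- The order on positions: the south-west most is the smallest, and of two which are equally far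
south-west the north-west most is smaller. -/
def PosLT (i j i' j' : ℕ) : Prop :=
  (j : ℤ) - i < (j' : ℤ) - i' ∨ ((j : ℤ) - i = (j' : ℤ) - i' ∧ i < i')

/-- `(i, j)` is the smallest violation of `D` outside row `a` (rows are counted from `0`). -/
def MinViolationOutside (a : ℕ) (D : Diagram) (i j : ℕ) : Prop :=
  D.Violation i j ∧ i ≠ a ∧
    ∀ i' j', D.Violation i' j' → i' ≠ a → (i', j') ≠ (i, j) → PosLT i j i' j'

/-- Fomin's algorithm. Rows are counted from `0`, so that the row just below the top `a` rows is
row `a`. First do an exchange operation between the rows `a - 1` and `a`; stop if all violations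
are in row `a`; otherwise do an exchange operation between the row of the smallest violation
outside row `a` and the row above it, and start again. -/
inductive FominRun (a : ℕ) : Diagram → Diagram → Prop
  | last (D D' : Diagram) : Exchange (a - 1) D D' → (∀ i j, D'.Violation i j → i = a) →
      FominRun a D D'
  | next (D D₁ D₂ D' : Diagram) (i j : ℕ) : Exchange (a - 1) D D₁ →
      MinViolationOutside a D₁ i j → Exchange (i - 1) D₁ D₂ → FominRun a D₂ D' → FominRun a D D'

/-- The diagram with `T` in the upper left corner, `Y` to the right of `T` within the top `a`
rows, and `X` below these `a` rows; `T` and `Y` have at most `a` rows, and missing rows count as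
empty ones. -/
def attach (a : ℕ) (T X Y : Diagram) : Diagram :=
  ((List.range a).map fun k => T.getD k [] ++ Y.getD k []) ++ X

/-- Fomin's involution for `a ≥ 1` maps the pair `(Q, P)` to `(Q', P')`. The pair `(Q, P)` is
identified with the diagram with `P` in the top `a` rows and `Q` below. -/
def Fomin (a : ℕ) (Q P Q' P' : Diagram) : Prop :=
  ∃ D', FominRun a (attach a [] Q P) D' ∧ P' = Diagram.trim (D'.take a) ∧ Q' = D'.drop a

/-! ### Rank conditions, rectangle diagrams and tableau diagrams -/

/-- A rectangle diagram with rectangles `R_{ij}` for `0 ≤ i < j ≤ n`: the number of rows weakly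
decreases when moving south-east and the number of columns weakly decreases when moving
south-west. -/
structure RectangleDiagram (n : ℕ) where
  rows : ℕ → ℕ → ℕ
  cols : ℕ → ℕ → ℕ
  rows_le : ∀ i j, i < j → j + 1 ≤ n → rows i (j + 1) ≤ rows i j
  cols_le : ∀ i j, i + 1 < j → j ≤ n → cols i j ≤ cols (i + 1) j

/-- Rank conditions `r_{ij}` for `0 ≤ i ≤ j ≤ n` which can occur. -/
structure RankConditions (n : ℕ) where
  r : ℕ → ℕ → ℕ
  le_left : ∀ i j, i ≤ j → j + 1 ≤ n → r i (j + 1) ≤ r i j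
  le_right : ∀ i j, i ≤ j → j + 1 ≤ n → r i (j + 1) ≤ r (i + 1) (j + 1)
  occur : ∀ i j, i < j → j + 1 ≤ n → r i j + r (i + 1) (j + 1) ≤ r i (j + 1) + r (i + 1) j

/-- The rectangle diagram of a set of rank conditions: `R_{ij}` has `r_{i+1,j} - r_{ij}` rows and
`r_{i,j-1} - r_{ij}` columns. -/
def RankConditions.rectangles {n : ℕ} (r : RankConditions n) : RectangleDiagram n where
  rows i j := r.r (i + 1) j - r.r i j
  cols i j := r.r i (j - 1) - r.r i j
  rows_le i j hij hj := by
    have := r.occur i j hij hj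
    have := r.le_right i j hij.le hj
    omega
  cols_le i j hij hj := by
    obtain ⟨k, rfl⟩ : ∃ k, j = k + 1 := ⟨j - 1, by omega⟩
    have := r.occur i k (by omega) hj
    have := r.le_left (i + 1) k (by omega) hj
    simp only [Nat.add_sub_cancel]
    omega

/-- A tableau diagram: a filling `T_{ij}` of each rectangle `R_{ij}`, such that the entries of
`T_{ij}` are strictly larger than those of each other `T_{kl}` with `i ≤ k < l ≤ j`. -/
structure TableauDiagram {n : ℕ} (R : RectangleDiagram n) where
  T : ℕ → ℕ → Diagram
  isTableau : ∀ i j, i < j → j ≤ n → (T i j).IsTableau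
  shape_eq : ∀ i j, i < j → j ≤ n →
    (T i j).shape = if R.cols i j = 0 then [] else List.replicate (R.rows i j) (R.cols i j)
  entries_lt : ∀ i j k l, i ≤ k → k < l → l ≤ j → j ≤ n → (k, l) ≠ (i, j) →
    ∀ x ∈ (T k l).flatten, ∀ y ∈ (T i j).flatten, x < y

/-! ### Paths -/

/-- A line segment of a path, from `r_{ij}` to `r_{i,j+1}` (down), to `r_{i+1,j}` (up) or to
`r_{i+1,j+1}` (horizontal). -/
inductive Seg
  | down
  | up
  | horiz

/-- The pair `(i, j)` such that the path which starts at `r_{00}` ends at `r_{ij}`. -/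
def endpoint : List Seg → ℕ × ℕ
  | [] => (0, 0)
  | Seg.down :: γ => ((endpoint γ).1, (endpoint γ).2 + 1)
  | Seg.up :: γ => ((endpoint γ).1 + 1, (endpoint γ).2)
  | Seg.horiz :: γ => ((endpoint γ).1 + 1, (endpoint γ).2 + 1)

/-- A path from `r_{00}` to `r_{nn}` in the triangle of the `r_{ij}` with `0 ≤ i ≤ j ≤ n`. -/
def IsPath (n : ℕ) (γ : List Seg) : Prop :=
  endpoint γ = (n, n) ∧ ∀ α, α <+: γ → (endpoint α).1 ≤ (endpoint α).2

/-- The lowest path, from `r_{00}` to `r_{0n}` to `r_{nn}`. -/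
def lowestPath (n : ℕ) : List Seg := List.replicate n Seg.down ++ List.replicate n Seg.up

/-! ### The element `P_γ` -/

/-- The linear map which replaces each basis element `⋯ ⊗ s_μ ⊗ ⋯`, with `s_μ` in position `k`
(counted from `0`), by `∑ c^μ_{στ} (⋯ ⊗ s_σ ⊗ s_τ ⊗ ⋯)`. -/
def splitMap (k ℓ ℓ' : ℕ) : ⨂[ℤ]^ℓ Lam →ₗ[ℤ] ⨂[ℤ]^ℓ' Lam :=
  (tensorBasis ℓ).constr ℤ fun ν =>
    match (List.ofFn ν).drop k with
    | μ :: B => ∑ᶠ p : YoungDiagram × YoungDiagram, lrCoeff μ p.1 p.2 •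
        pureTensor ℓ' (schurs ((List.ofFn ν).take k ++ p.1 :: p.2 :: B))
    | [] => 0

/-- The sequence of row lengths of the diagram which consists of a rectangle with `a` rows and `b`
columns, with `σ` attached to its right side and `τ` attached beneath. -/
def attachParts (a b : ℕ) (τ σ : YoungDiagram) : List ℤ :=
  ((List.range a).map fun k => (b : ℤ) + σ.rowLen k) ++ parts τ

/-- The linear map which replaces each basis element `⋯ ⊗ s_τ ⊗ s_σ ⊗ ⋯`, with `s_τ` in position
`k` (counted from `0`), by zero if `σ` has more than `a` rows, and otherwise by the element with
the two factors replaced by the Schur function of the rectangle with `a` rows and `b` columns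
with `σ` attached to its right side and `τ` attached beneath. -/
def mergeMap (a b k ℓ ℓ' : ℕ) : ⨂[ℤ]^ℓ Lam →ₗ[ℤ] ⨂[ℤ]^ℓ' Lam :=
  (tensorBasis ℓ).constr ℤ fun ν =>
    match (List.ofFn ν).drop k with
    | τ :: σ :: B =>
      if σ.colLen 0 ≤ a then
        pureTensor ℓ' (schurs ((List.ofFn ν).take k) ++ schur (attachParts a b τ σ) :: schurs B)
      else 0
    | _ => 0

/-- `IsPathElement R γ P`: the element `P` of `Λ^{⊗ℓ}`, with `ℓ` the length of `γ`, is obtained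
by the inductive construction of `P_γ`, for some choice of the lower paths used in it. -/
inductive IsPathElement {n : ℕ} (R : RectangleDiagram n) :
    (γ : List Seg) → ⨂[ℤ]^γ.length Lam → Prop
  | lowest : IsPathElement R (lowestPath n) (PiTensorProduct.tprod ℤ fun _ => 1)
  | split (α β : List Seg) (P : ⨂[ℤ]^(α ++ Seg.horiz :: β).length Lam) :
      IsPath n (α ++ Seg.up :: Seg.down :: β) →
      IsPathElement R (α ++ Seg.horiz :: β) P →
      IsPathElement R (α ++ Seg.up :: Seg.down :: β) (splitMap α.length _ _ P)
  | merge (α β : List Seg) (P : ⨂[ℤ]^(α ++ Seg.down :: Seg.up :: β).length Lam) :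
      IsPath n (α ++ Seg.horiz :: β) →
      IsPathElement R (α ++ Seg.down :: Seg.up :: β) P →
      IsPathElement R (α ++ Seg.horiz :: β)
        (mergeMap (R.rows (endpoint α).1 ((endpoint α).2 + 1))
          (R.cols (endpoint α).1 ((endpoint α).2 + 1)) α.length _ _ P)

/-! ### Factor sequences -/

/-- The factor sequences of a path for a given tableau diagram. -/
inductive IsFactorSeq {n : ℕ} {R : RectangleDiagram n} (𝒯 : TableauDiagram R) :
    List Seg → List Diagram → Prop
  | lowest : IsFactorSeq 𝒯 (lowestPath n) (List.replicate (2 * n) [])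
  | split (α β : List Seg) (A B : List Diagram) (P Q : Diagram) :
      IsPath n (α ++ Seg.up :: Seg.down :: β) → A.length = α.length →
      P.IsTableau → Q.IsTableau →
      IsFactorSeq 𝒯 (α ++ Seg.horiz :: β) (A ++ tmul P Q :: B) →
      IsFactorSeq 𝒯 (α ++ Seg.up :: Seg.down :: β) (A ++ P :: Q :: B)
  | merge (α β : List Seg) (A B : List Diagram) (Q P : Diagram) :
      IsPath n (α ++ Seg.horiz :: β) → A.length = α.length →
      IsFactorSeq 𝒯 (α ++ Seg.down :: Seg.up :: β) (A ++ Q :: P :: B) →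
      IsFactorSeq 𝒯 (α ++ Seg.horiz :: β)
        (A ++ tmul (tmul Q (𝒯.T (endpoint α).1 ((endpoint α).2 + 1))) P :: B)

/-- `S(W₁, …, W_ℓ) = S(W₁) ⊗ ⋯ ⊗ S(W_ℓ)`. -/
def tensorS (ℓ : ℕ) (W : List Diagram) : ⨂[ℤ]^ℓ Lam := pureTensor ℓ (W.map Diagram.S)

/-- The stronger conjecture, for one tableau diagram: let `γ` be a path with an angle pointing down
at the triangle of `R_{ij}`, with `a` rows and `b` columns, and let `X` and `Y` be the labels of
the two segments of this angle in a factor sequence of `γ`, such that `Y` has at most `a` rows,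
`(X, Y)` does not fit around `T = T_{ij}` and `S` of the attached diagram is non-zero. Write
`X = X₀ · X₁` for the vertical cut after column `b`, let `(X₁', Y')` be the image of `(X₁, Y)` under
Fomin's involution, and put `X' = X₀ · X₁'`. Then replacing `X, Y` by `X', Y'` gives a
factor sequence of `γ`. -/
def StrongConjecture {n : ℕ} {R : RectangleDiagram n} (𝒯 : TableauDiagram R) : Prop :=
  ∀ (α β : List Seg) (i j a b : ℕ) (T X Y X₁' Y' : Diagram) (A B : List Diagram),
    IsPath n (α ++ Seg.down :: Seg.up :: β) →
    i = (endpoint α).1 → j = (endpoint α).2 + 1 →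
    a = R.rows i j → b = R.cols i j → T = 𝒯.T i j →
    A.length = α.length →
    IsFactorSeq 𝒯 (α ++ Seg.down :: Seg.up :: β) (A ++ X :: Y :: B) →
    Y.length ≤ a →
    ¬ (attach a T X Y).Semistandard →
    (attach a T X Y).S ≠ 0 →
    Fomin a (rightCut b X) Y X₁' Y' →
    IsFactorSeq 𝒯 (α ++ Seg.down :: Seg.up :: β) (A ++ tmul (leftCut b X) X₁' :: Y' :: B)

end

end QuiverFactor

open QuiverFactor

namespace QuiverFactor

/-! ### Tableaux as elements of the plactic monoid -/

/-! ### Row insertion of words -/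

/-! Tableaux are handled through their classes in the plactic monoid: insertion respects the Knuth
relations (`insertWord_eq_of_pl`), the class of a product is the product of the classes
(`pl_insertWord`), and a tableau is determined by its class (`Tab.eq_of_pl`). The formula for `P_γ`
is proved by induction along the construction of `P_γ`. Since the sum over factor sequences involves
no choice of lower paths, the formula also shows that `P_γ` is well defined.

A factor sequence is given by some chain of lower paths, and the induction needs that it also arises
through any prescribed one. Lowerings at disjoint places commute, which gives this (`LP.lower`).

When a horizontal step is split, a label is replaced by all its factorizations into two tableaux.
The Littlewood-Richardson rule (`lrCoeff_eq`) says that the coefficients in `splitMap` count the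
factorizations of any fixed tableau. It is obtained by mapping `Λ` to the plactic ring, with `h_k`
going to the sum of all rows of length `k`. These sums commute because two rows can exchange their
lengths in a unique way (`exists_swap`, `rows_unique`), and the determinant of a partition becomes
the sum of all tableaux of that shape, by a sign-reversing cancellation
(`toPlactic_schur_partition`).

When an angle with labels `X`, `Y` is filled by a rectangle with tableau `T`, there are three kinds
of pairs. Pairs with too many rows in `Y`, or with `S = 0` for the attached diagram, contribute
zero. Pairs which fit around `T` correspond one to one to the factor sequences of the upper path:
their product with `T` is the attached tableau, from which they can be read off. That every upper
factor sequence arises in this way needs an argument: columns of `X` and rows of `Y` which stick out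
can be moved to the other side of the angle, within the set of factor sequences (`moves`), until the
labels fit (`AngleRel.exists_horiz`). The moves rest on the compatibility of products with vertical
and horizontal cuts (`cut_mul`, `rows_mul`) and on the monotonicity of the sizes of the rectangles.

For the remaining pairs Fomin's involution reverses the sign of `S` (`exists_fomin`). The hypothesis
`StrongConjecture` keeps its image inside the set of factor sequences, so these terms cancel
(`AngleSet.sum_nonFitting`). -/

/-- A weakly increasing row. -/
abbrev Sorted (r : List ℤ) : Prop := r.Pairwise (· ≤ ·)

/-- The reading word of a diagram: rows from left to right, from the bottom row to the top row. -/
def word (D : Diagram) : List ℤ := D.reverse.flatten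

/-- Row insertion of the letters of a word. -/
def insertWord (D : Diagram) (w : List ℤ) : Diagram := w.foldl (fun W x => rowInsert x W) D

/-- Bumping the letters of a word into a row; the second component is the word of the letters
which are bumped out. -/
def rowIns (r : List ℤ) : List ℤ → List ℤ × List ℤ
  | [] => (r, [])
  | x :: w => ((rowIns (bumpRow x r).1 w).1, (bumpRow x r).2.toList ++ (rowIns (bumpRow x r).1 w).2)

lemma tmul_eq_insertWord (U V : Diagram) : tmul U V = insertWord U (word V) := rfl

@[simp] lemma word_nil : word [] = [] := rfl

@[simp] lemma word_cons (r : List ℤ) (D : Diagram) : word (r :: D) = word D ++ r := by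
  simp [word]

lemma word_append (D E : Diagram) : word (D ++ E) = word E ++ word D := by
  simp [word]

@[simp] lemma insertWord_nil (D : Diagram) : insertWord D [] = D := rfl

@[simp] lemma insertWord_cons (D : Diagram) (x : ℤ) (w : List ℤ) :
    insertWord D (x :: w) = insertWord (rowInsert x D) w := rfl

lemma insertWord_append (D : Diagram) (v w : List ℤ) :
    insertWord D (v ++ w) = insertWord (insertWord D v) w := by
  simp [insertWord]

@[simp] lemma rowIns_nil (r : List ℤ) : rowIns r [] = (r, []) := rfl

lemma rowIns_cons (r : List ℤ) (x : ℤ) (w : List ℤ) : rowIns r (x :: w) =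
    ((rowIns (bumpRow x r).1 w).1, (bumpRow x r).2.toList ++ (rowIns (bumpRow x r).1 w).2) := rfl

lemma rowIns_append (r v w : List ℤ) : rowIns r (v ++ w) =
    ((rowIns (rowIns r v).1 w).1, (rowIns r v).2 ++ (rowIns (rowIns r v).1 w).2) := by
  induction v generalizing r with
  | nil => simp
  | cons x v ih => simp [rowIns_cons, ih]

lemma rowInsert_cons (x : ℤ) (r : List ℤ) (D : Diagram) :
    rowInsert x (r :: D) = (bumpRow x r).1 :: insertWord D (bumpRow x r).2.toList := by
  rw [rowInsert]
  rcases bumpRow x r with ⟨r', _ | y⟩ <;> simp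

/-- The letters bumped out of the top row form, in their order, the word inserted below. Through
this recursion most facts about insertion reduce to a single row. -/
lemma insertWord_row (r : List ℤ) (D : Diagram) (w : List ℤ) :
    insertWord (r :: D) w = (rowIns r w).1 :: insertWord D (rowIns r w).2 := by
  induction w generalizing r D with
  | nil => simp
  | cons x w ih => simp [rowInsert_cons, ih, rowIns_cons, insertWord_append]

/-- The empty diagram behaves like an empty row above an empty diagram. The empty word is excluded
because the right side would then have an empty top row. -/
lemma insertWord_empty {w : List ℤ} (hw : w ≠ []) :
    insertWord [] w = (rowIns [] w).1 :: insertWord [] (rowIns [] w).2 := by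
  rcases w with _ | ⟨x, w⟩
  · exact absurd rfl hw
  · simp [rowInsert, rowIns_cons, bumpRow, insertWord_row]

/-! ### Bumping into one row -/

lemma bumpRow_cons_lt {x y : ℤ} (h : x < y) (r : List ℤ) :
    bumpRow x (y :: r) = (x :: r, some y) := by simp [bumpRow, h]

lemma bumpRow_cons_ge {x y : ℤ} (h : y ≤ x) (r : List ℤ) :
    bumpRow x (y :: r) = (y :: (bumpRow x r).1, (bumpRow x r).2) := by
  simp [bumpRow, not_lt.2 h]

lemma bumpRow_perm (x : ℤ) (r : List ℤ) :
    ((bumpRow x r).2.toList ++ (bumpRow x r).1).Perm (x :: r) := by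
  induction r with
  | nil => simp [bumpRow]
  | cons y r ih =>
    rcases lt_or_ge x y with h | h
    · rw [bumpRow_cons_lt h]; exact List.Perm.swap _ _ _
    · rw [bumpRow_cons_ge h]
      refine List.perm_middle.trans ?_
      exact (ih.cons y).trans (List.Perm.swap _ _ _)

lemma mem_bumpRow {x z : ℤ} {r : List ℤ} (h : z ∈ (bumpRow x r).1) : z = x ∨ z ∈ r := by
  have := (bumpRow_perm x r).subset (List.mem_append_right _ h)
  simpa using this

lemma bumpRow_out_mem {x y : ℤ} {r : List ℤ} (h : (bumpRow x r).2 = some y) : y ∈ r ∧ x < y := by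
  induction r with
  | nil => simp [bumpRow] at h
  | cons z r ih =>
    rcases lt_or_ge x z with hz | hz
    · rw [bumpRow_cons_lt hz] at h; simp at h; subst h; exact ⟨by simp, hz⟩
    · rw [bumpRow_cons_ge hz] at h
      exact ⟨List.mem_cons_of_mem _ (ih h).1, (ih h).2⟩

lemma bumpRow_none_iff {x : ℤ} {r : List ℤ} : (bumpRow x r).2 = none ↔ ∀ y ∈ r, y ≤ x := by
  induction r with
  | nil => simp [bumpRow]
  | cons z r ih =>
    rcases lt_or_ge x z with hz | hz
    · rw [bumpRow_cons_lt hz]; simp; intro h; omega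
    · rw [bumpRow_cons_ge hz]; simp [ih, hz]

lemma bumpRow_of_le {x : ℤ} {r : List ℤ} (h : ∀ y ∈ r, y ≤ x) : bumpRow x r = (r ++ [x], none) := by
  induction r with
  | nil => simp [bumpRow]
  | cons z r ih =>
    rw [bumpRow_cons_ge (h z (by simp)), ih (fun y hy => h y (by simp [hy]))]; simp

lemma bumpRow_out_le {x y z : ℤ} {r : List ℤ} (hr : Sorted r) (h : (bumpRow x r).2 = some y)
    (hz : z ∈ r) (hxz : x < z) : y ≤ z := by
  induction r with
  | nil => simp at hz
  | cons c r ih =>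
    rw [Sorted, List.pairwise_cons] at hr
    rcases lt_or_ge x c with hc | hc
    · rw [bumpRow_cons_lt hc] at h
      simp at h; subst h
      rcases List.mem_cons.1 hz with rfl | hz
      · exact le_rfl
      · exact hr.1 z hz
    · rw [bumpRow_cons_ge hc] at h
      rcases List.mem_cons.1 hz with rfl | hz
      · omega
      · exact ih hr.2 h hz

lemma sorted_bumpRow {x : ℤ} {r : List ℤ} (hr : Sorted r) : Sorted (bumpRow x r).1 := by
  induction r with
  | nil => simp [bumpRow]
  | cons c r ih =>
    rw [Sorted, List.pairwise_cons] at hr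
    rcases lt_or_ge x c with hc | hc
    · rw [bumpRow_cons_lt hc, Sorted, List.pairwise_cons]
      exact ⟨fun z hz => hc.le.trans (hr.1 z hz), hr.2⟩
    · rw [bumpRow_cons_ge hc, Sorted, List.pairwise_cons]
      refine ⟨fun z hz => ?_, ih hr.2⟩
      rcases mem_bumpRow hz with rfl | hz
      · exact hc
      · exact hr.1 z hz

lemma sorted_rowIns {r w : List ℤ} (hr : Sorted r) : Sorted (rowIns r w).1 := by
  induction w generalizing r with
  | nil => exact hr
  | cons x w ih => exact ih (sorted_bumpRow hr)

lemma mem_bumpRow_self (x : ℤ) (r : List ℤ) : x ∈ (bumpRow x r).1 := by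
  induction r with
  | nil => simp [bumpRow]
  | cons c r ih =>
    rcases lt_or_ge x c with hc | hc
    · rw [bumpRow_cons_lt hc]; simp
    · rw [bumpRow_cons_ge hc]; simp [ih]

/-- If `y ≤ z` then what `z` bumps after `y` is at least what `y` bumps. -/
lemma bumpRow_bumpRow_out_le {y z s t : ℤ} {r : List ℤ} (hr : Sorted r) (hyz : y ≤ z)
    (hs : (bumpRow y r).2 = some s) (ht : (bumpRow z (bumpRow y r).1).2 = some t) : s ≤ t := by
  obtain ⟨h1, h2⟩ := bumpRow_out_mem ht
  rcases mem_bumpRow h1 with h | h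
  · omega
  · exact bumpRow_out_le hr hs h (by omega)

lemma bumpRow_bumpRow_none {y z : ℤ} {r : List ℤ} (hyz : y ≤ z)
    (hs : (bumpRow y r).2 = none) : (bumpRow z (bumpRow y r).1).2 = none := by
  rw [bumpRow_none_iff] at *
  intro c hc
  rcases mem_bumpRow hc with rfl | hc
  · exact hyz
  · exact (hs c hc).trans hyz

/-- If `y < z` then inserting `y` after `z` bumps a letter, which is at most `z`. -/
lemma bumpRow_bumpRow_lt {y z : ℤ} {r : List ℤ} (hr : Sorted r) (hyz : y < z) :
    ∃ s, (bumpRow y (bumpRow z r).1).2 = some s ∧ s ≤ z := by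
  have hz := mem_bumpRow_self z r
  rcases h : (bumpRow y (bumpRow z r).1).2 with _ | s
  · rw [bumpRow_none_iff] at h
    exact absurd (h z hz) (by omega)
  · exact ⟨s, rfl, bumpRow_out_le (sorted_bumpRow hr) h hz hyz⟩

/-! ### Knuth relations and the plactic monoid -/

/-- The elementary Knuth transformations on words with three letters. -/
inductive Knuth : List ℤ → List ℤ → Prop
  | left (x y z : ℤ) : x < y → y ≤ z → Knuth [y, z, x] [y, x, z]
  | right (x y z : ℤ) : x ≤ y → y < z → Knuth [x, z, y] [z, x, y]

lemma Knuth.ne_nil {v w : List ℤ} (h : Knuth v w) : v ≠ [] ∧ w ≠ [] := by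
  cases h <;> simp

lemma rowIns_empty_knuth {v w : List ℤ} (h : Knuth v w) : rowIns [] v = rowIns [] w := by
  cases h with
  | left x y z h1 h2 =>
    simp [rowIns_cons, bumpRow, h1, not_lt.2 h2, not_lt.2 (h1.le.trans h2)]
  | right x y z h1 h2 =>
    simp [rowIns_cons, bumpRow, h2, not_lt.2 h1, h1.trans_lt h2, not_lt.2 (h1.trans h2.le)]

/-- If all three letters are at least the first entry `c`, they pass it and induction applies;
otherwise `c` is bumped and the outputs can be compared directly. The relation between the outputs
may be of the other kind than the one between the inputs. -/
lemma rowIns_knuth {v w : List ℤ} (h : Knuth v w) {r : List ℤ} (hr : Sorted r) :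
    (rowIns r v).1 = (rowIns r w).1 ∧
      ((rowIns r v).2 = (rowIns r w).2 ∨ Knuth (rowIns r v).2 (rowIns r w).2 ∨
        Knuth (rowIns r w).2 (rowIns r v).2) := by
  induction r with
  | nil => rw [rowIns_empty_knuth h]; simp
  | cons c r ih =>
    have hr' := hr
    rw [Sorted, List.pairwise_cons] at hr
    obtain ⟨hc, hr⟩ := hr
    specialize ih hr
    cases h with
    | left x y z h1 h2 =>
      rcases lt_or_ge y c with hy | hy
      · simp only [rowIns_cons, bumpRow_cons_lt hy, bumpRow_cons_ge h2, bumpRow_cons_lt h1,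
          bumpRow_cons_ge (h1.le.trans h2), rowIns_nil, Option.toList_some, true_and,
          List.append_nil]
        rcases ht : (bumpRow z r).2 with _ | t
        · simp
        · refine Or.inr (Or.inl ?_)
          simp only [Option.toList_some, List.cons_append, List.nil_append]
          exact Knuth.left y c t hy (hc t (bumpRow_out_mem ht).1)
      · rcases lt_or_ge x c with hx | hx
        · simp only [rowIns_cons, bumpRow_cons_ge hy, bumpRow_cons_ge (hy.trans h2),
            bumpRow_cons_lt hx, bumpRow_cons_ge (h1.le.trans h2), rowIns_nil, Option.toList_some,
            List.append_nil, true_and]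
          rcases hs : (bumpRow y r).2 with _ | s
          · simp [bumpRow_bumpRow_none h2 hs]
          · rcases ht : (bumpRow z (bumpRow y r).1).2 with _ | t
            · simp
            · refine Or.inr (Or.inl ?_)
              have := (bumpRow_out_mem hs).2
              exact Knuth.left c s t (by omega) (bumpRow_bumpRow_out_le hr h2 hs ht)
        · simp only [rowIns_cons, bumpRow_cons_ge hy, bumpRow_cons_ge (hy.trans h2),
            bumpRow_cons_ge hx] at ih ⊢
          simpa using ih
    | right x y z h1 h2 =>
      rcases lt_or_ge z c with hz | hz
      · have hxz : x < z := by omega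
        rcases r with _ | ⟨d, r⟩
        · simp [rowIns_cons, bumpRow, hxz, not_lt.2 hxz.le, hz, hxz.trans hz, h2, not_lt.2 h1]
        -- Inserting `x, z, y` bumps `c, d, z`, while inserting `z, x, y` bumps `c, z, d`.
        · have hzd : z < d := hz.trans_le (hc d (by simp))
          have hyd : y < d := h2.trans hzd
          simp only [rowIns_cons, bumpRow_cons_lt (hxz.trans hz), bumpRow_cons_ge hxz.le,
            bumpRow_cons_lt hzd, bumpRow_cons_ge h1, bumpRow_cons_lt h2, bumpRow_cons_lt hz,
            bumpRow_cons_lt hxz, bumpRow_cons_lt hyd, rowIns_nil, true_and]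
          exact Or.inr (Or.inl (Knuth.left z c d hz (hc d (by simp))))
      · rcases lt_or_ge x c with hx | hx
        · simp only [rowIns_cons, bumpRow_cons_lt hx, bumpRow_cons_ge (h1.trans h2.le),
            bumpRow_cons_ge h1, bumpRow_cons_ge hz, rowIns_nil, Option.toList_some,
            List.append_nil, true_and]
          rcases ht : (bumpRow z r).2 with _ | t
          · simp
          · obtain ⟨s, hs, hsz⟩ := bumpRow_bumpRow_lt hr h2
            rw [hs]
            refine Or.inr (Or.inl ?_)
            refine Knuth.right c s t ?_ (hsz.trans_lt (bumpRow_out_mem ht).2)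
            rcases mem_bumpRow (bumpRow_out_mem hs).1 with rfl | h
            · exact hz
            · exact hc s h
        · simp only [rowIns_cons, bumpRow_cons_ge hx, bumpRow_cons_ge (hx.trans h1),
            bumpRow_cons_ge hz] at ih ⊢
          simpa using ih

/-- All rows are weakly increasing. -/
abbrev RowsSorted (D : Diagram) : Prop := ∀ r ∈ D, Sorted r

/-- Each row passes an elementary relation, or an equality, on to the next row. -/
lemma insertWord_knuth {D : Diagram} (hD : RowsSorted D) {v w : List ℤ} (h : Knuth v w) :
    insertWord D v = insertWord D w := by
  induction D generalizing v w with
  | nil =>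
    rw [insertWord_empty h.ne_nil.1, insertWord_empty h.ne_nil.2, rowIns_empty_knuth h]
  | cons r D ih =>
    have hD' : RowsSorted D := fun s hs => hD s (by simp [hs])
    rw [insertWord_row, insertWord_row]
    obtain ⟨h1, h2 | h2 | h2⟩ := rowIns_knuth h (hD r (by simp))
    · rw [h1, h2]
    · rw [h1, ih hD' h2]
    · rw [h1, ih hD' h2]

lemma rowsSorted_rowInsert {D : Diagram} (hD : RowsSorted D) (x : ℤ) :
    RowsSorted (rowInsert x D) := by
  induction D generalizing x with
  | nil => intro r hr; simp [rowInsert] at hr; simp [hr]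
  | cons s D ih =>
    rw [rowInsert_cons]
    intro r hr
    rcases List.mem_cons.1 hr with rfl | hr
    · exact sorted_bumpRow (hD s (by simp))
    · rcases h : (bumpRow x s).2 with _ | y
      · rw [h] at hr
        exact hD r (by simp at hr; simp [hr])
      · rw [h] at hr
        exact ih (fun t ht => hD t (by simp [ht])) y r (by simpa using hr)

lemma rowsSorted_insertWord {D : Diagram} (hD : RowsSorted D) (w : List ℤ) :
    RowsSorted (insertWord D w) := by
  induction w generalizing D with
  | nil => exact hD
  | cons x w ih => exact ih (rowsSorted_rowInsert hD x)

/-- The elementary Knuth transformations, as relations on the free monoid. -/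
def KnuthRel (v w : FreeMonoid ℤ) : Prop := Knuth v.toList w.toList

/-- The plactic monoid on the alphabet of integers. -/
abbrev Plactic : Type := PresentedMonoid KnuthRel

/-- The class of a word in the plactic monoid. -/
def pl (w : List ℤ) : Plactic := PresentedMonoid.mk KnuthRel (FreeMonoid.ofList w)

@[simp] lemma pl_nil : pl [] = 1 := rfl

lemma pl_append (v w : List ℤ) : pl (v ++ w) = pl v * pl w :=
  map_mul (PresentedMonoid.mk KnuthRel) _ _

lemma pl_cons (x : ℤ) (w : List ℤ) : pl (x :: w) = pl [x] * pl w := pl_append [x] w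

lemma pl_knuth {v w : List ℤ} (h : Knuth v w) : pl v = pl w :=
  Quotient.sound (ConGen.Rel.of _ _ h)

/-- Two words act in the same way on diagrams with weakly increasing rows. -/
def insertCon : Con (FreeMonoid ℤ) where
  r v w := ∀ D, RowsSorted D → insertWord D v.toList = insertWord D w.toList
  iseqv := ⟨fun _ _ _ => rfl, fun h D hD => (h D hD).symm, fun h h' D hD => (h D hD).trans (h' D hD)⟩
  mul' := by
    intro a b c d h h' D hD
    simp only [FreeMonoid.toList_mul, insertWord_append]
    rw [h D hD, h' _ (rowsSorted_insertWord hD _)]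

/-- The words acting alike form a congruence which contains the Knuth relations, so insertion is a
right action of the plactic monoid. -/
lemma insertWord_eq_of_pl {v w : List ℤ} (h : pl v = pl w) {D : Diagram} (hD : RowsSorted D) :
    insertWord D v = insertWord D w := by
  have hle : conGen KnuthRel ≤ insertCon :=
    Con.conGen_le.2 fun a b hab D hD => insertWord_knuth hD hab
  exact hle (Quotient.exact h) D hD

/-- Left multiplication: a word and the row bumping algorithm give the same plactic class. -/
lemma pl_bump_front {c x : ℤ} {r : List ℤ} (hxc : x < c) (hr : Sorted (c :: r)) :
    pl (c :: r ++ [x]) = pl (c :: x :: r) := by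
  induction r generalizing c with
  | nil => rfl
  | cons d r ih =>
    have hcd : c ≤ d := (List.pairwise_cons.1 hr).1 d (by simp)
    have h1 := ih (hxc.trans_le hcd) (List.pairwise_cons.1 hr).2
    have h2 : pl [c, d, x] = pl [c, x, d] := pl_knuth (Knuth.left x c d hxc hcd)
    calc pl (c :: d :: r ++ [x]) = pl [c] * pl (d :: r ++ [x]) := pl_append [c] _
      _ = pl [c, d, x] * pl r := by rw [h1, ← pl_append, ← pl_append]; rfl
      _ = _ := by rw [h2, ← pl_append]; rfl

lemma pl_bumpRow {x : ℤ} {r : List ℤ} (hr : Sorted r) :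
    pl (r ++ [x]) = pl ((bumpRow x r).2.toList ++ (bumpRow x r).1) := by
  induction r with
  | nil => rfl
  | cons c r ih =>
    have hr' := (List.pairwise_cons.1 hr).2
    rcases lt_or_ge x c with hc | hc
    · rw [bumpRow_cons_lt hc, pl_bump_front hc hr]; rfl
    · rw [bumpRow_cons_ge hc, List.cons_append, pl_cons, ih hr']
      rcases ht : (bumpRow x r).2 with _ | t
      · rw [← pl_cons]; rfl
      -- `e` is the new first letter of the rest of the row; `c ≤ e < t` is what allows the bumped
      -- letter `t` to pass `c` by a Knuth relation.
      · obtain ⟨e, s, hes, hce, het⟩ : ∃ e s, (bumpRow x r).1 = e :: s ∧ c ≤ e ∧ e < t := by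
          rcases r with _ | ⟨d, r⟩
          · simp [bumpRow] at ht
          · rcases lt_or_ge x d with hd | hd
            · rw [bumpRow_cons_lt hd] at ht ⊢
              simp at ht
              exact ⟨x, r, rfl, hc, by omega⟩
            · refine ⟨d, (bumpRow x r).1, by rw [bumpRow_cons_ge hd], ?_, ?_⟩
              · exact (List.pairwise_cons.1 hr).1 d (by simp)
              · exact hd.trans_lt (bumpRow_out_mem ht).2
        rw [hes]
        have h2 : pl [c, t, e] = pl [t, c, e] := pl_knuth (Knuth.right c e t hce het)
        calc pl [c] * pl ([t] ++ e :: s) = pl [c, t, e] * pl s := by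
              rw [← pl_append, ← pl_append]; rfl
          _ = _ := by rw [h2, ← pl_append]; rfl

lemma pl_rowIns {r w : List ℤ} (hr : Sorted r) :
    pl (r ++ w) = pl ((rowIns r w).2 ++ (rowIns r w).1) := by
  induction w generalizing r with
  | nil => simp
  | cons x w ih =>
    rw [rowIns_cons, ← List.singleton_append, ← List.append_assoc, pl_append, pl_bumpRow hr,
      pl_append, mul_assoc, ← pl_append _ w, ih (sorted_bumpRow hr), ← pl_append]
    simp

lemma pl_rowInsert {D : Diagram} (hD : RowsSorted D) (x : ℤ) :
    pl (word (rowInsert x D)) = pl (word D) * pl [x] := by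
  induction D generalizing x with
  | nil => simp [rowInsert]
  | cons r D ih =>
    have hD' : RowsSorted D := fun s hs => hD s (by simp [hs])
    have hr := pl_bumpRow (x := x) (hD r (by simp))
    rw [rowInsert_cons, word_cons, word_cons, pl_append (word D), mul_assoc, ← pl_append r, hr,
      pl_append, pl_append, ← mul_assoc]
    congr 1
    rcases h : (bumpRow x r).2 with _ | y
    · simp
    · simpa using ih hD' y

/-- Together with `Tab.eq_of_pl` this turns identities between products of tableaux into identities
in a monoid. -/
lemma pl_insertWord {D : Diagram} (hD : RowsSorted D) (w : List ℤ) :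
    pl (word (insertWord D w)) = pl (word D) * pl w := by
  induction w generalizing D with
  | nil => simp
  | cons x w ih =>
    rw [insertWord_cons, ih (rowsSorted_rowInsert hD x), pl_rowInsert hD, mul_assoc, ← pl_append]
    rfl

/-! ### Semistandard diagrams, recursively -/

/-- The row `r` may stand above the row `s` in a tableau. -/
def Over : List ℤ → List ℤ → Prop
  | _, [] => True
  | [], _ :: _ => False
  | x :: r, y :: s => x < y ∧ Over r s

@[simp] lemma over_nil (r : List ℤ) : Over r [] := by cases r <;> trivial

@[simp] lemma not_nil_over (y : ℤ) (s : List ℤ) : ¬ Over [] (y :: s) := id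

@[simp] lemma over_cons_cons {x y : ℤ} {r s : List ℤ} :
    Over (x :: r) (y :: s) ↔ x < y ∧ Over r s := Iff.rfl

lemma over_iff {r s : List ℤ} :
    Over r s ↔ ∀ (k : ℕ) (x : ℤ), s[k]? = some x → ∃ y, r[k]? = some y ∧ y < x := by
  induction s generalizing r with
  | nil => simp
  | cons y s ih =>
    rcases r with _ | ⟨x, r⟩
    · simp only [not_nil_over, false_iff]
      intro h
      simpa using h 0 y rfl
    · rw [over_cons_cons, ih]
      constructor
      · rintro ⟨h1, h2⟩ (_ | k) z hz
        · simp at hz; subst hz; exact ⟨x, rfl, h1⟩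
        · exact h2 k z (by simpa using hz)
      · intro h
        refine ⟨by simpa using h 0 y rfl, fun k z hz => ?_⟩
        simpa using h (k + 1) z (by simpa using hz)

lemma Over.length_le {r s : List ℤ} (h : Over r s) : s.length ≤ r.length := by
  induction s generalizing r with
  | nil => simp
  | cons y s ih =>
    rcases r with _ | ⟨x, r⟩
    · exact absurd h (by simp)
    · simpa using ih h.2

/-- Weakly increasing rows, each of which may stand above the next one. -/
def SS : Diagram → Prop
  | [] => True
  | r :: D => Sorted r ∧ Over r (D.headD []) ∧ SS D

/-- A tableau, recursively. -/
def Tab (D : Diagram) : Prop := SS D ∧ ∀ r ∈ D, r ≠ []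

@[simp] lemma ss_nil : SS [] := trivial

lemma ss_cons {r : List ℤ} {D : Diagram} :
    SS (r :: D) ↔ Sorted r ∧ Over r (D.headD []) ∧ SS D := Iff.rfl

@[simp] lemma tab_nil : Tab [] := ⟨trivial, by simp⟩

lemma tab_cons {r : List ℤ} {D : Diagram} :
    Tab (r :: D) ↔ r ≠ [] ∧ Sorted r ∧ Over r (D.headD []) ∧ Tab D := by
  simp only [Tab, ss_cons, List.mem_cons, forall_eq_or_imp]; tauto

lemma SS.rowsSorted {D : Diagram} (h : SS D) : RowsSorted D := by
  induction D with
  | nil => simp [RowsSorted]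
  | cons r D ih =>
    intro s hs
    rcases List.mem_cons.1 hs with rfl | hs
    · exact h.1
    · exact ih h.2.2 s hs

/-- The recursive form is the one used for induction on the rows. -/
lemma semistandard_iff {D : Diagram} : D.Semistandard ↔ SS D := by
  induction D with
  | nil => simp [Diagram.Semistandard, Diagram.Violation, Diagram.box]
  | cons r D ih =>
    rw [ss_cons, ← ih, over_iff]
    have hviol : ∀ i j, Diagram.Violation (r :: D) (i + 2) j ↔ Diagram.Violation D (i + 1) j := by
      intro i j
      simp [Diagram.Violation, Diagram.box]
    constructor
    · rintro ⟨h1, h2⟩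
      refine ⟨h1 r (by simp), fun k x hx => ?_, fun s hs => h1 s (by simp [hs]), ?_⟩
      · by_contra hcon
        refine h2 1 k ⟨by simp, x, ?_, fun y hy => ?_⟩
        · rcases D with _ | ⟨s, D⟩
          · simp at hx
          · simpa [Diagram.box] using hx
        · by_contra hxy
          exact hcon ⟨y, by simpa [Diagram.box] using hy, by omega⟩
      · rintro (_ | i) j hv
        · exact absurd hv.1 (by simp)
        · exact h2 (i + 2) j ((hviol i j).2 hv)
    · rintro ⟨h1, h2, h3, h4⟩
      refine ⟨fun s hs => ?_, ?_⟩
      · rcases List.mem_cons.1 hs with rfl | hs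
        · exact h1
        · exact h3 s hs
      · rintro (_ | _ | i) j hv
        · exact absurd hv.1 (by simp)
        · obtain ⟨-, x, hx, hy⟩ := hv
          rcases D with _ | ⟨s, D⟩
          · simp [Diagram.box] at hx
          · obtain ⟨y, hy', hyx⟩ := h2 j x (by simpa [Diagram.box] using hx)
            have := hy y (by simpa [Diagram.box] using hy')
            omega
        · exact h4 (i + 1) j ((hviol i j).1 hv)

lemma isTableau_iff {D : Diagram} : D.IsTableau ↔ Tab D := by
  rw [Diagram.IsTableau, Tab, semistandard_iff]; tauto

/-! ### Insertion gives tableaux -/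

lemma Over.mono_left {r r' s : List ℤ} (h : Over r s) (hlen : r.length ≤ r'.length)
    (hle : ∀ (k : ℕ) (x y : ℤ), r[k]? = some x → r'[k]? = some y → y ≤ x) : Over r' s := by
  rw [over_iff] at *
  intro k x hx
  obtain ⟨y, hy, hyx⟩ := h k x hx
  have hk : k < r'.length := by
    have := (List.getElem?_eq_some_iff.1 hy).1
    omega
  refine ⟨r'[k], List.getElem?_eq_getElem hk, ?_⟩
  exact (hle k y _ hy (List.getElem?_eq_getElem hk)).trans_lt hyx

lemma bumpRow_length {x : ℤ} {r : List ℤ} :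
    (bumpRow x r).1.length + (bumpRow x r).2.toList.length = r.length + 1 := by
  have := (bumpRow_perm x r).length_eq
  simp only [List.length_append, List.length_cons] at this
  omega

lemma bumpRow_le {x : ℤ} {r : List ℤ} {k : ℕ} {y z : ℤ} (hy : r[k]? = some y)
    (hz : (bumpRow x r).1[k]? = some z) : z ≤ y := by
  induction r generalizing k with
  | nil => simp at hy
  | cons c r ih =>
    rcases lt_or_ge x c with hc | hc
    · rw [bumpRow_cons_lt hc] at hz
      rcases k with _ | k
      · simp at hy hz; omega
      · simp at hy hz; rw [hy] at hz; simp at hz; omega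
    · rw [bumpRow_cons_ge hc] at hz
      rcases k with _ | k
      · simp at hy hz; omega
      · exact ih (by simpa using hy) (by simpa using hz)

lemma Over.bumpRow_left {r s : List ℤ} (h : Over r s) (x : ℤ) : Over (bumpRow x r).1 s := by
  refine h.mono_left ?_ fun k y z hy hz => bumpRow_le hy hz
  have := bumpRow_length (x := x) (r := r)
  rcases h : (bumpRow x r).2 <;> rw [h] at this <;> simp at this <;> omega

/-- If `s` reaches the column which `y` leaves, its entry there is larger than `y`. Hence `y` enters
the next row weakly further to the left, where the entries above are now at most `x < y`. -/
lemma Over.bump {r s : List ℤ} {x y : ℤ} (h : Over r s) (hy : (bumpRow x r).2 = some y) :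
    Over (bumpRow x r).1 (bumpRow y s).1 := by
  induction r generalizing s with
  | nil => simp [bumpRow] at hy
  | cons c r ih =>
    rcases lt_or_ge x c with hc | hc
    · rw [bumpRow_cons_lt hc] at hy ⊢
      simp at hy; subst hy
      rcases s with _ | ⟨d, s⟩
      · simp [bumpRow, hc]
      · obtain ⟨h1, h2⟩ := h
        rw [bumpRow_cons_lt h1]
        exact ⟨hc, h2⟩
    · rw [bumpRow_cons_ge hc] at hy ⊢
      have hxy := (bumpRow_out_mem hy).2
      rcases s with _ | ⟨d, s⟩
      · simp [bumpRow]; omega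
      · obtain ⟨h1, h2⟩ := h
        rcases lt_or_ge y d with hd | hd
        · rw [bumpRow_cons_lt hd]
          exact ⟨by omega, h2.bumpRow_left x⟩
        · rw [bumpRow_cons_ge hd]
          exact ⟨h1, ih h2 hy⟩

lemma tab_rowInsert {D : Diagram} (hD : Tab D) (x : ℤ) : Tab (rowInsert x D) := by
  induction D generalizing x with
  | nil => simp [rowInsert, tab_cons]
  | cons r D ih =>
    rw [tab_cons] at hD
    obtain ⟨h1, h2, h3, h4⟩ := hD
    rw [rowInsert_cons, tab_cons]
    refine ⟨List.ne_nil_of_mem (mem_bumpRow_self x r), sorted_bumpRow h2, ?_, ?_⟩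
    · rcases h : (bumpRow x r).2 with _ | y
      · exact h3.bumpRow_left x
      · have h5 := h3.bump h
        rcases D with _ | ⟨s, D⟩
        · simpa [rowInsert, bumpRow] using h5
        · simpa [rowInsert_cons] using h5
    · rcases h : (bumpRow x r).2 with _ | y
      · simpa using h4
      · simpa using ih h4 y

lemma tab_insertWord {D : Diagram} (hD : Tab D) (w : List ℤ) : Tab (insertWord D w) := by
  induction w generalizing D with
  | nil => exact hD
  | cons x w ih => exact ih (tab_rowInsert hD x)

lemma tab_tmul {U : Diagram} (hU : Tab U) (V : Diagram) : Tab (tmul U V) :=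
  tab_insertWord hU _

lemma pl_tmul {U : Diagram} (hU : RowsSorted U) (V : Diagram) :
    pl (word (tmul U V)) = pl (word U) * pl (word V) := pl_insertWord hU _

/-! ### Placing tableaux side by side -/

/-- The diagram obtained by placing `B` to the right of `A`, row by row. -/
def hcat : Diagram → Diagram → Diagram
  | [], B => B
  | r :: A, [] => r :: A
  | r :: A, s :: B => (r ++ s) :: hcat A B

@[simp] lemma hcat_nil (A : Diagram) : hcat A [] = A := by cases A <;> rfl

@[simp] lemma nil_hcat (B : Diagram) : hcat [] B = B := rfl

@[simp] lemma hcat_cons (r s : List ℤ) (A B : Diagram) :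
    hcat (r :: A) (s :: B) = (r ++ s) :: hcat A B := rfl

/-- Each row of `A` is weakly smaller than the corresponding row of `B`. -/
def LeftOf : Diagram → Diagram → Prop
  | [], _ => True
  | _ :: _, [] => True
  | r :: A, s :: B => (∀ x ∈ r, ∀ y ∈ s, x ≤ y) ∧ LeftOf A B

lemma bumpRow_append_le {x : ℤ} {r t : List ℤ} (h : ∀ y ∈ r, y ≤ x) :
    bumpRow x (r ++ t) = (r ++ (bumpRow x t).1, (bumpRow x t).2) := by
  induction r with
  | nil => simp
  | cons c r ih =>
    rw [List.cons_append, bumpRow_cons_ge (h c (by simp)), ih fun y hy => h y (by simp [hy])]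
    rfl

/-- Each letter of `s` bumps the entry of `t` in its own column, or is appended once `t` is used up;
thus `t` comes out unchanged. -/
lemma rowIns_over {r s t : List ℤ} (hrs : ∀ x ∈ r, ∀ y ∈ s, x ≤ y) (hs : Sorted s)
    (h : Over s t) : rowIns (r ++ t) s = (r ++ s, t) := by
  induction s generalizing r t with
  | nil => cases t <;> simp_all
  | cons x s ih =>
    rw [Sorted, List.pairwise_cons] at hs
    have h1 : ∀ y ∈ r ++ [x], ∀ z ∈ s, y ≤ z := by
      intro y hy z hz
      rcases List.mem_append.1 hy with hy | hy
      · exact hrs y hy z (by simp [hz])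
      · simp at hy; subst hy; exact hs.1 z hz
    rw [rowIns_cons, bumpRow_append_le fun y hy => hrs y hy x (by simp)]
    rcases t with _ | ⟨y, t⟩
    · have := ih (t := []) h1 hs.2 (by simp)
      simp only [List.append_nil] at this
      simp [bumpRow, this]
    · obtain ⟨h2, h3⟩ := h
      have := ih h1 hs.2 h3
      rw [bumpRow_cons_lt h2]
      simp only [List.append_assoc, List.singleton_append] at this
      simp [this]

lemma SS.exists_le {s : List ℤ} {D : Diagram} (h : SS (s :: D)) {y : ℤ}
    (hy : y ∈ (s :: D).flatten) : ∃ z ∈ s, z ≤ y := by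
  induction D generalizing s with
  | nil => exact ⟨y, by simpa using hy, le_rfl⟩
  | cons t D ih =>
    obtain ⟨-, h2, h3⟩ := h
    rw [List.flatten_cons, List.mem_append] at hy
    rcases hy with hy | hy
    · exact ⟨y, hy, le_rfl⟩
    · obtain ⟨z, hz, hzy⟩ := ih h3 hy
      obtain ⟨k, hk⟩ := List.mem_iff_getElem?.1 hz
      obtain ⟨x, hx, hxz⟩ := over_iff.1 h2 k z hk
      exact ⟨x, List.mem_of_getElem? hx, by omega⟩

/-- The rows of `B` are placed to the right of `r` one after the other, from the bottom one on, and
each pushes out its predecessor. -/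
lemma rowIns_word {r : List ℤ} {B : Diagram} (hB : SS B)
    (h : ∀ x ∈ r, ∀ y ∈ B.flatten, x ≤ y) :
    rowIns r (word B) = (r ++ B.headD [], word B.tail) := by
  induction B with
  | nil => simp
  | cons s B ih =>
    have hB' := hB
    obtain ⟨h1, h2, h3⟩ := hB'
    rw [word_cons, rowIns_append, ih h3 fun x hx y hy => h x hx y (by simp at hy ⊢; tauto),
      rowIns_over (fun x hx y hy => h x hx y (by simp [hy])) h1 h2]
    cases B <;> simp

lemma insertWord_word {B : Diagram} (hB : Tab B) : insertWord [] (word B) = B := by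
  induction B with
  | nil => rfl
  | cons s B ih =>
    have h1 := (tab_cons.1 hB)
    rw [insertWord_empty (by simp [h1.1]), rowIns_word hB.1 (by simp)]
    simp [ih h1.2.2.2]

lemma LeftOf.head {r : List ℤ} {A B : Diagram} (h : LeftOf (r :: A) B) (hB : SS B) :
    ∀ x ∈ r, ∀ y ∈ B.flatten, x ≤ y := by
  rcases B with _ | ⟨s, B⟩
  · simp
  · intro x hx y hy
    obtain ⟨z, hz, hzy⟩ := hB.exists_le hy
    exact (h.1 x hx z hz).trans hzy

/-- The rows of `A` stay where they are, and `rowIns_word` hands the rest of `B` down row by row. So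
placing side by side is a product. -/
lemma insertWord_hcat {A B : Diagram} (hB : Tab B) (h : LeftOf A B) :
    insertWord A (word B) = hcat A B := by
  induction A generalizing B with
  | nil => exact insertWord_word hB
  | cons r A ih =>
    rw [insertWord_row, rowIns_word hB.1 (h.head hB.1)]
    rcases B with _ | ⟨s, B⟩
    · simp
    · simp [ih (tab_cons.1 hB).2.2.2 h.2]

lemma pl_hcat {A B : Diagram} (hA : RowsSorted A) (hB : Tab B) (h : LeftOf A B) :
    pl (word (hcat A B)) = pl (word A) * pl (word B) := by
  rw [← insertWord_hcat hB h, pl_insertWord hA]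

/-- A tableau is determined by its plactic class. -/
lemma Tab.eq_of_pl {T T' : Diagram} (hT : Tab T) (hT' : Tab T')
    (h : pl (word T) = pl (word T')) : T = T' := by
  rw [← insertWord_word hT, ← insertWord_word hT', insertWord_eq_of_pl h (by simp [RowsSorted])]

lemma Tab.rowsSorted {T : Diagram} (h : Tab T) : RowsSorted T := h.1.rowsSorted

/-- The tableau of a word. -/
abbrev rect (w : List ℤ) : Diagram := insertWord [] w

lemma tab_rect (w : List ℤ) : Tab (rect w) := tab_insertWord tab_nil w

lemma pl_rect (w : List ℤ) : pl (word (rect w)) = pl w := by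
  rw [pl_insertWord (by simp [RowsSorted])]; simp

lemma Tab.eq_rect {T : Diagram} (hT : Tab T) {w : List ℤ} (h : pl (word T) = pl w) :
    T = rect w := hT.eq_of_pl (tab_rect w) (by rw [h, pl_rect])

lemma rect_congr {v w : List ℤ} (h : pl v = pl w) : rect v = rect w :=
  insertWord_eq_of_pl h (by simp [RowsSorted])

lemma Tab.insertWord_eq_rect {T : Diagram} (hT : Tab T) (w : List ℤ) :
    insertWord T w = rect (word T ++ w) := by
  rw [rect, insertWord_append, insertWord_word hT]

/-! ### Vertical and horizontal cuts, and their behaviour in products -/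

/-! ### Removing empty rows, vertical cuts -/

@[simp] lemma trim_nil : Diagram.trim [] = [] := rfl

lemma trim_cons (r : List ℤ) (D : Diagram) :
    Diagram.trim (r :: D) = if r = [] then Diagram.trim D else r :: Diagram.trim D := by
  rcases r with _ | ⟨x, r⟩ <;> simp [Diagram.trim]

@[simp] lemma word_trim (D : Diagram) : word (Diagram.trim D) = word D := by
  induction D with
  | nil => rfl
  | cons r D ih => rw [trim_cons]; split_ifs with h <;> simp [h, ih]

lemma trim_eq_self {D : Diagram} (h : ∀ r ∈ D, r ≠ []) : Diagram.trim D = D := by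
  rw [Diagram.trim, List.filter_eq_self]
  simpa using h

lemma trim_eq_nil {D : Diagram} (h : ∀ r ∈ D, r = []) : Diagram.trim D = [] := by
  rw [Diagram.trim, List.filter_eq_nil_iff]
  simpa using h

lemma SS.eq_nil_of_head {D : Diagram} (h : SS D) (h0 : D.headD [] = []) : ∀ r ∈ D, r = [] := by
  induction D with
  | nil => simp
  | cons r D ih =>
    obtain ⟨-, h2, h3⟩ := h
    simp at h0
    subst h0
    intro s hs
    rcases List.mem_cons.1 hs with rfl | hs
    · rfl
    · refine ih h3 ?_ s hs
      rcases hD : D.headD [] with _ | ⟨y, t⟩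
      · rfl
      · rw [hD] at h2; exact absurd h2 (by simp)

lemma SS.headD_trim {D : Diagram} (h : SS D) : (Diagram.trim D).headD [] = D.headD [] := by
  rcases D with _ | ⟨r, D⟩
  · rfl
  · by_cases hr : r = []
    · rw [trim_eq_nil (h.eq_nil_of_head (by simpa using hr))]; simp [hr]
    · rw [trim_cons, if_neg hr]; rfl

lemma SS.tab_trim {D : Diagram} (h : SS D) : Tab (Diagram.trim D) := by
  induction D with
  | nil => exact tab_nil
  | cons r D ih =>
    obtain ⟨h1, h2, h3⟩ := h
    rw [trim_cons]
    split_ifs with hr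
    · exact ih h3
    · rw [tab_cons, h3.headD_trim]
      exact ⟨hr, h1, h2, ih h3⟩

lemma trim_map_trim (f : List ℤ → List ℤ) (hf : f [] = []) (D : Diagram) :
    Diagram.trim ((Diagram.trim D).map f) = Diagram.trim (D.map f) := by
  induction D with
  | nil => rfl
  | cons r D ih =>
    rw [trim_cons, List.map_cons, trim_cons]
    split_ifs with h1 h2 h2
    · exact ih
    · exact absurd (h1 ▸ hf) h2
    · rw [List.map_cons, trim_cons, if_pos h2, ih]
    · rw [List.map_cons, trim_cons, if_neg h2, ih]

lemma Over.take {r s : List ℤ} (h : Over r s) (b : ℕ) : Over (r.take b) (s.take b) := by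
  induction b generalizing r s with
  | zero => simp
  | succ b ih =>
    rcases s with _ | ⟨y, s⟩
    · simp
    · rcases r with _ | ⟨x, r⟩
      · exact absurd h (by simp)
      · exact ⟨h.1, ih h.2⟩

lemma Over.drop {r s : List ℤ} (h : Over r s) (b : ℕ) : Over (r.drop b) (s.drop b) := by
  induction b generalizing r s with
  | zero => simpa
  | succ b ih =>
    rcases s with _ | ⟨y, s⟩
    · simp
    · rcases r with _ | ⟨x, r⟩
      · exact absurd h (by simp)
      · exact ih h.2

lemma SS.map {D : Diagram} (h : SS D) {f : List ℤ → List ℤ}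
    (hs : ∀ r, Sorted r → Sorted (f r)) (ho : ∀ r s, Over r s → Over (f r) (f s)) :
    SS (D.map f) := by
  induction D with
  | nil => trivial
  | cons r D ih =>
    obtain ⟨h1, h2, h3⟩ := h
    refine ⟨hs r h1, ?_, ih h3⟩
    rcases D with _ | ⟨s, D⟩
    · simp
    · exact ho r s h2

lemma SS.map_take {D : Diagram} (h : SS D) (b : ℕ) : SS (D.map fun r => r.take b) :=
  h.map (fun _ hr => hr.sublist (List.take_sublist _ _)) fun _ _ h => h.take b

lemma SS.map_drop {D : Diagram} (h : SS D) (b : ℕ) : SS (D.map fun r => r.drop b) :=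
  h.map (fun _ hr => hr.sublist (List.drop_sublist _ _)) fun _ _ h => h.drop b

lemma tab_leftCut {X : Diagram} (h : SS X) (b : ℕ) : Tab (leftCut b X) := (h.map_take b).tab_trim

lemma tab_rightCut {X : Diagram} (h : SS X) (b : ℕ) : Tab (rightCut b X) := (h.map_drop b).tab_trim

@[simp] lemma leftCut_nil (b : ℕ) : leftCut b [] = [] := rfl

@[simp] lemma rightCut_nil (b : ℕ) : rightCut b [] = [] := rfl

lemma leftCut_zero (X : Diagram) : leftCut 0 X = [] := trim_eq_nil (by simp)

lemma rightCut_zero {X : Diagram} (hX : Tab X) : rightCut 0 X = X := by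
  simp [rightCut, trim_eq_self hX.2]

lemma leftCut_cons {b : ℕ} (hb : b ≠ 0) {r : List ℤ} (hr : r ≠ []) (X : Diagram) :
    leftCut b (r :: X) = r.take b :: leftCut b X := by
  rw [leftCut, List.map_cons, trim_cons, if_neg (by simp [hb, hr])]; rfl

lemma rightCut_cons_of_le {b : ℕ} {r : List ℤ} {X : Diagram} (h : SS (r :: X))
    (hr : r.length ≤ b) : rightCut b (r :: X) = [] :=
  trim_eq_nil ((h.map_drop b).eq_nil_of_head (by simpa using hr))

lemma rightCut_cons_of_lt {b : ℕ} {r : List ℤ} (hr : b < r.length) (X : Diagram) :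
    rightCut b (r :: X) = r.drop b :: rightCut b X := by
  rw [rightCut, List.map_cons, trim_cons, if_neg (by simpa using hr)]; rfl

lemma leftCut_leftCut (b c : ℕ) (X : Diagram) :
    leftCut b (leftCut c X) = leftCut (min b c) X := by
  simp only [leftCut]
  rw [trim_map_trim _ (by simp), List.map_map]
  simp [Function.comp_def, List.take_take]

lemma rightCut_rightCut (b c : ℕ) (X : Diagram) :
    rightCut b (rightCut c X) = rightCut (c + b) X := by
  simp only [rightCut]
  rw [trim_map_trim _ (by simp), List.map_map]
  simp [Function.comp_def, List.drop_drop]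

lemma rightCut_leftCut (b c : ℕ) (X : Diagram) :
    rightCut b (leftCut (b + c) X) = leftCut c (rightCut b X) := by
  simp only [rightCut, leftCut]
  rw [trim_map_trim _ (by simp), trim_map_trim _ (by simp), List.map_map, List.map_map]
  simp [Function.comp_def, List.drop_take]

/-- `B` can be placed to the right of `A`, starting in column `b`. -/
def Fit (b : ℕ) : Diagram → Diagram → Prop
  | _, [] => True
  | [], _ :: _ => b = 0
  | r :: A, s :: B => r.length = b ∧ (∀ x ∈ r, ∀ y ∈ s, x ≤ y) ∧ Fit b A B

@[simp] lemma fit_nil (b : ℕ) (A : Diagram) : Fit b A [] := by cases A <;> trivial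

lemma nil_fit {b : ℕ} {s : List ℤ} {B : Diagram} : Fit b [] (s :: B) ↔ b = 0 := Iff.rfl

lemma fit_cons {b : ℕ} {r s : List ℤ} {A B : Diagram} : Fit b (r :: A) (s :: B) ↔
    r.length = b ∧ (∀ x ∈ r, ∀ y ∈ s, x ≤ y) ∧ Fit b A B := Iff.rfl

lemma Fit.leftOf {b : ℕ} {A B : Diagram} (h : Fit b A B) : LeftOf A B := by
  induction A generalizing B with
  | nil => trivial
  | cons r A ih =>
    rcases B with _ | ⟨s, B⟩
    · trivial
    · exact ⟨h.2.1, ih h.2.2⟩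

/-- All rows have length at most `b`. -/
abbrev ColsLE (b : ℕ) (A : Diagram) : Prop := ∀ r ∈ A, r.length ≤ b

lemma ColsLE.eq_nil {A : Diagram} (h : ColsLE 0 A) (hA : Tab A) : A = [] := by
  rcases A with _ | ⟨r, A⟩
  · rfl
  · have := h r (by simp)
    exact absurd (List.length_eq_zero_iff.1 (by omega)) (hA.2 r (by simp))

lemma Over.append {r r' s s' : List ℤ} (h : Over r r') (h' : Over s s')
    (hlen : s' ≠ [] → r'.length = r.length) : Over (r ++ s) (r' ++ s') := by
  induction r generalizing r' with
  | nil =>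
    rcases r' with _ | ⟨y, r'⟩
    · exact h'
    · exact absurd h (by simp)
  | cons x r ih =>
    rcases r' with _ | ⟨y, r'⟩
    · by_cases hs : s' = []
      · simp [hs]
      · exact absurd (hlen hs) (by simp)
    · exact ⟨h.1, ih h.2 fun hs => by simpa using hlen hs⟩

lemma Fit.ss_hcat {b : ℕ} {A B : Diagram} (h : Fit b A B) (hA : SS A) (hB : SS B)
    (hb : ColsLE b A) (hB' : ∀ s ∈ B, s ≠ []) : SS (hcat A B) := by
  induction A generalizing B with
  | nil => exact hB
  | cons r A ih =>
    rcases B with _ | ⟨s, B⟩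
    · exact hA
    · obtain ⟨h1, h2, h3⟩ := h
      obtain ⟨a1, a2, a3⟩ := hA
      obtain ⟨b1, b2, b3⟩ := hB
      refine ⟨List.pairwise_append.2 ⟨a1, b1, h2⟩, ?_,
        ih h3 a3 b3 (fun t ht => hb t (by simp [ht])) fun t ht => hB' t (by simp [ht])⟩
      rcases A with _ | ⟨r', A⟩
      · rcases B with _ | ⟨s', B⟩
        · simp
        · rw [nil_fit] at h3
          have : r = [] := List.length_eq_zero_iff.1 (by omega)
          simpa [this] using b2
      · rcases B with _ | ⟨s', B⟩
        · simpa using Over.append (s := s) (s' := []) a2 (by simp) (by simp)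
        · exact Over.append a2 b2 fun _ => by rw [h1]; exact h3.1

lemma Fit.tab_hcat {b : ℕ} {A B : Diagram} (h : Fit b A B) (hA : Tab A) (hB : Tab B)
    (hb : ColsLE b A) : Tab (hcat A B) := by
  refine ⟨h.ss_hcat hA.1 hB.1 hb hB.2, ?_⟩
  have hA' := hA.2
  have hB' := hB.2
  clear hA hB hb h
  induction A generalizing B with
  | nil => exact hB'
  | cons r A ih =>
    rcases B with _ | ⟨s, B⟩
    · exact hA'
    · intro t ht
      rcases List.mem_cons.1 ht with rfl | ht
      · simp [hA' r (by simp)]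
      · exact ih (fun t ht => hA' t (by simp [ht])) (fun t ht => hB' t (by simp [ht])) t ht

lemma leftCut_of_colsLE {b : ℕ} {A : Diagram} (hA : Tab A) (h : ColsLE b A) : leftCut b A = A := by
  have : A.map (fun r => r.take b) = A := by
    conv_rhs => rw [← List.map_id A]
    exact List.map_congr_left fun r hr => by simpa using h r hr
  rw [leftCut, this, trim_eq_self hA.2]

lemma Fit.leftCut {b : ℕ} {A B : Diagram} (h : Fit b A B) (hA : Tab A) (hb : ColsLE b A) :
    leftCut b (hcat A B) = A := by
  rcases Nat.eq_zero_or_pos b with rfl | hb0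
  · rw [leftCut_zero, hb.eq_nil hA]
  induction A generalizing B with
  | nil =>
    rcases B with _ | ⟨s, B⟩
    · rfl
    · rw [nil_fit] at h; omega
  | cons r A ih =>
    rcases B with _ | ⟨s, B⟩
    · exact leftCut_of_colsLE hA hb
    · have h1 := tab_cons.1 hA
      rw [hcat_cons, leftCut_cons hb0.ne' (by simp [h1.1]),
        ih h.2.2 h1.2.2.2 fun t ht => hb t (by simp [ht]), ← h.1]
      simp

lemma rightCut_of_colsLE {b : ℕ} {A : Diagram} (h : ColsLE b A) : rightCut b A = [] :=
  trim_eq_nil (by simpa using h)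

lemma Fit.rightCut {b : ℕ} {A B : Diagram} (h : Fit b A B) (hA : Tab A) (hb : ColsLE b A)
    (hB : Tab B) : rightCut b (hcat A B) = B := by
  induction A generalizing B with
  | nil =>
    rcases B with _ | ⟨s, B⟩
    · rfl
    · rw [nil_fit] at h; subst h
      exact rightCut_zero hB
  | cons r A ih =>
    rcases B with _ | ⟨s, B⟩
    · exact rightCut_of_colsLE hb
    · have h1 := tab_cons.1 hA
      have h2 := tab_cons.1 hB
      have hs : 0 < s.length := List.length_pos_of_ne_nil h2.1
      rw [hcat_cons, rightCut_cons_of_lt (by simp [h.1]; omega),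
        ih h.2.2 h1.2.2.2 (fun t ht => hb t (by simp [ht])) h2.2.2.2, ← h.1]
      simp

lemma fit_cut {X : Diagram} (hX : Tab X) (b : ℕ) : Fit b (leftCut b X) (rightCut b X) := by
  rcases Nat.eq_zero_or_pos b with rfl | hb
  · rw [leftCut_zero]
    cases rightCut 0 X <;> simp [Fit]
  induction X with
  | nil => trivial
  | cons r X ih =>
    have h1 := tab_cons.1 hX
    rw [leftCut_cons hb.ne' h1.1]
    rcases le_or_gt r.length b with h | h
    · rw [rightCut_cons_of_le hX.1 h]; simp
    · rw [rightCut_cons_of_lt h, fit_cons]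
      refine ⟨by simp; omega, fun x hx y hy => ?_, ih h1.2.2.2⟩
      have h2 := h1.2.1
      rw [← List.take_append_drop b r, Sorted, List.pairwise_append] at h2
      exact h2.2.2 x hx y hy

lemma colsLE_leftCut (b : ℕ) (X : Diagram) : ColsLE b (leftCut b X) := by
  intro r hr
  simp only [leftCut, Diagram.trim, List.mem_filter, List.mem_map] at hr
  obtain ⟨⟨s, -, rfl⟩, -⟩ := hr
  simp

lemma hcat_cut {X : Diagram} (hX : Tab X) (b : ℕ) : hcat (leftCut b X) (rightCut b X) = X := by
  rcases Nat.eq_zero_or_pos b with rfl | hb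
  · rw [leftCut_zero, rightCut_zero hX]; rfl
  induction X with
  | nil => rfl
  | cons r X ih =>
    have h1 := tab_cons.1 hX
    rcases le_or_gt r.length b with h | h
    · rw [rightCut_cons_of_le hX.1 h, hcat_nil, leftCut_of_colsLE hX]
      intro s hs
      have hlen : ∀ (r : List ℤ) (X : Diagram), SS (r :: X) → ∀ s ∈ r :: X, s.length ≤ r.length := by
        intro r X
        induction X generalizing r with
        | nil => simp
        | cons t X ih' =>
          intro hSS s hs
          rcases List.mem_cons.1 hs with rfl | hs
          · exact le_rfl
          · exact (ih' t hSS.2.2 s hs).trans hSS.2.1.length_le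
      exact (hlen r X hX.1 s hs).trans h
    · rw [leftCut_cons hb.ne' h1.1, rightCut_cons_of_lt h, hcat_cons, ih h1.2.2.2]
      simp

lemma pl_cut {X : Diagram} (hX : Tab X) (b : ℕ) :
    pl (word X) = pl (word (leftCut b X)) * pl (word (rightCut b X)) := by
  rw [← pl_hcat (tab_leftCut hX.1 b).rowsSorted (tab_rightCut hX.1 b) (fit_cut hX b).leftOf,
    hcat_cut hX]

/-! ### Column bumping -/

/-- Column bumping: `x` replaces the topmost entry which is at least `x`. -/
def colBump (x : ℤ) : List ℤ → List ℤ × Option ℤ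
  | [] => ([x], none)
  | y :: ys => if x ≤ y then (x :: ys, some y) else (y :: (colBump x ys).1, (colBump x ys).2)

lemma colBump_cons_le {x y : ℤ} (h : x ≤ y) (C : List ℤ) :
    colBump x (y :: C) = (x :: C, some y) := by simp [colBump, h]

lemma colBump_cons_gt {x y : ℤ} (h : y < x) (C : List ℤ) :
    colBump x (y :: C) = (y :: (colBump x C).1, (colBump x C).2) := by
  simp [colBump, not_le.2 h]

lemma colBump_out_ge {x y : ℤ} {C : List ℤ} (h : (colBump x C).2 = some y) : x ≤ y := by
  induction C with
  | nil => simp [colBump] at h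
  | cons c C ih =>
    rcases le_or_gt x c with hc | hc
    · rw [colBump_cons_le hc] at h; simp at h; omega
    · rw [colBump_cons_gt hc] at h; exact ih h

lemma colBump_mem {x z : ℤ} {C : List ℤ} (h : z ∈ (colBump x C).1) : z = x ∨ z ∈ C := by
  induction C with
  | nil => simpa [colBump] using h
  | cons c C ih =>
    rcases le_or_gt x c with hc | hc
    · rw [colBump_cons_le hc] at h
      rcases List.mem_cons.1 h with h | h <;> simp [h]
    · rw [colBump_cons_gt hc] at h
      rcases List.mem_cons.1 h with h | h
      · simp [h]
      · rcases ih h with h | h <;> simp [h]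

lemma colBump_sorted {x : ℤ} {C : List ℤ} (hC : C.Pairwise (· < ·)) :
    (colBump x C).1.Pairwise (· < ·) := by
  induction C with
  | nil => simp [colBump]
  | cons c C ih =>
    rw [List.pairwise_cons] at hC
    rcases le_or_gt x c with hc | hc
    · rw [colBump_cons_le hc, List.pairwise_cons]
      exact ⟨fun z hz => hc.trans_lt (hC.1 z hz), hC.2⟩
    · rw [colBump_cons_gt hc, List.pairwise_cons]
      refine ⟨fun z hz => ?_, ih hC.2⟩
      rcases colBump_mem hz with rfl | hz
      · exact hc
      · exact hC.1 z hz

/-- The column analogue of `pl_bumpRow`. Columns are read from bottom to top, so `x` enters at the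
left end and the bumped letter leaves at the right end. -/
lemma pl_colBump {x : ℤ} {C : List ℤ} (hC : C.Pairwise (· < ·)) :
    pl (x :: C.reverse) = pl ((colBump x C).1.reverse ++ (colBump x C).2.toList) := by
  induction C with
  | nil => rfl
  | cons c C ih =>
    have hC' := List.pairwise_cons.1 hC
    have h0 : pl (x :: (c :: C).reverse) = pl (x :: C.reverse) * pl [c] := by
      rw [← pl_append]; simp
    rw [h0, ih hC'.2]
    rcases le_or_gt x c with hc | hc
    · rw [colBump_cons_le hc]
      rcases C with _ | ⟨d, C⟩
      · rfl
      · have hcd : c < d := hC'.1 d (by simp)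
        rw [colBump_cons_le (hc.trans hcd.le)]
        have h2 : pl [x, d, c] = pl [d, x, c] := pl_knuth (Knuth.right x c d hc hcd)
        calc pl ((x :: C).reverse ++ [d]) * pl [c] = pl C.reverse * pl [x, d, c] := by
              rw [← pl_append, ← pl_append]; simp
          _ = _ := by rw [h2, ← pl_append]; simp
    · rw [colBump_cons_gt hc]
      rcases hy : (colBump x C).2 with _ | y
      · rw [← pl_append]; simp
      · obtain ⟨e, s, hes, hce, hey⟩ : ∃ e s, (colBump x C).1 = e :: s ∧ c < e ∧ e ≤ y := by
          rcases C with _ | ⟨d, C⟩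
          · simp [colBump] at hy
          · rcases le_or_gt x d with hd | hd
            · rw [colBump_cons_le hd] at hy ⊢
              simp at hy
              exact ⟨x, C, rfl, hc, by omega⟩
            · rw [colBump_cons_gt hd] at hy ⊢
              exact ⟨d, _, rfl, hC'.1 d (by simp), hd.le.trans (colBump_out_ge hy)⟩
        rw [hes]
        have h2 : pl [e, y, c] = pl [e, c, y] := pl_knuth (Knuth.left c e y hce hey)
        calc pl ((e :: s).reverse ++ [y]) * pl [c] = pl s.reverse * pl [e, y, c] := by
              rw [← pl_append, ← pl_append]; simp
          _ = _ := by rw [h2, ← pl_append]; simp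

/-- The column `C` may stand to the left of the column `D`. -/
def ColLE : List ℤ → List ℤ → Prop
  | _, [] => True
  | [], _ :: _ => False
  | c :: C, d :: D => c ≤ d ∧ ColLE C D

@[simp] lemma colLE_nil (C : List ℤ) : ColLE C [] := by cases C <;> trivial

lemma ColLE.colBump_left {C D : List ℤ} (h : ColLE C D) (x : ℤ) : ColLE (colBump x C).1 D := by
  induction C generalizing D with
  | nil =>
    rcases D with _ | ⟨d, D⟩
    · simp
    · exact absurd h id
  | cons c C ih =>
    rcases D with _ | ⟨d, D⟩
    · simp
    · rcases le_or_gt x c with hc | hc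
      · rw [colBump_cons_le hc]; exact ⟨hc.trans h.1, h.2⟩
      · rw [colBump_cons_gt hc]; exact ⟨h.1, ih h.2⟩

lemma ColLE.bump {C D : List ℤ} {x y : ℤ} (h : ColLE C D) (hy : (colBump x C).2 = some y) :
    ColLE (colBump x C).1 (colBump y D).1 := by
  induction C generalizing D with
  | nil => simp [colBump] at hy
  | cons c C ih =>
    rcases le_or_gt x c with hc | hc
    · rw [colBump_cons_le hc] at hy ⊢
      simp at hy; subst hy
      rcases D with _ | ⟨d, D⟩
      · exact ⟨hc, by simp⟩
      · rw [colBump_cons_le h.1]; exact ⟨hc, h.2⟩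
    · rw [colBump_cons_gt hc] at hy ⊢
      have hxy := colBump_out_ge hy
      rcases D with _ | ⟨d, D⟩
      · exact ⟨by omega, by simp⟩
      · rcases le_or_gt y d with hd | hd
        · rw [colBump_cons_le hd]; exact ⟨by omega, h.2.colBump_left x⟩
        · rw [colBump_cons_gt hd]; exact ⟨h.1, ih h.2 hy⟩

/-- A column, as a diagram. -/
def colD (C : List ℤ) : Diagram := C.map fun x => [x]

/-- The first column of a diagram without empty rows. -/
def col (A : Diagram) : List ℤ := A.map fun r => r.headD 0

lemma word_colD (C : List ℤ) : word (colD C) = C.reverse := by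
  induction C with
  | nil => rfl
  | cons c C ih => rw [colD, List.map_cons, word_cons, ← colD, ih]; simp

lemma tab_colD {C : List ℤ} (hC : C.Pairwise (· < ·)) : Tab (colD C) := by
  induction C with
  | nil => exact tab_nil
  | cons c C ih =>
    rw [List.pairwise_cons] at hC
    rw [colD, List.map_cons, tab_cons]
    refine ⟨by simp, by simp, ?_, ih hC.2⟩
    rcases C with _ | ⟨d, C⟩
    · simp
    · simpa using hC.1 d (by simp)

lemma leftCut_one {A : Diagram} (hA : ∀ r ∈ A, r ≠ []) : leftCut 1 A = colD (col A) := by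
  induction A with
  | nil => rfl
  | cons r A ih =>
    rw [leftCut_cons one_ne_zero (hA r (by simp)), ih fun s hs => hA s (by simp [hs])]
    rcases r with _ | ⟨x, r⟩
    · exact absurd rfl (hA _ (by simp))
    · rfl

lemma col_sorted {A : Diagram} (hA : Tab A) : (col A).Pairwise (· < ·) := by
  induction A with
  | nil => simp [col]
  | cons r A ih =>
    have h1 := tab_cons.1 hA
    have ih := ih h1.2.2.2
    rw [col, List.map_cons, List.pairwise_cons]
    refine ⟨?_, ih⟩
    rcases A with _ | ⟨s, A⟩
    · simp
    · rcases r with _ | ⟨x, r⟩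
      · exact absurd rfl h1.1
      rcases s with _ | ⟨y, s⟩
      · exact absurd rfl (hA.2 [] (by simp))
      have hxy : x < y := h1.2.2.1.1
      intro z hz
      rw [List.map_cons, List.mem_cons] at hz
      rcases hz with rfl | hz
      · exact hxy
      · rw [col, List.map_cons, List.pairwise_cons] at ih
        exact hxy.trans (ih.1 z hz)

lemma ColLE.fit {C : List ℤ} {B : Diagram} (h : ColLE C (col B)) (hB : RowsSorted B)
    (hB' : ∀ r ∈ B, r ≠ []) : Fit 1 (colD C) B := by
  induction C generalizing B with
  | nil =>
    rcases B with _ | ⟨s, B⟩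
    · trivial
    · exact absurd h id
  | cons c C ih =>
    rcases B with _ | ⟨s, B⟩
    · simp
    · rw [col, List.map_cons] at h
      refine ⟨rfl, fun x hx y hy => ?_, ih h.2 (fun r hr => hB r (by simp [hr]))
        fun r hr => hB' r (by simp [hr])⟩
      simp at hx; subst hx
      rcases s with _ | ⟨z, s⟩
      · simp at hy
      · have hz : x ≤ z := h.1
        rcases List.mem_cons.1 hy with rfl | hy
        · exact hz
        · exact hz.trans ((List.pairwise_cons.1 (hB (z :: s) (by simp))).1 y hy)

lemma Fit.colLE {C : List ℤ} {B : Diagram} (h : Fit 1 (colD C) B) (hB' : ∀ r ∈ B, r ≠ []) :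
    ColLE C (col B) := by
  induction C generalizing B with
  | nil =>
    rcases B with _ | ⟨s, B⟩
    · trivial
    · exact absurd h (by simp [colD, nil_fit])
  | cons c C ih =>
    rcases B with _ | ⟨s, B⟩
    · simp [col]
    · obtain ⟨-, h1, h2⟩ := h
      rcases s with _ | ⟨z, s⟩
      · exact absurd rfl (hB' [] (by simp))
      · exact ⟨h1 c (by simp) z (by simp), ih h2 fun r hr => hB' r (by simp [hr])⟩

lemma colsLE_colD (C : List ℤ) : ColsLE 1 (colD C) := by
  intro r hr
  simp only [colD, List.mem_map] at hr
  obtain ⟨x, -, rfl⟩ := hr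
  simp

/-- Left multiplication of a tableau by a letter, in terms of the first column. -/
lemma cut_one_cons {A : Diagram} (hA : Tab A) (x : ℤ) :
    leftCut 1 (rect (x :: word A)) = colD (colBump x (col A)).1 ∧
    rightCut 1 (rect (x :: word A)) =
      rect ((colBump x (col A)).2.toList ++ word (rightCut 1 A)) := by
  -- The bumped letter is multiplied to the columns from the second one on, which form a tableau
  -- with a shorter first row.
  induction hn : (A.headD []).length using Nat.strong_induction_on generalizing A x with
  | _ n ih =>
  subst hn
  set C := col A with hC
  set A' := rightCut 1 A with hA'
  have hAt : Tab A' := tab_rightCut hA.1 1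
  have hL : leftCut 1 A = colD C := leftCut_one hA.2
  have hle : ColLE C (col A') := by
    have := fit_cut hA 1
    rw [hL] at this
    exact this.colLE hAt.2
  have hCs := col_sorted hA
  have hB : ColLE (colBump x C).1 (col (rect ((colBump x C).2.toList ++ word A'))) := by
    rcases hy : (colBump x C).2 with _ | y
    · simp only [Option.toList_none, List.nil_append]
      rw [rect, insertWord_word hAt]
      exact hle.colBump_left x
    · simp only [Option.toList_some, List.singleton_append]
      have hlt : (A'.headD []).length < (A.headD []).length ∨ A = [] := by
        rcases A with _ | ⟨r, A⟩
        · simp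
        · left
          have hr : 0 < r.length := List.length_pos_of_ne_nil (hA.2 r (by simp))
          rcases le_or_gt r.length 1 with h | h
          · rw [hA', rightCut_cons_of_le hA.1 h]; simpa
          · rw [hA', rightCut_cons_of_lt h]; simpa
      rcases hlt with hlt | hnil
      · have h1 := (ih _ hlt hAt y rfl).1
        rw [leftCut_one (tab_rect _).2] at h1
        have h2 : col (rect (y :: word A')) = (colBump y (col A')).1 := by
          have := congrArg word h1
          rw [word_colD, word_colD] at this
          exact List.reverse_injective this
        rw [h2]
        exact hle.bump hy
      · simp [hC, hnil, col, colBump] at hy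
  have hfit : Fit 1 (colD (colBump x C).1) (rect ((colBump x C).2.toList ++ word A')) :=
    hB.fit (tab_rect _).rowsSorted (tab_rect _).2
  have hct : Tab (colD (colBump x C).1) := tab_colD (colBump_sorted hCs)
  -- The candidate on the left is a tableau with the plactic class of the product, so it is the
  -- product.
  have heq : hcat (colD (colBump x C).1) (rect ((colBump x C).2.toList ++ word A'))
      = rect (x :: word A) := by
    refine (hfit.tab_hcat hct (tab_rect _) (colsLE_colD _)).eq_rect ?_
    rw [pl_hcat hct.rowsSorted (tab_rect _) hfit.leftOf, pl_rect, word_colD, pl_cons, pl_cut hA 1,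
      hL, word_colD, ← mul_assoc, ← pl_cons, pl_colBump hCs, ← pl_append, ← pl_append]
    simp [hA', hC]
  rw [← heq]
  exact ⟨hfit.leftCut hct (colsLE_colD _), hfit.rightCut hct (colsLE_colD _) (tab_rect _)⟩

/-- The letters of `u` are multiplied from the left, the last one first. By `cut_one_cons` the new
first column depends only on the old one, and the letters leaving it multiply the other columns. -/
lemma cut_one_mul {A : Diagram} (hA : Tab A) (u : List ℤ) :
    leftCut 1 (rect (u ++ word A)) = leftCut 1 (rect (u ++ word (leftCut 1 A))) ∧
    rightCut 1 (rect (u ++ word A)) =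
      insertWord (rightCut 1 (rect (u ++ word (leftCut 1 A)))) (word (rightCut 1 A)) := by
  induction u using List.reverseRecOn generalizing A with
  | nil =>
    have hL := tab_leftCut hA.1 1
    simp only [List.nil_append, rect, insertWord_word hA, insertWord_word hL, leftCut_leftCut,
      true_and, min_self]
    rw [rightCut_of_colsLE (colsLE_leftCut 1 A), insertWord_word (tab_rightCut hA.1 1)]
  | append_singleton u x ih =>
    have hL := tab_leftCut hA.1 1
    have hR := tab_rightCut hA.1 1
    have key : ∀ B : Diagram, rect (u ++ [x] ++ word B) = rect (u ++ word (rect (x :: word B))) := by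
      intro B
      refine rect_congr ?_
      rw [pl_append u, pl_rect, ← pl_append]; simp
    rw [key A, key (leftCut 1 A)]
    obtain ⟨a1, a2⟩ := ih (tab_rect (x :: word A))
    obtain ⟨b1, b2⟩ := ih (tab_rect (x :: word (leftCut 1 A)))
    obtain ⟨c1, c2⟩ := cut_one_cons hA x
    obtain ⟨d1, d2⟩ := cut_one_cons hL x
    have hcol : col (leftCut 1 A) = col A := by
      rw [leftCut_one hA.2]
      simp [colD, col, Function.comp_def]
    rw [hcol] at d1 d2
    rw [rightCut_of_colsLE (colsLE_leftCut 1 A)] at d2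
    have hLL : leftCut 1 (rect (x :: word A)) = leftCut 1 (rect (x :: word (leftCut 1 A))) := by
      rw [c1, d1]
    refine ⟨by rw [a1, b1, hLL], ?_⟩
    rw [a2, b2, hLL]
    have hT : Tab (rightCut 1 (rect (u ++ word (leftCut 1 (rect (x :: word (leftCut 1 A))))))) :=
      tab_rightCut (tab_rect _).1 1
    rw [← insertWord_append]
    refine insertWord_eq_of_pl ?_ hT.rowsSorted
    rw [pl_append, c2, d2, pl_rect, pl_rect]
    simp [pl_append]

lemma Tab.eq_of_cut {X Y : Diagram} (hX : Tab X) (hY : Tab Y) (b : ℕ)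
    (hl : leftCut b X = leftCut b Y) (hr : rightCut b X = rightCut b Y) : X = Y := by
  rw [← hcat_cut hX b, ← hcat_cut hY b, hl, hr]

/-- Multiplication by a tableau `A` on the right does not mix the parts of `A` on the two sides of
a vertical cut. -/
lemma cut_mul {A : Diagram} (hA : Tab A) (u : List ℤ) (c : ℕ) :
    leftCut c (rect (u ++ word A)) = leftCut c (rect (u ++ word (leftCut c A))) ∧
    rightCut c (rect (u ++ word A)) =
      insertWord (rightCut c (rect (u ++ word (leftCut c A)))) (word (rightCut c A)) := by
  induction c generalizing A u with
  | zero =>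
    simp only [leftCut_zero, rightCut_zero (tab_rect _), rightCut_zero hA, true_and, word_nil,
      List.append_nil]
    rw [rect, insertWord_append]
  | succ c ih =>
    have hA0 : Tab (leftCut (c + 1) A) := tab_leftCut hA.1 _
    obtain ⟨a1, a2⟩ := cut_one_mul hA u
    obtain ⟨b1, b2⟩ := cut_one_mul hA0 u
    have e1 : leftCut 1 (leftCut (c + 1) A) = leftCut 1 A := by
      rw [leftCut_leftCut, min_eq_left (by omega)]
    have e2 : rightCut 1 (leftCut (c + 1) A) = leftCut c (rightCut 1 A) := by
      rw [add_comm, rightCut_leftCut]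
    rw [e1] at b1 b2
    rw [e2] at b2
    -- Apart from their common first column, both products are obtained by left multiplication with
    -- the same tableau `Z1`, so the induction hypothesis applies with `word Z1` in place of `u`.
    set Z1 := rightCut 1 (rect (u ++ word (leftCut 1 A))) with hZ1
    have hZ1t : Tab Z1 := tab_rightCut (tab_rect _).1 1
    obtain ⟨i1, i2⟩ := ih (tab_rightCut hA.1 1) (word Z1)
    rw [hZ1t.insertWord_eq_rect] at a2 b2
    rw [← a2, ← b2] at i1 i2
    set Z := rect (u ++ word A)
    set Z0 := rect (u ++ word (leftCut (c + 1) A))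
    constructor
    · refine (tab_leftCut (tab_rect _).1 _).eq_of_cut (tab_leftCut (tab_rect _).1 _) 1 ?_ ?_
      · rw [leftCut_leftCut, leftCut_leftCut, min_eq_left (by omega), a1, b1]
      · rw [add_comm, rightCut_leftCut, rightCut_leftCut, i1]
    · simpa only [rightCut_rightCut, add_comm] using i2

/-- The product is cut after column `b` although `A` is cut after column `c`: `cut_mul` separates
what lies beyond column `c`, and the columns between `b` and `c` are determined by `leftCut c A`. -/
lemma cut_mul_le {A : Diagram} (hA : Tab A) (u : List ℤ) {b c : ℕ} (hbc : b ≤ c) :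
    leftCut b (rect (u ++ word A)) = leftCut b (rect (u ++ word (leftCut c A))) ∧
    pl (word (rightCut b (rect (u ++ word A)))) =
      pl (word (rightCut b (rect (u ++ word (leftCut c A))))) * pl (word (rightCut c A)) := by
  obtain ⟨d, rfl⟩ := Nat.exists_eq_add_of_le hbc
  obtain ⟨h1, h2⟩ := cut_mul hA u (b + d)
  set Z := rect (u ++ word A)
  set Z0 := rect (u ++ word (leftCut (b + d) A))
  have hL : ∀ X : Diagram, leftCut b X = leftCut b (leftCut (b + d) X) := by
    intro X; rw [leftCut_leftCut, min_eq_left (by omega)]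
  have hR : ∀ X : Diagram, Tab X → pl (word (rightCut b X)) =
      pl (word (rightCut b (leftCut (b + d) X))) * pl (word (rightCut (b + d) X)) := by
    intro X hX
    rw [pl_cut (tab_rightCut hX.1 b) d, rightCut_leftCut, rightCut_rightCut]
  refine ⟨by rw [hL, h1, ← hL], ?_⟩
  rw [hR _ (tab_rect _), hR _ (tab_rect _), h1, h2,
    pl_insertWord (tab_rightCut (tab_rect _).1 _).rowsSorted, mul_assoc]

/-- Multiplication by a tableau `B` on the left does not mix the parts of `B` on the two sides of
a horizontal cut. -/
lemma rows_mul {B : Diagram} (hB : Tab B) (v : List ℤ) {a r : ℕ} (har : a ≤ r) :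
    (insertWord B v).take a = (insertWord (B.take r) v).take a ∧
    pl (word ((insertWord B v).drop a)) =
      pl (word (B.drop r)) * pl (word ((insertWord (B.take r) v).drop a)) := by
  induction a generalizing B v r with
  | zero =>
    have hB' : RowsSorted (B.take r) := fun s hs => hB.rowsSorted s (List.mem_of_mem_take hs)
    simp only [List.take_zero, List.drop_zero, true_and]
    rw [pl_insertWord hB.rowsSorted, pl_insertWord hB', ← mul_assoc,
      ← pl_append (word (B.drop r)), ← word_append, List.take_append_drop]
  | succ a ih =>
    rcases B with _ | ⟨s, B⟩
    · simp
    · obtain ⟨r, rfl⟩ : ∃ k, r = k + 1 := ⟨r - 1, by omega⟩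
      obtain ⟨h1, h2⟩ := ih (tab_cons.1 hB).2.2.2 (rowIns s v).2 (show a ≤ r by omega)
      rw [List.take_succ_cons, insertWord_row, insertWord_row]
      simp [h1, h2]

/-! ### Products with a rectangular tableau of small letters -/

lemma rowIns_over_append {p r s t : List ℤ} (hpt : ∀ x ∈ p, ∀ y ∈ t, x ≤ y) (ht : Sorted t)
    (h : Over t r) (hlen : r.length = t.length) :
    rowIns (p ++ r ++ s) t = (p ++ t ++ s, r) := by
  induction t generalizing p r with
  | nil => simp [List.length_eq_zero_iff.1 hlen]
  | cons x t ih =>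
    rcases r with _ | ⟨y, r⟩
    · simp at hlen
    · rw [Sorted, List.pairwise_cons] at ht
      obtain ⟨h2, h3⟩ := h
      have h1 : ∀ y ∈ p ++ [x], ∀ z ∈ t, y ≤ z := by
        intro y hy z hz
        rcases List.mem_append.1 hy with hy | hy
        · exact hpt y hy z (by simp [hz])
        · simp at hy; subst hy; exact ht.1 z hz
      have := ih h1 ht.2 h3 (by simpa using hlen)
      rw [rowIns_cons, List.append_assoc, bumpRow_append_le fun y hy => hpt y hy x (by simp),
        List.cons_append, bumpRow_cons_lt h2]
      simp only [List.append_assoc, List.nil_append, List.cons_append] at this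
      simp [this]

/-- Inserting a row of length `b` above a tableau pushes down its first `b` columns. -/
lemma insertWord_row_hcat {b : ℕ} (hb : b ≠ 0) {t : List ℤ} {A B : Diagram} (hA : Tab (t :: A))
    (hfit : Fit b A B) (hAb : ColsLE b A) (hB : Tab B) (hlen : B ≠ [] → t.length = b) :
    insertWord (hcat A B) t = hcat (t :: A) B := by
  induction A generalizing B t with
  | nil =>
    rcases B with _ | ⟨s, B⟩
    · simpa using insertWord_word hA
    · exact absurd hfit hb
  | cons r A ih =>
    rcases B with _ | ⟨s, B⟩
    · rw [hcat_nil, hcat_nil]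
      have hA' := (tab_cons.1 hA).2.2.2
      refine (tab_insertWord hA' t).eq_of_pl hA ?_
      rw [pl_insertWord hA'.rowsSorted, word_cons t, pl_append]
    · have h1 := tab_cons.1 hA
      have h2 := rowIns_over_append (p := []) (s := s) (by simp) h1.2.1 h1.2.2.1
        (by rw [hlen (by simp)]; exact hfit.1)
      simp only [List.nil_append, List.headD_cons] at h2
      rw [hcat_cons, insertWord_row, h2, hcat_cons,
        ih h1.2.2.2 hfit.2.2 (fun s hs => hAb s (by simp [hs])) (tab_cons.1 hB).2.2.2
          fun _ => hfit.1]

/-- Rows of `B` may slide up by one place, since each of their entries is at least some entry of the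
row above. -/
lemma Fit.tail {b : ℕ} {A B : Diagram} {s : List ℤ} (h : Fit b A (s :: B)) (hB : SS (s :: B)) :
    Fit b A B := by
  induction A generalizing B s with
  | nil =>
    rcases B with _ | ⟨s', B⟩
    · trivial
    · exact h
  | cons r A ih =>
    rcases B with _ | ⟨s', B⟩
    · trivial
    · refine ⟨h.1, fun x hx y hy => ?_, ih h.2.2 hB.2.2⟩
      obtain ⟨z, hz, hzy⟩ := hB.exists_le (y := y) (by simp [hy])
      exact (h.2.1 x hx z hz).trans hzy

lemma Fit.rows_append {b : ℕ} {T A B : Diagram} (h : Fit b A B) (hB : SS B)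
    (hT : ∀ t ∈ T, t.length = b) (hTB : ∀ x ∈ T.flatten, ∀ y ∈ B.flatten, x ≤ y) :
    Fit b (T ++ A) B := by
  induction T generalizing B with
  | nil => exact h
  | cons t T ih =>
    rcases B with _ | ⟨s, B⟩
    · trivial
    · refine ⟨hT t (by simp), fun x hx y hy => hTB x (by simp [hx]) y (by simp [hy]), ?_⟩
      refine ih (h.tail hB) hB.2.2 (fun r hr => hT r (by simp [hr])) fun x hx y hy => ?_
      exact hTB x (by simp at hx ⊢; tauto) y (by simp at hy ⊢; tauto)

lemma Tab.append_right {A B : Diagram} (h : Tab (A ++ B)) : Tab B := by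
  induction A with
  | nil => exact h
  | cons r A ih => exact ih (tab_cons.1 h).2.2.2

/-- The rows of `T` are inserted from the bottom one up; each pushes the left part down by one row
and leaves `B` in place. -/
lemma insertWord_rows_hcat {b : ℕ} (hb : b ≠ 0) {T A B : Diagram} (hA : Tab (T ++ A))
    (hfit : Fit b A B) (hAb : ColsLE b A) (hB : Tab B) (hT : ∀ t ∈ T, t.length = b)
    (hTB : ∀ x ∈ T.flatten, ∀ y ∈ B.flatten, x ≤ y) :
    insertWord (hcat A B) (word T) = hcat (T ++ A) B := by
  induction T with
  | nil => rfl
  | cons t T ih =>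
    have hT' : ∀ r ∈ T, r.length = b := fun r hr => hT r (by simp [hr])
    have hTB' : ∀ x ∈ T.flatten, ∀ y ∈ B.flatten, x ≤ y :=
      fun x hx => hTB x (by simp at hx ⊢; tauto)
    rw [word_cons, insertWord_append, ih (tab_cons.1 hA).2.2.2 hT' hTB',
      insertWord_row_hcat (A := T ++ A) hb hA (hfit.rows_append hB.1 hT' hTB') ?_ hB fun _ => hT t (by simp)]
    · rfl
    · intro r hr
      rcases List.mem_append.1 hr with hr | hr
      · exact (hT' r hr).le
      · exact hAb r hr

lemma ss_append {A B : Diagram} (hA : SS A) (hB : SS B)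
    (h : ∀ r ∈ A.getLast?, Over r (B.headD [])) : SS (A ++ B) := by
  induction A with
  | nil => exact hB
  | cons r A ih =>
    obtain ⟨h1, h2, h3⟩ := hA
    rcases A with _ | ⟨s, A⟩
    · exact ⟨h1, h r (by simp), hB⟩
    · exact ⟨h1, h2, ih h3 fun t ht => h t (by simpa using ht)⟩

lemma over_of_lt {r s : List ℤ} (hlen : s.length ≤ r.length) (h : ∀ x ∈ r, ∀ y ∈ s, x < y) :
    Over r s := by
  rw [over_iff]
  intro k x hx
  have hk := (List.getElem?_eq_some_iff.1 hx).1
  exact ⟨r[k], List.getElem?_eq_getElem (by omega), h _ (List.getElem_mem _) _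
    (List.mem_of_getElem? hx)⟩

/-- A rectangle of small letters on top of a tableau with at most as many columns. -/
lemma Tab.rows_append {b : ℕ} {T A : Diagram} (hT : Tab T) (hA : Tab A)
    (hTb : ∀ t ∈ T, t.length = b) (hAb : ColsLE b A)
    (hTA : ∀ x ∈ T.flatten, ∀ y ∈ A.flatten, x < y) : Tab (T ++ A) := by
  refine ⟨ss_append hT.1 hA.1 fun r hr => ?_, fun r hr => ?_⟩
  · have hrT : r ∈ T := List.mem_of_mem_getLast? hr
    rcases A with _ | ⟨s, A⟩
    · simp
    · refine over_of_lt ?_ fun x hx y hy => ?_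
      · rw [hTb r hrT]; exact hAb s (by simp)
      · exact hTA x (List.mem_flatten.2 ⟨r, hrT, hx⟩) y (by simp at hy; simp [hy])
  · rcases List.mem_append.1 hr with hr | hr
    · exact hT.2 r hr
    · exact hA.2 r hr

/-! ### Row insertion and the first columns -/

/-- The number of boxes in the first `b` columns. -/
def sizeLeft (b : ℕ) (D : Diagram) : ℕ := (D.map fun r => min b r.length).sum

lemma sizeLeft_cons (b : ℕ) (r : List ℤ) (D : Diagram) :
    sizeLeft b (r :: D) = min b r.length + sizeLeft b D := by simp [sizeLeft]

lemma bumpRow_some_length {x y : ℤ} {r : List ℤ} (h : (bumpRow x r).2 = some y) :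
    (bumpRow x r).1.length = r.length := by
  have := bumpRow_length (x := x) (r := r)
  rw [h] at this
  simpa using this

/-- The hypothesis says that `x` lands in the first `b` columns of the top row. Insertion paths move
weakly to the left, so the new box lies in these columns. -/
lemma sizeLeft_rowInsert {b : ℕ} {D : Diagram} (hD : SS D) {x : ℤ}
    (h : (D.headD []).length < b ∨ ∃ z ∈ (D.headD []).take b, x < z) :
    sizeLeft b (rowInsert x D) = sizeLeft b D + 1 := by
  induction D generalizing x with
  | nil =>
    simp at h
    simp [rowInsert, sizeLeft]; omega
  | cons r D ih =>
    obtain ⟨h1, h2, h3⟩ := hD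
    rw [rowInsert_cons, sizeLeft_cons, sizeLeft_cons]
    simp only [List.headD_cons] at h
    rcases hy : (bumpRow x r).2 with _ | y
    · rw [bumpRow_of_le (bumpRow_none_iff.1 hy)]
      rcases h with h | ⟨z, hz, hxz⟩
      · simp; omega
      · exact absurd (bumpRow_none_iff.1 hy z (List.mem_of_mem_take hz)) (by omega)
    · rw [bumpRow_some_length hy]
      have : sizeLeft b (rowInsert y D) = sizeLeft b D + 1 := by
        refine ih h3 ?_
        by_contra hcon
        push Not at hcon
        have hlen := h2.length_le
        rcases h with h | ⟨z, hz, hxz⟩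
        · omega
        · have hyz := bumpRow_out_le h1 hy (List.mem_of_mem_take hz) hxz
          obtain ⟨k, hk, rfl⟩ := List.mem_take_iff_getElem.1 hz
          have hk' : k < (D.headD []).length := by omega
          obtain ⟨c, hc, hcx⟩ := over_iff.1 h2 k _ (List.getElem?_eq_getElem hk')
          rw [List.getElem?_eq_getElem (by omega)] at hc
          simp only [Option.some.injEq] at hc
          have := hcon.2 _ (List.mem_take_iff_getElem.2 ⟨k, by omega, rfl⟩)
          omega
      simpa [this] using by omega

/-- An insertion path either enters the first `b` columns at some row, and then ends there, or it
stays to the right of them altogether. -/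
lemma rowInsert_cut {b : ℕ} {D : Diagram} (hD : Tab D) (x : ℤ) :
    sizeLeft b (rowInsert x D) = sizeLeft b D + 1 ∨
      (sizeLeft b (rowInsert x D) = sizeLeft b D ∧ leftCut b (rowInsert x D) = leftCut b D ∧
        rightCut b (rowInsert x D) = rowInsert x (rightCut b D)) := by
  by_cases h : (D.headD []).length < b ∨ ∃ z ∈ (D.headD []).take b, x < z
  · exact Or.inl (sizeLeft_rowInsert hD.1 h)
  push Not at h
  induction D generalizing x with
  | nil =>
    simp at h; subst h
    exact Or.inr ⟨by simp [sizeLeft, rowInsert], by simp [leftCut_zero],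
      by simp [rightCut_zero (tab_rowInsert tab_nil x)]⟩
  | cons r D ih =>
    obtain ⟨hr0, hr, ho, hD'⟩ := tab_cons.1 hD
    simp only [List.headD_cons] at h
    obtain ⟨hb, hx⟩ := h
    have hbump : bumpRow x r =
        (r.take b ++ (bumpRow x (r.drop b)).1, (bumpRow x (r.drop b)).2) := by
      conv_lhs => rw [← List.take_append_drop b r]
      exact bumpRow_append_le hx
    have hmin : min b r.length = b := by omega
    have hne : r.take b ++ (bumpRow x (r.drop b)).1 ≠ [] := by
      have := List.ne_nil_of_mem (mem_bumpRow_self x (r.drop b))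
      simp [this]
    have htl : (r.take b).length = b := by simp [hb]
    have hpos : 0 < (bumpRow x (r.drop b)).1.length :=
      List.length_pos_of_mem (mem_bumpRow_self x _)
    have hleft : ∀ E : Diagram, leftCut b ((r.take b ++ (bumpRow x (r.drop b)).1) :: E) =
        if b = 0 then [] else r.take b :: leftCut b E := by
      intro E
      split_ifs with h0
      · rw [h0, leftCut_zero]
      · rw [leftCut_cons h0 hne, List.take_append_of_le_length htl.ge, List.take_take, min_self]
    have hleft' : ∀ E : Diagram, leftCut b (r :: E) =
        if b = 0 then [] else r.take b :: leftCut b E := by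
      intro E
      split_ifs with h0
      · rw [h0, leftCut_zero]
      · rw [leftCut_cons h0 hr0]
    have hright : ∀ E : Diagram, rightCut b ((r.take b ++ (bumpRow x (r.drop b)).1) :: E) =
        (bumpRow x (r.drop b)).1 :: rightCut b E := by
      intro E
      rw [rightCut_cons_of_lt (by simp only [List.length_append, htl]; omega),
        List.drop_append_of_le_length htl.ge]
      simp
    have hsz : min b (r.take b ++ (bumpRow x (r.drop b)).1).length = b := by
      simp only [List.length_append, htl]; omega
    rw [rowInsert_cons, hbump, sizeLeft_cons, sizeLeft_cons, hsz, hmin, hleft, hleft', hright]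
    rcases hy : (bumpRow x (r.drop b)).2 with _ | y
    · refine Or.inr ⟨rfl, rfl, ?_⟩
      simp only [Option.toList_none, insertWord_nil]
      rcases hb.lt_or_eq with hlt | heq
      · rw [rightCut_cons_of_lt hlt, rowInsert_cons, hy]; rfl
      · rw [rightCut_cons_of_le hD.1 heq.ge, List.drop_eq_nil_of_le heq.ge]
        have : rightCut b D = [] := by
          rcases D with _ | ⟨s, D⟩
          · rfl
          · exact rightCut_cons_of_le hD'.1 (ho.length_le.trans heq.ge)
        rw [this]; rfl
    · have hlt : b < r.length := by
        by_contra hcon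
        rw [List.drop_eq_nil_of_le (by omega)] at hy
        simp [bumpRow] at hy
      simp only [Option.toList_some, insertWord_cons, insertWord_nil]
      have ih' : sizeLeft b (rowInsert y D) = sizeLeft b D + 1 ∨
          (sizeLeft b (rowInsert y D) = sizeLeft b D ∧ leftCut b (rowInsert y D) = leftCut b D ∧
          rightCut b (rowInsert y D) = rowInsert y (rightCut b D)) := by
        by_cases hc : (D.headD []).length < b ∨ ∃ z ∈ (D.headD []).take b, y < z
        · exact Or.inl (sizeLeft_rowInsert hD'.1 hc)
        · push Not at hc
          exact ih hD' y hc
      rcases ih' with h1 | ⟨h1, h2, h3⟩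
      · left; omega
      · refine Or.inr ⟨by omega, by rw [h2], ?_⟩
        rw [rightCut_cons_of_lt hlt, rowInsert_cons, hy, h3]; rfl

lemma sizeLeft_le_insertWord {b : ℕ} {D : Diagram} (hD : Tab D) (w : List ℤ) :
    sizeLeft b D ≤ sizeLeft b (insertWord D w) := by
  induction w generalizing D with
  | nil => exact le_rfl
  | cons x w ih =>
    refine le_trans (b := sizeLeft b (rowInsert x D)) ?_ (ih (tab_rowInsert hD x))
    rcases rowInsert_cut (b := b) hD x with h | h <;> omega

/-- If row insertion of a word does not add boxes in the first `b` columns, it happens to the right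
of these columns. -/
lemma insertWord_cut {b : ℕ} {D : Diagram} (hD : Tab D) {w : List ℤ}
    (h : sizeLeft b (insertWord D w) = sizeLeft b D) :
    leftCut b (insertWord D w) = leftCut b D ∧
      rightCut b (insertWord D w) = insertWord (rightCut b D) w := by
  induction w generalizing D with
  | nil => exact ⟨rfl, rfl⟩
  | cons x w ih =>
    have h1 := sizeLeft_le_insertWord (b := b) (tab_rowInsert hD x) w
    rw [insertWord_cons] at h
    rcases rowInsert_cut (b := b) hD x with h2 | ⟨h2, h3, h4⟩
    · omega
    · obtain ⟨i1, i2⟩ := ih (tab_rowInsert hD x) (by omega)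
      rw [insertWord_cons, i1, i2, h3, h4]
      exact ⟨rfl, rfl⟩

/-! ### Content -/

lemma perm_of_pl {v w : List ℤ} (h : pl v = pl w) : v.Perm w := by
  let c : Con (FreeMonoid ℤ) :=
    { r := fun v w => v.toList.Perm w.toList
      iseqv := ⟨fun _ => List.Perm.refl _, List.Perm.symm, List.Perm.trans⟩
      mul' := fun h h' => by simpa using h.append h' }
  have hle : conGen KnuthRel ≤ c := by
    refine Con.conGen_le.2 fun a b hab => ?_
    change a.toList.Perm b.toList
    unfold KnuthRel at hab
    rcases hab with ⟨x, y, z, -, -⟩ | ⟨x, y, z, -, -⟩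
    · exact (List.Perm.swap _ _ _).cons _
    · exact List.Perm.swap _ _ _
  exact hle (Quotient.exact h)

lemma word_perm_flatten (D : Diagram) : (word D).Perm D.flatten := by
  induction D with
  | nil => simp
  | cons r D ih =>
    rw [word_cons, List.flatten_cons]
    exact List.perm_append_comm.trans (ih.append_left r)

/-! ### Exchange of two rows and Fomin's algorithm -/

/-! ### Reversing words and the alphabet -/

/-- The anti-automorphism which reverses words and changes the signs of the letters. -/
def star (w : List ℤ) : List ℤ := (w.map fun x => -x).reverse

@[simp] lemma star_nil : star [] = [] := rfl

lemma star_append (v w : List ℤ) : star (v ++ w) = star w ++ star v := by simp [star]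

@[simp] lemma star_star (w : List ℤ) : star (star w) = w := by
  simp [star]

@[simp] lemma length_star (w : List ℤ) : (star w).length = w.length := by simp [star]

lemma mem_star {x : ℤ} {w : List ℤ} : x ∈ star w ↔ -x ∈ w := by
  simp only [star, List.mem_reverse, List.mem_map]
  constructor
  · rintro ⟨y, hy, rfl⟩; simpa using hy
  · intro h; exact ⟨-x, h, by simp⟩

lemma sorted_star {w : List ℤ} (h : Sorted w) : Sorted (star w) := by
  rw [Sorted, star, List.pairwise_reverse, List.pairwise_map]
  exact h.imp fun h => by omega

lemma knuth_star {v w : List ℤ} (h : Knuth v w) : Knuth (star w) (star v) := by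
  rcases h with ⟨x, y, z, h1, h2⟩ | ⟨x, y, z, h1, h2⟩
  · exact Knuth.right (-z) (-y) (-x) (by omega) (by omega)
  · exact Knuth.left (-z) (-y) (-x) (by omega) (by omega)

/-- `star` exchanges the two kinds of Knuth relations, so it descends to the plactic monoid. -/
lemma pl_star {v w : List ℤ} (h : pl v = pl w) : pl (star v) = pl (star w) := by
  let c : Con (FreeMonoid ℤ) :=
    { r := fun v w => pl (star v.toList) = pl (star w.toList)
      iseqv := ⟨fun _ => rfl, Eq.symm, Eq.trans⟩
      mul' := fun h h' => by simp only [FreeMonoid.toList_mul, star_append, pl_append, h, h'] }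
  have hle : conGen KnuthRel ≤ c :=
    Con.conGen_le.2 fun a b hab => (pl_knuth (knuth_star hab)).symm
  exact hle (Quotient.exact h)

/-! ### Insertion of a row into a row -/

lemma rowIns_perm (r w : List ℤ) : ((rowIns r w).2 ++ (rowIns r w).1).Perm (r ++ w) := by
  induction w generalizing r with
  | nil => simp
  | cons x w ih =>
    rw [rowIns_cons, List.append_assoc]
    refine ((ih _).append_left _).trans ?_
    rw [← List.append_assoc]
    refine ((bumpRow_perm x r).append_right w).trans ?_
    exact (List.perm_middle (a := x) (l₁ := r) (l₂ := w)).symm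

lemma length_le_rowIns (v u : List ℤ) : v.length ≤ (rowIns v u).1.length := by
  induction u generalizing v with
  | nil => simp
  | cons x u ih =>
    refine le_trans ?_ (ih (bumpRow x v).1)
    have := bumpRow_length (x := x) (r := v)
    rcases h : (bumpRow x v).2 <;> rw [h] at this <;> simp at this <;> omega

lemma mem_rowIns {r w : List ℤ} {z : ℤ} (h : z ∈ (rowIns r w).1) : z ∈ r ∨ z ∈ w := by
  have := (rowIns_perm r w).subset (List.mem_append_right _ h)
  simpa using this

lemma rowIns_out_mem {r w : List ℤ} (hw : Sorted w) {z : ℤ} (h : z ∈ (rowIns r w).2) :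
    z ∈ r ∧ ∃ c ∈ w, c < z := by
  induction w generalizing r with
  | nil => simp at h
  | cons x w ih =>
    rw [Sorted, List.pairwise_cons] at hw
    rw [rowIns_cons, List.mem_append] at h
    rcases h with h | h
    · have := bumpRow_out_mem (Option.mem_toList.1 h)
      exact ⟨this.1, x, by simp, this.2⟩
    · obtain ⟨h1, c, hc, hcz⟩ := ih hw.2 h
      refine ⟨?_, c, by simp [hc], hcz⟩
      rcases mem_bumpRow h1 with rfl | h1
      · exact absurd (hw.1 c hc) (by omega)
      · exact h1

lemma sorted_rowIns_out {r w : List ℤ} (hr : Sorted r) (hw : Sorted w) :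
    Sorted (rowIns r w).2 := by
  induction w generalizing r with
  | nil => simp
  | cons x w ih =>
    have hw' := List.pairwise_cons.1 hw
    rw [rowIns_cons]
    refine List.pairwise_append.2 ⟨?_, ih (sorted_bumpRow hr) hw'.2, fun y hy z hz => ?_⟩
    · rcases (bumpRow x r).2 <;> simp
    · obtain ⟨h1, c, hc, hcz⟩ := rowIns_out_mem hw'.2 hz
      have hxc := hw'.1 c hc
      rcases mem_bumpRow h1 with rfl | h1
      · omega
      · exact bumpRow_out_le hr (Option.mem_toList.1 hy) h1 (by omega)

lemma bumpRow_decomp {x y : ℤ} {r : List ℤ} (h : (bumpRow x r).2 = some y) :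
    ∃ p q, r = p ++ y :: q ∧ (bumpRow x r).1 = p ++ x :: q ∧ ∀ z ∈ p, z ≤ x := by
  induction r with
  | nil => simp [bumpRow] at h
  | cons c r ih =>
    rcases lt_or_ge x c with hc | hc
    · rw [bumpRow_cons_lt hc] at h ⊢
      simp at h; subst h
      exact ⟨[], r, rfl, rfl, by simp⟩
    · rw [bumpRow_cons_ge hc] at h ⊢
      obtain ⟨p, q, h1, h2, h3⟩ := ih h
      exact ⟨c :: p, q, by simp [h1], by simp [h2], by simpa [hc] using h3⟩

/-- The letters of a weakly increasing word act at places moving strictly to the right, so each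
entry of `q` is bumped at most once and none of `p` is. -/
lemma rowIns_out_length_le {p q w : List ℤ} (hw : Sorted w) (h : ∀ x ∈ p, ∀ y ∈ w, x ≤ y) :
    (rowIns (p ++ q) w).2.length ≤ q.length := by
  induction w generalizing p q with
  | nil => simp
  | cons x w ih =>
    have hw' := List.pairwise_cons.1 hw
    rw [rowIns_cons, bumpRow_append_le fun y hy => h y hy x (by simp)]
    rcases hy : (bumpRow x q).2 with _ | y
    · rw [bumpRow_of_le (bumpRow_none_iff.1 hy)]
      have := ih (p := p ++ (q ++ [x])) (q := []) hw'.2 (by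
        intro z hz c hc
        simp only [List.mem_append, List.mem_singleton] at hz
        rcases hz with hz | hz | rfl
        · exact h z hz c (by simp [hc])
        · exact (bumpRow_none_iff.1 hy z hz).trans (hw'.1 c hc)
        · exact hw'.1 c hc)
      simp only [List.append_nil] at this
      simp at this ⊢
      simp [this]
    · obtain ⟨a, b, h1, h2, h3⟩ := bumpRow_decomp hy
      have := ih (p := p ++ a ++ [x]) (q := b) hw'.2 (by
        intro z hz c hc
        simp only [List.mem_append, List.mem_singleton] at hz
        rcases hz with (hz | hz) | rfl
        · exact h z hz c (by simp [hc])
        · exact (h3 z hz).trans (hw'.1 c hc)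
        · exact hw'.1 c hc)
      rw [h2, h1]
      simp only [List.append_assoc, List.singleton_append] at this
      simp at this ⊢
      omega

lemma bumpRow_append_some {x y : ℤ} {a b : List ℤ} (h : (bumpRow x a).2 = some y) :
    bumpRow x (a ++ b) = ((bumpRow x a).1 ++ b, some y) := by
  induction a with
  | nil => simp [bumpRow] at h
  | cons c a ih =>
    rw [List.cons_append]
    rcases lt_or_ge x c with hc | hc
    · rw [bumpRow_cons_lt hc] at h ⊢
      rw [bumpRow_cons_lt hc]
      simp at h; simp [h]
    · rw [bumpRow_cons_ge hc] at h ⊢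
      rw [bumpRow_cons_ge hc, ih h]; rfl

/-- Each letter `x` of `s` finds its larger partner `y` still in the row. It bumps an entry weakly
to the left of `y`, so the later partners remain untouched. -/
lemma rowIns_length_of_forall₂ {a s t : List ℤ} (h : List.Forall₂ (· < ·) s t) :
    (rowIns (a ++ t) s).1.length = (a ++ t).length := by
  induction h generalizing a with
  | nil => simp
  | @cons x y s t hxy _ ih =>
    obtain ⟨z, hz⟩ : ∃ z, (bumpRow x (a ++ [y])).2 = some z := by
      rw [← Option.ne_none_iff_exists']
      intro hn
      exact absurd (bumpRow_none_iff.1 hn y (by simp)) (by omega)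
    have h1 : a ++ y :: t = (a ++ [y]) ++ t := by simp
    rw [rowIns_cons, h1, bumpRow_append_some hz]
    simp only
    rw [ih, List.length_append, List.length_append, bumpRow_some_length hz]

lemma Over.forall₂ {r s : List ℤ} (h : Over r s) :
    List.Forall₂ (· < ·) (r.take s.length) s := by
  induction s generalizing r with
  | nil => simp
  | cons y s ih =>
    rcases r with _ | ⟨x, r⟩
    · exact absurd h (by simp)
    · simpa using ⟨h.1, ih h.2⟩

lemma rowIns_empty_append {v u : List ℤ} (hv : Sorted v) : rowIns [] (v ++ u) = rowIns v u := by
  have h := rowIns_over (r := []) (s := v) (t := []) (by simp) hv (by simp)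
  simp only [List.append_nil, List.nil_append] at h
  rw [rowIns_append, h]; simp

lemma rect_sorted {z : List ℤ} (hz : Sorted z) (h : z ≠ []) : rect z = [z] := by
  have := insertWord_word (B := [z]) (by simp [tab_cons, h, hz])
  simpa using this

lemma word_rect_sorted {z : List ℤ} (hz : Sorted z) : word (rect z) = z := by
  by_cases h : z = []
  · simp [h]
  · rw [rect_sorted hz h]; simp

lemma rect_append_rows {v u : List ℤ} (hv : Sorted v) (h : v ++ u ≠ []) :
    rect (v ++ u) = (rowIns v u).1 :: rect (rowIns v u).2 := by
  rw [rect, insertWord_empty h, rowIns_empty_append hv]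

lemma rowIns_fst_over {v u : List ℤ} (hv : Sorted v) (hu : Sorted u) :
    Over (rowIns v u).1 (rowIns v u).2 := by
  by_cases h : v ++ u = []
  · simp at h; simp [h.1, h.2]
  · have h1 := tab_rect (v ++ u)
    rw [rect_append_rows hv h] at h1
    by_cases h2 : (rowIns v u).2 = []
    · simp [h2]
    · rw [rect_sorted (sorted_rowIns_out hv hu) h2] at h1
      exact h1.1.2.1

/-- The lengths of two rows can be exchanged, without changing their product. -/
lemma exists_swap {v u : List ℤ} (hv : Sorted v) (hu : Sorted u) :
    ∃ v' u', Sorted v' ∧ Sorted u' ∧ v'.length = u.length ∧ u'.length = v.length ∧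
      pl v' * pl u' = pl v * pl u := by
  -- `w` and `z` are the upper and the lower row of the product. The lengths of `v` and `u` both lie
  -- between those of `z` and `w`.
  set w := (rowIns v u).1 with hw
  set z := (rowIns v u).2 with hz
  have hpl : pl v * pl u = pl z * pl w := by rw [← pl_append, pl_rowIns hv, pl_append]
  have hlen : z.length + w.length = v.length + u.length := by
    simpa using (rowIns_perm v u).length_eq
  have hzv : z.length ≤ v.length := by
    simpa using rowIns_out_length_le (p := []) (q := v) hu (by simp)
  have hover : Over w z := rowIns_fst_over hv hu
  have hzs : Sorted z := sorted_rowIns_out hv hu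
  have hws : Sorted w := sorted_rowIns hv
  -- The product `z · w1` is factored with its two lengths exchanged, by inserting in the reversed
  -- alphabet; then `w2` is appended to the second factor, which gives it the length of `v`.
  set w1 := w.take u.length with hw1
  set w2 := w.drop u.length with hw2
  have hw12 : w1 ++ w2 = w := List.take_append_drop _ _
  have hw1len : w1.length = u.length := by simp [hw1]; omega
  have hws' : Sorted (w1 ++ w2) := hw12 ▸ hws
  obtain ⟨hs1, hs2, hs3⟩ := List.pairwise_append.1 hws'
  have hzu : z.length ≤ u.length := by
    have : v.length ≤ w.length := length_le_rowIns v u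
    omega
  -- The entries of `w1` above `z` are smaller than those of `z`. After applying `star` they are
  -- larger partners for the inserted letters, so no box is added.
  have hall : (rowIns (star w1) (star z)).1.length = (star w1).length := by
    have h1 : List.Forall₂ (· < ·) (w1.take z.length) z := by
      have := hover.forall₂
      rwa [hw1, List.take_take, min_eq_left hzu]
    have h2 : List.Forall₂ (· < ·) (star z) (star (w1.take z.length)) := by
      rw [star, star, List.forall₂_reverse_iff, List.forall₂_map_left_iff,
        List.forall₂_map_right_iff]
      exact h1.flip.imp fun _ _ h => neg_lt_neg h
    have h3 : star w1 = star (w1.drop z.length) ++ star (w1.take z.length) := by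
      rw [← star_append, List.take_append_drop]
    rw [h3]
    exact rowIns_length_of_forall₂ h2
  set r := (rowIns (star w1) (star z)).1 with hr
  set o := (rowIns (star w1) (star z)).2 with ho
  have hpl2 : pl z * pl w1 = pl (star r) * pl (star o) := by
    have h1 := pl_star (pl_rowIns (w := star z) (sorted_star hs1))
    rw [star_append, star_append, star_star, star_star] at h1
    rw [← pl_append, h1, pl_append]
  have hlen2 : o.length = z.length := by
    have := (rowIns_perm (star w1) (star z)).length_eq
    simp only [List.length_append] at this
    rw [hall] at this
    simp only [length_star] at this
    rw [ho]
    omega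
  have hos : Sorted (star o ++ w2) := by
    refine List.pairwise_append.2
      ⟨sorted_star (sorted_rowIns_out (sorted_star hs1) (sorted_star hzs)), hs2, ?_⟩
    intro x hx y hy
    have h1 := (rowIns_out_mem (sorted_star hzs) (mem_star.1 hx)).1
    rw [mem_star, neg_neg] at h1
    exact hs3 x h1 y hy
  refine ⟨star r, star o ++ w2, sorted_star (sorted_rowIns (sorted_star hs1)), hos, ?_, ?_, ?_⟩
  · rw [length_star, hall, length_star, hw1len]
  · have : w1.length + w2.length = w.length := by rw [← List.length_append, hw12]
    rw [List.length_append, length_star]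
    omega
  · rw [pl_append, ← mul_assoc, ← hpl2, mul_assoc, ← pl_append w1, hw12, hpl]

/-- Bumping can be undone: `y` returns to the place of the last entry smaller than itself. -/
lemma bumpRow_injective {x x' y : ℤ} {r r' w : List ℤ} (hr : Sorted r) (hr' : Sorted r')
    (h : bumpRow x r = (w, some y)) (h' : bumpRow x' r' = (w, some y)) : x = x' ∧ r = r' := by
  induction r generalizing r' w with
  | nil => simp [bumpRow] at h
  | cons c r ih =>
    rcases r' with _ | ⟨c', r'⟩
    · simp [bumpRow] at h'
    have hrs := List.pairwise_cons.1 hr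
    have hrs' := List.pairwise_cons.1 hr'
    rcases lt_or_ge x c with hc | hc <;> rcases lt_or_ge x' c' with hc' | hc'
    · rw [bumpRow_cons_lt hc] at h
      rw [bumpRow_cons_lt hc'] at h'
      simp only [Prod.mk.injEq, Option.some.injEq] at h h'
      obtain ⟨rfl, rfl⟩ := h
      obtain ⟨h1, rfl⟩ := h'
      simp at h1
      simp [h1]
    · rw [bumpRow_cons_lt hc] at h
      rw [bumpRow_cons_ge hc'] at h'
      simp only [Prod.mk.injEq, Option.some.injEq] at h h'
      obtain ⟨rfl, rfl⟩ := h
      obtain ⟨h1, h2⟩ := h'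
      simp at h1
      have := hrs.1 x' (h1.2 ▸ mem_bumpRow_self x' r')
      have := (bumpRow_out_mem h2).2
      omega
    · rw [bumpRow_cons_ge hc] at h
      rw [bumpRow_cons_lt hc'] at h'
      simp only [Prod.mk.injEq, Option.some.injEq] at h h'
      obtain ⟨rfl, rfl⟩ := h'
      obtain ⟨h1, h2⟩ := h
      simp at h1
      have := hrs'.1 x (h1.2 ▸ mem_bumpRow_self x r)
      have := (bumpRow_out_mem h2).2
      omega
    · rw [bumpRow_cons_ge hc] at h
      rw [bumpRow_cons_ge hc'] at h'
      simp only [Prod.mk.injEq] at h h'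
      obtain ⟨rfl, h2⟩ := h
      obtain ⟨h1, h3⟩ := h'
      simp at h1
      obtain ⟨i1, i2⟩ := ih hrs.2 hrs'.2 (w := (bumpRow x r).1) (Prod.ext rfl h2)
        (Prod.ext h1.2 h3)
      simp [i1, i2, h1.1]

/-- A weakly increasing word first bumps and then appends: after a letter has been appended, no
later one bumps. -/
lemma bumpRow_none_of_length_lt {v u : List ℤ} {x : ℤ} (hu : Sorted (u ++ [x]))
    (h : v.length < (rowIns v u).1.length) : (bumpRow x (rowIns v u).1).2 = none := by
  induction u generalizing v with
  | nil => simp at h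
  | cons c u ih =>
    have hu' := List.pairwise_cons.1 hu
    rw [rowIns_cons] at h ⊢
    rcases hy : (bumpRow c v).2 with _ | y
    · rw [bumpRow_none_iff]
      have hcx : c ≤ x := hu'.1 x (by simp)
      intro z hz
      rcases mem_rowIns hz with hz | hz
      · rcases mem_bumpRow hz with rfl | hz
        · exact hcx
        · exact (bumpRow_none_iff.1 hy z hz).trans hcx
      · exact (List.pairwise_append.1 hu'.2).2.2 z hz x (by simp)
    · exact ih hu'.2 (by rw [bumpRow_some_length hy]; exact h)

lemma rowIns_injective {v v' u u' : List ℤ} (hv : Sorted v) (hv' : Sorted v') (hu : Sorted u)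
    (hu' : Sorted u') (hlen : v.length = v'.length) (hlen' : u.length = u'.length)
    (h : rowIns v u = rowIns v' u') : v = v' ∧ u = u' := by
  induction u using List.reverseRecOn generalizing u' with
  | nil =>
    have : u' = [] := List.length_eq_zero_iff.1 (by simpa using hlen'.symm)
    subst this
    simpa using h
  | append_singleton u x ih =>
    rcases List.eq_nil_or_concat' u' with rfl | ⟨u', x', rfl⟩
    · simp at hlen'
    have hus := (List.pairwise_append.1 hu).1
    have hus' := (List.pairwise_append.1 hu').1
    rw [rowIns_append, rowIns_append, rowIns_cons, rowIns_cons] at h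
    simp only [rowIns_nil, List.append_nil, Prod.mk.injEq] at h
    obtain ⟨h1, h2⟩ := h
    have hs := sorted_rowIns (w := u) hv
    have hs' := sorted_rowIns (w := u') hv'
    have n1 := fun h => bumpRow_none_of_length_lt (v := v) hu h
    have n2 := fun h => bumpRow_none_of_length_lt (v := v') hu' h
    have l1 := bumpRow_length (x := x) (r := (rowIns v u).1)
    have l2 := bumpRow_length (x := x') (r := (rowIns v' u').1)
    have m1 := length_le_rowIns v u
    have m2 := length_le_rowIns v' u'
    have hlen1 := congrArg List.length h1
    -- The two last letters are both appended or both bump. In a mixed case the row in which a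
    -- letter bumps has not grown, and the two final rows would differ in length.
    have key : (rowIns v u).1 = (rowIns v' u').1 ∧ x = x' ∧ (rowIns v u).2 = (rowIns v' u').2 := by
      rcases hy : (bumpRow x (rowIns v u).1).2 with _ | y <;>
        rcases hy' : (bumpRow x' (rowIns v' u').1).2 with _ | y'
      · rw [bumpRow_of_le (bumpRow_none_iff.1 hy), bumpRow_of_le (bumpRow_none_iff.1 hy')] at h1
        rw [hy, hy'] at h2
        have := List.append_inj' h1 rfl
        simp at this h2
        exact ⟨this.1, this.2, h2⟩
      · rw [hy] at l1
        rw [hy'] at l2 n2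
        simp at l1 l2 n2
        omega
      · rw [hy] at l1 n1
        rw [hy'] at l2
        simp at l1 l2 n1
        omega
      · rw [hy, hy'] at h2
        have h3 := List.append_inj' h2 rfl
        simp at h3
        obtain ⟨i1, i2⟩ := bumpRow_injective hs hs' (w := (bumpRow x (rowIns v u).1).1)
          (Prod.ext rfl hy) (Prod.ext h1.symm (by rw [hy', h3.2]))
        exact ⟨i2, i1, h3.1⟩
    obtain ⟨k1, k2, k3⟩ := key
    obtain ⟨i1, i2⟩ := ih hus hus' (by simpa using hlen') (Prod.ext k1 k3)
    exact ⟨i1, by simp [i2, k2]⟩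

/-- Two rows are determined by their lengths and their product. -/
lemma rows_unique {v v' u u' : List ℤ} (hv : Sorted v) (hv' : Sorted v') (hu : Sorted u)
    (hu' : Sorted u') (hlen : v.length = v'.length) (hlen' : u.length = u'.length)
    (h : pl v * pl u = pl v' * pl u') : v = v' ∧ u = u' := by
  by_cases h0 : v ++ u = []
  · obtain ⟨rfl, rfl⟩ := List.append_eq_nil_iff.1 h0
    exact ⟨(List.length_eq_zero_iff.1 hlen.symm).symm, (List.length_eq_zero_iff.1 hlen'.symm).symm⟩
  · have h0' : v' ++ u' ≠ [] := by
      intro h1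
      obtain ⟨rfl, rfl⟩ := List.append_eq_nil_iff.1 h1
      exact h0 (by rw [List.length_eq_zero_iff.1 hlen, List.length_eq_zero_iff.1 hlen']; rfl)
    rw [← pl_append, ← pl_append] at h
    have h1 := rect_congr h
    rw [rect_append_rows hv h0, rect_append_rows hv' h0', List.cons.injEq] at h1
    refine rowIns_injective hv hv' hu hu' hlen hlen' (Prod.ext h1.1 ?_)
    have := congrArg word h1.2
    rwa [word_rect_sorted (sorted_rowIns_out hv hu),
      word_rect_sorted (sorted_rowIns_out hv' hu')] at this

/-! ### The exchange operation on two rows -/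

/-- The box in column `j` of the lower row `v` is a violation. -/
def RowViolation (u v : List ℤ) (j : ℕ) : Prop :=
  ∃ x, v[j]? = some x ∧ ∀ y, u[j]? = some y → x ≤ y

/-- The rows `u`, `v` are replaced by `u'`, `v'` in an exchange operation. -/
structure RowExchange (u v u' v' : List ℤ) : Prop where
  sorted_upper : Sorted u'
  sorted_lower : Sorted v'
  length_upper : u'.length + 1 = v.length
  length_lower : v'.length = u.length + 1
  pl_eq : pl v' * pl u' = pl v * pl u

lemma RowExchange.symm {u v u' v' : List ℤ} (h : RowExchange u v u' v') (hu : Sorted u)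
    (hv : Sorted v) : RowExchange u' v' u v :=
  ⟨hu, hv, h.length_lower.symm, h.length_upper.symm, h.pl_eq.symm⟩

lemma RowExchange.unique {u v u₁ v₁ u₂ v₂ : List ℤ} (h₁ : RowExchange u v u₁ v₁)
    (h₂ : RowExchange u v u₂ v₂) : u₁ = u₂ ∧ v₁ = v₂ := by
  have := rows_unique h₁.sorted_lower h₂.sorted_lower h₁.sorted_upper h₂.sorted_upper
    (by rw [h₁.length_lower, h₂.length_lower])
    (by have := h₁.length_upper; have := h₂.length_upper; omega) (h₁.pl_eq.trans h₂.pl_eq.symm)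
  exact ⟨this.2, this.1⟩

/-- Before the first violation `x` the parts `u1` and `v1`, of length `j`, form a tableau, and all
later letters are at least `x`. Thus `v · u` equals `v1 · u1 · x · v2 · u2`, and `exists_swap`
applied to `v2` and `u2` gives the exchange. Since `u2` begins in column `j` and `v2` in column `j +
1`, the lengths come out as `v.length - 1` and `u.length + 1`. Nothing before column `j` changes,
and `x` remains a violation. -/
lemma rowExchange_exists {u v : List ℤ} {j : ℕ} (hu : Sorted u) (hv : Sorted v)
    (hj : RowViolation u v j) (hmin : ∀ k < j, ¬ RowViolation u v k) :
    ∃ u' v', RowExchange u v u' v' ∧ (∀ k < j, u'[k]? = u[k]?) ∧ (∀ k ≤ j, v'[k]? = v[k]?) ∧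
      RowViolation u' v' j := by
  obtain ⟨x, hx, hxy⟩ := hj
  have hjv := (List.getElem?_eq_some_iff.1 hx).1
  have hlt : ∀ k < j, ∃ y z, u[k]? = some y ∧ v[k]? = some z ∧ y < z := by
    intro k hk
    have h1 := hmin k hk
    have h2 : v[k]? = some v[k] := List.getElem?_eq_getElem (by omega)
    simp only [RowViolation, not_exists, not_and, not_forall] at h1
    obtain ⟨y, hy, hlt⟩ := h1 _ h2
    exact ⟨y, _, hy, h2, by omega⟩
  have hju : j ≤ u.length := by
    by_contra hcon
    obtain ⟨y, z, hy, -, -⟩ := hlt u.length (by omega)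
    simp at hy
  set u1 := u.take j with hu1
  set u2 := u.drop j with hu2
  set v1 := v.take j with hv1
  set v2 := v.drop (j + 1) with hv2
  have hue : u = u1 ++ u2 := (List.take_append_drop j u).symm
  have hve : v = v1 ++ x :: v2 := by
    rw [hv1, hv2]
    have : v[j] = x := by simpa [List.getElem?_eq_getElem hjv] using hx
    rw [← this, List.getElem_cons_drop, List.take_append_drop]
  have hl1 : u1.length = j := by simp [hu1, hju]
  have hl2 : v1.length = j := by simp [hv1]; omega
  have hover : Over u1 v1 := by
    rw [over_iff]
    intro k z hz
    have hk : k < j := by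
      have := (List.getElem?_eq_some_iff.1 hz).1
      omega
    obtain ⟨y, z', hy, hz', hlt'⟩ := hlt k hk
    rw [hv1, List.getElem?_take_of_lt hk, hz'] at hz
    simp only [Option.some.injEq] at hz
    exact ⟨y, by rw [hu1, List.getElem?_take_of_lt hk, hy], by omega⟩
  have hu' := hu
  have hv' := hv
  rw [hue] at hu'
  rw [hve] at hv'
  obtain ⟨hus1, hus2, hus3⟩ := List.pairwise_append.1 hu'
  obtain ⟨hvs1, hvs2, hvs3⟩ := List.pairwise_append.1 hv'
  obtain ⟨hxv, hvs2⟩ := List.pairwise_cons.1 hvs2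
  have hxu : ∀ y ∈ u2, x ≤ y := by
    intro y hy
    rcases hc : u2 with _ | ⟨z, t⟩
    · simp [hc] at hy
    · have hz : u[j]? = some z := by
        rw [hue, List.getElem?_append_right hl1.le, hl1, hc]; simp
      have h1 := hxy z hz
      rw [hc] at hy hus2
      rcases List.mem_cons.1 hy with rfl | hy
      · exact h1
      · exact h1.trans ((List.pairwise_cons.1 hus2).1 y hy)
  have hu1x : ∀ y ∈ u1, y ≤ x := by
    intro y hy
    obtain ⟨k, hk⟩ := List.mem_iff_getElem?.1 hy
    have hkj := (List.getElem?_eq_some_iff.1 hk).1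
    obtain ⟨z, c, hz, hc, hzc⟩ := hlt k (by omega)
    rw [hu1, List.getElem?_take_of_lt (by omega), hz] at hk
    simp only [Option.some.injEq] at hk
    have : c ∈ v1 := by
      rw [hv1]
      exact List.mem_of_getElem? (i := k) (by rw [List.getElem?_take_of_lt (by omega), hc])
    have := hvs3 c this x (by simp)
    omega
  obtain ⟨v3, u3, hv3s, hu3s, hv3l, hu3l, hpl⟩ := exists_swap hvs2 hus2
  have hmem : ∀ y, y ∈ v3 ∨ y ∈ u3 → x ≤ y := by
    intro y hy
    rw [← pl_append, ← pl_append] at hpl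
    have := (perm_of_pl hpl).subset (a := y) (by simpa using hy)
    rcases List.mem_append.1 this with h | h
    · exact hxv y h
    · exact hxu y h
  -- Inserting `u1` into `v1 x p` bumps out exactly `v1`.
  have hform : ∀ p q : List ℤ, Sorted (v1 ++ x :: p) → pl (v1 ++ x :: p) * pl (u1 ++ q) =
      pl (v1 ++ u1 ++ [x]) * (pl p * pl q) := by
    intro p q hp
    have h1 : pl (v1 ++ x :: p ++ u1) = pl (v1 ++ (u1 ++ x :: p)) := by
      have h2 := rowIns_over_append (p := []) (s := x :: p) (by simp) hus1 hover
        (by rw [hl1, hl2])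
      simp only [List.nil_append] at h2
      rw [pl_rowIns hp, h2]
    rw [pl_append u1, ← mul_assoc, ← pl_append, h1, ← mul_assoc, ← pl_append, ← pl_append,
      ← pl_append]
    simp
  have hv3 : Sorted (v1 ++ x :: v3) := by
    refine List.pairwise_append.2
      ⟨hvs1, List.pairwise_cons.2 ⟨fun y hy => hmem y (Or.inl hy), hv3s⟩, fun y hy z hz => ?_⟩
    have hyx := hvs3 y hy x (by simp)
    rcases List.mem_cons.1 hz with rfl | hz
    · exact hyx
    · exact hyx.trans (hmem z (Or.inl hz))
  refine ⟨u1 ++ u3, v1 ++ x :: v3, ⟨?_, hv3, ?_, ?_, ?_⟩, ?_, ?_, x, ?_, ?_⟩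
  · exact List.pairwise_append.2
      ⟨hus1, hu3s, fun y hy z hz => (hu1x y hy).trans (hmem z (Or.inr hz))⟩
  · simp [hl1, hu3l, hv2]; omega
  · simp [hl2, hv3l, hu2]; omega
  · rw [hform _ _ hv3, hpl, ← hform _ _ hv', ← hue, ← hve]
  · intro k hk
    rw [hue, List.getElem?_append_left (by omega), List.getElem?_append_left (by omega)]
  · intro k hk
    rw [hve]
    rcases hk.lt_or_eq with hk | rfl
    · rw [List.getElem?_append_left (by omega), List.getElem?_append_left (by omega)]
    · rw [List.getElem?_append_right (by omega), List.getElem?_append_right (by omega), hl2]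
      simp
  · rw [List.getElem?_append_right (by omega), hl2]; simp
  · intro y hy
    rw [List.getElem?_append_right (by omega)] at hy
    exact hmem y (Or.inr (List.mem_of_getElem? hy))

/-! ### The exchange operation on diagrams -/

lemma violation_succ_iff {D : Diagram} {i j : ℕ} : D.Violation (i + 1) j ↔
    ∃ u v, D[i]? = some u ∧ D[i + 1]? = some v ∧ RowViolation u v j := by
  constructor
  · rintro ⟨-, x, hx, hy⟩
    obtain ⟨v, hv, hx⟩ := Option.bind_eq_some_iff.1 hx
    have hi := (List.getElem?_eq_some_iff.1 hv).1
    refine ⟨D[i], v, List.getElem?_eq_getElem (by omega), hv, x, hx, fun y hy' => hy y ?_⟩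
    simp only [Diagram.box, Nat.add_sub_cancel, Option.bind_eq_some_iff]
    exact ⟨_, List.getElem?_eq_getElem (by omega), hy'⟩
  · rintro ⟨u, v, hu, hv, x, hx, hy⟩
    exact ⟨by simp, x, by simp [Diagram.box, hv, hx], by simpa [Diagram.box, hu] using hy⟩

lemma getElem?_two_rows {A B : Diagram} {u v : List ℤ} :
    (A ++ u :: v :: B)[A.length]? = some u ∧ (A ++ u :: v :: B)[A.length + 1]? = some v := by
  simp

lemma exchange_iff {D D' : Diagram} {i : ℕ} (hD : RowsSorted D) : Exchange i D D' ↔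
    ∃ (A B : Diagram) (u v u' v' : List ℤ), A.length = i ∧ D = A ++ u :: v :: B ∧
      D' = A ++ u' :: v' :: B ∧ (∃ j, RowViolation u v j) ∧ RowExchange u v u' v' := by
  constructor
  · rintro ⟨⟨j, hj⟩, A, B, u, v, u', v', rfl, rfl, rfl, h1, h2, h3, h4, h5⟩
    refine ⟨A, B, u, v, u', v', rfl, rfl, rfl, ⟨j, ?_⟩, h1, h2, h3, h4, ?_⟩
    · obtain ⟨u₀, v₀, hu, hv, h⟩ := violation_succ_iff.1 hj
      rw [getElem?_two_rows.1, Option.some.injEq] at hu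
      rw [getElem?_two_rows.2, Option.some.injEq] at hv
      rwa [hu, hv]
    · have h6 := congrArg (fun D => pl (word D)) h5
      have hv : Sorted v := hD v (by simp)
      rw [pl_tmul (by simpa [RowsSorted] using h2), pl_tmul (by simpa [RowsSorted] using hv)] at h6
      simpa using h6
  · rintro ⟨A, B, u, v, u', v', rfl, rfl, rfl, ⟨j, hj⟩, h⟩
    refine ⟨⟨j, violation_succ_iff.2 ⟨u, v, getElem?_two_rows.1, getElem?_two_rows.2, hj⟩⟩,
      A, B, u, v, u', v', rfl, rfl, rfl, h.1, h.2, h.3, h.4, ?_⟩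
    have hv : Sorted v := hD v (by simp)
    have hv0 : v ≠ [] := by
      rintro rfl
      have := h.3
      simp at this
    have hv0' : v' ≠ [] := by
      rintro rfl
      have := h.4
      simp at this
    have t1 : Tab [v] := by simp [tab_cons, hv0, hv]
    have t2 : Tab [v'] := by simpa [tab_cons, hv0'] using h.2
    refine (tab_tmul t2 _).eq_of_pl (tab_tmul t1 _) ?_
    rw [pl_tmul t2.rowsSorted, pl_tmul t1.rowsSorted]
    simpa using h.5

lemma exists_first_violation {D : Diagram} {i j : ℕ} (h : D.Violation i j) :
    ∃ j₀ ≤ j, D.Violation i j₀ ∧ ∀ k < j₀, ¬ D.Violation i k := by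
  classical
  have hex : ∃ j, D.Violation i j := ⟨j, h⟩
  exact ⟨Nat.find hex, Nat.find_min' hex h, Nat.find_spec hex, fun k hk => Nat.find_min hex hk⟩

lemma getElem?_rows_ne {A B : Diagram} {u v u' v' : List ℤ} {k : ℕ} (h1 : k ≠ A.length)
    (h2 : k ≠ A.length + 1) : (A ++ u :: v :: B)[k]? = (A ++ u' :: v' :: B)[k]? := by
  rcases lt_or_ge k A.length with h | h
  · rw [List.getElem?_append_left h, List.getElem?_append_left h]
  · obtain ⟨m, rfl⟩ : ∃ m, k = A.length + (m + 2) := ⟨k - A.length - 2, by omega⟩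
    rw [List.getElem?_append_right (by omega), List.getElem?_append_right (by omega)]
    simp

/-- What an exchange operation changes and what it leaves in place, where `(i + 1, j)` is the
first violation in the lower row. -/
structure ExchangeSpec (i j : ℕ) (D D' : Diagram) : Prop where
  sorted : RowsSorted D'
  length_eq : D'.length = D.length
  row_eq : ∀ k, k ≠ i → k ≠ i + 1 → D'[k]? = D[k]?
  upper : ∀ l < j, D'.box i l = D.box i l
  lower : ∀ l ≤ j, D'.box (i + 1) l = D.box (i + 1) l
  viol : D'.Violation (i + 1) j
  symm : Exchange i D' D
  pl_eq : pl (word D') = pl (word D)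

/-- By uniqueness the given exchange is the one constructed in `rowExchange_exists`. -/
lemma Exchange.spec {D D' : Diagram} {i j : ℕ} (h : Exchange i D D') (hD : RowsSorted D)
    (hj : D.Violation (i + 1) j) (hmin : ∀ k < j, ¬ D.Violation (i + 1) k) :
    ExchangeSpec i j D D' := by
  obtain ⟨A, B, u, v, u', v', rfl, rfl, rfl, -, hx⟩ := (exchange_iff hD).1 h
  have hu : Sorted u := hD u (by simp)
  have hv : Sorted v := hD v (by simp)
  have hviol : ∀ k, Diagram.Violation (A ++ u :: v :: B) (A.length + 1) k ↔ RowViolation u v k := by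
    intro k
    rw [violation_succ_iff, getElem?_two_rows.1, getElem?_two_rows.2]
    simp
  obtain ⟨u₁, v₁, hx₁, h1, h2, h3⟩ := rowExchange_exists hu hv ((hviol j).1 hj)
    fun k hk => by rw [← hviol]; exact hmin k hk
  obtain ⟨rfl, rfl⟩ := hx.unique hx₁
  have hs : RowsSorted (A ++ u' :: v' :: B) := by
    intro r hr
    simp only [List.mem_append, List.mem_cons] at hr
    rcases hr with hr | rfl | rfl | hr
    · exact hD r (by simp [hr])
    · exact hx.1
    · exact hx.2
    · exact hD r (by simp [hr])
  refine ⟨hs, by simp, fun k hk1 hk2 => getElem?_rows_ne hk1 hk2, fun l hl => ?_, fun l hl => ?_,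
    ?_, ?_, ?_⟩
  · simp [Diagram.box, h1 l hl]
  · simp [Diagram.box, h2 l hl]
  · exact violation_succ_iff.2 ⟨u', v', getElem?_two_rows.1, getElem?_two_rows.2, h3⟩
  · exact (exchange_iff hs).2 ⟨A, B, u', v', u, v, rfl, rfl, rfl, ⟨j, h3⟩, hx.symm hu hv⟩
  · simp only [word_append, word_cons, pl_append, mul_assoc]
    rw [← mul_assoc (pl v'), hx.pl_eq, mul_assoc]

lemma Exchange.exists_spec {D D' : Diagram} {i : ℕ} (h : Exchange i D D') (hD : RowsSorted D) :
    ∃ j, D.Violation (i + 1) j ∧ ExchangeSpec i j D D' := by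
  obtain ⟨j, hj⟩ := h.1
  obtain ⟨j₀, -, h1, h2⟩ := exists_first_violation hj
  exact ⟨j₀, h1, h.spec hD h1 h2⟩

lemma exchange_exists {D : Diagram} {i j : ℕ} (hD : RowsSorted D) (h : D.Violation (i + 1) j) :
    ∃ D', Exchange i D D' := by
  obtain ⟨j₀, -, h1, h2⟩ := exists_first_violation h
  obtain ⟨u, v, hu, hv, hr⟩ := violation_succ_iff.1 h1
  obtain ⟨hi, hu'⟩ := List.getElem?_eq_some_iff.1 hu
  obtain ⟨hi', hv'⟩ := List.getElem?_eq_some_iff.1 hv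
  have hdec : D = D.take i ++ u :: v :: D.drop (i + 2) := by
    rw [← hu', ← hv', List.getElem_cons_drop, List.getElem_cons_drop, List.take_append_drop]
  obtain ⟨u₁, v₁, hx, -⟩ := rowExchange_exists (hD u (List.mem_of_getElem? hu))
    (hD v (List.mem_of_getElem? hv)) hr fun k hk hcon =>
      h2 k hk (violation_succ_iff.2 ⟨u, v, hu, hv, hcon⟩)
  exact ⟨D.take i ++ u₁ :: v₁ :: D.drop (i + 2), (exchange_iff hD).2
    ⟨_, _, u, v, u₁, v₁, by simp; omega, hdec, rfl, ⟨j₀, hr⟩, hx⟩⟩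

lemma Exchange.unique {D D₁ D₂ : Diagram} {i : ℕ} (hD : RowsSorted D) (h₁ : Exchange i D D₁)
    (h₂ : Exchange i D D₂) : D₁ = D₂ := by
  obtain ⟨A, B, u, v, u₁, v₁, hA, hd, rfl, -, hx⟩ := (exchange_iff hD).1 h₁
  obtain ⟨A', B', u', v', u₂, v₂, hA', hd', rfl, -, hx'⟩ := (exchange_iff hD).1 h₂
  rw [hd] at hd'
  obtain ⟨rfl, h3⟩ := List.append_inj hd' (by omega)
  simp only [List.cons.injEq] at h3
  obtain ⟨rfl, rfl, rfl⟩ := h3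
  obtain ⟨rfl, rfl⟩ := hx.unique hx'
  rfl

/-- An exchange changes the upper row from column `j` on and the lower row from column `j + 1` on.
It can affect violations in row `i` from column `j`, and in rows `i + 1` and `i + 2` from column `j
+ 1`; all these positions come later in the order. The box `(i + 2, j + 1)` lies on the same
diagonal as `(i + 1, j)`, which is why ties are decided by the row. -/
lemma ExchangeSpec.violation_iff {D D' : Diagram} {i j : ℕ} (h : ExchangeSpec i j D D')
    (hj : D.Violation (i + 1) j) {k l : ℕ} (hkl : ¬ PosLT (i + 1) j k l) :
    D'.Violation k l ↔ D.Violation k l := by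
  simp only [PosLT, not_or, not_and] at hkl
  push_cast at hkl
  obtain ⟨h1, h2⟩ := hkl
  rcases Nat.eq_zero_or_pos k with rfl | hk
  · simp [Diagram.Violation]
  by_cases heq : k = i + 1 ∧ l = j
  · obtain ⟨rfl, rfl⟩ := heq
    exact ⟨fun _ => hj, fun _ => h.viol⟩
  have e1 : D'.box k l = D.box k l := by
    by_cases hki : k = i
    · subst hki; exact h.upper l (by omega)
    · by_cases hki' : k = i + 1
      · subst hki'; exact h.lower l (by omega)
      · simp only [Diagram.box, h.row_eq k hki hki']
  have e2 : D'.box (k - 1) l = D.box (k - 1) l := by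
    by_cases hki : k - 1 = i
    · rw [hki]; exact h.upper l (by omega)
    · by_cases hki' : k - 1 = i + 1
      · rw [hki']; exact h.lower l (by omega)
      · simp only [Diagram.box, h.row_eq _ hki hki']
  simp only [Diagram.Violation, e1, e2]

lemma PosLT.trans {i j i' j' i'' j'' : ℕ} (h : PosLT i j i' j') (h' : PosLT i' j' i'' j'') :
    PosLT i j i'' j'' := by
  simp only [PosLT] at *; omega

lemma PosLT.asymm {i j i' j' : ℕ} (h : PosLT i j i' j') : ¬ PosLT i' j' i j := by
  simp only [PosLT] at *; omega

lemma MinViolationOutside.unique {a i j i' j' : ℕ} {D : Diagram}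
    (h : MinViolationOutside a D i j) (h' : MinViolationOutside a D i' j') :
    (i, j) = (i', j') := by
  by_contra hne
  exact (h.2.2 i' j' h'.1 h'.2.1 (Ne.symm hne)).asymm (h'.2.2 i j h.1 h.2.1 hne)

lemma Diagram.Violation.pos {D : Diagram} {i j : ℕ} (h : D.Violation i j) : 0 < i := h.1

lemma MinViolationOutside.first {a i j : ℕ} {D : Diagram} (h : MinViolationOutside a D i j) :
    ∀ k < j, ¬ D.Violation i k := by
  intro k hk hv
  have := h.2.2 i k hv h.2.1 (by simp; omega)
  simp only [PosLT] at this; omega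

lemma MinViolationOutside.spec {a i j : ℕ} {D D' : Diagram} (h : MinViolationOutside a D i j)
    (hD : RowsSorted D) (hx : Exchange (i - 1) D D') : ExchangeSpec (i - 1) j D D' := by
  have hi := h.1.pos
  have e : i - 1 + 1 = i := by omega
  exact hx.spec hD (by rw [e]; exact h.1) (by rw [e]; exact h.first)

/-- The smallest violation stays the smallest, so an exchange made there is undone by the exchange
which the same rule prescribes for the result. -/
lemma MinViolationOutside.exchange {a i j : ℕ} {D D' : Diagram}
    (h : MinViolationOutside a D i j) (hD : RowsSorted D) (hx : Exchange (i - 1) D D') :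
    MinViolationOutside a D' i j := by
  have hi := h.1.pos
  have e : i - 1 + 1 = i := by omega
  have hs := h.spec hD hx
  refine ⟨by simpa [e] using hs.viol, h.2.1, fun k l hv hk hne => ?_⟩
  by_contra hcon
  have := (hs.violation_iff (by rw [e]; exact h.1) (by rw [e]; exact hcon)).1 hv
  exact hcon (h.2.2 k l this hk hne)

lemma violation_finite (D : Diagram) : {p : ℕ × ℕ | D.Violation p.1 p.2}.Finite := by
  refine Set.Finite.subset ((Finset.range D.length ×ˢ
    Finset.range (D.flatten.length + 1)).finite_toSet) ?_
  rintro ⟨i, j⟩ ⟨-, x, hx, -⟩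
  obtain ⟨v, hv, hx⟩ := Option.bind_eq_some_iff.1 hx
  have h1 := (List.getElem?_eq_some_iff.1 hv).1
  have h2 := (List.getElem?_eq_some_iff.1 hx).1
  have h3 : v.length ≤ D.flatten.length :=
    (List.sublist_flatten_of_mem (List.mem_of_getElem? hv)).length_le
  simp only [Finset.coe_product, Finset.coe_range, Set.mem_prod, Set.mem_Iio]
  omega

lemma exists_minViolationOutside {a i j : ℕ} {D : Diagram} (h : D.Violation i j) (hi : i ≠ a) :
    ∃ i' j', MinViolationOutside a D i' j' := by
  have hfin : {p : ℕ × ℕ | D.Violation p.1 p.2 ∧ p.1 ≠ a}.Finite :=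
    (violation_finite D).subset fun p hp => hp.1
  let key : ℕ × ℕ → Lex (ℤ × ℕ) := fun p => toLex ((p.2 : ℤ) - p.1, p.1)
  obtain ⟨⟨i', j'⟩, ⟨h1, h2⟩, h3⟩ := Set.exists_min_image _ key hfin ⟨(i, j), h, hi⟩
  refine ⟨i', j', h1, h2, fun k l hv hk hne => ?_⟩
  have := h3 (k, l) ⟨hv, hk⟩
  simp only [key, Prod.Lex.toLex_le_toLex] at this
  simp only [ne_eq, Prod.mk.injEq] at hne
  simp only [PosLT]
  omega

/-! ### Finite sets of diagrams -/

lemma finite_lists {α : Type*} {s : Set α} (hs : s.Finite) (N : ℕ) :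
    {l : List α | l.length ≤ N ∧ ∀ x ∈ l, x ∈ s}.Finite := by
  have : Finite s := hs
  refine Set.Finite.subset ((List.finite_length_le s N).image (List.map Subtype.val)) ?_
  rintro l ⟨h1, h2⟩
  exact ⟨l.attach.map fun x => ⟨x.1, h2 x.1 x.2⟩, by simpa using h1, by simp [Function.comp_def]⟩

lemma finite_diagrams {s : Set ℤ} (hs : s.Finite) (M N : ℕ) :
    {D : Diagram | D.length ≤ M ∧ D.flatten.length ≤ N ∧ ∀ x ∈ D.flatten, x ∈ s}.Finite := by
  refine Set.Finite.subset (finite_lists (finite_lists hs N) M) ?_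
  rintro D ⟨h1, h2, h3⟩
  exact ⟨h1, fun r hr => ⟨(List.sublist_flatten_of_mem hr).length_le.trans h2,
    fun x hx => h3 x (List.mem_flatten.2 ⟨r, hr, hx⟩)⟩⟩

lemma finite_diagrams_pl (M : ℕ) (m : Plactic) :
    {D : Diagram | D.length ≤ M ∧ pl (word D) = m}.Finite := by
  by_cases hne : ∃ D₀ : Diagram, pl (word D₀) = m
  · obtain ⟨D₀, rfl⟩ := hne
    refine (finite_diagrams (s := {x | x ∈ D₀.flatten}) (List.finite_toSet _) M
      D₀.flatten.length).subset ?_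
    rintro D ⟨h1, h2⟩
    have hp : D.flatten.Perm D₀.flatten :=
      (word_perm_flatten D).symm.trans ((perm_of_pl h2).trans (word_perm_flatten D₀))
    exact ⟨h1, hp.length_eq.le, fun x hx => hp.subset hx⟩
  · refine Set.Finite.subset Set.finite_empty ?_
    rintro D ⟨-, h⟩
    exact hne ⟨D, h⟩

/-- Following an injective relation on a finite set from an element without predecessor, one
arrives at a final element. -/
lemma exists_final {α : Type*} {r : α → α → Prop} {s : Set α} (hs : s.Finite) {final : α → Prop}
    (hstep : ∀ x ∈ s, final x ∨ ∃ y ∈ s, r x y)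
    (hinj : ∀ x ∈ s, ∀ y ∈ s, ∀ z ∈ s, r x z → r y z → x = y) {x₀ : α} (hx₀ : x₀ ∈ s)
    (hpred : ∀ x ∈ s, ¬ r x x₀) : ∃ y ∈ s, Relation.ReflTransGen r x₀ y ∧ final y := by
  classical
  by_contra hcon
  push Not at hcon
  have hnext : ∀ x : {x // x ∈ s ∧ Relation.ReflTransGen r x₀ x},
      ∃ y : {x // x ∈ s ∧ Relation.ReflTransGen r x₀ x}, r x.1 y.1 := by
    rintro ⟨x, hx, hr⟩
    rcases hstep x hx with h | ⟨y, hy, hxy⟩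
    · exact absurd h (hcon x hx hr)
    · exact ⟨⟨y, hy, hr.tail hxy⟩, hxy⟩
  choose f hf using hnext
  let g : ℕ → {x // x ∈ s ∧ Relation.ReflTransGen r x₀ x} :=
    fun k => f^[k] ⟨x₀, hx₀, Relation.ReflTransGen.refl⟩
  have hg : ∀ k, r (g k).1 (g (k + 1)).1 := by
    intro k
    simp only [g, Function.iterate_succ_apply']
    exact hf _
  have : Finite {x // x ∈ s ∧ Relation.ReflTransGen r x₀ x} :=
    (hs.subset fun x (hx : x ∈ s ∧ Relation.ReflTransGen r x₀ x) => hx.1)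
  -- A repetition in the infinite chain is traced back by injectivity to the starting point, which
  -- has no predecessor.
  obtain ⟨m, k, hne, heq⟩ := Finite.exists_ne_map_eq_of_infinite g
  have key : ∀ m d, g m = g (m + (d + 1)) → False := by
    intro m
    induction m with
    | zero =>
      intro d h
      have h1 := hg d
      rw [Nat.zero_add] at h
      rw [← h] at h1
      exact hpred _ (g d).2.1 h1
    | succ m ih =>
      intro d h
      refine ih d (Subtype.ext (hinj _ (g m).2.1 _ (g _).2.1 _ (g (m + 1)).2.1 (hg m) ?_))
      rw [h]
      have := hg (m + (d + 1))
      rwa [show m + (d + 1) + 1 = m + 1 + (d + 1) by ring] at this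
  rcases lt_or_gt_of_ne hne with h | h
  · exact key m (k - m - 1) (by rw [heq]; congr 1; omega)
  · exact key k (m - k - 1) (by rw [← heq]; congr 1; omega)

/-! ### Fomin's algorithm -/

/-- One round of Fomin's algorithm, starting with the exchange at the smallest violation outside
row `a`. -/
def FominStep (a : ℕ) (E E' : Diagram) : Prop :=
  ∃ i j M, MinViolationOutside a E i j ∧ Exchange (i - 1) E M ∧ Exchange (a - 1) M E'

/-- A run regrouped as one exchange at row `a` followed by rounds. This form allows a run to be
reversed and termination to be proved. -/
lemma fominRun_iff {a : ℕ} {D D' : Diagram} : FominRun a D D' ↔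
    ∃ E, Exchange (a - 1) D E ∧ Relation.ReflTransGen (FominStep a) E D' ∧
      ∀ i j, D'.Violation i j → i = a := by
  constructor
  · intro h
    induction h with
    | last D D' h1 h2 => exact ⟨D', h1, Relation.ReflTransGen.refl, h2⟩
    | next D D₁ D₂ D' i j h1 h2 h3 _ ih =>
      obtain ⟨E, h4, h5, h6⟩ := ih
      exact ⟨D₁, h1, Relation.ReflTransGen.head ⟨i, j, D₂, h2, h3, h4⟩ h5, h6⟩
  · rintro ⟨E, h1, h2, h3⟩
    induction h2 using Relation.ReflTransGen.head_induction_on generalizing D with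
    | refl => exact FominRun.last _ _ h1 h3
    | head h4 _ ih =>
      obtain ⟨i, j, M, h5, h6, h7⟩ := h4
      exact FominRun.next _ _ _ _ i j h1 h5 h6 (ih h7)

lemma Exchange.sorted {D D' : Diagram} {i : ℕ} (h : Exchange i D D') (hD : RowsSorted D) :
    RowsSorted D' := by
  obtain ⟨j, -, hs⟩ := h.exists_spec hD
  exact hs.sorted

lemma Exchange.symm {D D' : Diagram} {i : ℕ} (h : Exchange i D D') (hD : RowsSorted D) :
    Exchange i D' D := by
  obtain ⟨j, -, hs⟩ := h.exists_spec hD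
  exact hs.symm

/-- Properties which are preserved by exchange operations are preserved by Fomin's algorithm. -/
lemma FominRun.preserves {a : ℕ} {D D' : Diagram} (h : FominRun a D D') {p : Diagram → Prop}
    (hp : ∀ i D D', RowsSorted D → Exchange i D D' → p D → p D') (hD : RowsSorted D) (h0 : p D) :
    RowsSorted D' ∧ p D' := by
  induction h with
  | last D D' h1 _ => exact ⟨h1.sorted hD, hp _ _ _ hD h1 h0⟩
  | next D D₁ D₂ D' i j h1 _ h3 _ ih =>
    have s1 := h1.sorted hD
    exact ih (h3.sorted s1) (hp _ _ _ s1 h3 (hp _ _ _ hD h1 h0))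

lemma FominRun.unique {a : ℕ} {D D₁ D₂ : Diagram} (hD : RowsSorted D) (h₁ : FominRun a D D₁)
    (h₂ : FominRun a D D₂) : D₁ = D₂ := by
  induction h₁ with
  | last D D' h1 h2 =>
    cases h₂ with
    | last _ _ h3 h4 => exact h1.unique hD h3
    | next _ E₁ E₂ _ i j h3 h4 h5 h6 =>
      rw [h1.unique hD h3] at h2
      exact absurd (h2 i j h4.1) h4.2.1
  | next D E₁ E₂ D' i j h1 h2 h3 _ ih =>
    cases h₂ with
    | last _ _ h4 h5 =>
      rw [← h1.unique hD h4] at h5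
      exact absurd (h5 i j h2.1) h2.2.1
    | next _ F₁ F₂ _ i' j' h4 h5 h6 h7 =>
      obtain rfl := h1.unique hD h4
      have := h2.unique h5
      simp only [Prod.mk.injEq] at this
      obtain ⟨rfl, rfl⟩ := this
      have s1 := h1.sorted hD
      obtain rfl := h3.unique s1 h6
      exact ih (h3.sorted s1) h7

/-- A run alternates between exchanges at row `a` and exchanges at smallest violations outside it,
beginning and ending with the former. Every exchange is reversible and the smallest violation is the
same before and after, so the run can be read backwards; `hv` lets it stop at `D`. -/
lemma FominRun.symm {a : ℕ} {D D' : Diagram} (hD : RowsSorted D) (h : FominRun a D D')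
    (hv : ∀ i j, D.Violation i j → i = a) : FominRun a D' D := by
  obtain ⟨E, h1, h2, -⟩ := fominRun_iff.1 h
  refine fominRun_iff.2 ?_
  have key : ∃ N, Exchange (a - 1) D' N ∧ Relation.ReflTransGen (FominStep a) N D := by
    clear h hv
    induction h2 using Relation.ReflTransGen.head_induction_on generalizing D with
    | refl => exact ⟨D, h1.symm hD, Relation.ReflTransGen.refl⟩
    | @head E E' h4 _ ih =>
      obtain ⟨i, j, M, h5, h6, h7⟩ := h4
      have sE := h1.sorted hD
      obtain ⟨N, h8, h9⟩ := ih (h6.sorted sE) h7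
      exact ⟨N, h8, h9.tail ⟨i, j, E, h5.exchange sE h6, h6.symm sE, h1.symm hD⟩⟩
  obtain ⟨N, h3, h4⟩ := key
  exact ⟨N, h3, h4, hv⟩

/-- `(a, j)` is the smallest violation. -/
def MinViolation (a j : ℕ) (D : Diagram) : Prop :=
  D.Violation a j ∧ ∀ k l, D.Violation k l → (k, l) ≠ (a, j) → PosLT a j k l

lemma MinViolation.exchange {a j : ℕ} {D D' : Diagram} (h : MinViolation a j D)
    (hD : RowsSorted D) (hx : Exchange (a - 1) D D') : MinViolation a j D' := by
  have hi := h.1.pos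
  have e : a - 1 + 1 = a := by omega
  have hs : ExchangeSpec (a - 1) j D D' := by
    refine hx.spec hD (by rw [e]; exact h.1) fun k hk hv => ?_
    rw [e] at hv
    have := h.2 a k hv (by simp; omega)
    simp only [PosLT] at this; omega
  refine ⟨by simpa [e] using hs.viol, fun k l hv hne => ?_⟩
  by_contra hcon
  have := (hs.violation_iff (by rw [e]; exact h.1) (by rw [e]; exact hcon)).1 hv
  exact hcon (h.2 k l this hne)

/-- An exchange at a later violation does not disturb the smallest one, in row `a`. So row `a`
always has a violation, and the next exchange there is possible. -/
lemma MinViolation.exchange_outside {a j i k : ℕ} {D D' : Diagram} (h : MinViolation a j D)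
    (hD : RowsSorted D) (hm : MinViolationOutside a D i k) (hx : Exchange (i - 1) D D') :
    MinViolation a j D' := by
  have hi := hm.1.pos
  have e : i - 1 + 1 = i := by omega
  have hs := hm.spec hD hx
  have hlt : PosLT a j i k := h.2 i k hm.1 (by simp [hm.2.1])
  have hiff := fun {k' l' : ℕ} (hc : ¬ PosLT i k k' l') =>
    hs.violation_iff (k := k') (l := l') (by rw [e]; exact hm.1) (by rw [e]; exact hc)
  refine ⟨(hiff hlt.asymm).2 h.1, fun k' l' hv hne => ?_⟩
  by_contra hcon
  have := (hiff fun hc => hcon (hlt.trans hc)).1 hv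
  exact hcon (h.2 k' l' this hne)

/-- Termination: the diagrams met lie in a finite set, since the plactic class and a bound for the
number of rows are kept, and a round is injective. The first diagram `E₀` has no predecessor,
because undoing the exchange at row `a` leads back to `D`, which has no violation outside that row.
-/
lemma fominRun_exists {a : ℕ} {D : Diagram} (hD : RowsSorted D)
    (hv : ∀ i j, D.Violation i j → i = a) (hne : ∃ i j, D.Violation i j) :
    ∃ D', FominRun a D D' := by
  obtain ⟨i, j, hij⟩ := hne
  obtain rfl := hv i j hij
  obtain ⟨j₀, -, hj₀, hfirst⟩ := exists_first_violation hij
  have ha := hij.pos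
  have e : i - 1 + 1 = i := by omega
  have hmin : MinViolation i j₀ D := by
    refine ⟨hj₀, fun k l hkl hne => ?_⟩
    obtain rfl := hv k l hkl
    have : ¬ l < j₀ := fun hl => hfirst l hl hkl
    simp only [ne_eq, Prod.mk.injEq, true_and] at hne
    simp only [PosLT]; omega
  obtain ⟨E₀, hE₀⟩ := exchange_exists (i := i - 1) (j := j₀) hD (by rw [e]; exact hj₀)
  let s : Set Diagram := {E | (E.length ≤ D.length ∧ pl (word E) = pl (word D)) ∧
    RowsSorted E ∧ MinViolation i j₀ E}
  have hs : s.Finite := (finite_diagrams_pl D.length (pl (word D))).subset fun E hE => hE.1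
  have hE₀s : E₀ ∈ s := by
    obtain ⟨_, -, h1⟩ := hE₀.exists_spec hD
    exact ⟨⟨h1.length_eq.le, h1.pl_eq⟩, h1.sorted, hmin.exchange hD hE₀⟩
  have hstep : ∀ x ∈ s, (∀ k l, x.Violation k l → k = i) ∨ ∃ y ∈ s, FominStep i x y := by
    rintro x ⟨⟨x1, x2⟩, x3, x4⟩
    by_cases hc : ∀ k l, x.Violation k l → k = i
    · exact Or.inl hc
    · right
      push Not at hc
      obtain ⟨k, l, hkl, hki⟩ := hc
      obtain ⟨k', l', hm⟩ := exists_minViolationOutside hkl hki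
      have e' : k' - 1 + 1 = k' := by have := hm.1.pos; omega
      obtain ⟨M, hM⟩ := exchange_exists (i := k' - 1) (j := l') x3 (by rw [e']; exact hm.1)
      have hMs := hm.spec x3 hM
      have hMm := x4.exchange_outside x3 hm hM
      obtain ⟨E', hE'⟩ := exchange_exists (i := i - 1) (j := j₀) hMs.sorted
        (by rw [e]; exact hMm.1)
      obtain ⟨_, -, h1⟩ := hE'.exists_spec hMs.sorted
      exact ⟨E', ⟨⟨by rw [h1.length_eq, hMs.length_eq]; exact x1,
        by rw [h1.pl_eq, hMs.pl_eq, x2]⟩, h1.sorted, hMm.exchange hMs.sorted hE'⟩,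
        k', l', M, hm, hM, hE'⟩
  have hback : ∀ x ∈ s, ∀ z ∈ s, FominStep i x z → ∃ k l M, MinViolationOutside i M k l ∧
      Exchange (k - 1) M x ∧ Exchange (i - 1) z M ∧ RowsSorted M := by
    rintro x ⟨-, x3, -⟩ z - ⟨k, l, M, h1, h2, h3⟩
    have sM := h2.sorted x3
    exact ⟨k, l, M, h1.exchange x3 h2, h2.symm x3, h3.symm sM, sM⟩
  have hinj : ∀ x ∈ s, ∀ y ∈ s, ∀ z ∈ s, FominStep i x z → FominStep i y z → x = y := by
    intro x hx y hy z hz hxz hyz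
    obtain ⟨k, l, M, h1, h2, h3, h4⟩ := hback x hx z hz hxz
    obtain ⟨k', l', M', h1', h2', h3', h4'⟩ := hback y hy z hz hyz
    obtain rfl := h3.unique hz.2.1 h3'
    have := h1.unique h1'
    simp only [Prod.mk.injEq] at this
    obtain ⟨rfl, rfl⟩ := this
    exact h2.unique h4 h2'
  have hpred : ∀ x ∈ s, ¬ FominStep i x E₀ := by
    intro x hx hxE
    obtain ⟨k, l, M, h1, h2, h3, h4⟩ := hback x hx E₀ hE₀s hxE
    obtain rfl := h3.unique hE₀s.2.1 (hE₀.symm hD)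
    exact h1.2.1 (hv k l h1.1)
  obtain ⟨y, hy, hr, hf⟩ := exists_final (r := FominStep i) hs
    (final := fun x => ∀ k l, x.Violation k l → k = i) hstep hinj hE₀s hpred
  exact ⟨y, fominRun_iff.2 ⟨E₀, hE₀, hr, hf⟩⟩

/-! ### The sign -/

lemma schur_eq_det {I : List ℤ} {N : ℕ} (h : I.length = N) :
    schur I = Matrix.det (Matrix.of fun i j : Fin N => hSym (I.getD i 0 + (j : ℤ) - (i : ℤ))) := by
  subst h
  rw [schur]
  congr 1
  ext i j
  simp

/-- Moving a row of the determinant down by one place amounts to increasing its entry of the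
sequence by one; the two determinants differ by a transposition of neighbouring rows. -/
lemma schur_exchange (A B : List ℤ) (p q : ℤ) :
    schur (A ++ (q - 1) :: (p + 1) :: B) = - schur (A ++ p :: q :: B) := by
  set N := (A ++ p :: q :: B).length with hN
  have hlt : A.length + 1 < N := by simp [hN]
  let i₀ : Fin N := ⟨A.length, by omega⟩
  let i₁ : Fin N := ⟨A.length + 1, hlt⟩
  have hne : i₀ ≠ i₁ := by simp [i₀, i₁]
  rw [schur_eq_det (N := N) (by simp [hN]), schur_eq_det (I := A ++ p :: q :: B) (N := N) rfl]
  have hsw := Matrix.det_permute (Equiv.swap i₀ i₁) (Matrix.of fun i j : Fin N =>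
    hSym ((A ++ p :: q :: B).getD i 0 + (j : ℤ) - (i : ℤ)))
  rw [Equiv.Perm.sign_swap hne] at hsw
  simp only [Units.val_neg, Units.val_one, Int.cast_neg, Int.cast_one, neg_mul, one_mul] at hsw
  rw [← hsw]
  refine congrArg Matrix.det (Matrix.ext fun i j => ?_)
  simp only [Matrix.of_apply, Matrix.submatrix_apply, id_eq]
  congr 1
  by_cases h0 : i = i₀
  · subst h0
    simp [i₀, i₁]; ring
  · by_cases h1 : i = i₁
    · subst h1
      simp [i₀, i₁]; ring
    · rw [Equiv.swap_apply_of_ne_of_ne h0 h1]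
      have h0' : (i : ℕ) ≠ A.length := fun h => h0 (Fin.ext h)
      have h1' : (i : ℕ) ≠ A.length + 1 := fun h => h1 (Fin.ext h)
      congr 2
      simp only [List.getD_eq_getElem?_getD]
      rcases lt_or_ge (i : ℕ) A.length with h | h
      · rw [List.getElem?_append_left h, List.getElem?_append_left h]
      · obtain ⟨m, hm⟩ : ∃ m, (i : ℕ) = A.length + (m + 2) := ⟨i - A.length - 2, by omega⟩
        rw [List.getElem?_append_right (by omega), List.getElem?_append_right (by omega), hm]
        simp

/-- The row lengths, shifted by `b`. -/
def lens (b : ℕ) (D : Diagram) : List ℤ := D.map fun r => (b : ℤ) + r.length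

/-- The shift `b` stands for `b` columns to the left of `D`, and `I` for further rows below; neither
takes part in the exchange. -/
lemma Exchange.schur_lens {D D' : Diagram} {i : ℕ} (h : Exchange i D D') (b : ℕ) (I : List ℤ) :
    schur (lens b D' ++ I) = - schur (lens b D ++ I) := by
  obtain ⟨-, A, B, u, v, u', v', -, rfl, rfl, -, -, h1, h2, -⟩ := h
  have e1 : (b : ℤ) + (u'.length : ℤ) = b + v.length - 1 := by omega
  have e2 : (b : ℤ) + (v'.length : ℤ) = b + u.length + 1 := by omega
  simp only [lens, List.map_append, List.map_cons, e1, e2, List.append_assoc, List.cons_append]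
  exact schur_exchange _ _ _ _

/-- A run consists of an odd number of exchanges. -/
lemma FominRun.schur_lens {a : ℕ} {D D' : Diagram} (h : FominRun a D D') (b : ℕ) (I : List ℤ) :
    schur (lens b D' ++ I) = - schur (lens b D ++ I) := by
  induction h with
  | last D D' h1 _ => exact h1.schur_lens b I
  | next D D₁ D₂ D' i j h1 _ h3 _ ih => rw [ih, h3.schur_lens, h1.schur_lens]; ring

/-! ### The Littlewood-Richardson rule via the plactic ring -/

/-! ### Symmetric functions in the plactic ring -/

lemma rows_finite (S : Finset ℤ) (k : ℤ) :
    {r : List ℤ | (r.length : ℤ) = k ∧ Sorted r ∧ ∀ x ∈ r, x ∈ S}.Finite := by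
  refine (finite_lists S.finite_toSet k.toNat).subset ?_
  rintro r ⟨h1, -, h3⟩
  exact ⟨by omega, h3⟩

/-- The weakly increasing rows of length `k` with entries in `S`. -/
noncomputable def rowsF (S : Finset ℤ) (k : ℤ) : Finset (List ℤ) := (rows_finite S k).toFinset

@[simp] lemma mem_rowsF {S : Finset ℤ} {k : ℤ} {r : List ℤ} :
    r ∈ rowsF S k ↔ (r.length : ℤ) = k ∧ Sorted r ∧ ∀ x ∈ r, x ∈ S := by simp [rowsF]

/-- The ring of the plactic monoid. -/
abbrev PlacticRing : Type := MonoidAlgebra ℤ Plactic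

/-- The sum of all weakly increasing rows of length `k` with entries in `S`. -/
noncomputable def placticH (S : Finset ℤ) (k : ℤ) : PlacticRing :=
  ∑ r ∈ rowsF S k, MonoidAlgebra.single (pl r) 1

lemma placticH_mul (S : Finset ℤ) (j k : ℤ) : placticH S j * placticH S k =
    ∑ p ∈ rowsF S j ×ˢ rowsF S k, MonoidAlgebra.single (pl p.1 * pl p.2) 1 := by
  rw [placticH, placticH, Finset.sum_mul_sum, ← Finset.sum_product']
  simp [MonoidAlgebra.single_mul_single]

/-- By `rows_unique` both sides are sums of distinct elements, and `exists_swap` matches the pairs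
of rows with equal product. -/
lemma placticH_comm (S : Finset ℤ) (j k : ℤ) :
    placticH S j * placticH S k = placticH S k * placticH S j := by
  have hex : ∀ j k : ℤ, ∀ p ∈ rowsF S j ×ˢ rowsF S k, ∃ q ∈ rowsF S k ×ˢ rowsF S j,
      pl q.1 * pl q.2 = pl p.1 * pl p.2 := by
    rintro j k ⟨v, u⟩ hp
    simp only [Finset.mem_product, mem_rowsF] at hp
    obtain ⟨⟨h1, h2, h3⟩, h4, h5, h6⟩ := hp
    obtain ⟨v', u', s1, s2, l1, l2, e⟩ := exists_swap h2 h5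
    refine ⟨(v', u'), ?_, e⟩
    have hperm : (v' ++ u').Perm (v ++ u) := perm_of_pl (by rw [pl_append, pl_append, e])
    have hmem : ∀ x ∈ v' ++ u', x ∈ S := by
      intro x hx
      rcases List.mem_append.1 (hperm.subset hx) with h | h
      · exact h3 x h
      · exact h6 x h
    simp only [Finset.mem_product, mem_rowsF]
    exact ⟨⟨by omega, s1, fun x hx => hmem x (by simp [hx])⟩, by omega, s2,
      fun x hx => hmem x (by simp [hx])⟩
  have huniq : ∀ j k : ℤ, ∀ p ∈ rowsF S j ×ˢ rowsF S k, ∀ q ∈ rowsF S j ×ˢ rowsF S k,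
      pl p.1 * pl p.2 = pl q.1 * pl q.2 → p = q := by
    rintro j k ⟨v, u⟩ hp ⟨v', u'⟩ hq h
    simp only [Finset.mem_product, mem_rowsF] at hp hq
    obtain ⟨h1, h2⟩ := rows_unique hp.1.2.1 hq.1.2.1 hp.2.2.1 hq.2.2.1 (by omega) (by omega) h
    exact Prod.ext h1 h2
  rw [placticH_mul, placticH_mul]
  choose! f hf using hex j k
  refine Finset.sum_bij (fun p _ => f p) (fun p hp => (hf p hp).1) (fun p hp q hq h => ?_)
    (fun q hq => ?_) fun p hp => by rw [(hf p hp).2]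
  · exact huniq j k p hp q hq (by rw [← (hf p hp).2, ← (hf q hq).2, h])
  · obtain ⟨p, hp, e⟩ := hex k j q hq
    exact ⟨p, hp, huniq k j _ (hf p hp).1 q hq (by rw [(hf p hp).2, e])⟩

/-- The commutative subring of the plactic ring generated by the sums of rows. -/
noncomputable abbrev hRing (S : Finset ℤ) : Subring PlacticRing :=
  Subring.closure (Set.range (placticH S))

instance (S : Finset ℤ) : IsMulCommutative (hRing S) :=
  Subring.isMulCommutative_closure (by
    rintro _ ⟨j, rfl⟩ _ ⟨k, rfl⟩
    exact placticH_comm S j k)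

open scoped IsMulCommutative in
/-- The homomorphism from the ring of symmetric functions to the plactic ring which maps `h_k` to
the sum of all rows of length `k` with entries in `S`. -/
noncomputable def toPlactic (S : Finset ℤ) : Lam →+* PlacticRing :=
  (hRing S).subtype.comp (MvPolynomial.eval₂Hom (Int.castRingHom (hRing S)) fun i : ℕ =>
    ⟨placticH S (i + 1), Subring.subset_closure ⟨_, rfl⟩⟩)

lemma toPlactic_hSym (S : Finset ℤ) (k : ℤ) : toPlactic S (hSym k) = placticH S k := by
  rw [hSym]
  split_ifs with h0 h1
  · rw [map_zero, placticH, Finset.sum_eq_zero]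
    intro r hr
    rw [mem_rowsF] at hr
    omega
  · subst h1
    have : rowsF S 0 = {[]} := by
      ext r
      simp only [mem_rowsF, Finset.mem_singleton]
      constructor
      · rintro ⟨h, -⟩
        exact List.length_eq_zero_iff.1 (by omega)
      · rintro rfl; simp
    rw [map_one, placticH, this, Finset.sum_singleton]
    rfl
  · have e : ((k.toNat - 1 : ℕ) : ℤ) + 1 = k := by omega
    simp [toPlactic, e]

/-- The diagrams with weakly increasing rows of the given lengths and entries in `S`. -/
noncomputable def diagF (S : Finset ℤ) : List ℤ → Finset Diagram
  | [] => {[]}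
  | k :: L => (rowsF S k ×ˢ diagF S L).image fun p => p.1 :: p.2

lemma mem_diagF {S : Finset ℤ} {L : List ℤ} {D : Diagram} : D ∈ diagF S L ↔
    D.map (fun r => (r.length : ℤ)) = L ∧ RowsSorted D ∧ ∀ x ∈ D.flatten, x ∈ S := by
  induction L generalizing D with
  | nil =>
    simp only [diagF, Finset.mem_singleton, List.map_eq_nil_iff]
    constructor
    · rintro rfl; simp [RowsSorted]
    · exact fun h => h.1
  | cons k L ih =>
    rcases D with _ | ⟨r, D⟩
    · simp [diagF]
    · simp only [diagF, Finset.mem_image, Finset.mem_product, List.cons.injEq, Prod.exists, ih, mem_rowsF, List.map_cons, RowsSorted, List.mem_cons,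
        forall_eq_or_imp, List.flatten_cons, List.mem_append]
      constructor
      · rintro ⟨r', D', ⟨⟨h1, h2, h3⟩, h4, h5, h6⟩, rfl, rfl⟩
        exact ⟨⟨h1, h4⟩, ⟨h2, h5⟩, fun x hx => hx.elim (h3 x) (h6 x)⟩
      · rintro ⟨⟨h1, h4⟩, ⟨h2, h5⟩, h⟩
        exact ⟨r, D, ⟨⟨h1, h2, fun x hx => h x (Or.inl hx)⟩, h4, h5, fun x hx => h x (Or.inr hx)⟩,
          rfl, rfl⟩

/-- The factors are reversed because reading words begin with the bottom row. -/
lemma placticH_prod (S : Finset ℤ) (L : List ℤ) : (L.reverse.map (placticH S)).prod =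
    ∑ D ∈ diagF S L, MonoidAlgebra.single (pl (word D)) 1 := by
  induction L with
  | nil => simp [diagF]; rfl
  | cons k L ih =>
    rw [List.reverse_cons, List.map_append, List.prod_append, ih, diagF, Finset.sum_image
      fun p _ q _ h => by simpa [Prod.ext_iff] using h, Finset.sum_product_right, List.map_singleton, List.prod_singleton, placticH,
      Finset.sum_mul_sum]
    simp [MonoidAlgebra.single_mul_single, pl_append]

/-! ### Schur functions as sums of tableaux -/

/-- The row lengths which belong to a permutation in the expansion of the determinant `s_I`. -/
def permLens (I : List ℤ) (π : Equiv.Perm (Fin I.length)) : List ℤ :=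
  List.ofFn fun i : Fin I.length => I.get (π i) + (i : ℤ) - (π i : ℤ)

lemma toPlactic_schur (S : Finset ℤ) (I : List ℤ) : toPlactic S (schur I) =
    ∑ π : Equiv.Perm (Fin I.length), ∑ D ∈ diagF S (permLens I π),
      Equiv.Perm.sign π • (MonoidAlgebra.single (pl (word D)) 1 : PlacticRing) := by
  rw [schur, Matrix.det_apply, map_sum]
  refine Finset.sum_congr rfl fun π _ => ?_
  rw [← Finset.smul_sum, ← placticH_prod, Units.smul_def, Units.smul_def, map_zsmul]
  congr 1
  simp only [Matrix.of_apply]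
  rw [← List.prod_ofFn, ← (List.reverse_perm _).prod_eq, map_list_prod, permLens,
    List.map_reverse, List.map_reverse, List.map_ofFn, List.map_ofFn]
  congr 3
  funext i
  simp [toPlactic_hSym]

/-- The row `i` above the smallest violation of `D`, and the result `D'` of the exchange of this
row with the next one. -/
def Partner (D : Diagram) (i : ℕ) (D' : Diagram) : Prop :=
  (∃ j, MinViolationOutside 0 D (i + 1) j) ∧ Exchange i D D'

lemma Partner.symm {D D' : Diagram} {i : ℕ} (hD : RowsSorted D) (h : Partner D i D') :
    Partner D' i D := by
  obtain ⟨⟨j, hj⟩, hx⟩ := h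
  exact ⟨⟨j, hj.exchange hD hx⟩, hx.symm hD⟩

lemma Partner.unique {D D₁ D₂ : Diagram} {i₁ i₂ : ℕ} (hD : RowsSorted D) (h₁ : Partner D i₁ D₁)
    (h₂ : Partner D i₂ D₂) : i₁ = i₂ ∧ D₁ = D₂ := by
  obtain ⟨⟨j, hj⟩, hx⟩ := h₁
  obtain ⟨⟨j', hj'⟩, hx'⟩ := h₂
  have := hj.unique hj'
  simp only [Prod.mk.injEq, Nat.add_right_cancel_iff] at this
  obtain ⟨rfl, -⟩ := this
  exact ⟨rfl, hx.unique hD hx'⟩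

/-- Row `0` contains no violation, so `MinViolationOutside 0` selects the smallest violation of all.
-/
lemma exists_partner {D : Diagram} (hD : RowsSorted D) (h : ¬ SS D) : ∃ i D', Partner D i D' := by
  rw [← semistandard_iff, Diagram.Semistandard] at h
  push Not at h
  obtain ⟨i, j, hij⟩ := h hD
  obtain ⟨i', j', hm⟩ := exists_minViolationOutside hij (a := 0) (by have := hij.pos; omega)
  have e : i' - 1 + 1 = i' := by have := hm.1.pos; omega
  obtain ⟨D', hD'⟩ := exchange_exists (i := i' - 1) hD (by rw [e]; exact hm.1)
  exact ⟨i' - 1, D', ⟨j', by rw [e]; exact hm⟩, hD'⟩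

lemma Partner.not_ss {D D' : Diagram} {i : ℕ} (h : Partner D i D') : ¬ SS D := by
  rw [← semistandard_iff]
  obtain ⟨⟨j, hj⟩, -⟩ := h
  exact fun hs => hs.2 _ _ hj.1

/-- Replacing the row lengths `p, q` by `q - 1, p + 1` is what a transposition of neighbours does to
the row lengths belonging to a permutation. -/
lemma Partner.lens {I : List ℤ} {D D' : Diagram} {i : ℕ} (h : Partner D i D')
    {π : Equiv.Perm (Fin I.length)} (hD : D.map (fun r => (r.length : ℤ)) = permLens I π) :
    ∃ hi : i + 1 < I.length, D'.map (fun r => (r.length : ℤ)) =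
      permLens I (π * Equiv.swap ⟨i, by omega⟩ ⟨i + 1, hi⟩) := by
  obtain ⟨-, -, A, B, u, v, u', v', rfl, rfl, rfl, -, -, h1, h2, -⟩ := h
  have hlen := congrArg List.length hD
  simp only [permLens, List.length_map, List.length_append, List.length_cons,
    List.length_ofFn] at hlen
  have hi : A.length + 1 < I.length := by omega
  refine ⟨hi, List.ext_getElem ?_ fun k hk hk' => ?_⟩
  · simp [permLens]; omega
  have hget : ∀ (k : ℕ) (hk : k < I.length),
      (((A ++ u :: v :: B).map (fun r => (r.length : ℤ)))[k]'(by simp; omega)) =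
        I.get (π ⟨k, hk⟩) + (k : ℤ) - (π ⟨k, hk⟩ : ℤ) := by
    intro k hk
    rw [List.getElem_of_eq hD]
    simp [permLens]
  have hk'' : k < I.length := by simpa [permLens] using hk'
  have hu := hget A.length (by omega)
  have hv := hget (A.length + 1) hi
  simp only [List.map_append, List.map_cons, List.getElem_append_right, List.length_map,
    Nat.le_refl, le_add_iff_nonneg_right, zero_le, Nat.sub_self, List.getElem_cons_zero,
    Nat.add_sub_cancel_left, List.getElem_cons_succ] at hu hv
  simp only [permLens, List.getElem_ofFn, Equiv.Perm.mul_apply]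
  by_cases e0 : k = A.length
  · subst e0
    rw [Equiv.swap_apply_left]
    simp
    simp at hv
    omega
  by_cases e1 : k = A.length + 1
  · subst e1
    rw [Equiv.swap_apply_right]
    simp
    simp at hu
    omega
  rw [Equiv.swap_apply_of_ne_of_ne (by simpa [Fin.ext_iff] using e0)
    (by simpa [Fin.ext_iff] using e1), ← hget k hk'']
  have := getElem?_rows_ne (B := B) (u := u) (v := v) (u' := u') (v' := v') e0 e1
  simp only [List.getElem_map]
  rw [List.getElem?_eq_getElem (by simpa using (by omega)),
    List.getElem?_eq_getElem (by simpa using (by omega)), Option.some.injEq] at this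
  rw [this]

/-- The shape of a diagram with a violation-free filling belongs to the identity permutation. -/
lemma perm_eq_one_of_ss {I : List ℤ} (hI : I.Pairwise (· ≥ ·)) {π : Equiv.Perm (Fin I.length)}
    {D : Diagram} (hD : D.map (fun r => (r.length : ℤ)) = permLens I π) (hs : SS D) : π = 1 := by
  have hanti : Antitone I.get := hI.sortedGE.antitone_get
  let f : Fin I.length → ℤ := fun i => I.get i - (i : ℤ)
  have hf : StrictAnti f := by
    intro i j hij
    have h1 := hanti hij.le
    have h2 : (i : ℕ) < j := hij
    simp only [f]; omega
  have hdec : (permLens I π).Pairwise (· ≥ ·) := by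
    rw [← hD]
    clear hD hf hanti hI
    induction D with
    | nil => simp
    | cons r D ih =>
      obtain ⟨-, h2, h3⟩ := hs
      have hl := h2.length_le
      rw [List.map_cons, List.pairwise_cons]
      refine ⟨?_, ih h3⟩
      have ih := ih h3
      rcases D with _ | ⟨s, D⟩
      · simp
      · rw [List.map_cons, List.pairwise_cons] at ih
        simp at hl
        intro x hx
        rw [List.map_cons, List.mem_cons] at hx
        rcases hx with rfl | hx
        · simpa using hl
        · have := ih.1 x hx; simp at this ⊢; omega
  have hmono : StrictMono π := by
    intro i j hij
    rw [permLens, List.pairwise_ofFn] at hdec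
    have := hdec hij
    have h2 : (i : ℕ) < j := hij
    have hlt : f (π j) < f (π i) := by simp only [f]; omega
    exact hf.lt_iff_gt.1 hlt
  ext i
  have := (Subsingleton.elim (hmono.orderIsoOfSurjective π π.surjective) (OrderIso.refl _))
  have h2 := congrArg (fun e : Fin I.length ≃o Fin I.length => e i) this
  simpa using congrArg Fin.val h2

-- Fillings with a violation cancel: the exchange at the smallest violation preserves the plactic
-- class, multiplies the permutation by a transposition, and is an involution. The fillings that
-- remain are semistandard and occur only for the identity permutation.
open Classical in
lemma toPlactic_schur_partition (S : Finset ℤ) {I : List ℤ} (hI : I.Pairwise (· ≥ ·)) :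
    toPlactic S (schur I) =
      ∑ D ∈ (diagF S I).filter SS, MonoidAlgebra.single (pl (word D)) 1 := by
  have hone : permLens I 1 = I := by
    simp [permLens]
  rw [toPlactic_schur, Finset.sum_sigma', ← Finset.sum_filter_add_sum_filter_not _
    (fun p : (_ : Equiv.Perm (Fin I.length)) × Diagram => SS p.2)]
  have hcancel : ∑ p ∈ (Finset.univ.sigma fun π => diagF S (permLens I π)).filter
      (fun p : (_ : Equiv.Perm (Fin I.length)) × Diagram => ¬ SS p.2),
      Equiv.Perm.sign p.1 • (MonoidAlgebra.single (pl (word p.2)) 1 : PlacticRing) = 0 := by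
    have hex : ∀ p ∈ (Finset.univ.sigma fun π => diagF S (permLens I π)).filter
        (fun p : (_ : Equiv.Perm (Fin I.length)) × Diagram => ¬ SS p.2),
        ∃ q ∈ (Finset.univ.sigma fun π => diagF S (permLens I π)).filter
        (fun p : (_ : Equiv.Perm (Fin I.length)) × Diagram => ¬ SS p.2),
        ∃ i, ∃ hi : i + 1 < I.length, Partner p.2 i q.2 ∧
          q.1 = p.1 * Equiv.swap ⟨i, by omega⟩ ⟨i + 1, hi⟩ ∧ pl (word q.2) = pl (word p.2) := by
      rintro ⟨π, D⟩ hp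
      simp only [Finset.mem_filter, Finset.mem_sigma, Finset.mem_univ, true_and, mem_diagF] at hp
      obtain ⟨⟨h1, h2, h3⟩, h4⟩ := hp
      obtain ⟨i, D', hpar⟩ := exists_partner h2 h4
      obtain ⟨hi, hl⟩ := hpar.lens h1
      obtain ⟨j, -, hspec⟩ := hpar.2.exists_spec h2
      refine ⟨⟨_, D'⟩, ?_, i, hi, hpar, rfl, hspec.pl_eq⟩
      simp only [Finset.mem_filter, Finset.mem_sigma, Finset.mem_univ, true_and, mem_diagF]
      refine ⟨⟨hl, hspec.sorted, fun x hx => h3 x ?_⟩, (hpar.symm h2).not_ss⟩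
      exact ((word_perm_flatten D').symm.trans ((perm_of_pl hspec.pl_eq).trans
        (word_perm_flatten D))).subset hx
    have hsort : ∀ p ∈ (Finset.univ.sigma fun π => diagF S (permLens I π)).filter
        (fun p : (_ : Equiv.Perm (Fin I.length)) × Diagram => ¬ SS p.2), RowsSorted p.2 := by
      intro p hp
      simp only [Finset.mem_filter, Finset.mem_sigma, mem_diagF] at hp
      exact hp.1.2.2.1
    choose! g hg using hex
    refine Finset.sum_involution (fun p _ => g p) (fun p hp => ?_) (fun p hp _ => ?_)
      (fun p hp => (hg p hp).1) fun p hp => ?_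
    · obtain ⟨-, i, hi, -, h2, h3⟩ := hg p hp
      rw [h2, h3, Equiv.Perm.sign_mul, Equiv.Perm.sign_swap (by simp)]
      simp
    · obtain ⟨-, i, hi, -, h2, -⟩ := hg p hp
      intro h
      have := congrArg Sigma.fst h
      rw [h2, mul_eq_left] at this
      have := Equiv.swap_eq_one_iff.1 this
      simp at this
    · obtain ⟨hm, i, hi, h1, h2, -⟩ := hg p hp
      obtain ⟨-, i', hi', h1', h2', -⟩ := hg (g p) hm
      obtain ⟨rfl, h3⟩ := (h1.symm (hsort p hp)).unique (hsort _ hm) h1'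
      rw [h2, mul_assoc, Equiv.swap_mul_self, mul_one] at h2'
      exact Sigma.ext h2' (heq_of_eq h3.symm)
  rw [hcancel, add_zero]
  refine Finset.sum_bij (fun p _ => p.2) (fun p hp => ?_) (fun p hp q hq h => ?_) (fun D hD => ?_)
    fun p hp => ?_
  · simp only [Finset.mem_filter, Finset.mem_sigma, Finset.mem_univ, true_and] at hp
    obtain ⟨π, D⟩ := p
    obtain rfl := perm_eq_one_of_ss hI (mem_diagF.1 hp.1).1 hp.2
    rw [hone] at hp
    exact Finset.mem_filter.2 hp
  · simp only [Finset.mem_filter, Finset.mem_sigma, Finset.mem_univ, true_and] at hp hq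
    have e1 := perm_eq_one_of_ss hI (mem_diagF.1 hp.1).1 hp.2
    have e2 := perm_eq_one_of_ss hI (mem_diagF.1 hq.1).1 hq.2
    exact Sigma.ext (e1.trans e2.symm) (heq_of_eq h)
  · refine ⟨⟨1, D⟩, ?_, rfl⟩
    simp only [Finset.mem_filter, Finset.mem_sigma, Finset.mem_univ, true_and, hone]
    exact Finset.mem_filter.1 hD
  · simp only [Finset.mem_filter, Finset.mem_sigma, Finset.mem_univ, true_and] at hp
    rw [perm_eq_one_of_ss hI (mem_diagF.1 hp.1).1 hp.2]
    simp

/-! ### The Littlewood-Richardson rule -/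

lemma parts_pairwise (μ : YoungDiagram) : (parts μ).Pairwise (· ≥ ·) := by
  rw [parts, List.pairwise_map]
  exact μ.rowLens_sorted.pairwise.imp fun h => by exact_mod_cast h

lemma lens_eq_parts_iff {D : Diagram} {μ : YoungDiagram} :
    D.map (fun r => (r.length : ℤ)) = parts μ ↔ D.shape = μ.rowLens := by
  have : D.map (fun r => (r.length : ℤ)) = D.shape.map (fun k : ℕ => (k : ℤ)) := by
    simp [Diagram.shape, Function.comp_def]
  rw [this, parts]
  exact (List.map_injective_iff.2 Nat.cast_injective).eq_iff

lemma ne_nil_of_shape {D : Diagram} {μ : YoungDiagram} (h : D.shape = μ.rowLens) :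
    ∀ r ∈ D, r ≠ [] := by
  rintro r hr rfl
  have : ([] : List ℤ).length ∈ D.shape := List.mem_map_of_mem hr
  rw [h] at this
  simpa using μ.pos_of_mem_rowLens _ this

/-- The pairs of tableaux of given shapes with a given product. -/
def factorPairs (U : Diagram) (σ τ : YoungDiagram) : Set (Diagram × Diagram) :=
  {p | Tab p.1 ∧ Tab p.2 ∧ tmul p.1 p.2 = U ∧ p.1.shape = σ.rowLens ∧ p.2.shape = τ.rowLens}

open Classical in
/-- The tableaux of a given shape with entries in `S`. -/
noncomputable def tabF (S : Finset ℤ) (μ : YoungDiagram) : Finset Diagram :=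
  (diagF S (parts μ)).filter SS

open Classical in
lemma mem_tabF {S : Finset ℤ} {μ : YoungDiagram} {D : Diagram} : D ∈ tabF S μ ↔
    Tab D ∧ D.shape = μ.rowLens ∧ ∀ x ∈ D.flatten, x ∈ S := by
  rw [tabF, Finset.mem_filter, mem_diagF, lens_eq_parts_iff]
  constructor
  · rintro ⟨⟨h1, h2, h3⟩, h4⟩
    exact ⟨⟨h4, ne_nil_of_shape h1⟩, h1, h3⟩
  · rintro ⟨h1, h2, h3⟩
    exact ⟨⟨h2, h1.rowsSorted, h3⟩, h1.1⟩

lemma toPlactic_schur_parts (S : Finset ℤ) (μ : YoungDiagram) :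
    toPlactic S (schur (parts μ)) = ∑ D ∈ tabF S μ, MonoidAlgebra.single (pl (word D)) 1 :=
  toPlactic_schur_partition S (parts_pairwise μ)

/-- The Littlewood-Richardson rule. -/
lemma lrCoeff_eq {U : Diagram} {μ : YoungDiagram} (hU : Tab U) (hμ : U.shape = μ.rowLens)
    (σ τ : YoungDiagram) : lrCoeff μ σ τ = (factorPairs U σ τ).ncard := by
  classical
  -- The letters of `U` suffice as alphabet, since the factors of `U` have no others.
  let S : Finset ℤ := U.flatten.toFinset
  have hUS : U ∈ tabF S μ := mem_tabF.2 ⟨hU, hμ, fun x hx => by simpa [S] using hx⟩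
  have hsum : schur (parts σ) * schur (parts τ) =
      (schurBasis.repr (schur (parts σ) * schur (parts τ))).sum
        fun ν c => c • schur (parts ν) := by
    conv_lhs => rw [← schurBasis.linearCombination_repr (schur (parts σ) * schur (parts τ))]
    rw [Finsupp.linearCombination_apply]
    simp [schurBasis]
  -- Distinct tableaux have distinct plactic classes, so the class of `U` occurs in the image of a
  -- single `s_ν`. Taking this coefficient of a symmetric function extracts its coefficient at
  -- `s_μ`.
  have hcoef : ∀ ν : YoungDiagram, (toPlactic S (schur (parts ν))).coeff (pl (word U)) =
      if ν = μ then 1 else 0 := by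
    intro ν
    rw [toPlactic_schur_parts, MonoidAlgebra.coeff_sum, Finsupp.finsetSum_apply]
    simp only [MonoidAlgebra.coeff_single, Finsupp.single_apply]
    have heq : ∀ D ∈ tabF S ν, pl (word D) = pl (word U) → D = U := fun D hD h =>
      (mem_tabF.1 hD).1.eq_of_pl hU h
    split_ifs with h
    · subst h
      rw [Finset.sum_eq_single_of_mem U hUS fun D hD hne => if_neg fun h => hne (heq D hD h)]
      simp
    · refine Finset.sum_eq_zero fun D hD => if_neg fun h' => h ?_
      obtain rfl := heq D hD h'
      have := (mem_tabF.1 hD).2.1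
      apply YoungDiagram.equivListRowLens.injective
      apply Subtype.ext
      exact this.symm.trans hμ
  have hl : (toPlactic S (schur (parts σ) * schur (parts τ))).coeff (pl (word U)) =
      lrCoeff μ σ τ := by
    rw [hsum, Finsupp.sum, map_sum, MonoidAlgebra.coeff_sum, Finsupp.finsetSum_apply]
    simp only [map_zsmul, MonoidAlgebra.coeff_smul, Finsupp.smul_apply, hcoef]
    simp [lrCoeff, eq_comm]
  rw [← hl, map_mul, toPlactic_schur_parts, toPlactic_schur_parts, Finset.sum_mul_sum,
    ← Finset.sum_product', MonoidAlgebra.coeff_sum, Finsupp.finsetSum_apply]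
  simp only [MonoidAlgebra.single_mul_single, mul_one, MonoidAlgebra.coeff_single,
    Finsupp.single_apply, Finset.sum_boole]
  rw [← Set.ncard_coe_finset]
  congr 2
  ext ⟨P, Q⟩
  simp only [Finset.coe_filter, Finset.mem_product, mem_tabF, Set.mem_ofPred_eq, factorPairs]
  constructor
  · rintro ⟨⟨⟨h1, h2, -⟩, h3, h4, -⟩, h5⟩
    exact ⟨h1, h3, (tab_tmul h1 Q).eq_of_pl hU (by rw [pl_tmul h1.rowsSorted, h5]), h2, h4⟩
  · rintro ⟨h1, h2, h3, h4, h5⟩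
    have hpl : pl (word P) * pl (word Q) = pl (word U) := by
      rw [← h3, pl_tmul h1.rowsSorted]
    have hperm : (word P ++ word Q).Perm (word U) := perm_of_pl (by rw [pl_append, hpl])
    have hmem : ∀ x ∈ word P ++ word Q, x ∈ S := fun x hx => by
      simpa [S] using (word_perm_flatten U).subset (hperm.subset hx)
    exact ⟨⟨⟨h1, h4, fun x hx => hmem x (by
      simp [(word_perm_flatten P).mem_iff.2 hx])⟩, h2, h5, fun x hx => hmem x (by
      simp [(word_perm_flatten Q).mem_iff.2 hx])⟩, hpl⟩

/-! ### Paths with labels, and moving factors between neighbouring labels -/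

section

/-! ### Paths -/

lemma pt_zero_add (p : ℕ × ℕ) : (0, 0) + p = p := by ext <;> simp

lemma pt_add_zero (p : ℕ × ℕ) : p + (0, 0) = p := by ext <;> simp

lemma endpoint_append (α β : List Seg) : endpoint (α ++ β) = endpoint α + endpoint β := by
  induction α with
  | nil => simp [endpoint, pt_zero_add]
  | cons f α ih =>
    rcases f <;> ext <;> simp [endpoint, ih, add_right_comm]

/-- A path which starts at `p` stays in the triangle. -/
def StaysFrom (p : ℕ × ℕ) : List Seg → Prop
  | [] => p.1 ≤ p.2
  | f :: γ => p.1 ≤ p.2 ∧ StaysFrom (p + endpoint [f]) γ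

lemma staysFrom_iff {p : ℕ × ℕ} {γ : List Seg} :
    StaysFrom p γ ↔ ∀ α, α <+: γ → (p + endpoint α).1 ≤ (p + endpoint α).2 := by
  induction γ generalizing p with
  | nil => simp [StaysFrom, endpoint]
  | cons f γ ih =>
    rw [StaysFrom, ih]
    constructor
    · rintro ⟨h1, h2⟩ α hα
      rcases α with _ | ⟨g, α⟩
      · simpa [endpoint] using h1
      · obtain ⟨rfl, hα'⟩ := List.cons_prefix_cons.1 hα
        have := h2 α hα'
        rwa [add_assoc, ← endpoint_append] at this
    · intro h
      refine ⟨by simpa [endpoint] using h [] ⟨_, rfl⟩, fun α hα => ?_⟩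
      have := h (f :: α) (List.cons_prefix_cons.2 ⟨rfl, hα⟩)
      rwa [add_assoc, ← endpoint_append]

lemma staysFrom_append {p : ℕ × ℕ} {α β : List Seg} :
    StaysFrom p (α ++ β) ↔ StaysFrom p α ∧ StaysFrom (p + endpoint α) β := by
  induction α generalizing p with
  | nil =>
    simp only [List.nil_append, StaysFrom, endpoint]
    rw [pt_add_zero]
    refine ⟨fun h => ⟨?_, h⟩, fun h => h.2⟩
    cases β with
    | nil => exact h
    | cons f β => exact h.1
  | cons f α ih =>
    rw [List.cons_append, StaysFrom, StaysFrom, ih, and_assoc, add_assoc, ← endpoint_append]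
    rfl

lemma isPath_iff {n : ℕ} {γ : List Seg} :
    IsPath n γ ↔ endpoint γ = (n, n) ∧ StaysFrom (0, 0) γ := by
  rw [IsPath, staysFrom_iff]
  simp

/-- The path `β` lies below the path `α` with the same end points. -/
inductive LowerSegs : List Seg → List Seg → Prop
  | split : LowerSegs [Seg.horiz] [Seg.up, Seg.down]
  | merge : LowerSegs [Seg.down, Seg.up] [Seg.horiz]

lemma LowerSegs.endpoint_eq {l u : List Seg} (h : LowerSegs l u) : endpoint l = endpoint u := by
  cases h <;> rfl

lemma LowerSegs.isPath {l u : List Seg} (h : LowerSegs l u) {n : ℕ} {α β : List Seg}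
    (hp : IsPath n (α ++ u ++ β)) : IsPath n (α ++ l ++ β) := by
  rw [isPath_iff, endpoint_append, endpoint_append, staysFrom_append, staysFrom_append,
    endpoint_append] at *
  rw [h.endpoint_eq]
  refine ⟨hp.1, ⟨hp.2.1.1, ?_⟩, hp.2.2⟩
  have h2 := hp.2.1.2
  cases h <;> simp only [StaysFrom, endpoint, Prod.fst_add, Prod.snd_add] at * <;> omega

lemma IsPath.bounds {n : ℕ} {α β : List Seg} {f : Seg} (h : IsPath n (α ++ f :: β)) :
    (endpoint α).1 ≤ (endpoint α).2 ∧ (endpoint (α ++ [f])).1 ≤ (endpoint (α ++ [f])).2 ∧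
      (endpoint (α ++ [f])).2 ≤ n := by
  refine ⟨h.2 α (List.prefix_append _ _), h.2 (α ++ [f]) ⟨β, by simp⟩, ?_⟩
  have h1 := congrArg Prod.snd h.1
  rw [← List.singleton_append, ← List.append_assoc, endpoint_append, Prod.snd_add] at h1
  simp only at h1
  omega

lemma isPath_lowest (n : ℕ) : IsPath n (lowestPath n) := by
  have hd : ∀ k, endpoint (List.replicate k Seg.down) = (0, k) := by
    intro k
    induction k with
    | zero => rfl
    | succ k ih => simp [List.replicate_succ, endpoint, ih]
  have hu : ∀ k, endpoint (List.replicate k Seg.up) = (k, 0) := by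
    intro k
    induction k with
    | zero => rfl
    | succ k ih => simp [List.replicate_succ, endpoint, ih]
  have sd : ∀ k (p : ℕ × ℕ), p.1 ≤ p.2 → StaysFrom p (List.replicate k Seg.down) := by
    intro k
    induction k with
    | zero => exact fun p hp => hp
    | succ k ih =>
      intro p hp
      refine ⟨hp, ih _ ?_⟩
      simp only [endpoint, Prod.fst_add, Prod.snd_add]; omega
  have su : ∀ k (p : ℕ × ℕ), p.1 + k ≤ p.2 → StaysFrom p (List.replicate k Seg.up) := by
    intro k
    induction k with
    | zero => exact fun p hp => hp
    | succ k ih =>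
      intro p hp
      refine ⟨by omega, ih _ ?_⟩
      simp only [endpoint, Prod.fst_add, Prod.snd_add]; omega
  rw [isPath_iff, lowestPath, endpoint_append, staysFrom_append, hd, hu]
  exact ⟨by simp, sd _ _ le_rfl, su _ _ (by simp)⟩

/-! ### Positions in lists -/

lemma append_cons_cases {ι : Type*} {α β α' β' : List ι} {x x' : ι}
    (h : α ++ x :: β = α' ++ x' :: β') :
    (α = α' ∧ x = x' ∧ β = β') ∨ (∃ m, α' = α ++ x :: m ∧ β = m ++ x' :: β') ∨
      ∃ m, α = α' ++ x' :: m ∧ β' = m ++ x :: β := by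
  rcases List.append_eq_append_iff.1 h with ⟨m, h1, h2⟩ | ⟨m, h1, h2⟩
  · rcases m with _ | ⟨y, m⟩
    · simp only [List.nil_append, List.cons.injEq, List.append_nil] at h1 h2
      exact Or.inl ⟨h1.symm, h2⟩
    · simp only [List.cons_append, List.cons.injEq] at h2
      obtain ⟨rfl, h2⟩ := h2
      exact Or.inr (Or.inl ⟨m, h1, h2⟩)
  · rcases m with _ | ⟨y, m⟩
    · simp only [List.nil_append, List.cons.injEq, List.append_nil] at h1 h2
      exact Or.inl ⟨h1, h2.1.symm, h2.2.symm⟩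
    · simp only [List.cons_append, List.cons.injEq] at h2
      obtain ⟨rfl, h2⟩ := h2
      exact Or.inr (Or.inr ⟨m, h1, h2⟩)

/-- The position of a single entry relative to a pair of consecutive entries. -/
lemma single_pair_cases {ι : Type*} {α β α' β' : List ι} {x p q : ι}
    (h : α' ++ x :: β' = α ++ p :: q :: β) :
    (∃ m, α = α' ++ x :: m ∧ β' = m ++ p :: q :: β) ∨
    (∃ m, α' = α ++ p :: q :: m ∧ β = m ++ x :: β') ∨
    (α' = α ∧ x = p ∧ β' = q :: β) ∨ (α' = α ++ [p] ∧ x = q ∧ β' = β) := by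
  rcases append_cons_cases h with ⟨h1, h2, h3⟩ | ⟨m, h1, h2⟩ | ⟨m, h1, h2⟩
  · exact Or.inr (Or.inr (Or.inl ⟨h1, h2, h3⟩))
  · exact Or.inl ⟨m, h1, h2⟩
  · rcases m with _ | ⟨y, m⟩
    · simp only [List.nil_append, List.cons.injEq] at h2
      exact Or.inr (Or.inr (Or.inr ⟨h1, h2.1.symm, h2.2.symm⟩))
    · simp only [List.cons_append, List.cons.injEq] at h2
      obtain ⟨rfl, h2⟩ := h2
      exact Or.inr (Or.inl ⟨m, h1, h2⟩)

/-- The relative position of two pairs of consecutive entries. -/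
lemma pair_pair_cases {ι : Type*} {α β α' β' : List ι} {x y p q : ι}
    (h : α' ++ x :: y :: β' = α ++ p :: q :: β) :
    (∃ m, α = α' ++ x :: y :: m ∧ β' = m ++ p :: q :: β) ∨
    (∃ m, α' = α ++ p :: q :: m ∧ β = m ++ x :: y :: β') ∨
    (α' = α ∧ x = p ∧ y = q ∧ β' = β) ∨ (α = α' ++ [x] ∧ y = p ∧ β' = q :: β) ∨
    (α' = α ++ [p] ∧ x = q ∧ β = y :: β') := by
  rcases append_cons_cases h with ⟨h1, h2, h3⟩ | ⟨m, h1, h2⟩ | ⟨m, h1, h2⟩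
  · simp only [List.cons.injEq] at h3
    exact Or.inr (Or.inr (Or.inl ⟨h1, h2, h3⟩))
  · rcases m with _ | ⟨z, m⟩
    · simp only [List.nil_append, List.cons.injEq] at h2
      exact Or.inr (Or.inr (Or.inr (Or.inl ⟨h1, h2⟩)))
    · simp only [List.cons_append, List.cons.injEq] at h2
      obtain ⟨rfl, h2⟩ := h2
      exact Or.inl ⟨m, h1, h2⟩
  · rcases m with _ | ⟨z, m⟩
    · simp only [List.nil_append, List.cons.injEq] at h2
      exact Or.inr (Or.inr (Or.inr (Or.inr ⟨h1, h2.1.symm, h2.2⟩)))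
    · simp only [List.cons_append, List.cons.injEq] at h2
      obtain ⟨rfl, h2⟩ := h2
      exact Or.inr (Or.inl ⟨m, h1, h2⟩)

/-! ### Labelled paths -/

/-- The plactic class of a diagram. -/
abbrev cl (D : Diagram) : Plactic := pl (word D)

lemma cl_nil : cl [] = 1 := rfl

lemma cl_tmul {U : Diagram} (hU : Tab U) (V : Diagram) : cl (tmul U V) = cl U * cl V :=
  pl_tmul hU.rowsSorted V

/-- A path with a diagram at each of its segments. -/
abbrev LPath : Type := List (Seg × Diagram)

/-- The underlying path. -/
abbrev segs (L : LPath) : List Seg := L.map Prod.fst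

/-- The end point of a labelled path. -/
abbrev ep (L : LPath) : ℕ × ℕ := endpoint (segs L)

lemma ep_append (α β : LPath) : ep (α ++ β) = ep α + ep β := by
  rw [ep, segs, List.map_append, endpoint_append]

variable {n : ℕ} {R : RectangleDiagram n}

/-- The two ways to obtain labels for a path from those for the path below it, at the point `p`. -/
inductive Loc (𝒯 : TableauDiagram R) (p : ℕ × ℕ) : LPath → LPath → Prop
  | split (P Q Z : Diagram) : Tab P → Tab Q → Tab Z → cl Z = cl P * cl Q →
      Loc 𝒯 p [(Seg.horiz, Z)] [(Seg.up, P), (Seg.down, Q)]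
  | merge (Q P Z : Diagram) : Tab Z → cl Z = cl Q * cl (𝒯.T p.1 (p.2 + 1)) * cl P →
      Loc 𝒯 p [(Seg.down, Q), (Seg.up, P)] [(Seg.horiz, Z)]

/-- The labelled paths which are obtained from the lowest path in `k` steps. -/
inductive LP (𝒯 : TableauDiagram R) : ℕ → LPath → Prop
  | lowest : LP 𝒯 0 ((lowestPath n).map fun f => (f, []))
  | step (k : ℕ) (α l u β : LPath) : Loc 𝒯 (ep α) l u → IsPath n (segs (α ++ u ++ β)) →
      LP 𝒯 k (α ++ l ++ β) → LP 𝒯 (k + 1) (α ++ u ++ β)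

variable {𝒯 : TableauDiagram R}

lemma Loc.lowerSegs {p : ℕ × ℕ} {l u : LPath} (h : Loc 𝒯 p l u) :
    LowerSegs (segs l) (segs u) := by
  cases h
  · exact LowerSegs.split
  · exact LowerSegs.merge

lemma Loc.ep_eq {p : ℕ × ℕ} {l u : LPath} (h : Loc 𝒯 p l u) : ep l = ep u :=
  h.lowerSegs.endpoint_eq

lemma LP.isPath {k : ℕ} {L : LPath} (h : LP 𝒯 k L) : IsPath n (segs L) := by
  cases h with
  | lowest => simpa [segs, Function.comp_def] using isPath_lowest n
  | step k α l u β h1 h2 h3 => exact h2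

lemma Loc.isPath_lower {p : ℕ × ℕ} {l u : LPath} (h : Loc 𝒯 p l u) {α β : LPath}
    (hp : IsPath n (segs (α ++ u ++ β))) : IsPath n (segs (α ++ l ++ β)) := by
  simp only [segs, List.map_append] at *
  exact h.lowerSegs.isPath hp

/-- A place where the path can be lowered. -/
def IsSite (u : LPath) : Prop :=
  (∃ Z, u = [(Seg.horiz, Z)]) ∨ ∃ P Q, u = [(Seg.up, P), (Seg.down, Q)]

lemma Loc.isSite {p : ℕ × ℕ} {l u : LPath} (h : Loc 𝒯 p l u) : IsSite u := by
  cases h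
  · exact Or.inr ⟨_, _, rfl⟩
  · exact Or.inl ⟨_, rfl⟩

/-- Two sites of a path coincide or are disjoint: a horizontal step belongs to no peak, and two
different peaks share no step. -/
lemma site_cases {α β α' β' u u' : LPath} (hu : IsSite u) (hu' : IsSite u')
    (h : α' ++ u' ++ β' = α ++ u ++ β) :
    (α' = α ∧ u' = u ∧ β' = β) ∨ (∃ m, α' = α ++ u ++ m ∧ β = m ++ u' ++ β') ∨
      ∃ m, α = α' ++ u' ++ m ∧ β' = m ++ u ++ β := by
  rcases hu with ⟨Z, rfl⟩ | ⟨P, Q, rfl⟩ <;> rcases hu' with ⟨Z', rfl⟩ | ⟨P', Q', rfl⟩ <;>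
    simp only [List.append_assoc, List.cons_append, List.nil_append] at h ⊢
  · rcases append_cons_cases h with ⟨h1, h2, h3⟩ | h | h
    · simp [h1, h2, h3]
    · exact Or.inr (Or.inr h)
    · exact Or.inr (Or.inl h)
  · rcases single_pair_cases h.symm with h | h | ⟨-, h, -⟩ | ⟨-, h, -⟩
    · exact Or.inr (Or.inl h)
    · exact Or.inr (Or.inr h)
    · simp at h
    · simp at h
  · rcases single_pair_cases h with h | h | ⟨-, h, -⟩ | ⟨-, h, -⟩
    · exact Or.inr (Or.inr h)
    · exact Or.inr (Or.inl h)
    · simp at h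
    · simp at h
  · rcases pair_pair_cases h with h | h | ⟨h1, h2, h3, h4⟩ | ⟨-, h, -⟩ | ⟨-, h, -⟩
    · exact Or.inr (Or.inr h)
    · exact Or.inr (Or.inl h)
    · simp [h1, h2, h3, h4]
    · simp at h
    · simp at h

lemma lowest_not_site {α β u : LPath} (hu : IsSite u)
    (h : lowestPath n = segs (α ++ u ++ β)) : False := by
  have h1 := h
  simp only [segs, List.map_append] at h1
  rcases hu with ⟨Z, rfl⟩ | ⟨P, Q, rfl⟩
  · have : Seg.horiz ∈ lowestPath n := by rw [h1]; simp
    simp [lowestPath, List.mem_replicate] at this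
  · simp only [List.map_cons, List.map_nil, List.append_assoc, lowestPath, List.cons_append,
      List.nil_append] at h1
    rcases List.append_eq_append_iff.1 h1 with ⟨m, h2, h3⟩ | ⟨m, h2, h3⟩
    · have : Seg.down ∈ List.replicate n Seg.up := by rw [h3]; simp
      simp [List.mem_replicate] at this
    · rcases m with _ | ⟨y, m⟩
      · have : Seg.down ∈ List.replicate n Seg.up := by
          rw [List.nil_append] at h3; rw [← h3]; simp
        simp [List.mem_replicate] at this
      · have : Seg.up ∈ List.replicate n Seg.down := by
          simp only [List.cons_append, List.cons.injEq] at h3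
          rw [h2, ← h3.1]; simp
        simp [List.mem_replicate] at this

/-- A labelled path can be lowered at each of its sites. -/
lemma LP.lower {k : ℕ} {L : LPath} (h : LP 𝒯 k L) {α u β : LPath} (hL : L = α ++ u ++ β)
    (hu : IsSite u) : ∃ j l, k = j + 1 ∧ Loc 𝒯 (ep α) l u ∧ LP 𝒯 j (α ++ l ++ β) := by
  induction h generalizing α u β with
  | lowest => exact (lowest_not_site (n := n) hu (by rw [← hL]; simp [segs, Function.comp_def])).elim
  | step k α' l' u' β' h1 h2 h3 ih =>
    rw [hL] at h2
    rcases site_cases hu h1.isSite hL with ⟨rfl, rfl, rfl⟩ | ⟨m, rfl, rfl⟩ | ⟨m, rfl, rfl⟩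
    · exact ⟨k, l', rfl, h1, h3⟩
    -- Disjoint sites commute: the wanted site is lowered in the path below, and the last step is
    -- then repeated. Lowering keeps end points, so the same rectangle is involved.
    · obtain ⟨j, l, rfl, h4, h5⟩ := ih (α := α) (u := u) (β := m ++ l' ++ β')
        (by simp only [List.append_assoc]) hu
      refine ⟨j + 1, l, rfl, h4, ?_⟩
      have h6 : Loc 𝒯 (ep (α ++ l ++ m)) l' u' := by
        rw [ep_append, ep_append, h4.ep_eq, ← ep_append, ← ep_append]; exact h1
      have := LP.step j (α ++ l ++ m) l' u' β' h6
        (by simpa only [List.append_assoc] using h4.isPath_lower h2)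
        (by simpa only [List.append_assoc] using h5)
      simpa only [List.append_assoc] using this
    · obtain ⟨j, l, rfl, h4, h5⟩ := ih (α := α' ++ l' ++ m) (u := u) (β := β)
        (by simp only [List.append_assoc]) hu
      have e : ep (α' ++ l' ++ m) = ep (α' ++ u' ++ m) := by
        rw [ep_append, ep_append, h1.ep_eq, ← ep_append, ← ep_append]
      rw [e] at h4
      refine ⟨j + 1, l, rfl, h4, ?_⟩
      have := LP.step j α' l' u' (m ++ l ++ β) h1
        (by simpa only [List.append_assoc] using h4.isPath_lower h2)
        (by simpa only [List.append_assoc] using h5)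
      simpa only [List.append_assoc] using this

lemma LP.lower_split {k : ℕ} {α β : LPath} {P Q : Diagram}
    (h : LP 𝒯 k (α ++ (Seg.up, P) :: (Seg.down, Q) :: β)) : Tab P ∧ Tab Q ∧ ∃ j Z, k = j + 1 ∧
      Tab Z ∧ cl Z = cl P * cl Q ∧ LP 𝒯 j (α ++ (Seg.horiz, Z) :: β) := by
  obtain ⟨j, l, hk, h1, h2⟩ := h.lower (α := α) (u := [(Seg.up, P), (Seg.down, Q)]) (β := β)
    (by simp) (Or.inr ⟨P, Q, rfl⟩)
  cases h1 with
  | split _ _ Z h3 h4 h5 h6 => exact ⟨h3, h4, j, Z, hk, h5, h6, by simpa using h2⟩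

lemma LP.lower_merge {k : ℕ} {α β : LPath} {Z : Diagram}
    (h : LP 𝒯 k (α ++ (Seg.horiz, Z) :: β)) : Tab Z ∧ ∃ j Q P, k = j + 1 ∧
      cl Z = cl Q * cl (𝒯.T (ep α).1 ((ep α).2 + 1)) * cl P ∧
      LP 𝒯 j (α ++ (Seg.down, Q) :: (Seg.up, P) :: β) := by
  obtain ⟨j, l, hk, h1, h2⟩ := h.lower (α := α) (u := [(Seg.horiz, Z)]) (β := β)
    (by simp) (Or.inl ⟨Z, rfl⟩)
  cases h1 with
  | merge Q P _ h3 h4 => exact ⟨h3, j, Q, P, hk, h4, by simpa using h2⟩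

lemma LP.split {k : ℕ} {α β : LPath} {P Q Z : Diagram} (h : LP 𝒯 k (α ++ (Seg.horiz, Z) :: β))
    (hp : IsPath n (segs (α ++ (Seg.up, P) :: (Seg.down, Q) :: β))) (hP : Tab P) (hQ : Tab Q)
    (hZ : Tab Z) (e : cl Z = cl P * cl Q) :
    LP 𝒯 (k + 1) (α ++ (Seg.up, P) :: (Seg.down, Q) :: β) := by
  have := LP.step k α _ _ β (Loc.split (𝒯 := 𝒯) (p := ep α) P Q Z hP hQ hZ e)
    (by simpa using hp) (by simpa using h)
  simpa using this

lemma LP.merge {k : ℕ} {α β : LPath} {P Q Z : Diagram}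
    (h : LP 𝒯 k (α ++ (Seg.down, Q) :: (Seg.up, P) :: β))
    (hp : IsPath n (segs (α ++ (Seg.horiz, Z) :: β))) (hZ : Tab Z)
    (e : cl Z = cl Q * cl (𝒯.T (ep α).1 ((ep α).2 + 1)) * cl P) :
    LP 𝒯 (k + 1) (α ++ (Seg.horiz, Z) :: β) := by
  have := LP.step k α _ _ β (Loc.merge (𝒯 := 𝒯) (p := ep α) Q P Z hZ e)
    (by simpa using hp) (by simpa using h)
  simpa using this

/-! ### The entries of the labels -/

/-- The label `X` of a segment from `p` to `q` is a tableau with entries from the `T_{kl}` with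
`k < q.1` and `p.2 < l`. -/
def GoodLabel (𝒯 : TableauDiagram R) (p q : ℕ × ℕ) (X : Diagram) : Prop :=
  Tab X ∧ ∀ x ∈ word X, ∃ k l, k < l ∧ l ≤ n ∧ k < q.1 ∧ p.2 < l ∧ x ∈ (𝒯.T k l).flatten

/-- All labels of a labelled path which starts at `p` are good. -/
def Good (𝒯 : TableauDiagram R) (p : ℕ × ℕ) : LPath → Prop
  | [] => True
  | (f, X) :: L => GoodLabel 𝒯 p (p + endpoint [f]) X ∧ Good 𝒯 (p + endpoint [f]) L

lemma good_append {p : ℕ × ℕ} {α β : LPath} :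
    Good 𝒯 p (α ++ β) ↔ Good 𝒯 p α ∧ Good 𝒯 (p + ep α) β := by
  induction α generalizing p with
  | nil =>
    have : p + ep [] = p := pt_add_zero p
    simp [Good, this]
  | cons e α ih =>
    obtain ⟨f, X⟩ := e
    have : p + ep ((f, X) :: α) = p + endpoint [f] + ep α := by
      rw [← List.singleton_append, ep_append, add_assoc]; rfl
    rw [List.cons_append, Good, Good, ih, and_assoc, this]

lemma mem_word_of_cl {A B C : Diagram} (h : cl A = cl B * cl C) {x : ℤ} :
    x ∈ word A ↔ x ∈ word B ∨ x ∈ word C := by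
  rw [← List.mem_append]
  exact (perm_of_pl (by rw [pl_append]; exact h)).mem_iff

lemma mem_word_iff {D : Diagram} {x : ℤ} : x ∈ word D ↔ x ∈ D.flatten :=
  (word_perm_flatten D).mem_iff

/-- Both labels of a split inherit the index range of the horizontal step. In a merge the new range
contains those of the two segments and the index of the rectangle itself. -/
lemma Loc.good {p : ℕ × ℕ} {l u : LPath} (h : Loc 𝒯 p l u) (hl : Good 𝒯 p l) (h1 : p.1 ≤ p.2)
    (h2 : p.2 + 1 ≤ n) : Good 𝒯 p u := by
  cases h with
  | split P Q Z hP hQ hZ e =>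
    simp only [Good, GoodLabel, endpoint, Prod.fst_add, Prod.snd_add, and_true] at hl ⊢
    refine ⟨⟨hP, fun x hx => ?_⟩, hQ, fun x hx => ?_⟩
    · obtain ⟨k, l, h3, h4, h5, h6, h7⟩ := hl.2 x ((mem_word_of_cl e).2 (Or.inl hx))
      exact ⟨k, l, h3, h4, by omega, by omega, h7⟩
    · obtain ⟨k, l, h3, h4, h5, h6, h7⟩ := hl.2 x ((mem_word_of_cl e).2 (Or.inr hx))
      exact ⟨k, l, h3, h4, by omega, by omega, h7⟩
  | merge Q P Z hZ e =>
    simp only [Good, GoodLabel, endpoint, Prod.fst_add, Prod.snd_add, and_true] at hl ⊢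
    refine ⟨hZ, fun x hx => ?_⟩
    have hperm : (word Z).Perm (word Q ++ word (𝒯.T p.1 (p.2 + 1)) ++ word P) :=
      perm_of_pl (by rw [pl_append, pl_append]; exact e)
    have := hperm.subset hx
    simp only [List.mem_append] at this
    rcases this with (h | h) | h
    · obtain ⟨k, l, h3, h4, h5, h6, h7⟩ := hl.1.2 x h
      exact ⟨k, l, h3, h4, by omega, by omega, h7⟩
    · exact ⟨p.1, p.2 + 1, by omega, by omega, by omega, by omega, mem_word_iff.1 h⟩
    · obtain ⟨k, l, h3, h4, h5, h6, h7⟩ := hl.2.2 x h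
      exact ⟨k, l, h3, h4, by omega, by omega, h7⟩

lemma Loc.snd_lt {p : ℕ × ℕ} {l u : LPath} (h : Loc 𝒯 p l u) : (ep u).2 = 1 := by
  cases h <;> rfl

lemma LP.good {k : ℕ} {L : LPath} (h : LP 𝒯 k L) : Good 𝒯 (0, 0) L := by
  induction h with
  | lowest =>
    have : ∀ (γ : List Seg) (p : ℕ × ℕ), Good 𝒯 p (γ.map fun f => (f, [])) := by
      intro γ
      induction γ with
      | nil => exact fun p => trivial
      | cons f γ ih => exact fun p => ⟨⟨tab_nil, by simp⟩, ih _⟩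
    exact this _ _
  | step k α l u β h1 h2 h3 ih =>
    rw [good_append, good_append, ep_append] at ih ⊢
    rw [h1.ep_eq, pt_zero_add] at ih
    rw [pt_zero_add]
    refine ⟨⟨ih.1.1, h1.good ih.1.2 ?_ ?_⟩, ih.2⟩
    · exact h2.2 (segs α) ⟨segs (u ++ β), by simp [segs]⟩
    · have h4 := congrArg Prod.snd h2.1
      simp only [segs, List.map_append, endpoint_append, Prod.snd_add] at h4
      have := h1.snd_lt
      simp only [ep, segs] at this ⊢
      omega

lemma LP.goodLabel {k : ℕ} {α β : LPath} {f : Seg} {X : Diagram}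
    (h : LP 𝒯 k (α ++ (f, X) :: β)) : GoodLabel 𝒯 (ep α) (ep α + endpoint [f]) X := by
  have := (good_append.1 h.good).2.1
  rwa [pt_zero_add] at this

/-- The tableau of the rectangle at a point. -/
abbrev tabAt (𝒯 : TableauDiagram R) (p : ℕ × ℕ) : Diagram := 𝒯.T p.1 (p.2 + 1)

/-- `T` has `a` rows and `b` columns, except that it is empty if there are no columns. -/
def IsRect (a b : ℕ) (T : Diagram) : Prop :=
  Tab T ∧ ((b = 0 ∧ T = []) ∨ (b ≠ 0 ∧ T.length = a ∧ ∀ t ∈ T, t.length = b))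

lemma isRect_tabAt {i j : ℕ} (hij : i < j) (hj : j ≤ n) :
    IsRect (R.rows i j) (R.cols i j) (𝒯.T i j) := by
  refine ⟨isTableau_iff.1 (𝒯.isTableau i j hij hj), ?_⟩
  have hs := 𝒯.shape_eq i j hij hj
  split_ifs at hs with h0
  · exact Or.inl ⟨h0, by simpa [Diagram.shape] using hs⟩
  · refine Or.inr ⟨h0, ?_, fun t ht => ?_⟩
    · have := congrArg List.length hs
      simpa [Diagram.shape] using this
    · have : t.length ∈ (𝒯.T i j).shape := List.mem_map_of_mem ht
      rw [hs] at this
      exact List.eq_of_mem_replicate this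

/-- The index intervals which `GoodLabel` allows for the two segments strictly contain that of the
rectangle at the angle, so the entries of its tableau are smaller than those of both labels. -/
lemma LP.angle {k : ℕ} {α β : LPath} {X Y : Diagram}
    (h : LP 𝒯 k (α ++ (Seg.down, X) :: (Seg.up, Y) :: β)) :
    (ep α).1 < (ep α).2 + 1 ∧ (ep α).2 + 1 ≤ n ∧ Tab X ∧ Tab Y ∧
      (∀ x ∈ word (tabAt 𝒯 (ep α)), ∀ y ∈ word X, x < y) ∧
      ∀ x ∈ word (tabAt 𝒯 (ep α)), ∀ y ∈ word Y, x < y := by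
  have hp := h.isPath
  simp only [segs, List.map_append, List.map_cons] at hp
  have hb := hp.bounds
  rw [endpoint_append] at hb
  simp only [endpoint, Prod.fst_add, Prod.snd_add] at hb
  have h1 := h.goodLabel
  have h2 : LP 𝒯 k ((α ++ [(Seg.down, X)]) ++ (Seg.up, Y) :: β) := by simpa using h
  have h2 := h2.goodLabel
  rw [ep_append] at h2
  simp only [GoodLabel, endpoint, Prod.fst_add, Prod.snd_add, ep, segs, List.map_cons,
    List.map_nil] at h1 h2 hb ⊢
  refine ⟨by omega, by omega, h1.1, h2.1, fun x hx y hy => ?_, fun x hx y hy => ?_⟩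
  · obtain ⟨k, l, h3, h4, h5, h6, h7⟩ := h1.2 y hy
    exact 𝒯.entries_lt k l _ _ (by omega) (by omega) (by omega) h4 (by simp; omega) x
      (mem_word_iff.1 hx) y h7
  · obtain ⟨k, l, h3, h4, h5, h6, h7⟩ := h2.2 y hy
    exact 𝒯.entries_lt k l _ _ (by omega) (by omega) (by omega) h4 (by simp; omega) x
      (mem_word_iff.1 hx) y h7

end

/-! ### The product around a rectangle -/

lemma Tab.append_left {A B : Diagram} (h : Tab (A ++ B)) : Tab A := by
  induction A with
  | nil => exact tab_nil
  | cons r A ih =>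
    have h' := tab_cons.1 (show Tab (r :: (A ++ B)) from h)
    refine tab_cons.2 ⟨h'.1, h'.2.1, ?_, ih h'.2.2.2⟩
    rcases A with _ | ⟨s, A⟩
    · simp
    · simpa using h'.2.2.1

lemma Tab.take {A : Diagram} (h : Tab A) (k : ℕ) : Tab (A.take k) :=
  Tab.append_left (B := A.drop k) (by rwa [List.take_append_drop])

lemma Tab.drop {A : Diagram} (h : Tab A) (k : ℕ) : Tab (A.drop k) :=
  Tab.append_right (A := A.take k) (by rwa [List.take_append_drop])

lemma cl_append (A B : Diagram) : cl (A ++ B) = cl B * cl A := by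
  rw [cl, word_append, pl_append]

lemma cl_take_drop (A : Diagram) (k : ℕ) : cl A = cl (A.drop k) * cl (A.take k) := by
  rw [← cl_append, List.take_append_drop]

lemma leftOf_of_le {A B : Diagram} (h : ∀ x ∈ A.flatten, ∀ y ∈ B.flatten, x ≤ y) :
    LeftOf A B := by
  induction A generalizing B with
  | nil => trivial
  | cons r A ih =>
    rcases B with _ | ⟨s, B⟩
    · trivial
    · exact ⟨fun x hx y hy => h x (by simp [hx]) y (by simp [hy]),
        ih fun x hx y hy => h x (by simp only [List.flatten_cons, List.mem_append, hx, or_true]) y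
          (by simp only [List.flatten_cons, List.mem_append, hy, or_true])⟩

lemma hcat_append_left (T X Y : Diagram) :
    hcat (T ++ X) Y = hcat T (Y.take T.length) ++ hcat X (Y.drop T.length) := by
  induction T generalizing Y with
  | nil => simp [hcat]
  | cons t T ih =>
    rcases Y with _ | ⟨y, Y⟩
    · simp
    · simp [ih]

lemma length_hcat_of_le {T Y : Diagram} (h : Y.length ≤ T.length) :
    (hcat T Y).length = T.length := by
  induction T generalizing Y with
  | nil => simp at h; simp [h]
  | cons t T ih =>
    rcases Y with _ | ⟨y, Y⟩
    · simp
    · simp at h; simp [hcat, ih h]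

lemma Fit.rows_append_drop {b : ℕ} {T X Y : Diagram} (h : Fit b X (Y.drop T.length))
    (hT : ∀ t ∈ T, t.length = b) (hTY : ∀ x ∈ T.flatten, ∀ y ∈ Y.flatten, x ≤ y) :
    Fit b (T ++ X) Y := by
  induction T generalizing Y with
  | nil => simpa using h
  | cons t T ih =>
    rcases Y with _ | ⟨y, Y⟩
    · simp
    · refine fit_cons.2 ⟨hT t (by simp), fun x hx z hz => hTY x (by simp [hx]) z (by simp [hz]),
        ih (by simpa using h) (fun t ht => hT t (by simp [ht])) fun x hx z hz => ?_⟩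
      exact hTY x (by simp only [List.flatten_cons, List.mem_append, hx, or_true]) z
        (by simp only [List.flatten_cons, List.mem_append, hz, or_true])

/-- Moving the columns beyond the `b`-th past a rectangle with smaller entries. -/
lemma IsRect.mul_right {a b : ℕ} {T X : Diagram} (hT : IsRect a b T) (hX : Tab X)
    (h : ∀ x ∈ word T, ∀ y ∈ word X, x < y) :
    cl X * cl T = cl (leftCut b X) * cl T * cl (rightCut b X) := by
  obtain ⟨hT1, ⟨rfl, rfl⟩ | ⟨hb, -, hTb⟩⟩ := hT
  · simp [leftCut_zero, rightCut_zero hX, cl_nil]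
  have hA := tab_leftCut hX.1 b
  have hB := tab_rightCut hX.1 b
  have hmem : ∀ y, y ∈ word X ↔ y ∈ word (leftCut b X) ∨ y ∈ word (rightCut b X) := fun y =>
    mem_word_of_cl (pl_cut hX b)
  have hTA : Tab (T ++ leftCut b X) := hT1.rows_append hA hTb (colsLE_leftCut b X)
    fun x hx y hy => h x (mem_word_iff.2 hx) y ((hmem y).2 (Or.inl (mem_word_iff.2 hy)))
  have hTB : ∀ x ∈ T.flatten, ∀ y ∈ (rightCut b X).flatten, x ≤ y := fun x hx y hy =>
    (h x (mem_word_iff.2 hx) y ((hmem y).2 (Or.inr (mem_word_iff.2 hy)))).le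
  -- Inserting `T` into `X` pushes the first `b` columns of `X` below `T` and leaves the other
  -- columns in place.
  have h1 := insertWord_rows_hcat hb hTA (fit_cut hX b) (colsLE_leftCut b X) hB hTb hTB
  rw [hcat_cut hX] at h1
  have h2 := pl_insertWord hX.rowsSorted (word T)
  rw [h1, pl_hcat hTA.rowsSorted hB ((fit_cut hX b).rows_append hB.1 hTb hTB).leftOf] at h2
  rw [cl, cl, ← h2, word_append, pl_append]

/-- Moving the rows beyond the `a`-th past a rectangle with smaller entries. -/
lemma IsRect.mul_left {a b : ℕ} {T Y : Diagram} (hT : IsRect a b T) (hY : Tab Y)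
    (h : ∀ x ∈ word T, ∀ y ∈ word Y, x < y) :
    cl T * cl Y = cl (Y.drop a) * cl T * cl (Y.take a) := by
  obtain ⟨hT1, ⟨rfl, rfl⟩ | ⟨hb, rfl, hTb⟩⟩ := hT
  · rw [cl_nil, one_mul, mul_one]
    exact cl_take_drop Y a
  have hTY : LeftOf T Y := leftOf_of_le fun x hx y hy =>
    (h x (mem_word_iff.2 hx) y (mem_word_iff.2 hy)).le
  have hTY' : LeftOf T (Y.take T.length) := leftOf_of_le fun x hx y hy =>
    (h x (mem_word_iff.2 hx) y ((mem_word_of_cl (cl_take_drop Y T.length)).2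
      (Or.inr (mem_word_iff.2 hy)))).le
  rw [← pl_hcat hT1.rowsSorted hY hTY, mul_assoc,
    ← pl_hcat hT1.rowsSorted (hY.take _) hTY', ← pl_append, ← word_append]
  have := hcat_append_left T [] Y
  rw [List.append_nil] at this
  rw [this]
  rfl

lemma sizeLeft_leftCut (b : ℕ) (D : Diagram) : sizeLeft b (leftCut b D) = sizeLeft b D := by
  induction D with
  | nil => rfl
  | cons r D ih =>
    rw [leftCut, List.map_cons, trim_cons, sizeLeft_cons]
    split_ifs with h
    · rw [← leftCut, ih]
      have := congrArg List.length h
      simp only [List.length_take, List.length_nil] at this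
      omega
    · rw [sizeLeft_cons, ← leftCut, ih, List.length_take]
      omega

lemma sizeLeft_le (b : ℕ) (D : Diagram) : sizeLeft b D ≤ (word D).length := by
  induction D with
  | nil => simp [sizeLeft]
  | cons r D ih =>
    rw [sizeLeft_cons, word_cons, List.length_append]
    omega

/-- A set of pairs of labels of an angle at the rectangle `T`, with `a` rows and `b` columns, from
which columns and rows which do not fit can be moved to the other side of the angle. -/
structure AngleRel (a b : ℕ) (T : Diagram) (F : Diagram → Diagram → Prop) : Prop where
  rect : IsRect a b T
  tab_left : ∀ X Y, F X Y → Tab X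
  tab_right : ∀ X Y, F X Y → Tab Y
  lt_left : ∀ X Y, F X Y → ∀ x ∈ word T, ∀ y ∈ word X, x < y
  lt_right : ∀ X Y, F X Y → ∀ x ∈ word T, ∀ y ∈ word Y, x < y
  vert : ∀ X Y Z, F X Y → Tab Z → cl Z = cl (rightCut b X) * cl Y → F (leftCut b X) Z
  horiz : ∀ X Y Z, F X Y → Tab Z → cl Z = cl X * cl (Y.drop a) → F Z (Y.take a)

/-- The rows of `Y` beyond the `a`-th are moved into `X`, and the columns of the result beyond the
`b`-th are moved back to the right label; the product around `T` does not change. The number of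
boxes of `X` in the first `b` columns never decreases and is bounded by the size of `W`. If it does
not grow, then by `insertWord_cut` the rows moved over were placed beside `X`, so `Y` fits beside `T
++ X` and `W` is the resulting diagram. -/
lemma AngleRel.exists_normal {a b : ℕ} {T : Diagram} {F : Diagram → Diagram → Prop}
    (hF : AngleRel a b T F) (hb : b ≠ 0) {X Y W : Diagram} (h : F X Y) (hXb : ColsLE b X)
    (hW : Tab W) (e : cl W = cl X * cl T * cl Y) : ∃ X' Y', F X' Y' ∧ ColsLE b X' ∧
      W = hcat (T ++ X') Y' ∧ Fit b (T ++ X') Y' ∧ Tab (T ++ X') ∧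
      F (hcat X' (Y'.drop a)) (Y'.take a) := by
  induction hm : (word W).length - sizeLeft b X using Nat.strong_induction_on generalizing X Y with
  | _ m ih =>
  subst hm
  have hX := hF.tab_left X Y h
  have hY := hF.tab_right X Y h
  obtain ⟨hT1, ⟨hb0, -⟩ | ⟨-, hTa, hTb⟩⟩ := hF.rect
  · exact absurd hb0 hb
  set Z := tmul X (Y.drop a) with hZ
  have hZt : Tab Z := tab_tmul hX _
  have hZc : cl Z = cl X * cl (Y.drop a) := pl_tmul hX.rowsSorted _
  have h1 : F Z (Y.take a) := hF.horiz X Y Z h hZt hZc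
  have hZr := tab_rightCut hZt.1 b
  have h2 : F (leftCut b Z) (tmul (rightCut b Z) (Y.take a)) :=
    hF.vert _ _ _ h1 (tab_tmul hZr _) (pl_tmul hZr.rowsSorted _)
  have e1 : cl W = cl Z * cl T * cl (Y.take a) := by
    rw [e, mul_assoc, hF.rect.mul_left hY (hF.lt_right X Y h), hZc]
    simp only [mul_assoc]
  have hsize : sizeLeft b X ≤ sizeLeft b Z := sizeLeft_le_insertWord hX _
  rcases hsize.lt_or_eq with hlt | heq
  · refine ih _ ?_ h2 (colsLE_leftCut b Z) ?_ rfl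
    · have h3 := sizeLeft_le b Z
      have h4 : (word Z).length ≤ (word W).length := by
        have : (word W).Perm (word Z ++ word T ++ word (Y.take a)) :=
          perm_of_pl (by rw [pl_append, pl_append]; exact e1)
        rw [this.length_eq]
        simp only [List.length_append]; omega
      rw [sizeLeft_leftCut]
      omega
    · rw [e1, hF.rect.mul_right hZt (hF.lt_left _ _ h1), cl_tmul hZr]
      simp only [mul_assoc]
  · obtain ⟨h3, h4⟩ := insertWord_cut (b := b) hX (w := word (Y.drop a)) heq.symm
    rw [← tmul_eq_insertWord, ← hZ] at h3 h4
    rw [leftCut_of_colsLE hX hXb] at h3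
    rw [rightCut_of_colsLE hXb, insertWord_word (hY.drop a)] at h4
    have h5 := fit_cut hZt b
    have h6 := hcat_cut hZt b
    rw [h3, h4] at h5 h6
    have hfit : Fit b (T ++ X) Y := by
      refine Fit.rows_append_drop (by rwa [hTa]) hTb fun x hx y hy => ?_
      exact (hF.lt_right X Y h x (mem_word_iff.2 hx) y (mem_word_iff.2 hy)).le
    have hTX : Tab (T ++ X) := hT1.rows_append hX hTb hXb fun x hx y hy =>
      hF.lt_left X Y h x (mem_word_iff.2 hx) y (mem_word_iff.2 hy)
    have hcols : ColsLE b (T ++ X) := by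
      intro r hr
      rcases List.mem_append.1 hr with hr | hr
      · exact (hTb r hr).le
      · exact hXb r hr
    refine ⟨X, Y, h, hXb, ?_, hfit, hTX, by rwa [h6]⟩
    refine hW.eq_of_pl (hfit.tab_hcat hTX hY hcols) ?_
    rw [pl_hcat hTX.rowsSorted hY hfit.leftOf, word_append, pl_append]
    exact e

/-- The labels of the angle can be chosen such that their product with the rectangle is read off
from a vertical cut. -/
lemma AngleRel.exists_vert {a b : ℕ} {T : Diagram} {F : Diagram → Diagram → Prop}
    (hF : AngleRel a b T F) {X Y W : Diagram} (h : F X Y) (hW : Tab W)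
    (e : cl W = cl X * cl T * cl Y) :
    ∃ X', F X' (rightCut b W) ∧ leftCut b W = T ++ X' := by
  have hX := hF.tab_left X Y h
  have hY := hF.tab_right X Y h
  have hXr := tab_rightCut hX.1 b
  have h1 := hF.vert X Y _ h (tab_tmul hXr Y) (pl_tmul hXr.rowsSorted _)
  have e1 : cl W = cl (leftCut b X) * cl T * cl (tmul (rightCut b X) Y) := by
    rw [e, hF.rect.mul_right hX (hF.lt_left X Y h), cl_tmul hXr]
    simp only [mul_assoc]
  -- Without columns `T` has no rows as a list even if `a` is positive, so this case is separate.
  by_cases hb : b = 0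
  · obtain ⟨-, ⟨rfl, rfl⟩ | ⟨hb', -⟩⟩ := hF.rect
    · rw [leftCut_zero] at h1 e1
      refine ⟨[], ?_, by simp [leftCut_zero]⟩
      rw [rightCut_zero hW]
      rwa [← hW.eq_of_pl (tab_tmul hXr Y) (by simpa [cl_nil] using e1)] at h1
    · exact absurd hb hb'
  · obtain ⟨X', Y', h2, h3, rfl, h5, h6, -⟩ :=
      hF.exists_normal hb h1 (colsLE_leftCut b X) hW e1
    obtain ⟨-, ⟨hb', -⟩ | ⟨-, -, hTb⟩⟩ := hF.rect
    · exact absurd hb' hb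
    have hcols : ColsLE b (T ++ X') := by
      intro r hr
      rcases List.mem_append.1 hr with hr | hr
      · exact (hTb r hr).le
      · exact h3 r hr
    refine ⟨X', ?_, h5.leftCut h6 hcols⟩
    rwa [h5.rightCut h6 hcols (hF.tab_right _ _ h2)]

/-- The labels of the angle can be chosen such that they fit around the rectangle. -/
lemma AngleRel.exists_horiz {a b : ℕ} {T : Diagram} {F : Diagram → Diagram → Prop}
    (hF : AngleRel a b T F) {X Y W : Diagram} (h : F X Y) (hW : Tab W)
    (e : cl W = cl X * cl T * cl Y) :
    ∃ Y', F (W.drop a) Y' ∧ W.take a = hcat T Y' ∧ Y'.length ≤ a := by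
  have hX := hF.tab_left X Y h
  have hY := hF.tab_right X Y h
  have hXr := tab_rightCut hX.1 b
  have h1 := hF.vert X Y _ h (tab_tmul hXr Y) (pl_tmul hXr.rowsSorted _)
  have e1 : cl W = cl (leftCut b X) * cl T * cl (tmul (rightCut b X) Y) := by
    rw [e, hF.rect.mul_right hX (hF.lt_left X Y h), cl_tmul hXr]
    simp only [mul_assoc]
  by_cases hb : b = 0
  · obtain ⟨-, ⟨rfl, rfl⟩ | ⟨hb', -⟩⟩ := hF.rect
    · rw [leftCut_zero] at h1 e1
      rw [← hW.eq_of_pl (tab_tmul hXr Y) (by simpa [cl_nil] using e1)] at h1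
      exact ⟨W.take a, hF.horiz _ _ _ h1 (hW.drop a) (by simp [cl_nil]), rfl, by simp⟩
    · exact absurd hb hb'
  · obtain ⟨X', Y', h2, h3, rfl, h5, h6, h7⟩ :=
      hF.exists_normal hb h1 (colsLE_leftCut b X) hW e1
    obtain ⟨-, ⟨hb', -⟩ | ⟨-, rfl, hTb⟩⟩ := hF.rect
    · exact absurd hb' hb
    refine ⟨Y'.take T.length, ?_, ?_, by simp⟩
    · rw [hcat_append_left, List.drop_left' (length_hcat_of_le (by simp))]
      exact h7
    · rw [hcat_append_left, List.take_left' (length_hcat_of_le (by simp))]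

section

variable {n : ℕ} {R : RectangleDiagram n} {𝒯 : TableauDiagram R}

/-! ### Moving factors between neighbouring labels -/

/-- The site is, in this order: before the pair, after it, its first segment, its second segment,
the whole pair, or a peak sharing only the first or only the second segment with it. -/
lemma site_pair_cases {α β α' β' u : LPath} {p q : Seg × Diagram} (hu : IsSite u)
    (h : α' ++ u ++ β' = α ++ p :: q :: β) :
    (∃ m, α = α' ++ u ++ m ∧ β' = m ++ p :: q :: β) ∨
    (∃ m, α' = α ++ p :: q :: m ∧ β = m ++ u ++ β') ∨
    (α' = α ∧ u = [p] ∧ β' = q :: β) ∨ (α' = α ++ [p] ∧ u = [q] ∧ β' = β) ∨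
    (α' = α ∧ u = [p, q] ∧ β' = β) ∨ (∃ e, α = α' ++ [e] ∧ u = [e, p] ∧ β' = q :: β) ∨
    ∃ e, α' = α ++ [p] ∧ u = [q, e] ∧ β = e :: β' := by
  rcases hu with ⟨Z, rfl⟩ | ⟨P, Q, rfl⟩ <;>
    simp only [List.append_assoc, List.cons_append, List.nil_append] at h ⊢
  · rcases single_pair_cases h with h | h | ⟨h1, h2, h3⟩ | ⟨h1, h2, h3⟩
    · exact Or.inl h
    · exact Or.inr (Or.inl h)
    · exact Or.inr (Or.inr (Or.inl ⟨h1, by rw [h2], h3⟩))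
    · exact Or.inr (Or.inr (Or.inr (Or.inl ⟨h1, by rw [h2], h3⟩)))
  · rcases pair_pair_cases h with h | h | ⟨h1, h2, h3, h4⟩ | ⟨h1, h2, h3⟩ | ⟨h1, h2, h3⟩
    · exact Or.inl h
    · exact Or.inr (Or.inl h)
    · exact Or.inr (Or.inr (Or.inr (Or.inr (Or.inl ⟨h1, by rw [h2, h3], h4⟩))))
    · exact Or.inr (Or.inr (Or.inr (Or.inr (Or.inr (Or.inl ⟨_, h1, by rw [h2], h3⟩)))))
    · exact Or.inr (Or.inr (Or.inr (Or.inr (Or.inr (Or.inr ⟨_, h1, by rw [h2], h3⟩)))))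

/-- The label `X` of a segment `f` which starts at `p` has the right factor `Z`, which can be moved
to the next segment. -/
def MovesRight (R : RectangleDiagram n) (p : ℕ × ℕ) : Seg → Diagram → Diagram → Diagram → Prop
  | Seg.up, X, Y, Z => Tab Y ∧ Tab Z ∧ cl X = cl Y * cl Z
  | Seg.down, X, Y, Z => ∃ c, R.cols p.1 (p.2 + 1) ≤ c ∧ Y = leftCut c X ∧ Z = rightCut c X
  | Seg.horiz, _, _, _ => False

/-- The label `X` of a segment `f` which starts at `p` has the left factor `Y`, which can be moved
to the previous segment. -/
def MovesLeft (R : RectangleDiagram n) (p : ℕ × ℕ) : Seg → Diagram → Diagram → Diagram → Prop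
  | Seg.down, X, Y, Z => Tab Y ∧ Tab Z ∧ cl X = cl Y * cl Z
  | Seg.up, X, Y, Z => ∃ r, R.rows p.1 p.2 ≤ r ∧ Y = X.drop r ∧ Z = X.take r
  | Seg.horiz, _, _, _ => False

/-- Factors can be moved to the right in labelled paths obtained in `k` steps. -/
def RightMoves (𝒯 : TableauDiagram R) (k : ℕ) : Prop :=
  ∀ (α β : LPath) (f s : Seg) (X Y Z B C : Diagram), LP 𝒯 k (α ++ (f, X) :: (s, B) :: β) →
    MovesRight R (ep α) f X Y Z → Tab C → cl C = cl Z * cl B →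
    LP 𝒯 k (α ++ (f, Y) :: (s, C) :: β)

/-- Factors can be moved to the left in labelled paths obtained in `k` steps. -/
def LeftMoves (𝒯 : TableauDiagram R) (k : ℕ) : Prop :=
  ∀ (α β : LPath) (s f : Seg) (X Y Z A C : Diagram), LP 𝒯 k (α ++ (s, A) :: (f, X) :: β) →
    MovesLeft R (ep (α ++ [(s, A)])) f X Y Z → Tab C → cl C = cl A * cl Y →
    LP 𝒯 k (α ++ (s, C) :: (f, Z) :: β)

/-- The two closure properties of `AngleRel` are the moves with the cut exactly at the size of the
rectangle. -/
lemma LP.angleRel {k : ℕ} (hr : RightMoves 𝒯 k) (hl : LeftMoves 𝒯 k) {α β : LPath} {X Y : Diagram}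
    (h : LP 𝒯 k (α ++ (Seg.down, X) :: (Seg.up, Y) :: β)) :
    AngleRel (R.rows (ep α).1 ((ep α).2 + 1)) (R.cols (ep α).1 ((ep α).2 + 1)) (tabAt 𝒯 (ep α))
      fun X Y => LP 𝒯 k (α ++ (Seg.down, X) :: (Seg.up, Y) :: β) where
  rect := isRect_tabAt h.angle.1 h.angle.2.1
  tab_left _ _ h := h.angle.2.2.1
  tab_right _ _ h := h.angle.2.2.2.1
  lt_left _ _ h := h.angle.2.2.2.2.1
  lt_right _ _ h := h.angle.2.2.2.2.2
  vert X Y Z h hZ e := hr _ _ _ _ _ _ _ _ _ h ⟨_, le_rfl, rfl, rfl⟩ hZ e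
  horiz X Y Z h hZ e := by
    refine hl _ _ _ _ _ _ _ _ _ h ⟨_, ?_, rfl, rfl⟩ hZ e
    simp [ep, segs, endpoint_append, endpoint]

lemma LP.tab {k : ℕ} {α β : LPath} {f : Seg} {X : Diagram} (h : LP 𝒯 k (α ++ (f, X) :: β)) :
    Tab X := h.goodLabel.1

lemma MovesRight.tab {p : ℕ × ℕ} {f : Seg} {X Y Z : Diagram} (h : MovesRight R p f X Y Z)
    (hX : Tab X) : Tab Z := by
  cases f with
  | up => exact h.2.1
  | down =>
    obtain ⟨c, -, -, rfl⟩ := h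
    exact tab_rightCut hX.1 c
  | horiz => exact h.elim

lemma Tab.eq_nil {D : Diagram} (hD : Tab D) (h : cl D = 1) : D = [] :=
  hD.eq_of_pl tab_nil h

lemma eq_nil_of_mul {Y Z : Diagram} (hY : Tab Y) (hZ : Tab Z) (h : cl Y * cl Z = 1) :
    Y = [] ∧ Z = [] := by
  have hp : (word Y ++ word Z).Perm [] := perm_of_pl (by rw [pl_append]; exact h)
  have h1 := hp.eq_nil
  simp only [List.append_eq_nil_iff] at h1
  exact ⟨hY.eq_nil (by rw [cl, h1.1]; rfl), hZ.eq_nil (by rw [cl, h1.2]; rfl)⟩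

lemma lowest_labels {α β : LPath} {p q : Seg × Diagram}
    (h : (lowestPath n).map (fun f => (f, ([] : Diagram))) = α ++ p :: q :: β) :
    p.2 = [] ∧ q.2 = [] := by
  have h1 : p ∈ (lowestPath n).map (fun f => (f, ([] : Diagram))) := by rw [h]; simp
  have h2 : q ∈ (lowestPath n).map (fun f => (f, ([] : Diagram))) := by rw [h]; simp
  simp only [List.mem_map] at h1 h2
  obtain ⟨_, -, rfl⟩ := h1
  obtain ⟨_, -, rfl⟩ := h2
  exact ⟨rfl, rfl⟩

/-- Repeats the last raising step after a pair of labels away from its site has been changed. -/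
lemma Loc.lift_left {α l u m β : LPath} {p q p' q' : Seg × Diagram} {k : ℕ}
    (h : Loc 𝒯 (ep α) l u) (hp : IsPath n (segs (α ++ u ++ (m ++ p :: q :: β))))
    (e : p'.1 = p.1) (e' : q'.1 = q.1) (hl : LP 𝒯 k (α ++ l ++ m ++ p' :: q' :: β)) :
    LP 𝒯 (k + 1) (α ++ u ++ m ++ p' :: q' :: β) := by
  have := LP.step k α l u (m ++ p' :: q' :: β) h (by simpa [segs, e, e'] using hp)
    (by simpa only [List.append_assoc] using hl)
  simpa only [List.append_assoc] using this

lemma Loc.lift_right {α l u m β : LPath} {p q p' q' : Seg × Diagram} {k : ℕ}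
    (h : Loc 𝒯 (ep (α ++ p :: q :: m)) l u)
    (hp : IsPath n (segs (α ++ p :: q :: m ++ u ++ β)))
    (e : p'.1 = p.1) (e' : q'.1 = q.1) (hl : LP 𝒯 k (α ++ p' :: q' :: (m ++ l ++ β))) :
    LP 𝒯 (k + 1) (α ++ p' :: q' :: (m ++ u ++ β)) := by
  have e1 : ep (α ++ p' :: q' :: m) = ep (α ++ p :: q :: m) := by
    simp [ep, segs, e, e']
  have := LP.step k (α ++ p' :: q' :: m) l u β (by rw [e1]; exact h)
    (by simpa [segs, e, e'] using hp) (by simpa using hl)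
  simpa using this

/-- The move is made in a lower path and the last raising step is repeated. This is formal unless
`X` labels the down step of a peak whose up step lies outside the pair: a part of `X` is then a
factor of the product `P · X` only, and the horizontal step carrying this product must be lowered
once more. -/
lemma rightMoves_succ {k : ℕ} (hr : ∀ j ≤ k, RightMoves 𝒯 j) (hl : ∀ j ≤ k, LeftMoves 𝒯 j) :
    RightMoves 𝒯 (k + 1) := by
  intro α β f s X Y Z B C h hmv hC eC
  generalize hL : α ++ (f, X) :: (s, B) :: β = L at h
  cases h with
  | step _ α' l u β' h1 h2 h3 =>
  rcases site_pair_cases h1.isSite hL.symm with ⟨m, rfl, rfl⟩ | ⟨m, rfl, rfl⟩ |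
    ⟨rfl, rfl, rfl⟩ | ⟨rfl, rfl, rfl⟩ | ⟨rfl, rfl, rfl⟩ | ⟨e, rfl, rfl, rfl⟩ | ⟨e, rfl, rfl, rfl⟩
  · have e1 : ep (α' ++ u ++ m) = ep (α' ++ l ++ m) := by
      rw [ep_append, ep_append, ← h1.ep_eq, ← ep_append, ← ep_append]
    rw [e1] at hmv
    exact h1.lift_left h2 rfl rfl (hr k le_rfl (α' ++ l ++ m) β f s X Y Z B C
      (by simpa only [List.append_assoc] using h3) hmv hC eC)
  · exact h1.lift_right h2 rfl rfl (hr k le_rfl α (m ++ l ++ β') f s X Y Z B C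
      (by simpa using h3) hmv hC eC)
  · cases h1
    exact hmv.elim
  · cases h1 with
    | merge Q P _ hZ e =>
    have h0 : LP 𝒯 k (α ++ (f, X) :: (Seg.down, Q) :: (Seg.up, P) :: β') := by simpa using h3
    have hZ' : Tab Z := hmv.tab h0.tab
    have h4 := hr k le_rfl α ((Seg.up, P) :: β') f Seg.down X Y Z Q (tmul Z Q) h0 hmv (tab_tmul hZ' _) (cl_tmul hZ' _)
    have h5 : LP 𝒯 k ((α ++ [(f, Y)]) ++ (Seg.down, tmul Z Q) :: (Seg.up, P) :: β') := by
      simpa using h4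
    have e1 : ep (α ++ [(f, Y)]) = ep (α ++ [(f, X)]) := by simp [ep, segs]
    have := h5.merge (Z := C) (by simpa [segs] using h2) hC (by
      rw [eC, e, e1, cl_tmul hZ']; simp only [mul_assoc])
    simpa using this
  · cases h1 with
    | split _ _ Z' hX hB hZ' e =>
    have := LP.split (P := Y) (Q := C) (α := α') (β := β') (Z := Z') (by simpa using h3)
      (by simpa [segs] using h2) hmv.1 hC hZ' (by rw [e, hmv.2.2, eC, mul_assoc])
    simpa using this
  · cases h1 with
    | split P _ Z' hP hX hZ' e =>
    obtain ⟨c, hc, rfl, rfl⟩ := hmv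
    have h4 : LP 𝒯 k (α' ++ (Seg.horiz, Z') :: (s, B) :: β) := by simpa using h3
    obtain ⟨-, j, Q₀, P₀, rfl, e0, h5⟩ := h4.lower_merge
    have hang := h5.angleRel (hr j (by omega)) (hl j (by omega))
    -- The right label of the angle below the horizontal step may be taken to be the part of `P · X`
    -- beyond column `b`.
    obtain ⟨Q₁, h6, h7⟩ := hang.exists_vert h5 hZ' e0
    have hYt := tab_leftCut hX.1 c
    have hZt := tab_rightCut hX.1 c
    -- The rectangle under the peak has at most as many columns as the one at the down step of `X`,
    -- by the condition on column numbers in a rectangle diagram.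
    have hbd : R.cols (ep α').1 ((ep α').2 + 1) ≤ c := by
      refine le_trans (R.cols_le _ _ ?_ h5.angle.2.1) (by
        simpa [ep, segs, endpoint_append, endpoint] using hc)
      have h8 : IsPath n (segs α' ++ Seg.up :: segs ((Seg.down, X) :: (s, B) :: β)) := by
        simpa [segs] using h2
      have := h8.bounds.2.1
      rw [endpoint_append] at this
      simp only [endpoint, Prod.fst_add, Prod.snd_add] at this
      simp only [ep]
      omega
    set b := R.cols (ep α').1 ((ep α').2 + 1)
    have hW := tab_tmul hP (leftCut c X)
    -- Since `b ≤ c`, the tableau `rightCut c X` is a right factor of this part, and an up step may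
    -- give away any right factor. The first `b` columns are not affected, so merging again yields
    -- `P · leftCut c X`.
    obtain ⟨c1, c2⟩ := cut_mul_le hX (word P) hbd
    rw [← hZ'.eq_rect (by rw [pl_append]; exact e), ← hW.eq_rect (by
      rw [pl_append]; exact cl_tmul hP _)] at c1 c2
    have h9 := hr j (by omega) (α' ++ [(Seg.down, Q₁)]) β Seg.up s (rightCut b Z')
      (rightCut b (tmul P (leftCut c X))) (rightCut c X) B C (by simpa using h6)
      ⟨tab_rightCut hW.1 _, hZt, c2⟩ hC eC
    have h10 := LP.merge (α := α') (β := (s, C) :: β) (Q := Q₁)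
      (P := rightCut b (tmul P (leftCut c X))) (Z := tmul P (leftCut c X)) (k := j)
      (by simpa using h9) (by simpa [segs] using h4.isPath) hW (by
        rw [cl, pl_cut hW b, ← c1, h7, word_append, pl_append])
    have h11 := LP.split (P := P) (Q := leftCut c X) h10 (by simpa [segs] using h2) hP hYt hW
      (cl_tmul hP _)
    simpa using h11
  · cases h1 with
    | split _ Q Z' hB hQ hZ' e =>
    have h0 : LP 𝒯 k (α ++ (f, X) :: (Seg.horiz, Z') :: β') := by simpa using h3
    have hZt : Tab Z := hmv.tab h0.tab
    have h4 := hr k le_rfl α β' f Seg.horiz X Y Z Z' (tmul Z Z') h0 hmv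
      (tab_tmul hZt _) (cl_tmul hZt _)
    have := LP.split (α := α ++ [(f, Y)]) (β := β') (P := C) (Q := Q) (Z := tmul Z Z') (k := k)
      (by simpa using h4) (by simpa [segs] using h2) hC hQ (tab_tmul hZt _) (by
        rw [cl_tmul hZt, e, eC, mul_assoc])
    simpa using this

/-- Dual to `rightMoves_succ`, with rows in place of columns. In the essential case `X` labels the
up step of a peak, and `exists_horiz`, `rows_mul` and the condition on row numbers take the roles of
`exists_vert`, `cut_mul_le` and the condition on column numbers. -/
lemma leftMoves_succ {k : ℕ} (hr : ∀ j ≤ k, RightMoves 𝒯 j) (hl : ∀ j ≤ k, LeftMoves 𝒯 j) :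
    LeftMoves 𝒯 (k + 1) := by
  intro α β s f X Y Z A C h hmv hC eC
  generalize hL : α ++ (s, A) :: (f, X) :: β = L at h
  cases h with
  | step _ α' l u β' h1 h2 h3 =>
  rcases site_pair_cases h1.isSite hL.symm with ⟨m, rfl, rfl⟩ | ⟨m, rfl, rfl⟩ |
    ⟨rfl, rfl, rfl⟩ | ⟨rfl, rfl, rfl⟩ | ⟨rfl, rfl, rfl⟩ | ⟨e, rfl, rfl, rfl⟩ | ⟨e, rfl, rfl, rfl⟩
  · have e1 : ep (α' ++ u ++ m ++ [(s, A)]) = ep (α' ++ l ++ m ++ [(s, A)]) := by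
      rw [ep_append, ep_append, ep_append, ← h1.ep_eq, ← ep_append, ← ep_append, ← ep_append]
    rw [e1] at hmv
    exact h1.lift_left h2 rfl rfl (hl k le_rfl (α' ++ l ++ m) β s f X Y Z A C
      (by simpa only [List.append_assoc] using h3) hmv hC eC)
  · exact h1.lift_right h2 rfl rfl (hl k le_rfl α (m ++ l ++ β') s f X Y Z A C
      (by simpa using h3) hmv hC eC)
  · cases h1 with
    | merge Q P _ hA e =>
    have h0 : LP 𝒯 k ((α' ++ [(Seg.down, Q)]) ++ (Seg.up, P) :: (f, X) :: β) := by
      simpa using h3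
    have hP : Tab P := h0.tab
    have e1 : ep (α' ++ [(Seg.down, Q)] ++ [(Seg.up, P)]) = ep (α' ++ [(Seg.horiz, A)]) := by
      simp [ep, segs, endpoint_append, endpoint]
    have h4 := hl k le_rfl (α' ++ [(Seg.down, Q)]) β Seg.up f X Y Z P (tmul P Y) h0 (by rw [e1]; exact hmv) (tab_tmul hP _) (cl_tmul hP _)
    have := LP.merge (α := α') (β := (f, Z) :: β) (Q := Q) (P := tmul P Y) (Z := C) (k := k)
      (by simpa using h4) (by simpa [segs] using h2) hC (by
        rw [eC, e, cl_tmul hP]; simp only [mul_assoc])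
    simpa using this
  · cases h1
    exact hmv.elim
  · cases h1 with
    | split _ _ Z' hA hX hZ' e =>
    have := LP.split (P := C) (Q := Z) (α := α') (β := β') (Z := Z') (by simpa using h3)
      (by simpa [segs] using h2) hC hmv.2.1 hZ' (by rw [e, hmv.2.2, eC, mul_assoc])
    simpa using this
  · cases h1 with
    | split P _ Z' hP hA hZ' e =>
    have e1 : ep (α' ++ [(Seg.up, P)] ++ [(Seg.down, A)]) = ep (α' ++ [(Seg.horiz, Z')]) := by
      simp [ep, segs, endpoint_append, endpoint]
    rw [e1] at hmv
    have h4 := hl k le_rfl α' β Seg.horiz f X Y Z Z' (tmul Z' Y) (by simpa using h3) hmv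
      (tab_tmul hZ' _) (cl_tmul hZ' _)
    have := LP.split (α := α') (β := (f, Z) :: β) (P := P) (Q := C) (Z := tmul Z' Y) (k := k)
      (by simpa using h4) (by simpa [segs] using h2) hP hC (tab_tmul hZ' _) (by
        rw [cl_tmul hZ', e, eC, mul_assoc])
    simpa using this
  · cases h1 with
    | split _ Q Z' hX hQ hZ' e =>
    obtain ⟨r, hrr, rfl, rfl⟩ := hmv
    have h4 : LP 𝒯 k ((α ++ [(s, A)]) ++ (Seg.horiz, Z') :: β') := by simpa using h3
    obtain ⟨-, j, Q₀, P₀, rfl, e0, h5⟩ := h4.lower_merge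
    have hang := h5.angleRel (hr j (by omega)) (hl j (by omega))
    obtain ⟨Y₁, h6, h7, -⟩ := hang.exists_horiz h5 hZ' e0
    set p := ep (α ++ [(s, A)]) with hp
    have hbd : R.rows p.1 (p.2 + 1) ≤ r := by
      have h8 : IsPath n (segs (α ++ [(s, A)]) ++ Seg.up :: segs ((Seg.down, Q) :: β')) := by
        simpa [segs] using h2
      have := h8.bounds.2.1
      rw [endpoint_append] at this
      simp only [endpoint, Prod.fst_add, Prod.snd_add] at this
      exact le_trans (R.rows_le _ _ (by rw [hp]; simp only [ep]; omega) h5.angle.2.1) hrr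
    set a := R.rows p.1 (p.2 + 1)
    have hW : Tab (tmul (X.take r) Q) := tab_tmul (hX.take r) Q
    obtain ⟨c1, c2⟩ := rows_mul hX (word Q) hbd
    rw [← tmul_eq_insertWord, ← tmul_eq_insertWord, ← hZ'.eq_of_pl (tab_tmul hX Q) (by
      exact e.trans (cl_tmul hX Q).symm)] at c1 c2
    have h9 := hl j (by omega) α ((Seg.up, Y₁) :: β') s Seg.down (Z'.drop a) (X.drop r)
      ((tmul (X.take r) Q).drop a) A C (by simpa using h6) ⟨hX.drop r, hW.drop a, c2⟩ hC eC
    have e1 : ep (α ++ [(s, C)]) = ep (α ++ [(s, A)]) := by simp [ep, segs]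
    have h8 := h6.angle
    have h10 := LP.merge (α := α ++ [(s, C)]) (β := β') (Q := (tmul (X.take r) Q).drop a)
      (P := Y₁) (Z := tmul (X.take r) Q) (k := j) (by simpa using h9)
      (by simpa [segs] using h4.isPath) hW (by
        rw [cl_take_drop _ a, ← c1, h7, e1, cl, cl, pl_hcat hang.rect.1.rowsSorted h8.2.2.2.1
          (leftOf_of_le fun x hx y hy =>
            (h8.2.2.2.2.2 x (mem_word_iff.2 hx) y (mem_word_iff.2 hy)).le)]
        simp only [mul_assoc]
        rfl)
    have h11 := LP.split (P := X.take r) (Q := Q) h10 (by simpa [segs] using h2) (hX.take r) hQ hW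
      (cl_tmul (hX.take r) _)
    simpa using h11

/-- Factors can be moved between neighbouring labels. -/
theorem moves (k : ℕ) : RightMoves 𝒯 k ∧ LeftMoves 𝒯 k := by
  induction k using Nat.strong_induction_on with
  | _ k ih =>
  rcases k with _ | k
  · constructor
    · intro α β f s X Y Z B C h hmv hC eC
      generalize hL : α ++ (f, X) :: (s, B) :: β = L at h
      cases h
      have := lowest_labels hL.symm
      simp only at this
      obtain ⟨rfl, rfl⟩ := this
      have hYZ : Y = [] ∧ Z = [] := by
        cases f with
        | up => exact eq_nil_of_mul hmv.1 hmv.2.1 (by rw [← hmv.2.2]; rfl)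
        | down =>
          obtain ⟨c, -, rfl, rfl⟩ := hmv
          exact ⟨rfl, rfl⟩
        | horiz => exact hmv.elim
      obtain ⟨rfl, rfl⟩ := hYZ
      obtain rfl := hC.eq_nil (by rw [eC]; rfl)
      rw [hL]
      exact LP.lowest
    · intro α β s f X Y Z A C h hmv hC eC
      generalize hL : α ++ (s, A) :: (f, X) :: β = L at h
      cases h
      have := lowest_labels hL.symm
      simp only at this
      obtain ⟨rfl, rfl⟩ := this
      have hYZ : Y = [] ∧ Z = [] := by
        cases f with
        | down => exact eq_nil_of_mul hmv.1 hmv.2.1 (by rw [← hmv.2.2]; rfl)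
        | up =>
          obtain ⟨c, -, rfl, rfl⟩ := hmv
          exact ⟨by simp, by simp⟩
        | horiz => exact hmv.elim
      obtain ⟨rfl, rfl⟩ := hYZ
      obtain rfl := hC.eq_nil (by rw [eC]; rfl)
      rw [hL]
      exact LP.lowest
  · exact ⟨rightMoves_succ (fun j hj => (ih j (by omega)).1) fun j hj => (ih j (by omega)).2,
      leftMoves_succ (fun j hj => (ih j (by omega)).1) fun j hj => (ih j (by omega)).2⟩

end

/-! ### Pairs of labels around a rectangle, and Fomin's involution on them -/

/-! ### Diagrams attached to a rectangle -/

/-- The top `a` rows of an attached diagram. -/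
def topRows (a : ℕ) (T Y : Diagram) : Diagram :=
  (List.range a).map fun k => T.getD k [] ++ Y.getD k []

lemma attach_eq (a : ℕ) (T X Y : Diagram) : attach a T X Y = topRows a T Y ++ X := rfl

@[simp] lemma length_topRows (a : ℕ) (T Y : Diagram) : (topRows a T Y).length = a := by
  simp [topRows]

lemma topRows_eq {a : ℕ} {T Y : Diagram} (hT : T.length ≤ a) (hY : Y.length ≤ a) :
    topRows a T Y = hcat T Y ++ List.replicate (a - (hcat T Y).length) [] := by
  induction a generalizing T Y with
  | zero =>
    obtain rfl := List.length_eq_zero_iff.1 (Nat.le_zero.1 hT)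
    obtain rfl := List.length_eq_zero_iff.1 (Nat.le_zero.1 hY)
    rfl
  | succ a ih =>
    have hs : topRows (a + 1) T Y = (T.getD 0 [] ++ Y.getD 0 []) :: topRows a T.tail Y.tail := by
      rw [topRows, List.range_succ_eq_map, List.map_cons, List.map_map, topRows]
      congr 1
      refine List.map_congr_left fun k _ => ?_
      rcases T with _ | ⟨t, T⟩ <;> rcases Y with _ | ⟨y, Y⟩ <;> simp
    rw [hs, ih (by simpa using hT) (by simpa using hY)]
    rcases T with _ | ⟨t, T⟩ <;> rcases Y with _ | ⟨y, Y⟩ <;>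
      simp [hcat, List.replicate_succ]

lemma trim_append (A B : Diagram) :
    Diagram.trim (A ++ B) = Diagram.trim A ++ Diagram.trim B := by
  simp [Diagram.trim]

@[simp] lemma trim_replicate (m : ℕ) : Diagram.trim (List.replicate m []) = [] :=
  trim_eq_nil fun _ hr => List.eq_of_mem_replicate hr

lemma SS.append_right {A B : Diagram} (h : SS (A ++ B)) : SS B := by
  induction A with
  | nil => exact h
  | cons r A ih => exact ih h.2.2

lemma SS.append_over {A B : Diagram} (h : SS (A ++ B)) :
    ∀ r ∈ A.getLast?, Over r (B.headD []) := by
  induction A with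
  | nil => simp
  | cons r A ih =>
    rcases A with _ | ⟨s, A⟩
    · intro t ht
      simp at ht
      subst ht
      exact h.2.1
    · intro t ht
      exact ih h.2.2 t (by simpa using ht)

lemma SS.eq_trim_append {D : Diagram} (h : SS D) :
    D = Diagram.trim D ++ List.replicate (D.length - (Diagram.trim D).length) [] := by
  induction D with
  | nil => rfl
  | cons r D ih =>
    by_cases hr : r = []
    · have h1 := h.eq_nil_of_head (by simpa using hr)
      rw [trim_eq_nil h1]
      simpa using List.eq_replicate_iff.2 ⟨rfl, h1⟩
    · rw [trim_cons, if_neg hr]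
      simpa using ih h.2.2

lemma ss_append_replicate {D : Diagram} (h : SS D) (m : ℕ) : SS (D ++ List.replicate m []) := by
  refine ss_append h ?_ fun r _ => ?_
  · induction m with
    | zero => trivial
    | succ m ih =>
      refine ⟨List.Pairwise.nil, ?_, ih⟩
      rcases m with _ | m <;> simp [List.replicate_succ]
  · rcases m with _ | m <;> simp [List.replicate_succ]

lemma hcat_ne_nil {A B : Diagram} (hA : ∀ r ∈ A, r ≠ []) (hB : ∀ r ∈ B, r ≠ []) :
    ∀ r ∈ hcat A B, r ≠ [] := by
  induction A generalizing B with
  | nil => exact hB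
  | cons r A ih =>
    rcases B with _ | ⟨s, B⟩
    · simpa using hA
    · intro t ht
      rcases List.mem_cons.1 ht with rfl | ht
      · simp [hA r (by simp)]
      · exact ih (fun r hr => hA r (by simp [hr])) (fun r hr => hB r (by simp [hr])) t ht

lemma hcat_cancel {T Y Y' : Diagram} (hY : ∀ r ∈ Y, r ≠ []) (hY' : ∀ r ∈ Y', r ≠ [])
    (h : hcat T Y = hcat T Y') : Y = Y' := by
  induction T generalizing Y Y' with
  | nil => exact h
  | cons t T ih =>
    rcases Y with _ | ⟨y, Y⟩ <;> rcases Y' with _ | ⟨y', Y'⟩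
    · rfl
    · simp only [hcat, List.cons.injEq] at h
      exact absurd (List.self_eq_append_right.1 h.1) (hY' y' (by simp))
    · simp only [hcat, List.cons.injEq] at h
      exact absurd (List.self_eq_append_right.1 h.1.symm) (hY y (by simp))
    · simp only [hcat, List.cons.injEq, List.append_cancel_left_eq] at h
      rw [h.1, ih (fun r hr => hY r (by simp [hr])) (fun r hr => hY' r (by simp [hr])) h.2]

/-- The parts of a tableau attached to a rectangle can be read off. -/
lemma trim_attach {a : ℕ} {T X Y : Diagram} (hT : Tab T) (hX : Tab X) (hY : Tab Y)
    (hTa : T.length ≤ a) (hYa : Y.length ≤ a) (h : SS (attach a T X Y)) :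
    (Diagram.trim (attach a T X Y)).drop a = X ∧
      (Diagram.trim (attach a T X Y)).take a = hcat T Y := by
  rw [attach_eq, topRows_eq hTa hYa] at h ⊢
  have hH := hcat_ne_nil hT.2 hY.2
  rw [trim_append, trim_append, trim_replicate, trim_eq_self hH, trim_eq_self hX.2, List.append_nil]
  have hlen : (hcat T Y).length ≤ a := by
    clear h hH
    induction T generalizing Y a with
    | nil => exact hYa
    | cons t T ih =>
      rcases Y with _ | ⟨y, Y⟩
      · exact hTa
      · obtain ⟨a, rfl⟩ : ∃ c, a = c + 1 := ⟨a - 1, by simp at hTa; omega⟩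
        simp only [hcat, List.length_cons, Nat.add_le_add_iff_right] at hTa hYa ⊢
        exact ih (tab_cons.1 hT).2.2.2 (tab_cons.1 hY).2.2.2 hTa hYa
  rcases hlen.eq_or_lt with heq | hlt
  · rw [List.drop_left' heq, List.take_left' heq]
    exact ⟨rfl, rfl⟩
  -- Here the top part is padded by at least one empty row, below which a semistandard diagram has
  -- only empty rows; hence `X` is empty.
  · obtain ⟨m, hm⟩ : ∃ m, a - (hcat T Y).length = m + 1 := ⟨a - (hcat T Y).length - 1, by omega⟩
    rw [hm, List.append_assoc, List.replicate_succ, List.cons_append] at h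
    have h1 := h.append_right.eq_nil_of_head (by simp)
    have hX0 : X = [] := by
      rcases X with _ | ⟨x, X⟩
      · rfl
      · exact absurd (h1 x (by simp)) (hX.2 x (by simp))
    subst hX0
    rw [List.append_nil, List.drop_of_length_le hlt.le, List.take_of_length_le hlt.le]
    exact ⟨rfl, rfl⟩

lemma attach_take_drop {a : ℕ} {T Y W : Diagram} (hTa : T.length ≤ a) (hYa : Y.length ≤ a)
    (h : W.take a = hcat T Y) :
    attach a T (W.drop a) Y = W ++ List.replicate (a - W.length) [] := by
  rw [attach_eq, topRows_eq hTa hYa, ← h]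
  rcases le_or_gt a W.length with hl | hl
  · rw [List.length_take, min_eq_left hl, Nat.sub_self, Nat.sub_eq_zero_of_le hl]
    simp
  · rw [List.drop_of_length_le hl.le, List.take_of_length_le hl.le, List.append_nil]

lemma IsRect.length_le {a b : ℕ} {T : Diagram} (h : IsRect a b T) : T.length ≤ a := by
  obtain ⟨-, ⟨-, rfl⟩ | ⟨-, h, -⟩⟩ := h
  · simp
  · exact h.le

lemma IsRect.length_getD {a b : ℕ} {T : Diagram} (h : IsRect a b T) {k : ℕ} (hk : k < a) :
    (T.getD k []).length = b := by
  obtain ⟨-, ⟨rfl, rfl⟩ | ⟨-, rfl, h⟩⟩ := h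
  · simp
  · rw [List.getD_eq_getElem _ _ hk]
    exact h _ (List.getElem_mem _)

lemma cl_replicate_append (D : Diagram) (m : ℕ) : cl (D ++ List.replicate m []) = cl D := by
  have : word (List.replicate m ([] : List ℤ)) = [] := by
    rw [← word_trim, trim_replicate, word_nil]
  rw [cl_append, cl, this]
  simp

lemma cl_attach {a b : ℕ} {T X Y : Diagram} (hT : IsRect a b T) (hY : Tab Y)
    (hYa : Y.length ≤ a) (h : ∀ x ∈ word T, ∀ y ∈ word Y, x < y) :
    cl (attach a T X Y) = cl X * cl T * cl Y := by
  rw [attach_eq, cl_append, topRows_eq hT.length_le hYa, cl_replicate_append, mul_assoc, cl, cl,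
    pl_hcat hT.1.rowsSorted hY (leftOf_of_le fun x hx y hy =>
      (h x (mem_word_iff.2 hx) y (mem_word_iff.2 hy)).le)]

lemma SS.topRows {a b : ℕ} {T Y : Diagram} (hT : IsRect a b T) (hY : Tab Y)
    (hYa : Y.length ≤ a) (h : ∀ x ∈ word T, ∀ y ∈ word Y, x < y) : SS (topRows a T Y) := by
  rw [topRows_eq hT.length_le hYa]
  refine ss_append_replicate ?_ _
  obtain ⟨hT1, ⟨rfl, rfl⟩ | ⟨-, rfl, hTb⟩⟩ := hT
  · exact hY.1
  · have hfit : Fit b (T ++ []) Y := Fit.rows_append_drop (by simp [List.drop_of_length_le hYa]) hTb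
      fun x hx y hy => (h x (mem_word_iff.2 hx) y (mem_word_iff.2 hy)).le
    rw [List.append_nil] at hfit
    exact hfit.ss_hcat hT1.1 hY.1 (fun r hr => (hTb r hr).le) hY.2

lemma getLast?_topRows {a : ℕ} (ha : a ≠ 0) (T Y : Diagram) :
    (topRows a T Y).getLast? = some (T.getD (a - 1) [] ++ Y.getD (a - 1) []) := by
  rw [topRows, List.getLast?_map, List.getLast?_range, if_neg ha]
  rfl

lemma headD_rightCut {X : Diagram} (hX : SS X) (b : ℕ) :
    (rightCut b X).headD [] = (X.headD []).drop b := by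
  rw [rightCut, (hX.map_drop b).headD_trim]
  rcases X with _ | ⟨r, X⟩ <;> simp

/-- Whether a pair fits around a rectangle is not affected by the columns below the rectangle. -/
lemma ss_attach_iff {a b : ℕ} {T X Y : Diagram} (hT : IsRect a b T) (hX : Tab X) (hY : Tab Y)
    (hYa : Y.length ≤ a) (hTX : ∀ x ∈ word T, ∀ y ∈ word X, x < y)
    (hTY : ∀ x ∈ word T, ∀ y ∈ word Y, x < y) :
    SS (attach a T X Y) ↔ SS (attach a [] (rightCut b X) Y) := by
  have hE : IsRect a 0 [] := ⟨tab_nil, Or.inl ⟨rfl, rfl⟩⟩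
  rcases Nat.eq_zero_or_pos a with rfl | ha
  · exact ⟨fun _ => (tab_rightCut hX.1 b).1, fun _ => hX.1⟩
  rw [attach_eq, attach_eq]
  have hlast := fun T => getLast?_topRows ha.ne' T Y
  have hlen := hT.length_getD (k := a - 1) (by omega)
  constructor
  · intro h
    refine ss_append (SS.topRows hE hY hYa (by simp)) (tab_rightCut hX.1 b).1 fun r hr => ?_
    rw [hlast] at hr
    simp only [List.getD_nil, List.nil_append, Option.mem_def, Option.some.injEq] at hr
    subst hr
    have h1 := (h.append_over _ (hlast T)).drop b
    rwa [List.drop_left' hlen, ← headD_rightCut hX.1] at h1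
  · intro h
    refine ss_append (SS.topRows hT hY hYa hTY) hX.1 fun r hr => ?_
    rw [hlast, Option.mem_def, Option.some.injEq] at hr
    subst hr
    have h1 := h.append_over _ (hlast [])
    rw [headD_rightCut hX.1] at h1
    simp only [List.getD_nil, List.nil_append] at h1
    -- The first `b` boxes of the top row of `X` lie under `T`, whose entries are smaller; the
    -- others lie under `Y`.
    rw [← List.take_append_drop b (X.headD [])]
    refine Over.append (over_of_lt ?_ fun x hx y hy => ?_) h1 fun h0 => ?_
    · rw [hlen]; simp
    · refine hTX x (mem_word_iff.2 (List.mem_flatten.2 ⟨_, ?_, hx⟩)) y (mem_word_iff.2 ?_)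
      · by_contra hc
        have : a - 1 < T.length ∨ T.length ≤ a - 1 := lt_or_ge _ _
        rcases this with h2 | h2
        · rw [List.getD_eq_getElem _ _ h2] at hc
          exact hc (List.getElem_mem _)
        · rw [List.getD_eq_default _ _ h2] at hx
          simp at hx
      · rcases X with _ | ⟨r, X⟩
        · simp at hy
        · exact List.mem_flatten.2 ⟨r, by simp, List.mem_of_mem_take (by simpa using hy)⟩
    · rw [hlen, List.length_take, min_eq_left]
      by_contra hc
      exact h0 (List.drop_of_length_le (by omega))

/-! ### Fomin's involution on the labels of an angle -/

lemma violation_append_left {A B : Diagram} {i j : ℕ} (hi : i < A.length)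
    (h : Diagram.Violation (A ++ B) i j) : A.Violation i j := by
  obtain ⟨h0, x, hx, hy⟩ := h
  refine ⟨h0, x, ?_, fun y hy' => hy y ?_⟩
  · rwa [Diagram.box, List.getElem?_append_left hi] at hx
  · rwa [Diagram.box, List.getElem?_append_left (by omega)]

lemma violation_append_right {A B : Diagram} {i j : ℕ} (hi : A.length < i) :
    Diagram.Violation (A ++ B) i j ↔ B.Violation (i - A.length) j := by
  have e : i - 1 - A.length = i - A.length - 1 := by omega
  simp only [Diagram.Violation, Diagram.box, List.getElem?_append_right hi.le,
    List.getElem?_append_right (show A.length ≤ i - 1 by omega), e]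
  constructor
  · rintro ⟨-, h⟩; exact ⟨by omega, h⟩
  · rintro ⟨-, h⟩; exact ⟨by omega, h⟩

lemma violation_append_eq {a : ℕ} {A B : Diagram} (hA : SS A) (hB : SS B) (ha : A.length = a)
    {i j : ℕ} (h : Diagram.Violation (A ++ B) i j) : i = a := by
  rcases lt_trichotomy i a with hi | hi | hi
  · exact absurd (violation_append_left (by omega) h) ((semistandard_iff.2 hA).2 i j)
  · exact hi
  · exact absurd ((violation_append_right (by omega)).1 h) ((semistandard_iff.2 hB).2 _ j)

lemma ss_take_drop {a : ℕ} {D : Diagram} (hD : RowsSorted D)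
    (hv : ∀ i j, D.Violation i j → i = a) (ha : a ≤ D.length) :
    SS (D.take a) ∧ SS (D.drop a) := by
  have hlen : (D.take a).length = a := by simp [ha]
  constructor <;> refine semistandard_iff.1 ⟨fun r hr => hD r ?_, fun i j h => ?_⟩
  · exact List.mem_of_mem_take hr
  · obtain ⟨h0, x, hx, hy⟩ := h
    obtain ⟨v, hv', hx'⟩ := Option.bind_eq_some_iff.1 hx
    have hi := (List.getElem?_eq_some_iff.1 hv').1
    have : D.Violation i j := by
      refine ⟨h0, x, ?_, fun y hy' => hy y ?_⟩
      · rw [Diagram.box, List.getElem?_take_of_lt (by omega)] at hx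
        exact hx
      · rw [Diagram.box, List.getElem?_take_of_lt (by omega)]
        exact hy'
    have := hv i j this
    omega
  · exact List.mem_of_mem_drop hr
  · have h1 : Diagram.Violation (D.take a ++ D.drop a) (i + a) j := by
      rw [violation_append_right (by have := h.pos; omega), hlen, Nat.add_sub_cancel]
      exact h
    rw [List.take_append_drop] at h1
    have := hv _ j h1
    have := h.pos
    omega

/-- The lower row keeps its first letter, since column `0` is never to the right of the first
violation. -/
lemma Exchange.rows {D D' : Diagram} {i : ℕ} (hD : RowsSorted D) (h : Exchange i D D') :
    ∃ (A B : Diagram) (u v u' v' : List ℤ), A.length = i ∧ D = A ++ u :: v :: B ∧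
      D' = A ++ u' :: v' :: B ∧ v' ≠ [] ∧ Sorted v' ∧ v'.head? = v.head? ∧
      ∀ x ∈ u', x ∈ u ∨ x ∈ v := by
  obtain ⟨j, hj, hs⟩ := h.exists_spec hD
  obtain ⟨A, B, u, v, u', v', rfl, rfl, rfl, -, hx⟩ := (exchange_iff hD).1 h
  refine ⟨A, B, u, v, u', v', rfl, rfl, rfl, ?_, hx.2, ?_, fun x hx' => ?_⟩
  · rintro rfl
    have := hx.4
    simp at this
  · have := hs.lower 0 (by omega)
    simpa [Diagram.box, List.head?_eq_getElem?] using this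
  · have hp : (v' ++ u').Perm (v ++ u) := perm_of_pl (by rw [pl_append, pl_append, hx.pl_eq])
    have := hp.subset (List.mem_append_right _ hx')
    rw [List.mem_append] at this
    exact this.symm

/-- Exchange operations respect lower bounds for the entries of the rows from row `a` on. -/
lemma Exchange.bound {D D' : Diagram} {i a N : ℕ} (hD : RowsSorted D) (h : Exchange i D D')
    {P : ℕ → ℤ → Prop} (hmono : ∀ k x y, x ≤ y → P k x → P k y)
    (hP : ∀ k x, a + k + 1 < N → P (k + 1) x → P k x) (hN : D.length = N)
    (hb : ∀ k r, D[a + k]? = some r → ∀ x ∈ r, P k x) :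
    ∀ k r, D'[a + k]? = some r → ∀ x ∈ r, P k x := by
  obtain ⟨A, B, u, v, u', v', rfl, rfl, rfl, -, hv', hhead, hu'⟩ := h.rows hD
  intro k r hr x hx
  by_cases h0 : a + k = A.length
  · rw [h0, getElem?_two_rows.1, Option.some.injEq] at hr
    subst hr
    have hN' : a + k + 1 < N := by rw [← hN, h0]; simp
    rcases hu' x hx with hx | hx
    · exact hb k u (by rw [h0, getElem?_two_rows.1]) x hx
    · exact hP k x hN' (hb (k + 1) v (by rw [← add_assoc, h0, getElem?_two_rows.2]) x hx)
  by_cases h1 : a + k = A.length + 1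
  · rw [h1, getElem?_two_rows.2, Option.some.injEq] at hr
    subst hr
    rcases v' with _ | ⟨z, v'⟩
    · simp at hx
    · rcases v with _ | ⟨w, v⟩
      · simp at hhead
      · simp only [List.head?_cons, Option.some.injEq] at hhead
        subst hhead
        have hz := hb k _ (by rw [h1, getElem?_two_rows.2]) z (by simp)
        rcases List.mem_cons.1 hx with rfl | hx
        · exact hz
        · exact hmono k z x ((List.pairwise_cons.1 hv').1 x hx) hz
  · rw [getElem?_rows_ne h0 h1 (u' := u) (v' := v)] at hr
    exact hb k r hr x hx

/-- The last row is either untouched or the lower row of the exchange, which is never empty. This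
keeps empty rows out of the lower part produced by Fomin's algorithm. -/
lemma Exchange.last_ne_nil {D D' : Diagram} {i : ℕ} (hD : RowsSorted D) (h : Exchange i D D')
    (hl : ∀ r ∈ D.getLast?, r ≠ []) : ∀ r ∈ D'.getLast?, r ≠ [] := by
  obtain ⟨A, B, u, v, u', v', rfl, rfl, rfl, hv', -⟩ := h.rows hD
  rcases List.eq_nil_or_concat B with rfl | ⟨B, s, rfl⟩
  · intro r hr
    simp at hr
    rwa [← hr]
  · intro r hr
    refine hl r ?_
    have e : ∀ u v : List ℤ, (A ++ u :: v :: B.concat s).getLast? = some s := by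
      intro u v
      have : A ++ u :: v :: B.concat s = (A ++ u :: v :: B) ++ [s] := by simp
      rw [this, List.getLast?_concat]
    rw [e] at hr ⊢
    exact hr

lemma Fit.replace {b : ℕ} {A B B' : Diagram} (h : Fit b A B) (hlen : B'.length = B.length)
    (hB' : ∀ k r, B'[k]? = some r → ∀ x ∈ r, ∀ y ∈ A.getD k [], y ≤ x) : Fit b A B' := by
  induction A generalizing B B' with
  | nil =>
    rcases B' with _ | ⟨s, B'⟩
    · trivial
    · rcases B with _ | ⟨s', B⟩
      · simp at hlen
      · exact h
  | cons r A ih =>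
    rcases B' with _ | ⟨s, B'⟩
    · trivial
    · rcases B with _ | ⟨s', B⟩
      · simp at hlen
      · refine fit_cons.2 ⟨h.1, fun x hx y hy => hB' 0 s rfl y hy x hx,
          ih h.2.2 (by simpa using hlen) fun k r hr x hx y hy => hB' (k + 1) r (by simpa using hr) x
            hx y (by simpa using hy)⟩

lemma Fit.lens_hcat {b : ℕ} {A B : Diagram} (h : Fit b A B) :
    (hcat A B).map (fun r => (r.length : ℤ)) =
      lens b B ++ (A.drop B.length).map fun r => (r.length : ℤ) := by
  induction A generalizing B with
  | nil =>
    rcases B with _ | ⟨s, B⟩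
    · rfl
    · rw [nil_fit] at h
      subst h
      simp [hcat, lens]
  | cons r A ih =>
    rcases B with _ | ⟨s, B⟩
    · simp [lens]
    · have := ih h.2.2
      simp [hcat, lens, h.1] at this ⊢
      exact this

lemma Fit.length_getD {b : ℕ} {A B : Diagram} (h : Fit b A B) {k : ℕ} (hk : k < B.length) :
    (A.getD k []).length = b := by
  induction A generalizing B k with
  | nil =>
    rcases B with _ | ⟨s, B⟩
    · simp at hk
    · simp [nil_fit.1 h]
  | cons r A ih =>
    rcases B with _ | ⟨s, B⟩
    · simp at hk
    · rcases k with _ | k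
      · simpa using h.1
      · simpa using ih h.2.2 (by simpa using hk)

lemma SS.getD_over {A : Diagram} (h : SS A) (k : ℕ) : Over (A.getD k []) (A.getD (k + 1) []) := by
  induction A generalizing k with
  | nil => simp
  | cons r A ih =>
    rcases k with _ | k
    · rcases A with _ | ⟨s, A⟩
      · simp
      · exact h.2.1
    · simpa using ih h.2.2 k

lemma lens_topRows {a b : ℕ} {T : Diagram} (hT : IsRect a b T) (Y : Diagram) :
    (topRows a T Y).map (fun r => (r.length : ℤ)) = lens b (topRows a [] Y) := by
  simp only [topRows, lens, List.map_map]
  refine List.map_congr_left fun k hk => ?_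
  have := hT.length_getD (List.mem_range.1 hk)
  simp only [Function.comp_apply, List.length_append, this]
  simp

lemma lens_append (b : ℕ) (A B : Diagram) : lens b (A ++ B) = lens b A ++ lens b B := by
  simp [lens]

lemma fit_of_rows {b : ℕ} {A B : Diagram} (h : Fit b A B) :
    ∀ k r, B[k]? = some r → ∀ x ∈ r, ∀ y ∈ A.getD k [], y ≤ x := by
  induction A generalizing B with
  | nil => simp
  | cons s A ih =>
    rcases B with _ | ⟨t, B⟩
    · simp
    · intro k r hr x hx y hy
      rcases k with _ | k
      · simp only [List.getElem?_cons_zero, Option.some.injEq] at hr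
        subst hr
        exact h.2.1 y (by simpa using hy) x hx
      · exact ih h.2.2 k r (by simpa using hr) x hx y (by simpa using hy)

lemma Fomin.unique {a : ℕ} {Q P Q₁ P₁ Q₂ P₂ : Diagram} (hs : RowsSorted (attach a [] Q P))
    (h₁ : Fomin a Q P Q₁ P₁) (h₂ : Fomin a Q P Q₂ P₂) : Q₁ = Q₂ ∧ P₁ = P₂ := by
  obtain ⟨D, hD, rfl, rfl⟩ := h₁
  obtain ⟨D', hD', rfl, rfl⟩ := h₂
  rw [hD.unique hs hD']
  exact ⟨rfl, rfl⟩

lemma rowsSorted_attach {a : ℕ} {Q P : Diagram} (hQ : Tab Q) (hP : Tab P) (hPa : P.length ≤ a) :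
    RowsSorted (attach a [] Q P) := by
  have hE : IsRect a 0 [] := ⟨tab_nil, Or.inl ⟨rfl, rfl⟩⟩
  intro r hr
  rw [attach_eq, List.mem_append] at hr
  rcases hr with hr | hr
  · exact (SS.topRows hE hP hPa (by simp)).rowsSorted r hr
  · exact hQ.rowsSorted r hr

/-- Fomin's involution applied to a pair of labels which does not fit around a rectangle. -/
lemma exists_fomin {a b : ℕ} {T X Y : Diagram} (hT : IsRect a b T) (hX : Tab X) (hY : Tab Y)
    (hYa : Y.length ≤ a) (hTX : ∀ x ∈ word T, ∀ y ∈ word X, x < y)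
    (hTY : ∀ x ∈ word T, ∀ y ∈ word Y, x < y) (hns : ¬ SS (attach a T X Y)) :
    ∃ X₁ Y', Fomin a (rightCut b X) Y X₁ Y' ∧ Tab X₁ ∧ Tab Y' ∧ Y'.length ≤ a ∧
      leftCut b (tmul (leftCut b X) X₁) = leftCut b X ∧
      rightCut b (tmul (leftCut b X) X₁) = X₁ ∧ Fomin a X₁ Y' (rightCut b X) Y ∧
      ¬ SS (attach a [] X₁ Y') ∧
      (attach a T (tmul (leftCut b X) X₁) Y').S = - (attach a T X Y).S := by
  have hE : IsRect a 0 [] := ⟨tab_nil, Or.inl ⟨rfl, rfl⟩⟩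
  rw [ss_attach_iff hT hX hY hYa hTX hTY] at hns
  set X₀ := leftCut b X with hX₀
  set X₂ := rightCut b X with hX₂
  have tX₀ : Tab X₀ := tab_leftCut hX.1 b
  have tX₂ : Tab X₂ := tab_rightCut hX.1 b
  have hfit : Fit b X₀ X₂ := fit_cut hX b
  have hcut : hcat X₀ X₂ = X := hcat_cut hX b
  set D := attach a [] X₂ Y with hD
  have sD : RowsSorted D := rowsSorted_attach tX₂ hY hYa
  have hDlen : D.length = a + X₂.length := by simp [hD, attach_eq]
  have hSS_rows : SS (topRows a [] Y) := SS.topRows hE hY hYa (by simp)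
  -- `Y` and `X₂` are tableaux, so violations occur only where they meet.
  have hvD : ∀ i j, D.Violation i j → i = a := fun i j h =>
    violation_append_eq hSS_rows tX₂.1 (by simp) h
  have hexD : ∃ i j, D.Violation i j := by
    rw [← semistandard_iff, Diagram.Semistandard] at hns
    push Not at hns
    exact hns sD
  have hX₂ne : X₂ ≠ [] := by
    intro h0
    apply hns
    rw [hD, h0, attach_eq, List.append_nil]
    exact hSS_rows
  obtain ⟨D', hrun⟩ := fominRun_exists sD hvD hexD
  have hrun' : FominRun a D' D := hrun.symm sD hvD
  -- Three properties survive every exchange: the number of rows, a non-empty last row, and the rows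
  -- of `X₀` as lower bounds for the rows from row `a` on. A bound for row `k + 1` implies the one
  -- for row `k` because the columns of `X₀` increase. The bounds make the new lower part fit beside
  -- `X₀`.
  obtain ⟨sD', hlen, hlast, hbd⟩ := hrun.preserves
    (p := fun E => E.length = a + X₂.length ∧ (∀ r ∈ E.getLast?, r ≠ []) ∧
      ∀ k r, E[a + k]? = some r → ∀ x ∈ r, ∀ y ∈ X₀.getD k [], y ≤ x)
    (fun i E E' sE hx hE => by
      obtain ⟨_, -, hsp⟩ := hx.exists_spec sE
      refine ⟨hsp.length_eq.trans hE.1, hx.last_ne_nil sE hE.2.1, ?_⟩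
      refine hx.bound sE (P := fun k x => ∀ y ∈ X₀.getD k [], y ≤ x)
        (fun k x y hxy h z hz => (h z hz).trans hxy) (fun k x hk h y hy => ?_) hE.1 hE.2.2
      have hov := tX₀.1.getD_over k
      have l1 := hfit.length_getD (k := k) (by omega)
      have l2 := hfit.length_getD (k := k + 1) (by omega)
      obtain ⟨c, hc, rfl⟩ := List.mem_iff_getElem.1 hy
      obtain ⟨z, hz, hlt⟩ := over_iff.1 hov c _ (List.getElem?_eq_getElem (by omega))
      rw [List.getElem?_eq_getElem hc, Option.some.injEq] at hz
      have := h _ (List.getElem_mem (show c < (X₀.getD (k + 1) []).length by omega))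
      omega) sD ⟨hDlen, by
        intro r hr
        rw [hD, attach_eq, List.getLast?_append_of_ne_nil _ hX₂ne] at hr
        exact tX₂.2 r (List.mem_of_mem_getLast? hr), fun k r hr => by
        rw [hD, attach_eq, List.getElem?_append_right (by simp), length_topRows,
          Nat.add_sub_cancel_left] at hr
        exact fit_of_rows hfit k r hr⟩
  have hvD' : ∀ i j, D'.Violation i j → i = a := (fominRun_iff.1 hrun).choose_spec.2.2
  obtain ⟨st, sd⟩ := ss_take_drop sD' hvD' (by omega)
  have hX₁len : (D'.drop a).length = X₂.length := by simp [hlen]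
  -- In a semistandard diagram empty rows can only be at the bottom, and `hlast` excludes one there.
  have tX₁ : Tab (D'.drop a) := by
    refine ⟨sd, ?_⟩
    have h1 := sd.eq_trim_append
    rcases Nat.eq_zero_or_pos ((D'.drop a).length - (Diagram.trim (D'.drop a)).length) with h0 | h0
    · rw [h0, List.replicate_zero, List.append_nil] at h1
      rw [h1]
      intro r hr
      simp only [Diagram.trim, List.mem_filter] at hr
      simpa using hr.2
    · exfalso
      have h2 : (D'.drop a).getLast? = some [] := by
        rw [h1, List.getLast?_append_of_ne_nil _ (by simp; omega), List.getLast?_replicate,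
          if_neg (by omega)]
      have hne : D'.drop a ≠ [] := by
        intro h; rw [h] at h2; simp at h2
      refine hlast [] ?_ rfl
      rw [← List.take_append_drop a D', List.getLast?_append_of_ne_nil _ hne]
      exact h2
  have tY' : Tab (Diagram.trim (D'.take a)) := st.tab_trim
  have hY'a : (Diagram.trim (D'.take a)).length ≤ a := by
    refine (List.length_filter_le _ _).trans ?_
    simp
  have hatt : attach a [] (D'.drop a) (Diagram.trim (D'.take a)) = D' := by
    rw [attach_eq, topRows_eq (by simp) hY'a]
    have h1 := st.eq_trim_append
    rw [List.length_take, min_eq_left (by omega)] at h1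
    change Diagram.trim (D'.take a) ++ List.replicate (a - (Diagram.trim (D'.take a)).length) []
      ++ _ = D'
    rw [← h1, List.take_append_drop]
  have hfit' : Fit b X₀ (D'.drop a) := hfit.replace hX₁len fun k r hr => by
    refine hbd k r ?_
    rwa [List.getElem?_drop] at hr
  have hmul : tmul X₀ (D'.drop a) = hcat X₀ (D'.drop a) := insertWord_hcat tX₁ hfit'.leftOf
  have hcols : ColsLE b X₀ := colsLE_leftCut b X
  refine ⟨D'.drop a, Diagram.trim (D'.take a), ⟨D', hrun, rfl, rfl⟩, tX₁, tY', hY'a, ?_, ?_, ?_,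
    ?_, ?_⟩
  · rw [hmul, hfit'.leftCut tX₀ hcols]
  · rw [hmul, hfit'.rightCut tX₀ hcols tX₁]
  · refine ⟨D, by rwa [hatt], ?_, ?_⟩
    · rw [hD, attach_eq, List.take_left' (by simp), topRows_eq (by simp) hYa, trim_append,
        trim_replicate, List.append_nil]
      exact (trim_eq_self hY.2).symm
    · rw [hD, attach_eq, List.drop_left' (by simp)]
  · rw [hatt, ← semistandard_iff]
    intro h
    obtain ⟨E, hE', -⟩ := fominRun_iff.1 hrun'
    obtain ⟨j, hj⟩ := hE'.1
    exact h.2 _ _ hj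
  -- In both attached diagrams the rows of Fomin's diagram have `b` boxes to their left, from `T` or
  -- from `X₀`, and below them are the rows of `X₀` beyond those of `X₂`.
  · have key := hrun.schur_lens b ((X₀.drop X₂.length).map fun r => (r.length : ℤ))
    have e1 : (attach a T X Y).map (fun r => (r.length : ℤ)) =
        lens b D ++ (X₀.drop X₂.length).map fun r => (r.length : ℤ) := by
      rw [hD, attach_eq, attach_eq, List.map_append, lens_topRows hT, lens_append,
        List.append_assoc, ← hfit.lens_hcat, hcut]
    have e2 : (attach a T (tmul X₀ (D'.drop a)) (Diagram.trim (D'.take a))).map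
        (fun r => (r.length : ℤ)) =
        lens b D' ++ (X₀.drop X₂.length).map fun r => (r.length : ℤ) := by
      conv_rhs => rw [← hatt, attach_eq]
      rw [attach_eq, List.map_append, lens_topRows hT, lens_append,
        List.append_assoc, ← hX₁len, ← hfit'.lens_hcat, hmul]
    rw [Diagram.S, Diagram.S, e1, e2, key]

/-! ### Lowering of factor sequences, and finiteness -/

section

variable {n : ℕ} {R : RectangleDiagram n} {𝒯 : TableauDiagram R}

/-! ### Factor sequences as labelled paths -/

/-- Labelled paths and factor sequences carry the same information; the former use plactic
identities and count steps. This lemma and `IsFactorSeq.exists_LP` translate between them. -/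
lemma LP.isFactorSeq {k : ℕ} {L : LPath} (h : LP 𝒯 k L) :
    IsFactorSeq 𝒯 (segs L) (L.map Prod.snd) := by
  induction h with
  | lowest =>
    have e : ((lowestPath n).map fun f => (f, ([] : Diagram))).map Prod.snd =
        List.replicate (2 * n) [] := by
      rw [List.map_map, List.eq_replicate_iff]
      refine ⟨by simp [lowestPath]; omega, by simp⟩
    rw [e]
    simpa [segs, Function.comp_def] using IsFactorSeq.lowest
  | step k α l u β h1 h2 h3 ih =>
    cases h1 with
    | split P Q Z hP hQ hZ e =>
      rw [hZ.eq_of_pl (tab_tmul hP Q) (e.trans (cl_tmul hP Q).symm)] at ih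
      have := IsFactorSeq.split (𝒯 := 𝒯) (segs α) (segs β) (α.map Prod.snd) (β.map Prod.snd) P Q
        (by simpa [segs] using h2) (by simp) (isTableau_iff.2 hP) (isTableau_iff.2 hQ)
        (by simpa [segs] using ih)
      simpa [segs] using this
    | merge Q P Z hZ e =>
      have hQ : Tab Q := LP.tab (α := α) (f := Seg.down) (β := (Seg.up, P) :: β)
        (by simpa using h3)
      have := IsFactorSeq.merge (𝒯 := 𝒯) (segs α) (segs β) (α.map Prod.snd) (β.map Prod.snd) Q P
        (by simpa [segs] using h2) (by simp) (by simpa [segs] using ih)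
      rw [← hZ.eq_of_pl (tab_tmul (tab_tmul hQ _) P) (by
        rw [pl_tmul (tab_tmul hQ _).rowsSorted, pl_tmul hQ.rowsSorted]; exact e)] at this
      simpa [segs] using this

lemma zip_append_cons {α β : List Seg} {A B : List Diagram} {f : Seg} {X : Diagram}
    (h : A.length = α.length) :
    (α ++ f :: β).zip (A ++ X :: B) = α.zip A ++ (f, X) :: β.zip B := by
  rw [List.zip_append h.symm, List.zip_cons_cons]

lemma segs_zip {α : List Seg} {A : List Diagram} (h : A.length = α.length) :
    segs (α.zip A) = α := List.map_fst_zip h.ge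

lemma IsFactorSeq.length_eq {γ : List Seg} {W : List Diagram} (h : IsFactorSeq 𝒯 γ W) :
    W.length = γ.length := by
  induction h with
  | lowest => simp [lowestPath]; omega
  | split α β A B P Q _ hA _ _ _ ih => simp at ih ⊢; omega
  | merge α β A B Q P _ hA _ ih => simp at ih ⊢; omega

lemma IsFactorSeq.exists_LP {γ : List Seg} {W : List Diagram} (h : IsFactorSeq 𝒯 γ W) :
    ∃ k, LP 𝒯 k (γ.zip W) := by
  induction h with
  | lowest =>
    have e : (lowestPath n).zip (List.replicate (2 * n) []) =
        (lowestPath n).map fun f => (f, ([] : Diagram)) := by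
      refine List.ext_getElem (by simp [lowestPath]; omega) fun i h1 h2 => ?_
      simp
    exact ⟨0, e ▸ LP.lowest⟩
  | split α β A B P Q hp hA hP hQ h ih =>
    obtain ⟨k, hk⟩ := ih
    have hP := isTableau_iff.1 hP
    have hQ := isTableau_iff.1 hQ
    have hB : B.length = β.length := by
      have := h.length_eq
      simp at this
      omega
    rw [zip_append_cons hA] at hk ⊢
    rw [List.zip_cons_cons]
    exact ⟨k + 1, hk.split (by simpa [segs_zip hA, segs_zip hB] using hp) hP hQ (tab_tmul hP Q)
      (cl_tmul hP Q)⟩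
  | merge α β A B Q P hp hA h ih =>
    obtain ⟨k, hk⟩ := ih
    have hB : B.length = β.length := by
      have := h.length_eq
      simp at this
      omega
    rw [zip_append_cons hA] at hk ⊢
    rw [List.zip_cons_cons] at hk
    have hQ := hk.tab
    refine ⟨k + 1, hk.merge (by simpa [segs_zip hA, segs_zip hB] using hp)
      (tab_tmul (tab_tmul hQ _) P) ?_⟩
    rw [cl_tmul (tab_tmul hQ _), cl_tmul hQ, ep, segs_zip hA]

lemma LP.isFactorSeq_zip {k : ℕ} {γ : List Seg} {W : List Diagram} (h : LP 𝒯 k (γ.zip W))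
    (hl : W.length = γ.length) : IsFactorSeq 𝒯 γ W := by
  have := h.isFactorSeq
  rwa [segs_zip hl, List.map_snd_zip hl.le] at this

lemma IsFactorSeq.exists_append {α β : List Seg} {W : List Diagram}
    (h : IsFactorSeq 𝒯 (α ++ β) W) : ∃ A B, W = A ++ B ∧ A.length = α.length ∧
      B.length = β.length := by
  have := h.length_eq
  rw [List.length_append] at this
  exact ⟨W.take α.length, W.drop α.length, (List.take_append_drop _ _).symm, by simp; omega,
    by simp; omega⟩

lemma IsFactorSeq.exists_cons {α β : List Seg} {f : Seg} {W : List Diagram}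
    (h : IsFactorSeq 𝒯 (α ++ f :: β) W) : ∃ A X B, W = A ++ X :: B ∧ A.length = α.length ∧
      B.length = β.length := by
  obtain ⟨A, B, rfl, hA, hB⟩ := h.exists_append
  rcases B with _ | ⟨X, B⟩
  · simp at hB
  · exact ⟨A, X, B, rfl, hA, by simpa using hB⟩

lemma IsFactorSeq.exists_cons_cons {α β : List Seg} {f g : Seg} {W : List Diagram}
    (h : IsFactorSeq 𝒯 (α ++ f :: g :: β) W) : ∃ A X Y B, W = A ++ X :: Y :: B ∧
      A.length = α.length ∧ B.length = β.length := by
  obtain ⟨A, X, B, rfl, hA, hB⟩ := h.exists_cons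
  rcases B with _ | ⟨Y, B⟩
  · simp at hB
  · exact ⟨A, X, Y, B, rfl, hA, by simpa using hB⟩

lemma IsFactorSeq.tab {γ : List Seg} {W : List Diagram} (h : IsFactorSeq 𝒯 γ W) :
    ∀ X ∈ W, Tab X := by
  intro X hX
  obtain ⟨A, B, rfl⟩ := List.append_of_mem hX
  have hl := h.length_eq
  obtain ⟨k, hk⟩ := h.exists_LP
  have hγ : γ = γ.take A.length ++ γ.drop A.length := (List.take_append_drop _ _).symm
  rcases hd : γ.drop A.length with _ | ⟨f, β⟩
  · have := congrArg List.length hd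
    simp at this hl
    omega
  · rw [hγ, hd, zip_append_cons (by simp at hl ⊢; omega)] at hk
    exact hk.tab

/-- The sequence may have been constructed through other lower paths; by `LP.lower` it also arises
through this one. -/
lemma IsFactorSeq.lower_split {α β : List Seg} {A B : List Diagram} {P Q : Diagram}
    (hA : A.length = α.length)
    (h : IsFactorSeq 𝒯 (α ++ Seg.up :: Seg.down :: β) (A ++ P :: Q :: B)) :
    IsFactorSeq 𝒯 (α ++ Seg.horiz :: β) (A ++ tmul P Q :: B) := by
  have hl := h.length_eq
  obtain ⟨k, hk⟩ := h.exists_LP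
  rw [zip_append_cons hA, List.zip_cons_cons] at hk
  obtain ⟨hP, hQ, j, Z, -, hZ, e, hj⟩ := hk.lower_split
  rw [hZ.eq_of_pl (tab_tmul hP Q) (e.trans (cl_tmul hP Q).symm), ← zip_append_cons hA] at hj
  exact hj.isFactorSeq_zip (by simp at hl ⊢; omega)

lemma IsFactorSeq.angle {α β : List Seg} {A B : List Diagram} {X Y : Diagram}
    (hA : A.length = α.length)
    (h : IsFactorSeq 𝒯 (α ++ Seg.down :: Seg.up :: β) (A ++ X :: Y :: B)) :
    IsRect (R.rows (endpoint α).1 ((endpoint α).2 + 1)) (R.cols (endpoint α).1 ((endpoint α).2 + 1))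
      (𝒯.T (endpoint α).1 ((endpoint α).2 + 1)) ∧ Tab X ∧ Tab Y ∧
    (∀ x ∈ word (𝒯.T (endpoint α).1 ((endpoint α).2 + 1)), ∀ y ∈ word X, x < y) ∧
    ∀ x ∈ word (𝒯.T (endpoint α).1 ((endpoint α).2 + 1)), ∀ y ∈ word Y, x < y := by
  obtain ⟨k, hk⟩ := h.exists_LP
  rw [zip_append_cons hA, List.zip_cons_cons] at hk
  have := hk.angle
  rw [ep, segs_zip hA] at this
  exact ⟨isRect_tabAt this.1 this.2.1, this.2.2⟩

/-- Each factor sequence of the upper path comes from labels which fit around the rectangle. -/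
lemma IsFactorSeq.lower_merge {α β : List Seg} {A B : List Diagram} {Z : Diagram}
    (hA : A.length = α.length)
    (h : IsFactorSeq 𝒯 (α ++ Seg.horiz :: β) (A ++ Z :: B)) :
    ∃ Y, IsFactorSeq 𝒯 (α ++ Seg.down :: Seg.up :: β)
        (A ++ Z.drop (R.rows (endpoint α).1 ((endpoint α).2 + 1)) :: Y :: B) ∧
      Z.take (R.rows (endpoint α).1 ((endpoint α).2 + 1)) =
        hcat (𝒯.T (endpoint α).1 ((endpoint α).2 + 1)) Y ∧
      Y.length ≤ R.rows (endpoint α).1 ((endpoint α).2 + 1) := by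
  have hl := h.length_eq
  obtain ⟨k, hk⟩ := h.exists_LP
  rw [zip_append_cons hA] at hk
  obtain ⟨hZ, j, Q, P, -, e, hj⟩ := hk.lower_merge
  -- Lowering gives some pair of labels for the angle; the moves replace it by the pair read off
  -- from a horizontal cut of `Z`.
  have hang := hj.angleRel (moves j).1 (moves j).2
  obtain ⟨Y, h1, h2, h3⟩ := hang.exists_horiz hj hZ e
  rw [ep, segs_zip hA] at h1 h2 h3
  refine ⟨Y, LP.isFactorSeq_zip (k := j) ?_ (by simp at hl ⊢; omega), h2, h3⟩
  rw [zip_append_cons hA, List.zip_cons_cons]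
  exact h1

lemma IsFactorSeq.eq_lowest {W : List Diagram} (h : IsFactorSeq 𝒯 (lowestPath n) W) :
    W = List.replicate (2 * n) [] := by
  have hl := h.length_eq
  obtain ⟨k, hk⟩ := h.exists_LP
  generalize hL : (lowestPath n).zip W = L at hk
  have hs : segs L = lowestPath n := by rw [← hL, segs_zip hl]
  cases hk with
  | lowest =>
    have := congrArg (List.map Prod.snd) hL
    rw [List.map_snd_zip hl.le, List.map_map] at this
    rw [this, List.eq_replicate_iff]
    exact ⟨by simp [lowestPath]; omega, by simp⟩
  | step k α l u β h1 _ _ => exact (lowest_not_site h1.isSite hs.symm).elim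

/-! ### Induction on paths -/

/-- Twice the number of pairs of an up step and a later down step, where a horizontal step counts
as one half of such a pair with itself. -/
def area : List Seg → ℕ
  | [] => 0
  | Seg.down :: γ => area γ
  | Seg.up :: γ => 2 * (endpoint γ).2 + area γ
  | Seg.horiz :: γ => 2 * (endpoint γ).2 + area γ + 1

lemma area_append (α β : List Seg) :
    area (α ++ β) = area α + 2 * ((endpoint α).1 * (endpoint β).2) + area β := by
  induction α with
  | nil => simp [area, endpoint]
  | cons f α ih =>
    rcases f <;> simp only [List.cons_append, area, ih, endpoint, endpoint_append, Prod.snd_add] <;>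
      ring

lemma LowerSegs.area_lt {l u : List Seg} (h : LowerSegs l u) (α β : List Seg) :
    area (α ++ l ++ β) < area (α ++ u ++ β) := by
  simp only [area_append, endpoint_append, h.endpoint_eq]
  cases h <;> simp [area, endpoint]

lemma site_or_lowest (γ : List Seg) : (∃ α β, γ = α ++ Seg.horiz :: β) ∨
    (∃ α β, γ = α ++ Seg.up :: Seg.down :: β) ∨
    ∃ p q, γ = List.replicate p Seg.down ++ List.replicate q Seg.up := by
  induction γ with
  | nil => exact Or.inr (Or.inr ⟨0, 0, rfl⟩)
  | cons f γ ih =>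
    rcases ih with ⟨α, β, rfl⟩ | ⟨α, β, rfl⟩ | ⟨p, q, rfl⟩
    · exact Or.inl ⟨f :: α, β, rfl⟩
    · exact Or.inr (Or.inl ⟨f :: α, β, rfl⟩)
    · cases f with
      | horiz => exact Or.inl ⟨[], _, rfl⟩
      | down => exact Or.inr (Or.inr ⟨p + 1, q, rfl⟩)
      | up =>
        rcases p with _ | p
        · exact Or.inr (Or.inr ⟨0, q + 1, rfl⟩)
        · exact Or.inr (Or.inl ⟨[], _, rfl⟩)

lemma endpoint_replicate (p q : ℕ) :
    endpoint (List.replicate p Seg.down ++ List.replicate q Seg.up) = (q, p) := by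
  induction p with
  | zero =>
    induction q with
    | zero => rfl
    | succ q ih =>
      rw [List.replicate_zero, List.nil_append] at ih ⊢
      rw [List.replicate_succ, endpoint, ih]
  | succ p ih => rw [List.replicate_succ, List.cons_append, endpoint, ih]

/-- Lowering decreases `area`, and a path which cannot be lowered goes only down and then only up,
so its end point identifies it as the lowest one. -/
lemma path_induction {motive : List Seg → Prop} (lowest : motive (lowestPath n))
    (split : ∀ α β, IsPath n (α ++ Seg.up :: Seg.down :: β) → motive (α ++ Seg.horiz :: β) →
      motive (α ++ Seg.up :: Seg.down :: β))
    (merge : ∀ α β, IsPath n (α ++ Seg.horiz :: β) → motive (α ++ Seg.down :: Seg.up :: β) →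
      motive (α ++ Seg.horiz :: β)) {γ : List Seg} (hγ : IsPath n γ) : motive γ := by
  induction hm : area γ using Nat.strong_induction_on generalizing γ with
  | _ m ih =>
  subst hm
  rcases site_or_lowest γ with ⟨α, β, rfl⟩ | ⟨α, β, rfl⟩ | ⟨p, q, rfl⟩
  · refine merge α β hγ (ih _ ?_ ?_ rfl)
    · simpa using LowerSegs.merge.area_lt α β
    · simpa using LowerSegs.merge.isPath (α := α) (β := β) (by simpa using hγ)
  · refine split α β hγ (ih _ ?_ ?_ rfl)
    · simpa using LowerSegs.split.area_lt α β
    · simpa using LowerSegs.split.isPath (α := α) (β := β) (by simpa using hγ)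
  · have := hγ.1
    rw [endpoint_replicate, Prod.mk.injEq] at this
    obtain ⟨rfl, rfl⟩ := this
    exact lowest

/-! ### Finiteness -/

lemma factorPairs_finite (m : Plactic) :
    {p : Diagram × Diagram | Tab p.1 ∧ Tab p.2 ∧ cl p.1 * cl p.2 = m}.Finite := by
  by_cases hne : ∃ w, pl w = m
  · obtain ⟨w, rfl⟩ := hne
    have hfin := finite_diagrams (s := {x | x ∈ w}) (List.finite_toSet _) w.length w.length
    refine (hfin.prod hfin).subset ?_
    rintro ⟨P, Q⟩ ⟨hP, hQ, e⟩
    have hp : (word P ++ word Q).Perm w := perm_of_pl (by rw [pl_append]; exact e)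
    have hlen : ∀ D : Diagram, Tab D → D.length ≤ D.flatten.length := by
      intro D hD
      induction D with
      | nil => simp
      | cons r D ih =>
        have h1 := tab_cons.1 hD
        have h2 := List.length_pos_iff.2 h1.1
        have := ih h1.2.2.2
        simp only [List.flatten_cons, List.length_cons, List.length_append]
        omega
    have l1 := (word_perm_flatten P).length_eq
    have l2 := (word_perm_flatten Q).length_eq
    have l3 := hp.length_eq
    have l4 := hlen P hP
    have l5 := hlen Q hQ
    rw [List.length_append] at l3
    refine ⟨⟨by simp only; omega, by simp only; omega, fun x hx => ?_⟩, by simp only; omega,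
      by simp only; omega, fun x hx => ?_⟩
    · exact hp.subset (List.mem_append_left _ (mem_word_iff.2 hx))
    · exact hp.subset (List.mem_append_right _ (mem_word_iff.2 hx))
  · refine Set.finite_empty.subset ?_
    rintro ⟨P, Q⟩ ⟨-, -, e⟩
    exact hne ⟨word P ++ word Q, by rw [pl_append]; exact e⟩

lemma tmul_finite (U : Diagram) :
    {p : Diagram × Diagram | Tab p.1 ∧ Tab p.2 ∧ tmul p.1 p.2 = U}.Finite := by
  refine (factorPairs_finite (cl U)).subset ?_
  rintro ⟨P, Q⟩ ⟨hP, hQ, rfl⟩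
  exact ⟨hP, hQ, (cl_tmul hP Q).symm⟩

/-- Finiteness is inherited from the lower path: a tableau has finitely many factorizations, and a
merged label is determined by the labels fitting around the rectangle. -/
lemma isFactorSeq_finite {γ : List Seg} (hγ : IsPath n γ) : {W | IsFactorSeq 𝒯 γ W}.Finite := by
  refine path_induction (n := n) (motive := fun γ => {W | IsFactorSeq 𝒯 γ W}.Finite) ?_ ?_ ?_ hγ
  · exact (Set.finite_singleton (List.replicate (2 * n) ([] : Diagram))).subset fun W hW =>
      hW.eq_lowest
  · intro α β hp ih
    have hfin := ih.biUnion (t := fun W' => (fun p : Diagram × Diagram =>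
      W'.take α.length ++ p.1 :: p.2 :: W'.drop (α.length + 1)) ''
        {p | Tab p.1 ∧ Tab p.2 ∧ tmul p.1 p.2 = W'.getD α.length []})
      fun W' _ => (tmul_finite _).image _
    refine hfin.subset ?_
    intro W hW
    obtain ⟨A, P, Q, B, rfl, hA, hB⟩ := IsFactorSeq.exists_cons_cons hW
    refine Set.mem_biUnion (IsFactorSeq.lower_split hA hW) ?_
    refine ⟨(P, Q), ⟨hW.tab P (by simp), hW.tab Q (by simp), ?_⟩, ?_⟩
    · simp [← hA]
    · simp [← hA]
  · intro α β hp ih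
    refine (ih.image fun W' => W'.take α.length ++
      Diagram.trim (attach (R.rows (endpoint α).1 ((endpoint α).2 + 1))
        (𝒯.T (endpoint α).1 ((endpoint α).2 + 1)) (W'.getD α.length [])
          (W'.getD (α.length + 1) [])) :: W'.drop (α.length + 2)).subset ?_
    intro W hW
    obtain ⟨A, Z, B, rfl, hA, hB⟩ := IsFactorSeq.exists_cons hW
    obtain ⟨Y, h1, h2, h3⟩ := IsFactorSeq.lower_merge hA hW
    refine ⟨_, h1, ?_⟩
    have hang := h1.angle hA
    have hatt := attach_take_drop hang.1.length_le h3 h2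
    have hZ : Tab Z := hW.tab Z (by simp)
    simp [← hA] at hatt ⊢
    rw [hatt, trim_append, trim_replicate, trim_eq_self hZ.2, List.append_nil]

end

/-! ### The sum over factor sequences, and the cancellation -/

/-! ### Schur functions of tableaux -/

/-- The last row of the larger determinant is `0, …, 0, 1`. -/
lemma schur_append_zero (I : List ℤ) : schur (I ++ [0]) = schur I := by
  rw [schur_eq_det (N := I.length + 1) (by simp), schur_eq_det (I := I) rfl,
    Matrix.det_succ_row _ (Fin.last _), Fin.sum_univ_castSucc, Finset.sum_eq_zero, zero_add]
  · have h1 : (-1 : Lam) ^ ((Fin.last I.length : ℕ) + (Fin.last I.length : ℕ)) = 1 :=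
      Even.neg_one_pow ⟨_, rfl⟩
    rw [h1, one_mul]
    have h2 : Matrix.of (fun i j : Fin (I.length + 1) =>
        hSym ((I ++ [0]).getD i 0 + (j : ℤ) - (i : ℤ))) (Fin.last _) (Fin.last _) = 1 := by
      simp [hSym]
    rw [h2, one_mul]
    congr 1
    ext i j
    simp [Fin.succAbove_last]
  · intro j _
    have : hSym ((I ++ [0]).getD (Fin.last I.length : ℕ) 0 + ((j.castSucc : ℕ) : ℤ)
        - ((Fin.last I.length : ℕ) : ℤ)) = 0 := by
      have := j.2
      rw [hSym, if_pos]
      simp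
    simp only [Matrix.of_apply, this, mul_zero, zero_mul]

lemma S_append_replicate (D : Diagram) (m : ℕ) :
    Diagram.S (D ++ List.replicate m []) = D.S := by
  induction m with
  | zero => simp
  | succ m ih =>
    rw [List.replicate_succ', ← List.append_assoc, Diagram.S, List.map_append, List.map_singleton,
      List.length_nil, Nat.cast_zero, schur_append_zero]
    exact ih

lemma SS.S_trim {D : Diagram} (h : SS D) : (Diagram.trim D).S = D.S := by
  conv_rhs => rw [h.eq_trim_append]
  rw [S_append_replicate]

lemma SS.shape_sorted {D : Diagram} (h : SS D) : D.shape.SortedGE := by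
  have : D.shape.Pairwise (· ≥ ·) := by
    induction D with
    | nil => simp [Diagram.shape]
    | cons r D ih =>
      obtain ⟨-, h2, h3⟩ := h
      have hl := h2.length_le
      have ih := ih h3
      rw [Diagram.shape, List.map_cons, List.pairwise_cons]
      refine ⟨?_, ih⟩
      rcases D with _ | ⟨s, D⟩
      · simp
      · rw [Diagram.shape, List.map_cons, List.pairwise_cons] at ih
        intro x hx
        rw [List.map_cons, List.mem_cons] at hx
        rcases hx with rfl | hx
        · simpa using hl
        · exact (ih.1 x hx).trans (by simpa using hl)
  exact this.sortedGE

lemma Tab.exists_youngDiagram {D : Diagram} (h : Tab D) : ∃ μ : YoungDiagram,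
    D.shape = μ.rowLens := by
  refine ⟨YoungDiagram.ofRowLens D.shape h.1.shape_sorted, ?_⟩
  rw [YoungDiagram.rowLens_ofRowLens_eq_self]
  intro x hx
  obtain ⟨r, hr, rfl⟩ := List.mem_map.1 hx
  exact List.length_pos_iff.2 (h.2 r hr)

open Classical in
/-- The Young diagram of a tableau. -/
noncomputable def yd (D : Diagram) : YoungDiagram :=
  if h : ∃ μ : YoungDiagram, D.shape = μ.rowLens then h.choose else ⊥

lemma Tab.shape_eq {D : Diagram} (h : Tab D) : D.shape = (yd D).rowLens := by
  rw [yd, dif_pos h.exists_youngDiagram]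
  exact h.exists_youngDiagram.choose_spec

lemma rowLens_injective : Function.Injective YoungDiagram.rowLens := fun _ _ h =>
  YoungDiagram.equivListRowLens.injective (Subtype.ext h)

lemma Tab.yd_eq_iff {D : Diagram} (h : Tab D) {μ : YoungDiagram} :
    yd D = μ ↔ D.shape = μ.rowLens := by
  rw [h.shape_eq]
  exact rowLens_injective.eq_iff.symm

lemma Tab.S_eq {D : Diagram} (h : Tab D) : D.S = schur (parts (yd D)) := by
  rw [Diagram.S, lens_eq_parts_iff.2 h.shape_eq]

lemma Tab.colLen_yd {D : Diagram} (h : Tab D) : (yd D).colLen 0 = D.length := by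
  rw [← YoungDiagram.length_rowLens, ← h.shape_eq, Diagram.shape, List.length_map]

lemma Tab.rowLen_yd {D : Diagram} (h : Tab D) (k : ℕ) :
    (yd D).rowLen k = (D.getD k []).length := by
  rcases lt_or_ge k D.length with hk | hk
  · have h1 : k < (yd D).rowLens.length := by
      rw [YoungDiagram.length_rowLens, h.colLen_yd]; exact hk
    have h2 : (yd D).rowLens[k] = D.shape[k]'(by simpa [Diagram.shape] using hk) :=
      List.getElem_of_eq h.shape_eq.symm _
    rw [YoungDiagram.get_rowLens] at h2
    rw [h2, List.getD_eq_getElem _ _ hk]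
    simp [Diagram.shape]
  · rw [List.getD_eq_default _ _ hk, List.length_nil]
    by_contra h0
    have h1 : (k, 0) ∈ yd D := YoungDiagram.mem_iff_lt_rowLen.2 (by omega)
    rw [YoungDiagram.mem_iff_lt_colLen, h.colLen_yd] at h1
    omega

lemma schur_attachParts {a b : ℕ} {T X Y : Diagram} (hT : IsRect a b T) (hX : Tab X)
    (hY : Tab Y) : schur (attachParts a b (yd X) (yd Y)) = (attach a T X Y).S := by
  rw [Diagram.S, attach_eq, List.map_append, lens_topRows hT, lens_eq_parts_iff.2 hX.shape_eq,
    attachParts]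
  congr 2
  simp only [lens, topRows, List.map_map]
  refine List.map_congr_left fun k _ => ?_
  simp [hY.rowLen_yd k]

/-! ### Tensors -/

lemma tensorBasis_apply (ℓ : ℕ) (ν : Fin ℓ → YoungDiagram) :
    tensorBasis ℓ ν = PiTensorProduct.tprod ℤ fun k => schur (parts (ν k)) := by
  rw [tensorBasis, Basis.piTensorProduct_apply]
  simp [schurBasis]

/-- The sequence of shapes of a sequence of tableaux. -/
noncomputable def shapes (ℓ : ℕ) (W : List Diagram) : Fin ℓ → YoungDiagram :=
  fun k => yd (W.getD k [])

lemma ofFn_shapes {ℓ : ℕ} {W : List Diagram} (h : W.length = ℓ) :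
    List.ofFn (shapes ℓ W) = W.map yd := by
  subst h
  refine List.ext_getElem (by simp) fun i h1 h2 => ?_
  have h3 : i < W.length := by simpa using h2
  simp [shapes, List.getElem?_eq_getElem h3]

lemma tensorS_eq {ℓ : ℕ} {W : List Diagram} (h : W.length = ℓ) (hW : ∀ X ∈ W, Tab X) :
    tensorS ℓ W = tensorBasis ℓ (shapes ℓ W) := by
  subst h
  rw [tensorBasis_apply, tensorS, pureTensor]
  congr 1
  funext k
  simp [shapes, (hW _ (List.getElem_mem k.2)).S_eq]

lemma schurs_map_yd {W : List Diagram} (hW : ∀ X ∈ W, Tab X) :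
    schurs (W.map yd) = W.map Diagram.S := by
  rw [schurs, List.map_map]
  exact List.map_congr_left fun X hX => (hW X hX).S_eq.symm

lemma getD_append_cons_eq_update {ℓ : ℕ} (A B : List Lam) (f : Lam) (hA : A.length < ℓ) :
    (fun k : Fin ℓ => (A ++ f :: B).getD k 1) =
      Function.update (fun k : Fin ℓ => (A ++ 0 :: B).getD k 1) ⟨A.length, hA⟩ f := by
  funext k
  by_cases hk : k = ⟨A.length, hA⟩
  · subst hk
    simp
  · rw [Function.update_of_ne hk]
    have hk' : (k : ℕ) ≠ A.length := fun h => hk (Fin.ext h)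
    simp only [List.getD_eq_getElem?_getD]
    rcases lt_or_ge (k : ℕ) A.length with h | h
    · rw [List.getElem?_append_left h, List.getElem?_append_left h]
    · obtain ⟨m, hm⟩ : ∃ m, (k : ℕ) = A.length + (m + 1) := ⟨k - A.length - 1, by omega⟩
      rw [List.getElem?_append_right (by omega), List.getElem?_append_right (by omega), hm]
      simp

lemma pureTensor_zero {ℓ : ℕ} (A B : List Lam) (hA : A.length < ℓ) :
    pureTensor ℓ (A ++ 0 :: B) = 0 := by
  rw [pureTensor, getD_append_cons_eq_update A B 0 hA, MultilinearMap.map_update_zero]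

lemma pureTensor_neg {ℓ : ℕ} (A B : List Lam) (f : Lam) (hA : A.length < ℓ) :
    pureTensor ℓ (A ++ -f :: B) = - pureTensor ℓ (A ++ f :: B) := by
  rw [pureTensor, pureTensor, getD_append_cons_eq_update A B _ hA,
    getD_append_cons_eq_update A B f hA, MultilinearMap.map_update_neg]

/-- When the factorizations of `U` are grouped by the shapes of the factors, each pair of shapes
occurs as often as its Littlewood-Richardson coefficient says. -/
lemma splitMap_tensorS {ℓ ℓ' : ℕ} {A B : List Diagram} {U : Diagram}
    (hℓ : (A ++ U :: B).length = ℓ) (hW : ∀ X ∈ A ++ U :: B, Tab X) :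
    splitMap A.length ℓ ℓ' (tensorS ℓ (A ++ U :: B)) =
      ∑ p ∈ (tmul_finite U).toFinset, tensorS ℓ' (A ++ p.1 :: p.2 :: B) := by
  classical
  have hU : Tab U := hW U (by simp)
  have hA : ∀ X ∈ A, Tab X := fun X hX => hW X (by simp [hX])
  have hB : ∀ X ∈ B, Tab X := fun X hX => hW X (by simp [hX])
  rw [tensorS_eq hℓ hW, splitMap, Module.Basis.constr_basis, ofFn_shapes hℓ]
  have e1 : ((A ++ U :: B).map yd).drop A.length = yd U :: B.map yd := by simp
  have e2 : ((A ++ U :: B).map yd).take A.length = A.map yd := by simp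
  rw [e1, e2]
  simp only
  set t : YoungDiagram × YoungDiagram → ⨂[ℤ]^ℓ' Lam := fun p =>
    pureTensor ℓ' (schurs (A.map yd ++ p.1 :: p.2 :: B.map yd)) with ht
  set s := (tmul_finite U).toFinset with hs
  have hmem : ∀ p, p ∈ s ↔ Tab p.1 ∧ Tab p.2 ∧ tmul p.1 p.2 = U := fun p => by
    simp [hs]
  have hcard : ∀ p : YoungDiagram × YoungDiagram, lrCoeff (yd U) p.1 p.2 =
      ((s.filter fun q => (yd q.1, yd q.2) = p).card : ℤ) := by
    rintro ⟨σ, τ⟩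
    rw [lrCoeff_eq hU hU.shape_eq, ← Set.ncard_coe_finset]
    congr 2
    ext ⟨P, Q⟩
    simp only [factorPairs, Set.mem_ofPred_eq, Finset.coe_filter, hmem, Prod.mk.injEq]
    constructor
    · rintro ⟨h1, h2, h3, h4, h5⟩
      exact ⟨⟨h1, h2, h3⟩, h1.yd_eq_iff.2 h4, h2.yd_eq_iff.2 h5⟩
    · rintro ⟨⟨h1, h2, h3⟩, h4, h5⟩
      exact ⟨h1, h2, h3, h1.yd_eq_iff.1 h4, h2.yd_eq_iff.1 h5⟩
  have hR : ∀ p ∈ s, tensorS ℓ' (A ++ p.1 :: p.2 :: B) = t (yd p.1, yd p.2) := by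
    intro p hp
    obtain ⟨h1, h2, -⟩ := (hmem p).1 hp
    rw [ht]
    simp only
    rw [← List.map_cons, ← List.map_cons, ← List.map_append, schurs_map_yd]
    · rfl
    · intro X hX
      simp only [List.mem_append, List.mem_cons] at hX
      rcases hX with hX | rfl | rfl | hX
      · exact hA X hX
      · exact h1
      · exact h2
      · exact hB X hX
  -- The formal sum over all pairs of shapes reduces to the shapes of actual factorizations, as the
  -- other coefficients vanish.
  rw [Finset.sum_congr rfl hR, Finset.sum_comp t fun p : Diagram × Diagram => (yd p.1, yd p.2),
    finsum_eq_sum_of_support_subset (s := s.image fun p => (yd p.1, yd p.2))]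
  · refine Finset.sum_congr rfl fun p _ => ?_
    rw [hcard, natCast_zsmul]
  · intro p hp
    rw [Function.mem_support] at hp
    have h0 : lrCoeff (yd U) p.1 p.2 ≠ 0 := fun h => hp (by rw [h, zero_smul])
    rw [hcard, Nat.cast_ne_zero, Finset.card_ne_zero] at h0
    obtain ⟨q, hq⟩ := h0
    rw [Finset.mem_filter] at hq
    exact Finset.mem_coe.2 (Finset.mem_image.2 ⟨q, hq.1, hq.2⟩)

lemma mergeMap_tensorS {a b ℓ ℓ' : ℕ} {A B : List Diagram} {T X Y : Diagram}
    (hT : IsRect a b T) (hℓ : (A ++ X :: Y :: B).length = ℓ)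
    (hW : ∀ Z ∈ A ++ X :: Y :: B, Tab Z) :
    mergeMap a b A.length ℓ ℓ' (tensorS ℓ (A ++ X :: Y :: B)) =
      if Y.length ≤ a then
        pureTensor ℓ' (A.map Diagram.S ++ (attach a T X Y).S :: B.map Diagram.S) else 0 := by
  have hX : Tab X := hW X (by simp)
  have hY : Tab Y := hW Y (by simp)
  have hA : ∀ X ∈ A, Tab X := fun X hX => hW X (by simp [hX])
  have hB : ∀ X ∈ B, Tab X := fun X hX => hW X (by simp [hX])
  rw [tensorS_eq hℓ hW, mergeMap, Module.Basis.constr_basis, ofFn_shapes hℓ]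
  have e1 : ((A ++ X :: Y :: B).map yd).drop A.length = yd X :: yd Y :: B.map yd := by simp
  have e2 : ((A ++ X :: Y :: B).map yd).take A.length = A.map yd := by simp
  rw [e1, e2]
  simp only [hY.colLen_yd, schurs_map_yd hA, schurs_map_yd hB, schur_attachParts hT hX hY]

section

/-! ### Cancellation by Fomin's involution -/

/-- A form of the cancellation argument for an involution given as a relation, as Fomin's is. -/
lemma sum_eq_zero_of_matching {ι M : Type*} [AddCommGroup M] (s : Finset ι) (f : ι → M)
    (r : ι → ι → Prop) (hex : ∀ x ∈ s, ∃ y ∈ s, r x y) (hsymm : ∀ x ∈ s, ∀ y, r x y → r y x)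
    (huniq : ∀ x ∈ s, ∀ y z, r x y → r x z → y = z) (hne : ∀ x ∈ s, ∀ y, r x y → y ≠ x)
    (hf : ∀ x ∈ s, ∀ y, r x y → f x + f y = 0) : ∑ x ∈ s, f x = 0 := by
  choose g hg hr using hex
  exact Finset.sum_involution g (fun x hx => hf x hx _ (hr x hx))
    (fun x hx _ => hne x hx _ (hr x hx)) hg
    (fun x hx => huniq _ (hg x hx) _ _ (hr _ (hg x hx)) (hsymm x hx _ (hr x hx)))

lemma tmul_leftCut_rightCut {X : Diagram} (hX : Tab X) (b : ℕ) :
    tmul (leftCut b X) (rightCut b X) = X := by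
  rw [tmul_eq_insertWord, insertWord_hcat (tab_rightCut hX.1 b) (fit_cut hX b).leftOf, hcat_cut hX]

/-- The pairs of labels in position `k` and `k + 1` correspond under Fomin's involution. -/
def FominRel (a b k : ℕ) (W W' : List Diagram) : Prop :=
  ∃ A X Y B X₁ Y', W = A ++ X :: Y :: B ∧ A.length = k ∧
    W' = A ++ tmul (leftCut b X) X₁ :: Y' :: B ∧ Fomin a (rightCut b X) Y X₁ Y'

lemma append_cons_cons_inj {α : Type*} {A A' B B' : List α} {x y x' y' : α}
    (h : A ++ x :: y :: B = A' ++ x' :: y' :: B') (hl : A.length = A'.length) :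
    A = A' ∧ x = x' ∧ y = y' ∧ B = B' := by
  simpa using List.append_inj h hl

/-- A sequence whose labels in position `k` and `k + 1` do not fit around `T`, but contribute to
the element of the upper path. -/
def NonFitting (a k : ℕ) (T : Diagram) (W : List Diagram) : Prop :=
  ∃ A X Y B, W = A ++ X :: Y :: B ∧ A.length = k ∧ Y.length ≤ a ∧ ¬ SS (attach a T X Y) ∧
    (attach a T X Y).S ≠ 0

/-- A sequence whose labels in position `k` and `k + 1` fit around `T`. -/
def Fitting (a k : ℕ) (T : Diagram) (W : List Diagram) : Prop :=
  ∃ A X Y B, W = A ++ X :: Y :: B ∧ A.length = k ∧ Y.length ≤ a ∧ SS (attach a T X Y)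

/-- The properties of the set `F` of factor sequences of a path with a down-pointing angle at a
rectangle with tableau `T`, the labels of the angle being in position `k` and `k + 1`. -/
structure AngleSet (a b k ℓ : ℕ) (T : Diagram) (F : Finset (List Diagram)) : Prop where
  exists_eq : ∀ W ∈ F, ∃ A X Y B, W = A ++ X :: Y :: B ∧ A.length = k
  length_eq : ∀ W ∈ F, W.length = ℓ
  tab : ∀ W ∈ F, ∀ X ∈ W, Tab X
  isRect : F.Nonempty → IsRect a b T
  lt_left : ∀ A X Y B, A.length = k → A ++ X :: Y :: B ∈ F → ∀ x ∈ word T, ∀ y ∈ word X, x < y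
  lt_right : ∀ A X Y B, A.length = k → A ++ X :: Y :: B ∈ F → ∀ x ∈ word T, ∀ y ∈ word Y, x < y

variable {a b k ℓ ℓ' : ℕ} {T : Diagram} {F F' : Finset (List Diagram)}

lemma AngleSet.mergeMap_eq (hF : AngleSet a b k ℓ T F) {A B : List Diagram} {X Y : Diagram}
    (hA : A.length = k) (h : A ++ X :: Y :: B ∈ F) :
    mergeMap a b k ℓ ℓ' (tensorS ℓ (A ++ X :: Y :: B)) = if Y.length ≤ a then
        pureTensor ℓ' (A.map Diagram.S ++ (attach a T X Y).S :: B.map Diagram.S) else 0 := by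
  rw [← hA]
  exact mergeMap_tensorS (hF.isRect ⟨_, h⟩) (hF.length_eq _ h) (hF.tab _ h)

-- `hconj` keeps the image of Fomin's involution in `F`, and by `exists_fomin` the image is again
-- non-fitting, is sent back to the given pair, and has the opposite `S`. As `S` is not zero, no
-- sequence is its own partner, so the terms cancel in pairs.
open Classical in
lemma AngleSet.sum_nonFitting (hF : AngleSet a b k ℓ T F) (hk : k < ℓ')
    (hconj : ∀ A X Y B X₁ Y', A.length = k → A ++ X :: Y :: B ∈ F → Y.length ≤ a →
      ¬ SS (attach a T X Y) → (attach a T X Y).S ≠ 0 → Fomin a (rightCut b X) Y X₁ Y' →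
      A ++ tmul (leftCut b X) X₁ :: Y' :: B ∈ F) :
    ∑ W ∈ F with NonFitting a k T W, mergeMap a b k ℓ ℓ' (tensorS ℓ W) = 0 := by
  have key : ∀ A X Y B X₁ Y', A.length = k → A ++ X :: Y :: B ∈ F → Y.length ≤ a →
      ¬ SS (attach a T X Y) → (attach a T X Y).S ≠ 0 → Fomin a (rightCut b X) Y X₁ Y' →
      A ++ tmul (leftCut b X) X₁ :: Y' :: B ∈ F ∧ Y'.length ≤ a ∧
      ¬ SS (attach a T (tmul (leftCut b X) X₁) Y') ∧
      leftCut b (tmul (leftCut b X) X₁) = leftCut b X ∧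
      rightCut b (tmul (leftCut b X) X₁) = X₁ ∧ Fomin a X₁ Y' (rightCut b X) Y ∧
      (attach a T (tmul (leftCut b X) X₁) Y').S = - (attach a T X Y).S := by
    intro A X Y B X₁ Y' hA h hYa hns hS hfom
    have hT := hF.isRect ⟨_, h⟩
    have hX : Tab X := hF.tab _ h X (by simp)
    have hY : Tab Y := hF.tab _ h Y (by simp)
    obtain ⟨X₂, Y₂, g1, g2, g3, g4, g5, g6, g7, g8, g9⟩ := exists_fomin hT hX hY hYa
      (hF.lt_left _ _ _ _ hA h) (hF.lt_right _ _ _ _ hA h) hns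
    obtain ⟨rfl, rfl⟩ := Fomin.unique (rowsSorted_attach (tab_rightCut hX.1 b) hY hYa) g1 hfom
    have h' := hconj A X Y B _ _ hA h hYa hns hS hfom
    refine ⟨h', g4, fun hss => g8 ?_, g5, g6, g7, g9⟩
    rwa [ss_attach_iff hT (tab_tmul (tab_leftCut hX.1 b) _) g3 g4 (hF.lt_left _ _ _ _ hA h')
      (hF.lt_right _ _ _ _ hA h'), g6] at hss
  refine sum_eq_zero_of_matching _ _ (FominRel a b k) ?_ ?_ ?_ ?_ ?_
  · intro W hW
    obtain ⟨hW, A, X, Y, B, rfl, hA, hYa, hns, hS⟩ := Finset.mem_filter.1 hW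
    have hX : Tab X := hF.tab _ hW X (by simp)
    obtain ⟨X₁, Y', hfom, -⟩ := exists_fomin (hF.isRect ⟨_, hW⟩) hX (hF.tab _ hW Y (by simp)) hYa
      (hF.lt_left _ _ _ _ hA hW) (hF.lt_right _ _ _ _ hA hW) hns
    obtain ⟨g1, g2, g3, -, -, -, g4⟩ := key A X Y B X₁ Y' hA hW hYa hns hS hfom
    refine ⟨_, Finset.mem_filter.2 ⟨g1, A, _, _, B, rfl, hA, g2, g3, ?_⟩,
      A, X, Y, B, X₁, Y', rfl, hA, rfl, hfom⟩
    rw [g4]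
    exact neg_ne_zero.2 hS
  · rintro W hW W' ⟨A', X', Y', B', X₁, Y₁, hWW, hA', rfl, hfom⟩
    obtain ⟨hW, A, X, Y, B, rfl, hA, hYa, hns, hS⟩ := Finset.mem_filter.1 hW
    obtain ⟨rfl, rfl, rfl, rfl⟩ := append_cons_cons_inj hWW (hA.trans hA'.symm)
    have hX : Tab X := hF.tab _ hW X (by simp)
    obtain ⟨g1, g2, g3, g4, g5, g6, -⟩ := key _ _ _ _ _ _ hA hW hYa hns hS hfom
    refine ⟨A, _, _, B, rightCut b X, Y, rfl, hA, ?_, ?_⟩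
    · rw [g4, tmul_leftCut_rightCut hX]
    · rwa [g5]
  · rintro W hW W₁ W₂ ⟨A', X', Y', B', X₁, Y₁, hWW, hA', rfl, hfom⟩
      ⟨A'', X'', Y'', B'', X₂, Y₂, hWW', hA'', rfl, hfom'⟩
    obtain ⟨hW, A, X, Y, B, rfl, hA, hYa, hns, hS⟩ := Finset.mem_filter.1 hW
    obtain ⟨rfl, rfl, rfl, rfl⟩ := append_cons_cons_inj hWW (hA.trans hA'.symm)
    obtain ⟨rfl, rfl, rfl, rfl⟩ := append_cons_cons_inj hWW' (hA.trans hA''.symm)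
    have hX : Tab X := hF.tab _ hW X (by simp)
    obtain ⟨rfl, rfl⟩ := Fomin.unique
      (rowsSorted_attach (tab_rightCut hX.1 b) (hF.tab _ hW Y (by simp)) hYa) hfom hfom'
    rfl
  · rintro W hW W' ⟨A', X', Y', B', X₁, Y₁, hWW, hA', rfl, hfom⟩ heq
    obtain ⟨hW, A, X, Y, B, rfl, hA, hYa, hns, hS⟩ := Finset.mem_filter.1 hW
    obtain ⟨rfl, rfl, rfl, rfl⟩ := append_cons_cons_inj hWW (hA.trans hA'.symm)
    obtain ⟨-, -, -, -, -, -, g⟩ := key _ _ _ _ _ _ hA hW hYa hns hS hfom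
    obtain ⟨-, e1, e2, -⟩ := append_cons_cons_inj heq rfl
    rw [e1, e2] at g
    exact hS (CharZero.eq_neg_self_iff.1 g)
  · rintro W hW W' ⟨A', X', Y', B', X₁, Y₁, hWW, hA', rfl, hfom⟩
    obtain ⟨hW, A, X, Y, B, rfl, hA, hYa, hns, hS⟩ := Finset.mem_filter.1 hW
    obtain ⟨rfl, rfl, rfl, rfl⟩ := append_cons_cons_inj hWW (hA.trans hA'.symm)
    obtain ⟨g1, g2, -, -, -, -, g⟩ := key _ _ _ _ _ _ hA hW hYa hns hS hfom
    rw [hF.mergeMap_eq hA hW, hF.mergeMap_eq hA g1, if_pos hYa, if_pos g2, g,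
      pureTensor_neg _ _ _ (by simpa [hA] using hk), add_neg_cancel]

-- A fitting pair has the attached tableau as its product with `T`, and `trim_attach` recovers the
-- pair from it; this gives injectivity. By `hlower` every sequence in `F'` arises from a fitting
-- pair.
open Classical in
lemma AngleSet.sum_fitting (hF : AngleSet a b k ℓ T F)
    (hmerge : ∀ A X Y B, A.length = k → A ++ X :: Y :: B ∈ F →
      A ++ tmul (tmul X T) Y :: B ∈ F')
    (hlower : ∀ W ∈ F', ∃ A Z B Y, W = A ++ Z :: B ∧ A.length = k ∧ Tab Z ∧
      A ++ Z.drop a :: Y :: B ∈ F ∧ Z.take a = hcat T Y ∧ Y.length ≤ a) :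
    ∑ W ∈ F with Fitting a k T W, mergeMap a b k ℓ ℓ' (tensorS ℓ W) = ∑ W ∈ F', tensorS ℓ' W := by
  refine Finset.sum_bij (fun W _ => W.take k ++
    Diagram.trim (attach a T (W.getD k []) (W.getD (k + 1) [])) :: W.drop (k + 2)) ?_ ?_ ?_ ?_
  · intro W hW
    obtain ⟨hW, A, X, Y, B, rfl, hA, hYa, hss⟩ := Finset.mem_filter.1 hW
    have hX : Tab X := hF.tab _ hW X (by simp)
    have e : tmul (tmul X T) Y = Diagram.trim (attach a T X Y) := by
      refine (tab_tmul (tab_tmul hX _) _).eq_of_pl hss.tab_trim ?_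
      rw [word_trim]
      refine (cl_tmul (tab_tmul hX _) _).trans ?_
      rw [cl_tmul hX]
      exact (cl_attach (hF.isRect ⟨_, hW⟩) (hF.tab _ hW Y (by simp)) hYa
        (hF.lt_right _ _ _ _ hA hW)).symm
    have := hmerge A X Y B hA hW
    rw [e] at this
    simpa [← hA] using this
  · intro W hW W' hW' heq
    obtain ⟨hW, A, X, Y, B, rfl, hA, hYa, hss⟩ := Finset.mem_filter.1 hW
    obtain ⟨hW', A', X', Y', B', rfl, hA', hYa', hss'⟩ := Finset.mem_filter.1 hW'
    have hT := hF.isRect ⟨_, hW⟩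
    have hX : Tab X := hF.tab _ hW X (by simp)
    have hY : Tab Y := hF.tab _ hW Y (by simp)
    have hX' : Tab X' := hF.tab _ hW' X' (by simp)
    have hY' : Tab Y' := hF.tab _ hW' Y' (by simp)
    have heq' : A ++ Diagram.trim (attach a T X Y) :: B =
        A' ++ Diagram.trim (attach a T X' Y') :: B' := by
      have e1 : ∀ (A B : List Diagram) (X Y : Diagram), A.length = k →
          (A ++ X :: Y :: B).take k ++ Diagram.trim (attach a T ((A ++ X :: Y :: B).getD k [])
            ((A ++ X :: Y :: B).getD (k + 1) [])) :: (A ++ X :: Y :: B).drop (k + 2) =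
          A ++ Diagram.trim (attach a T X Y) :: B := by
        intro A B X Y hA
        simp [← hA]
      rw [← e1 _ _ _ _ hA, ← e1 _ _ _ _ hA']
      exact heq
    obtain ⟨rfl, h2⟩ := List.append_inj heq' (hA.trans hA'.symm)
    obtain ⟨h3, rfl⟩ := List.cons.inj h2
    obtain ⟨u1, u2⟩ := trim_attach hT.1 hX hY hT.length_le hYa hss
    obtain ⟨v1, v2⟩ := trim_attach hT.1 hX' hY' hT.length_le hYa' hss'
    rw [← h3] at v1 v2
    obtain rfl := u1.symm.trans v1
    obtain rfl := hcat_cancel hY.2 hY'.2 (u2.symm.trans v2)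
    rfl
  · intro W hW
    obtain ⟨A, Z, B, Y, rfl, hA, hZ, h1, h2, h3⟩ := hlower W hW
    have hatt := attach_take_drop (hF.isRect ⟨_, h1⟩).length_le h3 h2
    refine ⟨_, Finset.mem_filter.2 ⟨h1, A, _, _, B, rfl, hA, h3, ?_⟩, ?_⟩
    · rw [hatt]
      exact ss_append_replicate hZ.1 _
    · simp [← hA] at hatt ⊢
      rw [hatt, trim_append, trim_replicate, trim_eq_self hZ.2, List.append_nil]
  · intro W hW
    obtain ⟨hW, A, X, Y, B, rfl, hA, hYa, hss⟩ := Finset.mem_filter.1 hW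
    rw [hF.mergeMap_eq hA hW, if_pos hYa, tensorS, ← hss.S_trim]
    congr 1
    simp [← hA]

/-- A sequence which is neither fitting nor among those that cancel is sent to zero, because its
second label has too many rows or because `S` vanishes. -/
lemma AngleSet.sum_mergeMap (hF : AngleSet a b k ℓ T F) (hk : k < ℓ')
    (hconj : ∀ A X Y B X₁ Y', A.length = k → A ++ X :: Y :: B ∈ F → Y.length ≤ a →
      ¬ SS (attach a T X Y) → (attach a T X Y).S ≠ 0 → Fomin a (rightCut b X) Y X₁ Y' →
      A ++ tmul (leftCut b X) X₁ :: Y' :: B ∈ F)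
    (hmerge : ∀ A X Y B, A.length = k → A ++ X :: Y :: B ∈ F →
      A ++ tmul (tmul X T) Y :: B ∈ F')
    (hlower : ∀ W ∈ F', ∃ A Z B Y, W = A ++ Z :: B ∧ A.length = k ∧ Tab Z ∧
      A ++ Z.drop a :: Y :: B ∈ F ∧ Z.take a = hcat T Y ∧ Y.length ≤ a) :
    mergeMap a b k ℓ ℓ' (∑ W ∈ F, tensorS ℓ W) = ∑ W ∈ F', tensorS ℓ' W := by
  classical
  rw [map_sum, ← Finset.sum_filter_add_sum_filter_not F (Fitting a k T),
    hF.sum_fitting hmerge hlower, add_eq_left, ← hF.sum_nonFitting hk hconj]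
  symm
  refine Finset.sum_subset (fun W hW => ?_) fun W hW hW' => ?_
  · obtain ⟨hW, A, X, Y, B, rfl, hA, hYa, hns, hS⟩ := Finset.mem_filter.1 hW
    refine Finset.mem_filter.2 ⟨hW, ?_⟩
    rintro ⟨A', X', Y', B', hWW, hA', -, hss⟩
    obtain ⟨rfl, rfl, rfl, rfl⟩ := append_cons_cons_inj hWW (hA.trans hA'.symm)
    exact hns hss
  · obtain ⟨hW, hnf⟩ := Finset.mem_filter.1 hW
    obtain ⟨A, X, Y, B, rfl, hA⟩ := hF.exists_eq W hW
    rw [hF.mergeMap_eq hA hW]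
    split_ifs with hYa
    · have hS : (attach a T X Y).S = 0 := by
        by_contra hS
        exact hW' (Finset.mem_filter.2 ⟨hW, A, X, Y, B, rfl, hA, hYa,
          fun hss => hnf ⟨A, X, Y, B, rfl, hA, hYa, hss⟩, hS⟩)
      rw [hS, pureTensor_zero _ _ (by simpa [hA] using hk)]
    · rfl

end

section

variable {n : ℕ} {R : RectangleDiagram n} {𝒯 : TableauDiagram R}

/-! ### The sum over the factor sequences -/

/-- The sum of `S(W₁) ⊗ ⋯ ⊗ S(W_ℓ)` over the factor sequences of a path. -/
noncomputable def factorSum (𝒯 : TableauDiagram R) (γ : List Seg) : ⨂[ℤ]^γ.length Lam :=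
  ∑ᶠ W ∈ {W | IsFactorSeq 𝒯 γ W}, tensorS γ.length W

lemma factorSum_eq {γ : List Seg} (hfin : {W | IsFactorSeq 𝒯 γ W}.Finite) :
    factorSum 𝒯 γ = ∑ W ∈ hfin.toFinset, tensorS γ.length W :=
  finsum_mem_eq_finite_toFinset_sum _ hfin

lemma isPath_of_split {α β : List Seg} (h : IsPath n (α ++ Seg.up :: Seg.down :: β)) :
    IsPath n (α ++ Seg.horiz :: β) := by
  simpa using LowerSegs.split.isPath (α := α) (β := β) (by simpa using h)

lemma isPath_of_merge {α β : List Seg} (h : IsPath n (α ++ Seg.horiz :: β)) :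
    IsPath n (α ++ Seg.down :: Seg.up :: β) := by
  simpa using LowerSegs.merge.isPath (α := α) (β := β) (by simpa using h)

lemma factorSum_lowest :
    factorSum 𝒯 (lowestPath n) = PiTensorProduct.tprod ℤ fun _ => 1 := by
  have hset : {W | IsFactorSeq 𝒯 (lowestPath n) W} = {List.replicate (2 * n) []} := by
    ext W
    exact ⟨fun h => h.eq_lowest, fun h => h ▸ IsFactorSeq.lowest⟩
  have h1 : Diagram.S [] = 1 := Matrix.det_isEmpty (n := Fin 0)
  rw [factorSum, hset, finsum_mem_singleton, tensorS, pureTensor]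
  congr 1
  funext k
  rw [List.map_replicate, h1, List.getD_eq_getElem?_getD, List.getElem?_replicate]
  split_ifs <;> rfl

/-- Multiplying the two labels of the peak maps the factor sequences of the upper path to those of
the lower one, and the fibres consist of the factorizations of one label. -/
lemma factorSum_split {α β : List Seg} (hp : IsPath n (α ++ Seg.up :: Seg.down :: β)) :
    splitMap α.length _ _ (factorSum 𝒯 (α ++ Seg.horiz :: β)) =
      factorSum 𝒯 (α ++ Seg.up :: Seg.down :: β) := by
  classical
  rw [factorSum_eq (isFactorSeq_finite (isPath_of_split hp)), factorSum_eq (isFactorSeq_finite hp),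
    map_sum]
  have hg : ∀ (A B : List Diagram) (P Q : Diagram), A.length = α.length →
      (A ++ P :: Q :: B).take α.length ++ tmul ((A ++ P :: Q :: B).getD α.length [])
        ((A ++ P :: Q :: B).getD (α.length + 1) []) :: (A ++ P :: Q :: B).drop (α.length + 2) =
      A ++ tmul P Q :: B := by
    intro A B P Q hA
    simp [← hA]
  rw [← Finset.sum_fiberwise_of_maps_to (s := (isFactorSeq_finite hp).toFinset)
    (t := (isFactorSeq_finite (isPath_of_split hp)).toFinset)
    (g := fun W => W.take α.length ++ tmul (W.getD α.length []) (W.getD (α.length + 1) []) ::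
      W.drop (α.length + 2))]
  · refine Finset.sum_congr rfl fun W hW => ?_
    rw [Set.Finite.mem_toFinset] at hW
    obtain ⟨A, U, B, rfl, hA, hB⟩ := IsFactorSeq.exists_cons hW
    have hs := splitMap_tensorS (ℓ' := (α ++ Seg.up :: Seg.down :: β).length) hW.length_eq hW.tab
    rw [hA] at hs
    rw [hs]
    refine Finset.sum_bij (fun p _ => A ++ p.1 :: p.2 :: B) ?_ ?_ ?_ fun _ _ => rfl
    · rintro ⟨P, Q⟩ hPQ
      obtain ⟨hP, hQ, rfl⟩ := (Set.Finite.mem_toFinset _).1 hPQ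
      rw [Finset.mem_filter, Set.Finite.mem_toFinset]
      exact ⟨IsFactorSeq.split _ _ _ _ _ _ hp hA (isTableau_iff.2 hP) (isTableau_iff.2 hQ) hW,
        hg A B P Q hA⟩
    · rintro ⟨P, Q⟩ - ⟨P', Q'⟩ - h
      obtain ⟨-, h1, h2, -⟩ := append_cons_cons_inj h rfl
      exact Prod.ext h1 h2
    · intro W' hW'
      rw [Finset.mem_filter, Set.Finite.mem_toFinset] at hW'
      obtain ⟨hW', e⟩ := hW'
      obtain ⟨A', P, Q, B', rfl, hA', -⟩ := IsFactorSeq.exists_cons_cons hW'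
      rw [hg _ _ _ _ hA'] at e
      obtain ⟨rfl, e2⟩ := List.append_inj e (hA'.trans hA.symm)
      obtain ⟨e3, rfl⟩ := List.cons.inj e2
      exact ⟨(P, Q), (Set.Finite.mem_toFinset _).2
        ⟨IsFactorSeq.tab hW' P (by simp), IsFactorSeq.tab hW' Q (by simp), e3⟩, rfl⟩
  · intro W hW
    rw [Set.Finite.mem_toFinset] at hW ⊢
    obtain ⟨A, P, Q, B, rfl, hA, -⟩ := IsFactorSeq.exists_cons_cons hW
    rw [hg _ _ _ _ hA]
    exact IsFactorSeq.lower_split hA hW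

lemma factorSum_merge (hstrong : StrongConjecture 𝒯) {α β : List Seg}
    (hp : IsPath n (α ++ Seg.horiz :: β)) :
    mergeMap (R.rows (endpoint α).1 ((endpoint α).2 + 1))
      (R.cols (endpoint α).1 ((endpoint α).2 + 1)) α.length _ _
      (factorSum 𝒯 (α ++ Seg.down :: Seg.up :: β)) = factorSum 𝒯 (α ++ Seg.horiz :: β) := by
  have hp' := isPath_of_merge hp
  rw [factorSum_eq (isFactorSeq_finite hp'), factorSum_eq (isFactorSeq_finite hp)]
  have hF : AngleSet (R.rows (endpoint α).1 ((endpoint α).2 + 1))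
      (R.cols (endpoint α).1 ((endpoint α).2 + 1)) α.length
      (α ++ Seg.down :: Seg.up :: β).length (𝒯.T (endpoint α).1 ((endpoint α).2 + 1))
      (isFactorSeq_finite (𝒯 := 𝒯) hp').toFinset := by
    refine ⟨?_, ?_, ?_, ?_, ?_, ?_⟩ <;> try simp only [Set.Finite.mem_toFinset, Set.mem_ofPred_eq]
    · intro W hW
      obtain ⟨A, X, Y, B, h, hA, -⟩ := hW.exists_cons_cons
      exact ⟨A, X, Y, B, h, hA⟩
    · exact fun W hW => hW.length_eq
    · exact fun W hW => hW.tab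
    · rintro ⟨W, hW⟩
      rw [Set.Finite.mem_toFinset] at hW
      obtain ⟨A, X, Y, B, rfl, hA, -⟩ := IsFactorSeq.exists_cons_cons hW
      exact (IsFactorSeq.angle hA hW).1
    · exact fun A X Y B hA h => (h.angle hA).2.2.2.1
    · exact fun A X Y B hA h => (h.angle hA).2.2.2.2
  refine hF.sum_mergeMap (by simp) ?_ ?_ ?_ <;>
    simp only [Set.Finite.mem_toFinset, Set.mem_ofPred_eq]
  · intro A X Y B X₁ Y' hA h hYa hns hS hfom
    exact hstrong α β _ _ _ _ _ X Y X₁ Y' A B hp' rfl rfl rfl rfl rfl hA h hYa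
      (fun h => hns (semistandard_iff.1 h)) hS hfom
  · exact fun A X Y B hA h => IsFactorSeq.merge α β A B X Y hp hA h
  · intro W hW
    obtain ⟨A, Z, B, rfl, hA, -⟩ := hW.exists_cons
    obtain ⟨Y, h1, h2, h3⟩ := hW.lower_merge hA
    exact ⟨A, Z, B, Y, rfl, hA, hW.tab Z (by simp), h1, h2, h3⟩

/-- The right side does not refer to the choices made for `P`, so the independence of these choices
is part of the conclusion. -/
lemma IsPathElement.eq_factorSum (hstrong : StrongConjecture 𝒯) {γ : List Seg}
    {P : ⨂[ℤ]^γ.length Lam} (h : IsPathElement R γ P) : P = factorSum 𝒯 γ := by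
  induction h with
  | lowest => exact factorSum_lowest.symm
  | split α β P hp _ ih => rw [ih, factorSum_split hp]
  | merge α β P hp _ ih => rw [ih, factorSum_merge hstrong hp]

lemma exists_isPathElement (R : RectangleDiagram n) {γ : List Seg} (hγ : IsPath n γ) :
    ∃ P, IsPathElement R γ P := by
  refine path_induction (n := n) (motive := fun γ => ∃ P, IsPathElement R γ P) ?_ ?_ ?_ hγ
  · exact ⟨_, IsPathElement.lowest⟩
  · rintro α β hp ⟨P, hP⟩
    exact ⟨_, IsPathElement.split α β P hp hP⟩
  · rintro α β hp ⟨P, hP⟩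
    exact ⟨_, IsPathElement.merge α β P hp hP⟩

lemma isPathElement_iff (hstrong : StrongConjecture 𝒯) {γ : List Seg} (hγ : IsPath n γ)
    (P : ⨂[ℤ]^γ.length Lam) : IsPathElement R γ P ↔ P = factorSum 𝒯 γ := by
  refine ⟨fun h => h.eq_factorSum hstrong, ?_⟩
  rintro rfl
  obtain ⟨P, hP⟩ := exists_isPathElement R hγ
  rwa [← hP.eq_factorSum hstrong]

/-! ### Coefficients -/

lemma shapes_eq_iff {ℓ : ℕ} {W : List Diagram} (hl : W.length = ℓ) (hW : ∀ X ∈ W, Tab X)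
    (μ : Fin ℓ → YoungDiagram) :
    shapes ℓ W = μ ↔ W.map Diagram.shape = List.ofFn fun k => (μ k).rowLens := by
  have e1 : W.map Diagram.shape = (W.map yd).map YoungDiagram.rowLens := by
    rw [List.map_map]
    exact List.map_congr_left fun X hX => (hW X hX).shape_eq
  have e2 : (List.ofFn fun k => (μ k).rowLens) = (List.ofFn μ).map YoungDiagram.rowLens := by
    rw [List.map_ofFn]
    rfl
  rw [e1, e2, (List.map_injective_iff.2 rowLens_injective).eq_iff, ← ofFn_shapes hl,
    List.ofFn_injective.eq_iff]

/-- The labels are tableaux, so each summand is an element of the tensor basis and a coefficient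
counts the sequences of given shapes. -/
lemma repr_factorSum {γ : List Seg} (hγ : IsPath n γ) (μ : Fin γ.length → YoungDiagram) :
    (tensorBasis γ.length).repr (factorSum 𝒯 γ) μ =
      ({W | IsFactorSeq 𝒯 γ W ∧
        W.map Diagram.shape = List.ofFn fun k => (μ k).rowLens}.ncard : ℤ) := by
  classical
  have hfin := isFactorSeq_finite (𝒯 := 𝒯) hγ
  have hset : {W | IsFactorSeq 𝒯 γ W ∧
      W.map Diagram.shape = List.ofFn fun k => (μ k).rowLens} =
      ↑(hfin.toFinset.filter fun W => shapes γ.length W = μ) := by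
    ext W
    simp only [Set.mem_ofPred_eq, Finset.coe_filter, Set.Finite.mem_toFinset]
    exact and_congr_right fun hW => (shapes_eq_iff hW.length_eq hW.tab μ).symm
  rw [hset, Set.ncard_coe_finset, factorSum_eq hfin, map_sum, Finsupp.finsetSum_apply,
    Finset.card_filter, Nat.cast_sum]
  refine Finset.sum_congr rfl fun W hW => ?_
  have hW : IsFactorSeq 𝒯 γ W := hfin.mem_toFinset.1 hW
  rw [tensorS_eq hW.length_eq hW.tab, Module.Basis.repr_self, Finsupp.single_apply]
  split_ifs <;> simp

end

end QuiverFactor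

theorem mainTheorem2 {n : ℕ} (R : RectangleDiagram n) (𝒯 : TableauDiagram R)
    (hstrong : StrongConjecture 𝒯) (γ : List Seg) (hγ : IsPath n γ) :
    {W | IsFactorSeq 𝒯 γ W}.Finite ∧
    (∀ P : TensorPower ℤ γ.length Lam,
      IsPathElement R γ P ↔ P = ∑ᶠ W ∈ {W | IsFactorSeq 𝒯 γ W}, tensorS γ.length W) ∧
    (∀ P : TensorPower ℤ γ.length Lam, IsPathElement R γ P →
      ∀ μ : Fin γ.length → YoungDiagram,
        (tensorBasis γ.length).repr P μ =
          ({W | IsFactorSeq 𝒯 γ W ∧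
            W.map Diagram.shape = List.ofFn fun k => (μ k).rowLens}.ncard : ℤ)) := by
  refine ⟨isFactorSeq_finite hγ, isPathElement_iff hstrong hγ, fun P hP μ => ?_⟩
  rw [hP.eq_factorSum hstrong, repr_factorSum hγ]
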